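/- Let $k\ge 2$ and let $\mathbf p=(p_0,\dots,p_{k-1})$ be a probability vector with $p_i>0$ for every $i$. A $\mathbf p$-shuffle of a deck of $N$ cards is the following random operation. Draw a multinomial$(N,\mathbf p)$ vector $(n_0,\dots,n_{k-1})$ and cut the deck into $k$ consecutive piles, the top $n_0$ cards forming pile $0$, the next $n_1$ cards forming pile $1$, and so on. Then drop the cards one at a time to form the new deck: if the current pile sizes are $A_0,\dots,A_{k-1}$, the next card is dropped from pile $i$ (from its bottom) with probability $A_i/(A_0+\dots+A_{k-1})$, until all the piles are empty. Let $d_N(K)$ be the total variation distance between the uniform distribution on the permutations of the $N$ cards and the law of the order of an initially sorted deck after $K$ independent $\mathbf p$-shuffles. Let $\phi_{\mathbf p}(t)=\sum_{i=0}^{k-1}p_i^t$, $\psi_{\mathbf p}(t)=-\log\phi_{\mathbf p}(t)$ and $p_{\max}=\max_i p_i$. There is exactly one $\theta_{\mathbf p}>0$ with $\psi_{\mathbf p}(\theta_{\mathbf p})=2\psi_{\mathbf p}(2)$. Put $$C_{\mathbf p}=\frac{3+\theta_{\mathbf p}}{4\psi_{\mathbf p}(2)},\qquad \widetilde C_{\mathbf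 p}=\frac{1}{\log(1/p_{\max})},\qquad \overline C_{\mathbf p}=\max(\widetilde C_{\mathbf p},C_{\mathbf p}).$$ Then the $\mathbf p$-shuffles undergo total variation cutoff after $\overline C_{\mathbf p}\log N$ steps: for every $\varepsilon>0$, $$\lim_{N\to\infty}d_N\big(\lfloor(1-\varepsilon)\overline C_{\mathbf p}\log N\rfloor\big)=1,\qquad \lim_{N\to\infty}d_N\big(\lfloor(1+\varepsilon)\overline C_{\mathbf p}\log N\rfloor\big)=0,$$ where a negative number of shuffles (possible only for $\varepsilon>1$) is read as $0$. -/

import Mathlib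

namespace RiffleShuffle

/-- Mass at `n` of the multinomial distribution with `∑ i, n i` trials and cell probabilities
`p i`. -/
noncomputable def multinomialMass {k : ℕ} (p : Fin k → ℝ) (n : Fin k → ℕ) : ℝ :=
  (Nat.multinomial Finset.univ n : ℝ) * ∏ i, p i ^ n i

/-- Cut a deck (listed from top to bottom) into `k` consecutive piles of sizes
`n 0, n 1, …`: pile `0` consists of the top `n 0` cards, pile `1` of the next `n 1` cards, … -/
def cut {α : Type*} {k : ℕ} (n : Fin k → ℕ) (deck : List α) (i : Fin k) : List α :=
  (deck.drop (∑ j ∈ Finset.Iio i, n j)).take (n i)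

/-- The probability that interleaving the piles (each listed from top to bottom) drops the cards
in the order given by the second argument. At each step a pile `i` is selected with probability
`A i / ∑ j, A j`, where `A` are the current pile sizes, and its bottom card is dropped. -/
noncomputable def interleaveProb {α : Type*} [DecidableEq α] {k : ℕ} :
    (Fin k → List α) → List α → ℝ
  | piles, [] => if ∀ i, piles i = [] then 1 else 0
  | piles, c :: rest =>
      ∑ i, if (piles i).getLast? = some c then
          ((piles i).length : ℝ) / (∑ j, ((piles j).length : ℝ)) *
            interleaveProb (Function.update piles i (piles i).dropLast) rest
        else 0

/-- The law on permutations of one `p`-shuffle of `N` cards. A permutation `ρ` is the order of the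
deck in which the card at position `j` (position `0` is the top) is the one that was at position
`ρ j` before the shuffle. The first card dropped ends at the bottom, so the cards are dropped in
the order `ρ (N-1), …, ρ 1, ρ 0`. -/
noncomputable def shuffleProb {k : ℕ} (p : Fin k → ℝ) (N : ℕ) (ρ : Equiv.Perm (Fin N)) : ℝ :=
  ∑ n ∈ Finset.piAntidiag (Finset.univ : Finset (Fin k)) N,
    multinomialMass p n * interleaveProb (cut n (List.finRange N)) (List.ofFn ρ).reverse

/-- The law of the order of the deck after `K` independent `p`-shuffles of a sorted deck of `N`
cards. If the order is `τ` and then a shuffle `ρ` is applied, the new order is `τ * ρ`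
(the card at position `j` is `τ (ρ j)`). -/
noncomputable def deckProb {k : ℕ} (p : Fin k → ℝ) (N : ℕ) : ℕ → Equiv.Perm (Fin N) → ℝ
  | 0, σ => if σ = 1 then 1 else 0
  | K + 1, σ => ∑ ρ : Equiv.Perm (Fin N), deckProb p N K (σ * ρ⁻¹) * shuffleProb p N ρ

/-- `d_N(K)`: the total variation distance to the uniform distribution on the permutations of
`N` cards after `K` `p`-shuffles. -/
noncomputable def tvDist {k : ℕ} (p : Fin k → ℝ) (N K : ℕ) : ℝ :=
  (1 / 2) * ∑ σ : Equiv.Perm (Fin N), |deckProb p N K σ - 1 / (Nat.factorial N : ℝ)|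

/-- `φ_p(t) = ∑ i, p_i ^ t`. -/
noncomputable def phi {k : ℕ} (p : Fin k → ℝ) (t : ℝ) : ℝ := ∑ i, p i ^ t

/-- `ψ_p(t) = - log φ_p(t)`. -/
noncomputable def psi {k : ℕ} (p : Fin k → ℝ) (t : ℝ) : ℝ := -Real.log (phi p t)

/-- `p_max`, the largest entry of `p`. -/
noncomputable def pMax {k : ℕ} (p : Fin k → ℝ) : ℝ := ⨆ i, p i

/-- `C̄_p = max (1 / log (1 / p_max)) ((3 + θ) / (4 ψ_p(2)))`, as a function of `p` and of the
value `θ` of the constant `θ_p`. -/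
noncomputable def cutoffConst {k : ℕ} (p : Fin k → ℝ) (θ : ℝ) : ℝ :=
  max (1 / Real.log (1 / pMax p)) ((3 + θ) / (4 * psi p 2))

end RiffleShuffle

/-! One shuffle is the inverse of the stable sort of independent labels with law `p` attached to the
final positions (`shuffleProb_eq_sum`). Radix sort (`sort_mul_sort`) merges `K` shuffles into one
sort by words of `K` independent letters (`deckProb_eq_sum`). Up to inversion the law is then a
mixture: draw `N` independent words and sort them into `s`; given `s`, the permutation is uniform
among those ascending along the edges of `s`, the adjacent positions carrying equal words. The
question becomes whether these prescribed ascents can be seen in a uniform permutation. Their number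
of completions is explicit, `N!` divided by a product of run lengths (`ascCount_mul_prod_runLen`).

Upper bound: a second moment. For two sorted sequences whose cells hold at most `L` cards, the
ascent events are correlated only through common edges, each costing a factor `L`
(`ascCount_union_mul_le`), so it suffices that two independent sorted sequences rarely share an
edge. The generating function of the shared edges is expanded over lists of well separated edges,
and the probability that `s` contains such a list is bounded by a chain of Poisson convolutions
(`sum_sortedMass_subset_edges_le`). Cauchy-Schwarz along the chain (`sepSum_chainBound_sq_le`)
leaves one collision sum: over distances `d`, the square of a bound for the chance that a repeated
word starts `d` positions further on.

At distances of order `D`, Poisson fluctuations blur positions over `√D`, so words are grouped into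
cylinders holding about `√D` cards. In a cylinder with prefix mass `P` and length `M`, the squared
collision mass is of order `P ^ 4 * φ(2) ^ (2 * (K - M))`. Since `φ(θ) = φ(2)²`, the factor `φ(2) ^
(-2 * M)` is, up to a power of `P`, the mass of the cylinder under the letter law tilted by `θ`,
which sums to one (`sum_block_sq_le`). Scale `D` then contributes about `D ^ ((3 + θ) / 2) * exp (-2
ψ(2) (K - log (N / D) / log (1 / p_max)))`. The exponent is affine in `log D`: the end `D = N`
requires `K` above `C log N`, the end `D = 1` requires `K` above `log N / log (1 / p_max)`, hence
the maximum (`scale_exponent_le`, `exists_collision_bound`, `tendsto_tvDist_zero`).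

Lower bound: two tests. Below `log N / log (1 / p_max)` the likeliest word is repeated a power of
`N` times and leaves an ascending run that a uniform permutation does not have
(`tendsto_tvDist_one_of_lt`). Between the two constants, ascents are counted in the positions
belonging to cylinders of mass about `N ^ (-1 / 2)` and of one well chosen length. Ascents are
negatively correlated, so the count fluctuates by at most the square root of the number of positions
(`sum_ascents_sub_sq_le`), while the prescribed ascents raise its mean by a sixth of their number up
to boundary terms (`sum_ascCount_insert_ge`). Pigeonhole on the tilted law provides a length for
which the gain wins (`exists_stopDepth_large`, `tendsto_tvDist_one_of_lt_collision`). -/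

open Finset

namespace RiffleShuffle

/-! ### The label description of a shuffle -/

/-- The piles, emptied from the bottom in the order given by a list of pile labels, produce the
given list of cards. -/
def DropsTo {α : Type*} {k : ℕ} : (Fin k → List α) → List (Fin k) → List α → Prop
  | piles, [], [] => ∀ i, piles i = []
  | piles, i :: w, c :: cs =>
      (piles i).getLast? = some c ∧ DropsTo (Function.update piles i (piles i).dropLast) w cs
  | _, _, _ => False

theorem DropsTo.length_eq_count {α : Type*} {k : ℕ} :
    ∀ {w : List (Fin k)} {cs : List α} {piles : Fin k → List α}, DropsTo piles w cs →
      ∀ i, (piles i).length = w.count i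
  | [], [], piles, h, i => by
      have : piles i = [] := h i
      simp [this]
  | [], c :: cs, piles, h, i => by simp [DropsTo] at h
  | a :: w, [], piles, h, i => by simp [DropsTo] at h
  | a :: w, c :: cs, piles, h, i => by
      obtain ⟨h1, h2⟩ := h
      have := h2.length_eq_count i
      rw [List.count_cons]
      by_cases hi : a = i
      · subst hi
        have hne : piles a ≠ [] := by
          intro h0; simp [h0] at h1
        have hpos : 0 < (piles a).length := List.length_pos_iff.mpr hne
        simp at this ⊢
        omega
      · rw [Function.update_of_ne (Ne.symm hi)] at this
        simp [this, hi]

-- Along any label word that empties the piles, the numerators of the drop probabilities run down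
-- from each pile size to `1` and the denominators from `n` to `1`. Every admissible word thus has
-- the same weight, and the interleaving is uniform.
open Classical in
theorem interleaveProb_eq_sum {α : Type*} [DecidableEq α] {k : ℕ} :
    ∀ (n : ℕ) (cs : List α) (_ : cs.length = n) (piles : Fin k → List α),
      (∑ i, (piles i).length = n) →
      interleaveProb piles cs = (∏ i, ((piles i).length.factorial : ℝ)) / (n.factorial : ℝ) *
        ∑ w : Fin n → Fin k, if DropsTo piles (List.ofFn w) cs then (1 : ℝ) else 0 := by
  intro n
  induction n with
  | zero =>
    intro cs hcs piles hp
    have : cs = [] := List.length_eq_zero_iff.mp hcs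
    subst this
    have h0 : ∀ i, piles i = [] := by
      intro i
      have := (Finset.sum_eq_zero_iff.mp hp) i (mem_univ i)
      exact List.length_eq_zero_iff.mp this
    simp [interleaveProb, DropsTo, h0]
  | succ n ih =>
    intro cs hcs piles hp
    match cs, hcs with
    | c :: cs, hcs =>
    have hcs' : cs.length = n := by simpa using hcs
    have hsum : (∑ j, ((piles j).length : ℝ)) = n + 1 := by
      rw [← Nat.cast_sum, hp]; push_cast; rfl
    rw [interleaveProb, ← (Fin.consEquiv (fun _ : Fin (n + 1) => Fin k)).sum_comp,
      Fintype.sum_prod_type, Finset.mul_sum]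
    refine Finset.sum_congr rfl fun i _ => ?_
    by_cases hi : (piles i).getLast? = some c
    · have hne : piles i ≠ [] := by
        intro h0; simp [h0] at hi
      have hpos : 0 < (piles i).length := List.length_pos_iff.mpr hne
      have hlen : ∀ j, (Function.update piles i (piles i).dropLast j).length =
          Function.update (fun j => (piles j).length) i ((piles i).length - 1) j := by
        intro j
        by_cases hj : j = i
        · subst hj; simp
        · simp [hj]
      have hs : ∑ j, (Function.update piles i (piles i).dropLast j).length = n := by
        simp_rw [hlen]
        rw [Finset.sum_update_of_mem (mem_univ i)]
        rw [← Finset.add_sum_erase _ _ (mem_univ i)] at hp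
        rw [Finset.sdiff_singleton_eq_erase]
        omega
      rw [if_pos hi, ih cs hcs' _ hs, hsum]
      have hprod : (∏ j, ((piles j).length.factorial : ℝ)) =
          (piles i).length * ∏ j, ((Function.update piles i (piles i).dropLast j).length.factorial
            : ℝ) := by
        rw [← Finset.mul_prod_erase _ _ (mem_univ i),
          ← Finset.mul_prod_erase _ (fun j => ((Function.update piles i (piles i).dropLast
            j).length.factorial : ℝ)) (mem_univ i)]
        have : ∀ j ∈ univ.erase i, ((Function.update piles i (piles i).dropLast j).length.factorial
            : ℝ) = ((piles j).length.factorial : ℝ) := by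
          intro j hj
          rw [Function.update_of_ne (ne_of_mem_erase hj)]
        rw [Finset.prod_congr rfl this]
        rw [← mul_assoc]
        congr 1
        simp only [Function.update_self, List.length_dropLast]
        rw [← Nat.mul_factorial_pred hpos.ne']
        push_cast; rfl
      rw [hprod, Nat.factorial_succ]
      have : ∀ w : Fin n → Fin k, (DropsTo piles (List.ofFn ((Fin.consEquiv fun _ => Fin k) (i, w)))
          (c :: cs)) ↔ DropsTo (Function.update piles i (piles i).dropLast) (List.ofFn w) cs := by
        intro w
        simp [Fin.consEquiv, List.ofFn_succ, DropsTo, hi]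
      simp_rw [this]
      have h1 : (n.factorial : ℝ) ≠ 0 := by positivity
      have h2 : (n : ℝ) + 1 ≠ 0 := by positivity
      push_cast
      field_simp
    · rw [if_neg hi]
      symm
      apply mul_eq_zero_of_right
      apply Finset.sum_eq_zero
      intro w _
      rw [if_neg]
      simp [Fin.consEquiv, List.ofFn_succ, DropsTo, hi]

/-- The inverse of the stable sort lists positions by label, ties broken by position. -/
theorem sort_symm_lt_iff {N m : ℕ} (w : Fin N → Fin m) (i j : Fin N) :
    (Tuple.sort w).symm i < (Tuple.sort w).symm j ↔ w i < w j ∨ (w i = w j ∧ i < j) := by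
  obtain ⟨hm, ht⟩ := (Tuple.eq_sort_iff (f := w) (σ := Tuple.sort w)).mp rfl
  have key : ∀ i j, (Tuple.sort w).symm i < (Tuple.sort w).symm j →
      w i < w j ∨ (w i = w j ∧ i < j) := by
    intro i j h
    have h1 := hm h.le
    simp only [Function.comp_apply, Equiv.apply_symm_apply] at h1
    rcases h1.lt_or_eq with h2 | h2
    · exact Or.inl h2
    · refine Or.inr ⟨h2, ?_⟩
      have := ht _ _ h (by simpa using h2)
      simpa using this
  refine ⟨key i j, fun h => ?_⟩
  by_contra hn
  rcases (not_lt.mp hn).lt_or_eq with h2 | h2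
  · have := key j i h2
    rcases h with h | h <;> rcases this with h' | h' <;> simp_all <;> omega
  · have : j = i := (Tuple.sort w).symm.injective h2
    subst this
    simp at h

/-- The two summands are what a cut deck needs: the offset of the pile labelled `w j`, and the depth
inside that pile. -/
theorem sort_symm_val {N m : ℕ} (w : Fin N → Fin m) (j : Fin N) :
    (((Tuple.sort w).symm j : Fin N) : ℕ) =
      (univ.filter fun i => w i < w j).card + (univ.filter fun i => w i = w j ∧ i < j).card := by
  rw [← Finset.card_union_of_disjoint]
  · rw [← Finset.filter_or]
    have h1 : ((Tuple.sort w).symm j : ℕ) = (Iio ((Tuple.sort w).symm j)).card := by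
      rw [Fin.card_Iio]
    rw [h1]
    symm
    refine Finset.card_bij (fun i _ => (Tuple.sort w).symm i) ?_ ?_ ?_
    · intro i hi
      rw [mem_Iio, sort_symm_lt_iff]
      simpa using hi
    · intro a _ b _ h
      exact (Tuple.sort w).symm.injective h
    · intro b hb
      refine ⟨Tuple.sort w b, ?_, by simp⟩
      have := (sort_symm_lt_iff w (Tuple.sort w b) j).mp (by simpa using hb)
      simpa using this
  · rw [Finset.disjoint_filter]
    intro i _ h1 h2
    exact absurd h2.1 h1.ne

/-- Dropping the piles of a cut deck according to the labels `w` of the final positions. -/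
theorem dropsTo_cut_iff {N k : ℕ} (w : Fin N → Fin k) (ρ : Equiv.Perm (Fin N)) :
    ∀ m (hm : m ≤ N),
      DropsTo (fun i => (cut (fun i => (univ.filter fun j => w j = i).card) (List.finRange N) i).take
          (univ.filter fun j : Fin N => w j = i ∧ (j : ℕ) < m).card)
        (List.ofFn fun j : Fin m => w (Fin.castLE hm j)).reverse
        (List.ofFn fun j : Fin m => ρ (Fin.castLE hm j)).reverse ↔
      ∀ j : Fin N, (j : ℕ) < m → ρ j = (Tuple.sort w).symm j := by
  intro m
  -- Cards are dropped from the last position to the first, so the state before position `m - 1` is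
  -- filled keeps from pile `i` its top cards, one for each of the first `m` positions labelled `i`.
  induction m with
  | zero => intro hm; simp [DropsTo]
  | succ m ih =>
    intro hm
    have hm' : m < N := hm
    set a : Fin N := ⟨m, hm'⟩ with ha
    have e1 : ∀ {β : Type} (f : Fin N → β),
        (List.ofFn fun j : Fin (m + 1) => f (Fin.castLE hm j)).reverse =
          f a :: (List.ofFn fun j : Fin m => f (Fin.castLE hm'.le j)).reverse := by
      intro β f
      rw [List.ofFn_succ', List.concat_eq_append, List.reverse_concat]
      rfl
    rw [e1, e1, DropsTo]
    set n : Fin k → ℕ := fun i => (univ.filter fun j => w j = i).card with hn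
    have hcard : ∀ i, (univ.filter fun j : Fin N => w j = i ∧ (j : ℕ) < m + 1).card =
        (univ.filter fun j : Fin N => w j = i ∧ (j : ℕ) < m).card + if w a = i then 1 else 0 := by
      intro i
      split_ifs with h
      · have : (univ.filter fun j : Fin N => w j = i ∧ (j : ℕ) < m + 1) =
            insert a (univ.filter fun j : Fin N => w j = i ∧ (j : ℕ) < m) := by
          ext j
          simp only [mem_filter, mem_univ, true_and, mem_insert]
          constructor
          · rintro ⟨h1, h2⟩
            rcases Nat.lt_succ_iff_lt_or_eq.mp h2 with h3 | h3
            · exact Or.inr ⟨h1, h3⟩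
            · exact Or.inl (Fin.ext h3)
          · rintro (h1 | ⟨h1, h2⟩)
            · subst h1
              exact ⟨h, by simp [ha]⟩
            · exact ⟨h1, by omega⟩
        rw [this, card_insert_of_notMem]
        simp [ha]
      · rw [add_zero]
        congr 1
        ext j
        simp only [mem_filter, mem_univ, true_and]
        constructor
        · rintro ⟨h1, h2⟩
          refine ⟨h1, ?_⟩
          rcases Nat.lt_succ_iff_lt_or_eq.mp h2 with h3 | h3
          · exact h3
          · have : j = a := Fin.ext h3
            subst this
            exact absurd h1 h
        · rintro ⟨h1, h2⟩
          exact ⟨h1, by omega⟩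
    have hoff : ∑ i ∈ Iio (w a), n i = (univ.filter fun j => w j < w a).card := by
      rw [Finset.card_eq_sum_card_fiberwise (f := w) (t := Iio (w a))]
      · refine Finset.sum_congr rfl fun i hi => ?_
        rw [hn]
        simp only
        congr 1
        ext j
        simp only [mem_filter, mem_univ, true_and]
        constructor
        · rintro rfl
          exact ⟨by simpa using hi, rfl⟩
        · exact fun h => h.2
      · intro j hj
        simpa using hj
    have hlt : (univ.filter fun j : Fin N => w j = w a ∧ (j : ℕ) < m).card < n (w a) := by
      apply Finset.card_lt_card
      rw [Finset.ssubset_iff_of_subset]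
      · exact ⟨a, by simp, by simp [ha]⟩
      · intro j; simp +contextual
    have hsv := sort_symm_val w a
    have hfa : (univ.filter fun j : Fin N => w j = w a ∧ j < a) =
        (univ.filter fun j : Fin N => w j = w a ∧ (j : ℕ) < m) := by
      ext j; simp [Fin.lt_def, ha]
    rw [hfa] at hsv
    -- The bottom card of the truncated pile `w a` sits at the offset of the pile plus the number of
    -- earlier equal labels, which is the rank of `a` in the stable sort.
    have hget : ((cut n (List.finRange N) (w a)).take
        (univ.filter fun j : Fin N => w j = w a ∧ (j : ℕ) < m + 1).card) =
        (cut n (List.finRange N) (w a)).take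
          (univ.filter fun j : Fin N => w j = w a ∧ (j : ℕ) < m).card ++
            [(Tuple.sort w).symm a] := by
      rw [hcard, if_pos rfl, List.take_add_one]
      congr 1
      rw [cut, List.getElem?_take_of_lt hlt, List.getElem?_drop, hoff, ← hsv,
        List.getElem?_eq_getElem (by simp), Option.toList_some]
      simp
    have hup : (Function.update (fun i => (cut n (List.finRange N) i).take
        (univ.filter fun j : Fin N => w j = i ∧ (j : ℕ) < m + 1).card) (w a)
        ((cut n (List.finRange N) (w a)).take
        (univ.filter fun j : Fin N => w j = w a ∧ (j : ℕ) < m + 1).card).dropLast) =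
        (fun i => (cut n (List.finRange N) i).take
          (univ.filter fun j : Fin N => w j = i ∧ (j : ℕ) < m).card) := by
      funext i
      by_cases hi : i = w a
      · subst hi
        rw [Function.update_self, hget, List.dropLast_concat]
      · rw [Function.update_of_ne hi, hcard, if_neg (Ne.symm hi), add_zero]
    rw [hup, ih hm'.le, hget, List.getLast?_concat, Option.some_inj]
    constructor
    · rintro ⟨h1, h2⟩ j hj
      rcases Nat.lt_succ_iff_lt_or_eq.mp hj with h3 | h3
      · exact h2 j h3
      · have : j = a := Fin.ext h3
        rw [this, h1]
    · intro h
      exact ⟨(h a (by simp [ha])).symm, fun j hj => h j (by omega)⟩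

theorem length_cut {N k : ℕ} {n : Fin k → ℕ} (hn : ∑ i, n i = N) {α : Type*} (deck : List α)
    (hd : deck.length = N) (i : Fin k) : (cut n deck i).length = n i := by
  have : ∑ j ∈ Iio i, n j + n i ≤ N := by
    rw [← hn, add_comm, ← Finset.sum_insert (by simp)]
    exact Finset.sum_le_sum_of_subset (subset_univ _)
  rw [cut, List.length_take, List.length_drop, hd]
  omega

/-- A shuffle is the inverse of the stable sort of independent labels of the final positions. -/
theorem shuffleProb_eq_sum {k : ℕ} (p : Fin k → ℝ) (N : ℕ) (ρ : Equiv.Perm (Fin N)) :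
    shuffleProb p N ρ =
      ∑ w : Fin N → Fin k, (∏ j, p (w j)) * if (Tuple.sort w).symm = ρ then 1 else 0 := by
  classical
  have h1 : ∀ n ∈ Finset.piAntidiag (Finset.univ : Finset (Fin k)) N,
      multinomialMass p n * interleaveProb (cut n (List.finRange N)) (List.ofFn ρ).reverse =
      ∑ w : Fin N → Fin k, if (fun i => (univ.filter fun j => w j = i).card) = n then
        (∏ j, p (w j)) * (if (Tuple.sort w).symm = ρ then 1 else 0) else 0 := by
    intro n hn
    have hn' : ∑ i, n i = N := by simpa using hn
    have hlen : ∀ i, (cut n (List.finRange N) i).length = n i :=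
      fun i => length_cut hn' _ (by simp) i
    rw [interleaveProb_eq_sum N _ (by simp) _ (by simp_rw [hlen]; exact hn'), ← mul_assoc,
      multinomialMass]
    -- The multinomial coefficient of the cut cancels the uniform weight of an interleaving; only
    -- independent labels remain.
    have hmult : (Nat.multinomial univ n : ℝ) * (∏ i, p i ^ n i) *
        ((∏ i, ((cut n (List.finRange N) i).length.factorial : ℝ)) / (N.factorial : ℝ)) =
        ∏ i, p i ^ n i := by
      have h := Nat.multinomial_spec (univ : Finset (Fin k)) n
      rw [hn'] at h
      have h' : (∏ i, ((n i).factorial : ℝ)) * (Nat.multinomial univ n : ℝ) = N.factorial := by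
        rw [← h]; push_cast; rfl
      simp_rw [hlen]
      have : (N.factorial : ℝ) ≠ 0 := by positivity
      field_simp
      linear_combination (∏ i, p i ^ n i) * h'
    -- The drop order starts at the bottom of the new deck, so labels by time of drop are labels by
    -- position read backwards.
    rw [hmult, ← (Equiv.arrowCongr (Fin.revPerm (n := N)) (Equiv.refl (Fin k))).sum_comp,
      Finset.mul_sum]
    refine Finset.sum_congr rfl fun w _ => ?_
    have hw : List.ofFn ((Equiv.arrowCongr (Fin.revPerm (n := N)) (Equiv.refl (Fin k))) w) =
        (List.ofFn w).reverse := by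
      apply List.ext_getElem (by simp)
      intro i h1 h2
      simp only [List.getElem_ofFn, List.getElem_reverse, List.length_ofFn]
      simp only [Equiv.arrowCongr_apply, Function.comp_apply, Equiv.refl_apply]
      congr 1
      apply Fin.ext
      simp at h1
      simp [Fin.val_rev]
      omega
    rw [hw]
    by_cases hc : (fun i => (univ.filter fun j => w j = i).card) = n
    · rw [if_pos hc]
      have hd := dropsTo_cut_iff w ρ N le_rfl
      simp only [Fin.castLE_rfl, id] at hd
      rw [hc] at hd
      have : (fun i => (cut n (List.finRange N) i).take
          (univ.filter fun j : Fin N => w j = i ∧ (j : ℕ) < N).card) =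
          cut n (List.finRange N) := by
        funext i
        apply List.take_of_length_le
        rw [hlen, ← hc]
        simp
      rw [this] at hd
      have hp : ∏ i, p i ^ n i = ∏ j, p (w j) := by
        rw [← hc]
        simp_rw [← Finset.prod_const]
        rw [← Finset.prod_fiberwise univ w (fun j => p (w j))]
        refine Finset.prod_congr rfl fun i _ => Finset.prod_congr rfl fun j hj => ?_
        rw [(mem_filter.mp hj).2]
      rw [hp]
      congr 1
      refine if_congr ?_ rfl rfl
      rw [hd]
      constructor
      · intro h; ext j; rw [h j j.2]
      · rintro rfl j _; rfl
    · rw [if_neg hc]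
      apply mul_eq_zero_of_right
      rw [if_neg]
      intro hD
      apply hc
      funext i
      have := hD.length_eq_count i
      rw [hlen] at this
      rw [this, List.count_reverse, List.count_eq_countP, List.ofFn_eq_map, List.countP_map,
        Finset.card, Finset.filter_val, ← Multiset.countP_eq_card_filter]
      change List.countP _ (List.finRange N) = _
      congr 1
  rw [shuffleProb, Finset.sum_congr rfl h1, Finset.sum_comm]
  refine Finset.sum_congr rfl fun w _ => ?_
  rw [Finset.sum_ite_eq, if_pos]
  rw [mem_piAntidiag]
  refine ⟨?_, by simp⟩
  rw [← Finset.card_eq_sum_card_fiberwise (by simp)]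
  simp

/-! ### Words -/

/-- The probability of the word with base `k` digits those of `x < k ^ K`, when the digits are
independent with law `p`. -/
noncomputable def wordMass {k : ℕ} [NeZero k] (p : Fin k → ℝ) : ℕ → ℕ → ℝ
  | 0, _ => 1
  | K + 1, x => wordMass p K (x / k) * p (Fin.ofNat k x)

theorem wordMass_zero {k : ℕ} [NeZero k] (p : Fin k → ℝ) (x : ℕ) : wordMass p 0 x = 1 := rfl

theorem wordMass_succ {k : ℕ} [NeZero k] (p : Fin k → ℝ) (K x : ℕ) :
    wordMass p (K + 1) x = wordMass p K (x / k) * p (Fin.ofNat k x) := rfl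

/-- Radix sort: sorting by a pair of labels is sorting by the minor label, then stably by the
major one. -/
theorem sort_mul_sort {N m k : ℕ} (v : Fin N → Fin m) (w : Fin N → Fin k) :
    Tuple.sort w * Tuple.sort (v ∘ Tuple.sort w) =
      Tuple.sort (fun j => finProdFinEquiv (v j, w j)) := by
  set α := Tuple.sort w with hα
  set β := Tuple.sort (v ∘ α) with hβ
  obtain ⟨hm1, ht1⟩ := Tuple.eq_sort_iff.mp hα
  obtain ⟨hm2, ht2⟩ := Tuple.eq_sort_iff.mp hβ
  have hle : ∀ a b : Fin m × Fin k, finProdFinEquiv a ≤ finProdFinEquiv b ↔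
      a.1 < b.1 ∨ (a.1 = b.1 ∧ a.2 ≤ b.2) := by
    rintro ⟨a1, a2⟩ ⟨b1, b2⟩
    rw [Fin.le_def, Fin.lt_def, Fin.le_def, Fin.ext_iff]
    simp only [finProdFinEquiv_apply_val]
    have h1 := a2.2
    have h2 := b2.2
    constructor
    · intro h
      rcases lt_trichotomy (a1 : ℕ) b1 with h3 | h3 | h3
      · exact Or.inl h3
      · refine Or.inr ⟨h3, ?_⟩
        rw [h3] at h; omega
      · exfalso
        have : k * (b1 + 1) ≤ k * (a1 : ℕ) := Nat.mul_le_mul_left k h3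
        rw [mul_add] at this
        omega
    · rintro (h | ⟨h, h'⟩)
      · have : k * (a1 + 1) ≤ k * (b1 : ℕ) := Nat.mul_le_mul_left k h
        rw [mul_add] at this
        omega
      · rw [h]; omega
  rw [Tuple.eq_sort_iff]
  constructor
  · intro i j hij
    simp only [Function.comp_apply, Equiv.Perm.mul_apply]
    rw [hle]
    rcases hij.eq_or_lt with h | h
    · subst h; exact Or.inr ⟨rfl, le_rfl⟩
    rcases (hm2 hij).lt_or_eq with h' | h'
    · exact Or.inl h'
    · exact Or.inr ⟨h', hm1 (ht2 i j h h').le⟩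
  · intro i j hij heq
    simp only [Equiv.Perm.mul_apply] at heq ⊢
    have heq' := finProdFinEquiv.injective heq
    rw [Prod.mk.injEq] at heq'
    exact ht1 _ _ (ht2 i j hij heq'.1) heq'.2

theorem deckProb_eq_sum {k : ℕ} [NeZero k] (p : Fin k → ℝ) (N : ℕ) :
    ∀ (K : ℕ) (σ : Equiv.Perm (Fin N)), deckProb p N K σ =
      ∑ u : Fin N → Fin (k ^ K), (∏ j, wordMass p K (u j)) *
        if (Tuple.sort u).symm = σ then 1 else 0 := by
  intro K
  induction K with
  | zero =>
    intro σ
    have : ∀ u : Fin N → Fin (k ^ 0), (Tuple.sort u).symm = 1 := by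
      intro u
      have : Tuple.sort u = Equiv.refl _ := by
        rw [Tuple.sort_eq_refl_iff_monotone]
        intro i j _
        have h : ∀ x : Fin (k ^ 0), (x : ℕ) = 0 := fun x => by have := x.2; simp at this; omega
        rw [Fin.le_def, h, h]
      rw [this]; rfl
    simp only [this, wordMass_zero, deckProb, eq_comm (a := σ)]
    have hc : (univ : Finset (Fin N → Fin (k ^ 0))).card = 1 := by
      rw [Finset.card_univ, Fintype.card_fun]; simp
    simp only [prod_const_one, one_mul, sum_const, hc, one_smul]
  | succ K ih =>
    intro σ
    rw [deckProb]
    simp_rw [ih, shuffleProb_eq_sum, Finset.sum_mul_sum]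
    have e : ∀ (ρ : Equiv.Perm (Fin N)) (v : Fin N → Fin (k ^ K)) (w : Fin N → Fin k),
        ((∏ j, wordMass p K (v j)) * if (Tuple.sort v).symm = σ * ρ⁻¹ then 1 else 0) *
          ((∏ j, p (w j)) * if (Tuple.sort w).symm = ρ then 1 else 0) =
        if (Tuple.sort w).symm = ρ then (∏ j, wordMass p K (v j)) * (∏ j, p (w j)) *
          (if (Tuple.sort v).symm * (Tuple.sort w).symm = σ then 1 else 0) else 0 := by
      intro ρ v w
      by_cases h : (Tuple.sort w).symm = ρ
      · subst h
        simp only [if_true, mul_one]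
        simp only [eq_mul_inv_iff_mul_eq]
        ring
      · simp [h]
    simp_rw [e]
    rw [Finset.sum_comm]
    simp_rw [Finset.sum_comm (s := (univ : Finset (Equiv.Perm (Fin N))))]
    simp only [Finset.sum_ite_eq, mem_univ, if_true]
    rw [Finset.sum_comm]
    have e2 : ∀ w : Fin N → Fin k,
        (∑ v : Fin N → Fin (k ^ K), (∏ j, wordMass p K (v j)) * (∏ j, p (w j)) *
          (if (Tuple.sort v).symm * (Tuple.sort w).symm = σ then (1 : ℝ) else 0)) =
        ∑ v : Fin N → Fin (k ^ K), (∏ j, wordMass p (K + 1) (finProdFinEquiv (v j, w j) : Fin _)) *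
          (if (Tuple.sort fun j => finProdFinEquiv (v j, w j)).symm = σ then (1 : ℝ) else 0) := by
      intro w
      -- Letting the earlier labels `v` travel with the cards, as `v ∘ sort w`, does not change
      -- their product mass and puts the composition in the form of a radix sort, with `w` as minor
      -- digit.
      rw [← (Equiv.arrowCongr (Tuple.sort w).symm (Equiv.refl (Fin (k ^ K)))).sum_comp]
      refine Finset.sum_congr rfl fun v _ => ?_
      have hv : (Equiv.arrowCongr (Tuple.sort w).symm (Equiv.refl (Fin (k ^ K)))) v =
          v ∘ Tuple.sort w := by
        funext j; simp
      rw [hv, ← sort_mul_sort]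
      congr 1
      have h1 : (∏ j, wordMass p K ((v ∘ Tuple.sort w) j)) = ∏ j, wordMass p K (v j) :=
        Equiv.prod_comp (Tuple.sort w) (fun j => wordMass p K (v j))
      rw [h1, ← Finset.prod_mul_distrib]
      refine Finset.prod_congr rfl fun j _ => ?_
      have hk : 0 < k := Nat.pos_of_neZero k
      rw [wordMass_succ]
      congr 2
      · rw [finProdFinEquiv_apply_val]
        simp only
        rw [Nat.add_mul_div_left _ _ hk, Nat.div_eq_of_lt (w j).2, zero_add]
      · apply Fin.ext
        simp [Fin.ofNat, Nat.mod_eq_of_lt]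
    simp_rw [e2]
    rw [Finset.sum_comm, ← Fintype.sum_prod_type']
    refine Fintype.sum_equiv ((Equiv.arrowProdEquivProdArrow (Fin N) (fun _ => Fin (k ^ K))
      (fun _ => Fin k)).symm.trans (Equiv.arrowCongr (Equiv.refl _) finProdFinEquiv)) _ _ ?_
    rintro ⟨v, w⟩
    rfl

/-! ### Permutations ascending along a set of edges -/

/-- `π` ascends along the edges of `A`, the edge `e` joining the positions `e` and `e + 1`. -/
def Ascends {N : ℕ} (A : Finset ℕ) (π : Equiv.Perm (Fin N)) : Prop :=
  ∀ i j : Fin N, (j : ℕ) = i + 1 → (i : ℕ) ∈ A → π i < π j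

/-- The edges along which `s` is constant. -/
def edges {N T : ℕ} (s : Fin N → Fin T) : Finset ℕ :=
  (range N).filter fun e => ∃ i j : Fin N, (i : ℕ) = e ∧ (j : ℕ) = e + 1 ∧ s i = s j

theorem mem_edges {N T : ℕ} {s : Fin N → Fin T} {e : ℕ} :
    e ∈ edges s ↔ ∃ i j : Fin N, (i : ℕ) = e ∧ (j : ℕ) = e + 1 ∧ s i = s j := by
  rw [edges, mem_filter, mem_range, and_iff_right_iff_imp]
  rintro ⟨i, j, rfl, _⟩
  exact i.2

theorem edge_mem_edges {N T : ℕ} {s : Fin N → Fin T} {i j : Fin N} (hij : (j : ℕ) = i + 1) :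
    (i : ℕ) ∈ edges s ↔ s i = s j := by
  rw [mem_edges]
  constructor
  · rintro ⟨a, b, ha, hb, h⟩
    rwa [Fin.ext ha, Fin.ext (hb.trans hij.symm)] at h
  · exact fun h => ⟨i, j, rfl, hij, h⟩

open Classical in
/-- The number of permutations ascending along `A`. -/
noncomputable def ascCount (N : ℕ) (A : Finset ℕ) : ℕ :=
  (univ.filter fun π : Equiv.Perm (Fin N) => Ascends A π).card

/-- The level sets of a monotone sequence are intervals, so comparisons of neighbours chain to
comparisons inside a block. -/
theorem ascends_edges_iff {N T : ℕ} {s : Fin N → Fin T} (hs : Monotone s)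
    (π : Equiv.Perm (Fin N)) :
    Ascends (edges s) π ↔ ∀ i j, i < j → s i = s j → π i < π j := by
  constructor
  · intro h
    have key : ∀ d : ℕ, ∀ i j : Fin N, (j : ℕ) = i + d + 1 → s i = s j → π i < π j := by
      intro d
      induction d with
      | zero => intro i j hij hs'; exact h i j hij ((edge_mem_edges hij).mpr hs')
      | succ d ih =>
        intro i j hij hs'
        have hj := j.2
        let m : Fin N := ⟨i + d + 1, by omega⟩
        have him : i ≤ m := by simp [Fin.le_def, m]; omega
        have hmj : m ≤ j := by simp [Fin.le_def, m]; omega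
        have h1 : s i = s m := le_antisymm (hs him) (hs' ▸ hs hmj)
        have h2 : s m = s j := h1.symm.trans hs'
        exact (ih i m rfl h1).trans (h m j (by simp [m]; omega)
          ((edge_mem_edges (by simp [m]; omega)).mpr h2))
    intro i j hij
    exact key (j - i - 1) i j (by have : (i : ℕ) < j := hij; omega)
  · intro h i j hij hmem
    exact h i j (by rw [Fin.lt_def]; omega) ((edge_mem_edges hij).mp hmem)

theorem sort_eq_iff {N T : ℕ} (u : Fin N → Fin T) (π : Equiv.Perm (Fin N)) :
    π = Tuple.sort u ↔ Monotone (u ∘ π) ∧ Ascends (edges (u ∘ π)) π := by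
  rw [Tuple.eq_sort_iff]
  constructor
  · rintro ⟨h1, h2⟩
    exact ⟨h1, (ascends_edges_iff h1 π).mpr h2⟩
  · rintro ⟨h1, h2⟩
    exact ⟨h1, (ascends_edges_iff h1 π).mp h2⟩

open Classical in
/-- The nondecreasing sequences. -/
noncomputable def sortedSeqs (N T : ℕ) : Finset (Fin N → Fin T) :=
  univ.filter fun s => Monotone s

theorem mem_sortedSeqs {N T : ℕ} {s : Fin N → Fin T} : s ∈ sortedSeqs N T ↔ Monotone s := by
  classical simp [sortedSeqs]

open Classical in
/-- A sequence is the same thing as its sorted version with a permutation ascending on blocks. -/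
theorem sum_eq_sum_sorted {M : Type*} [AddCommMonoid M] {N T : ℕ} (F : (Fin N → Fin T) → M) :
    ∑ u, F u = ∑ s ∈ sortedSeqs N T,
      ∑ π ∈ univ.filter (fun π : Equiv.Perm (Fin N) => Ascends (edges s) π), F (s ∘ π.symm) := by
  rw [Finset.sum_sigma']
  refine Finset.sum_bij' (fun u _ => ⟨u ∘ Tuple.sort u, Tuple.sort u⟩)
    (fun x _ => x.1 ∘ x.2.symm) ?_ ?_ ?_ ?_ ?_
  · intro u _
    obtain ⟨h1, h2⟩ := (sort_eq_iff u _).mp rfl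
    simp [mem_sortedSeqs, h1, h2]
  · intro x _; simp
  · intro u _; funext i; simp
  · rintro ⟨s, π⟩ h
    simp only [mem_sigma, mem_sortedSeqs, mem_filter, mem_univ, true_and] at h
    have hc : (s ∘ π.symm) ∘ π = s := by funext i; simp
    have : π = Tuple.sort (s ∘ π.symm) := by
      rw [sort_eq_iff, hc]; exact h
    simp only
    rw [← this, hc]
  · intro u _
    congr 1
    funext i; simp

/-- The law of the sorted sequence of `N` independent labels. -/
noncomputable def sortedMass {N T : ℕ} (q : Fin T → ℝ) (s : Fin N → Fin T) : ℝ :=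
  (∏ i, q (s i)) * ascCount N (edges s)

theorem sortedMass_nonneg {N T : ℕ} {q : Fin T → ℝ} (hq : ∀ x, 0 ≤ q x) (s : Fin N → Fin T) :
    0 ≤ sortedMass q s :=
  mul_nonneg (prod_nonneg fun _ _ => hq _) (Nat.cast_nonneg _)

/-- Each sorted `s` comes from `ascCount N (edges s)` sequences, all of the same mass. -/
theorem sum_sortedMass_mul {N T : ℕ} (q : Fin T → ℝ) (F : (Fin N → Fin T) → ℝ) :
    ∑ s ∈ sortedSeqs N T, sortedMass q s * F s =
      ∑ u : Fin N → Fin T, (∏ i, q (u i)) * F (u ∘ Tuple.sort u) := by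
  classical
  rw [sum_eq_sum_sorted]
  refine Finset.sum_congr rfl fun s hs => ?_
  have : ∀ π ∈ univ.filter (fun π : Equiv.Perm (Fin N) => Ascends (edges s) π),
      (∏ i, q ((s ∘ π.symm) i)) * F ((s ∘ π.symm) ∘ Tuple.sort (s ∘ π.symm)) =
        (∏ i, q (s i)) * F s := by
    intro π hπ
    have hc : (s ∘ π.symm) ∘ π = s := by funext i; simp
    have h : π = Tuple.sort (s ∘ π.symm) := by
      rw [sort_eq_iff, hc]; exact ⟨mem_sortedSeqs.mp hs, (mem_filter.mp hπ).2⟩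
    rw [← h, hc]
    congr 1
    exact Equiv.prod_comp π.symm (fun i => q (s i))
  rw [Finset.sum_congr rfl this, sum_const, sortedMass, ascCount, nsmul_eq_mul]
  ring

theorem sum_sortedMass {N T : ℕ} {q : Fin T → ℝ} (hq : ∑ x, q x = 1) :
    ∑ s ∈ sortedSeqs N T, sortedMass q s = 1 := by
  have := sum_sortedMass_mul q (fun _ : Fin N → Fin T => (1 : ℝ))
  simp only [mul_one] at this
  rw [this]
  have h := (Finset.prod_univ_sum (fun _ : Fin N => (univ : Finset (Fin T)))
    (fun _ x => q x)).symm
  rw [Fintype.piFinset_univ] at h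
  rw [h, hq, prod_const_one]

open Classical in
theorem deckProb_eq_sum_sorted {k : ℕ} [NeZero k] (p : Fin k → ℝ) (N K : ℕ)
    (π : Equiv.Perm (Fin N)) :
    deckProb p N K π.symm = ∑ s ∈ sortedSeqs N (k ^ K),
      (∏ i, wordMass p K (s i)) * if Ascends (edges s) π then 1 else 0 := by
  rw [deckProb_eq_sum, sum_eq_sum_sorted]
  refine Finset.sum_congr rfl fun s hs => ?_
  have : ∀ τ ∈ univ.filter (fun τ : Equiv.Perm (Fin N) => Ascends (edges s) τ),
      ((∏ i, wordMass p K ((s ∘ τ.symm) i)) *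
        if (Tuple.sort (s ∘ τ.symm)).symm = π.symm then (1 : ℝ) else 0) =
        if τ = π then ∏ i, wordMass p K (s i) else 0 := by
    intro τ hτ
    have hc : (s ∘ τ.symm) ∘ τ = s := by funext i; simp
    have h : τ = Tuple.sort (s ∘ τ.symm) := by
      rw [sort_eq_iff, hc]; exact ⟨mem_sortedSeqs.mp hs, (mem_filter.mp hτ).2⟩
    rw [← h]
    have hp : (∏ i, wordMass p K ((s ∘ τ.symm) i)) = ∏ i, wordMass p K (s i) :=
      Equiv.prod_comp τ.symm (fun i => wordMass p K (s i))
    rw [hp]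
    by_cases h1 : τ = π
    · simp [h1]
    · rw [if_neg h1, if_neg (fun h2 => h1 (Equiv.symm_bijective.injective h2)), mul_zero]
  rw [Finset.sum_congr rfl this, Finset.sum_ite_eq']
  simp

/-- The number of positions of the maximal run of edges of `A` ending at position `i`. -/
def runLen (A : Finset ℕ) : ℕ → ℕ
  | 0 => 1
  | i + 1 => if i ∈ A then runLen A i + 1 else 1

theorem one_le_runLen (A : Finset ℕ) (i : ℕ) : 1 ≤ runLen A i := by
  cases i with
  | zero => exact le_rfl
  | succ i => rw [runLen]; split_ifs <;> omega

theorem runLen_mono {A B : Finset ℕ} (h : A ⊆ B) (i : ℕ) : runLen A i ≤ runLen B i := by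
  induction i with
  | zero => exact le_rfl
  | succ i ih =>
    rw [runLen, runLen]
    split_ifs with h1 h2 h2
    · omega
    · exact absurd (h h1) h2
    · omega
    · exact le_rfl

theorem runLen_edges {N T : ℕ} {s : Fin N → Fin T} (hs : Monotone s) :
    ∀ i : Fin N, runLen (edges s) i = (univ.filter fun j => s j = s i ∧ j ≤ i).card := by
  have key : ∀ m : ℕ, ∀ i : Fin N, (i : ℕ) = m →
      runLen (edges s) i = (univ.filter fun j => s j = s i ∧ j ≤ i).card := by
    intro m
    induction m with
    | zero =>
      intro i hi
      rw [hi, runLen]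
      symm
      rw [card_eq_one]
      refine ⟨i, ?_⟩
      ext j
      simp only [mem_filter, mem_univ, true_and, mem_singleton]
      constructor
      · rintro ⟨_, h⟩
        apply Fin.ext
        have : (j : ℕ) ≤ i := h
        omega
      · rintro rfl; simp
    | succ m ih =>
      intro i hi
      let i' : Fin N := ⟨m, by have := i.2; omega⟩
      have hii : (i : ℕ) = i' + 1 := hi
      rw [hi, runLen]
      have hmem : m ∈ edges s ↔ s i' = s i := edge_mem_edges (i := i') hii
      have hih := ih i' rfl
      by_cases h : m ∈ edges s
      · rw [if_pos h]
        have hs' := hmem.mp h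
        have : (univ.filter fun j => s j = s i ∧ j ≤ i) =
            insert i (univ.filter fun j => s j = s i' ∧ j ≤ i') := by
          ext j
          simp only [mem_filter, mem_univ, true_and, mem_insert, hs', Fin.le_def]
          constructor
          · rintro ⟨h1, h2⟩
            rcases Nat.lt_or_eq_of_le h2 with h3 | h3
            · exact Or.inr ⟨h1, by omega⟩
            · exact Or.inl (Fin.ext h3)
          · rintro (rfl | ⟨h1, h2⟩)
            · exact ⟨rfl, le_rfl⟩
            · exact ⟨h1, by omega⟩
        rw [this, card_insert_of_notMem, ← hih]
        simp only [mem_filter, not_and, Fin.le_def]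
        intro _ _; omega
      · rw [if_neg h]
        symm
        rw [card_eq_one]
        refine ⟨i, ?_⟩
        ext j
        simp only [mem_filter, mem_univ, true_and, mem_singleton]
        constructor
        · rintro ⟨h1, h2⟩
          by_contra hne
          have h3 : j ≤ i' := by
            have h4 : (j : ℕ) ≠ i := fun h4 => hne (Fin.ext h4)
            have h5 : (j : ℕ) ≤ i := h2
            rw [Fin.le_def]; omega
          have h6 : i' ≤ i := by rw [Fin.le_def]; omega
          exact h (hmem.mpr (le_antisymm (hs h6) (h1 ▸ hs h3)))
        · rintro rfl; simp
  exact fun i => key i i rfl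

theorem prod_card_filter_le {N : ℕ} (F : Finset (Fin N)) :
    ∏ i ∈ F, (F.filter fun j => j ≤ i).card = F.card.factorial := by
  induction F using Finset.induction_on_max with
  | empty => simp
  | insert a F hF ih =>
    have ha : a ∉ F := fun h => lt_irrefl _ (hF a h)
    rw [prod_insert ha, card_insert_of_notMem ha, Nat.factorial_succ]
    congr 1
    · rw [filter_true_of_mem, card_insert_of_notMem ha]
      intro j hj
      rcases mem_insert.mp hj with rfl | h
      · exact le_rfl
      · exact (hF j h).le
    · rw [← ih]
      refine prod_congr rfl fun i hi => ?_
      rw [filter_insert, if_neg (not_le.mpr (hF i hi))]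

theorem prod_factorial_eq_prod_runLen {N T : ℕ} {s : Fin N → Fin T} (hs : Monotone s) :
    ∏ x, ((univ.filter fun i => s i = x).card.factorial) = ∏ i ∈ range N, runLen (edges s) i := by
  rw [Finset.prod_range, ← Finset.prod_fiberwise univ s]
  refine prod_congr rfl fun x _ => ?_
  rw [← prod_card_filter_le]
  refine prod_congr rfl fun i hi => ?_
  rw [runLen_edges hs, filter_filter]
  rw [(mem_filter.mp hi).2]

-- Every permutation factors uniquely as `π * g` with `g` preserving the blocks of `s` and `π`
-- ascending on them; `π` is recovered as the stable sort of `s ∘ ρ⁻¹`. The factors `g` are counted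
-- by the product of the block factorials.
open Classical in
theorem ascCount_edges_mul {N T : ℕ} {s : Fin N → Fin T} (hs : Monotone s) :
    ascCount N (edges s) * ∏ x, ((univ.filter fun i => s i = x).card.factorial) =
      N.factorial := by
  have h1 : Fintype.card {g : Equiv.Perm (Fin N) // s ∘ g = s} =
      ∏ x, ((univ.filter fun i => s i = x).card.factorial) := by
    rw [DomMulAct.stabilizer_card]
    refine prod_congr rfl fun x _ => ?_
    rw [Fintype.card_subtype]
  rw [← h1, ascCount, Fintype.card_subtype, ← card_product]
  have h2 : N.factorial = (univ : Finset (Equiv.Perm (Fin N))).card := by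
    rw [card_univ, Fintype.card_perm, Fintype.card_fin]
  rw [h2]
  refine card_bij' (fun x _ => x.1 * x.2) (fun ρ _ => (Tuple.sort (s ∘ ρ.symm),
    (Tuple.sort (s ∘ ρ.symm)).symm * ρ)) ?_ ?_ ?_ ?_
  · intro x _; exact mem_univ _
  · intro ρ _
    obtain ⟨h3, h4⟩ := (sort_eq_iff (s ∘ ρ.symm) _).mp rfl
    have h5 : (s ∘ ρ.symm) ∘ Tuple.sort (s ∘ ρ.symm) = s := by
      have h6 := Tuple.unique_monotone (f := s ∘ ρ.symm) (σ := ρ) (τ := Tuple.sort (s ∘ ρ.symm))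
        (by have : (s ∘ ρ.symm) ∘ ρ = s := by (funext i; simp)
            rw [this]; exact hs) h3
      rw [← h6]; funext i; simp
    rw [h5] at h4
    simp only [mem_product, mem_filter, mem_univ, true_and]
    refine ⟨h4, ?_⟩
    have h7 : ∀ i, s i = s (ρ.symm (Tuple.sort (s ∘ ρ.symm) i)) := fun i => (congrFun h5 i).symm
    funext i
    simp only [Function.comp_apply, Equiv.Perm.mul_apply]
    rw [h7]
    simp
  · rintro ⟨π, g⟩ h
    simp only [mem_product, mem_filter, mem_univ, true_and] at h
    obtain ⟨h3, h4⟩ := h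
    have h5 : s ∘ (π * g).symm = s ∘ π.symm := by
      funext i
      have : ∀ j, s (g.symm j) = s j := by
        intro j
        have := congrFun h4 (g.symm j)
        simpa using this.symm
      change s (g.symm (π.symm i)) = s (π.symm i)
      exact this _
    have h6 : π = Tuple.sort (s ∘ π.symm) := by
      have hc : (s ∘ π.symm) ∘ π = s := by funext i; simp
      rw [sort_eq_iff, hc]; exact ⟨hs, h3⟩
    simp only [h5, ← h6]
    congr 1
    ext i; simp
  · intro ρ _
    ext i; simp

theorem ascCount_mul_prod_runLen (N : ℕ) (A : Finset ℕ) :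
    ascCount N A * ∏ i ∈ range N, runLen A i = N.factorial := by
  classical
  -- Counting the missing edges before `i` gives a monotone sequence that is constant along the
  -- edges of `A` between two of the `N` positions and along no others; this reduces to the case of
  -- blocks.
  let s : Fin N → Fin (N + 1) := fun i => ⟨((range i).filter (· ∉ A)).card, by
    have := card_filter_le (range (i : ℕ)) (· ∉ A)
    rw [card_range] at this
    have := i.2
    omega⟩
  have hs : Monotone s := by
    intro i j hij
    rw [Fin.le_def]
    exact card_le_card (filter_subset_filter _ (range_subset_range.mpr hij))
  have hmem : ∀ i j : Fin N, (j : ℕ) = i + 1 → ((i : ℕ) ∈ edges s ↔ (i : ℕ) ∈ A) := by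
    intro i j hij
    rw [edge_mem_edges hij, Fin.ext_iff]
    simp only [s]
    rw [hij, range_add_one, filter_insert]
    split_ifs with h
    · simp [h]
    · simp only [h, not_false_eq_true] at *
      simp
  have h1 : ascCount N A = ascCount N (edges s) := by
    rw [ascCount, ascCount]
    congr 1
    ext π
    rw [mem_filter, mem_filter]
    refine and_congr_right fun _ => ?_
    refine forall_congr' fun i => forall_congr' fun j => forall_congr' fun hij => ?_
    rw [hmem i j hij]
  have h2 : ∀ i < N, runLen A i = runLen (edges s) i := by
    intro i
    induction i with
    | zero => intro _; rfl
    | succ i ih =>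
      intro hi
      rw [runLen, runLen, ih (by omega)]
      have := hmem ⟨i, by omega⟩ ⟨i + 1, hi⟩ rfl
      simp only at this
      simp only [this]
  rw [h1, prod_congr rfl fun i hi => h2 i (mem_range.mp hi), ← prod_factorial_eq_prod_runLen hs,
    ascCount_edges_mul hs]

theorem ascCount_pos (N : ℕ) (A : Finset ℕ) : 0 < ascCount N A := by
  have := ascCount_mul_prod_runLen N A
  have h : 0 < N.factorial := Nat.factorial_pos N
  rw [← this] at h
  exact Nat.pos_of_mul_pos_right h

theorem prod_runLen_pos (N : ℕ) (A : Finset ℕ) : 0 < ∏ i ∈ range N, runLen A i :=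
  prod_pos fun i _ => one_le_runLen A i

/-- Unless the edge just before `i` lies in both sets, one of the two runs ending at `i` has length
`1`, and the other is at most the run of the union. -/
theorem runLen_mul_le {A B : Finset ℕ} {L i : ℕ} (hB : runLen B i ≤ L) :
    runLen A i * runLen B i ≤ runLen (A ∪ B) i * if 1 ≤ i ∧ i - 1 ∈ A ∩ B then L else 1 := by
  have h1 := runLen_mono (subset_union_left (s₁ := A) (s₂ := B)) i
  have h2 := runLen_mono (subset_union_right (s₁ := A) (s₂ := B)) i
  split_ifs with h
  · exact Nat.mul_le_mul h1 hB
  · cases i with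
    | zero => simp [runLen]
    | succ i =>
      rw [mul_one]
      simp only [Nat.le_add_left, Nat.add_sub_cancel, true_and, mem_inter, not_and] at h
      by_cases hA : i ∈ A
      · have hb : runLen B (i + 1) = 1 := by rw [runLen, if_neg (h hA)]
        rw [hb, mul_one]; exact h1
      · have ha : runLen A (i + 1) = 1 := by rw [runLen, if_neg hA]
        rw [ha, one_mul]; exact h2

/-- Divided by `N!` squared, this compares the joint probability of the two ascent events with the
product of their probabilities: only common edges correlate them, at a factor `L` each. It drives
the second moment. -/
theorem ascCount_union_mul_le {N L : ℕ} {A B : Finset ℕ} (hL : 1 ≤ L)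
    (hB : ∀ i < N, runLen B i ≤ L) :
    ascCount N (A ∪ B) * N.factorial ≤ ascCount N A * ascCount N B * L ^ (A ∩ B).card := by
  have hU := ascCount_mul_prod_runLen N (A ∪ B)
  have hA := ascCount_mul_prod_runLen N A
  have hB' := ascCount_mul_prod_runLen N B
  have key : (∏ i ∈ range N, runLen A i) * (∏ i ∈ range N, runLen B i) ≤
      (∏ i ∈ range N, runLen (A ∪ B) i) * L ^ (A ∩ B).card := by
    rw [← prod_mul_distrib]
    calc ∏ i ∈ range N, runLen A i * runLen B i
        ≤ ∏ i ∈ range N, (runLen (A ∪ B) i * if 1 ≤ i ∧ i - 1 ∈ A ∩ B then L else 1) :=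
          prod_le_prod' fun i hi => runLen_mul_le (hB i (mem_range.mp hi))
      _ = (∏ i ∈ range N, runLen (A ∪ B) i) *
          L ^ ((range N).filter fun i => 1 ≤ i ∧ i - 1 ∈ A ∩ B).card := by
          rw [prod_mul_distrib, ← prod_filter, prod_const]
      _ ≤ _ := by
          refine Nat.mul_le_mul_left _ (Nat.pow_le_pow_right hL ?_)
          refine card_le_card_of_injOn (fun i => i - 1) ?_ ?_
          · intro i hi
            exact (mem_filter.mp hi).2.2
          · intro i hi j hj h
            have h1 := (mem_filter.mp hi).2.1
            have h2 := (mem_filter.mp hj).2.1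
            simp only at h
            omega
  have hpA := prod_runLen_pos N A
  have hpB := prod_runLen_pos N B
  refine Nat.le_of_mul_le_mul_right ?_ (Nat.mul_pos hpA hpB)
  calc ascCount N (A ∪ B) * N.factorial *
        ((∏ i ∈ range N, runLen A i) * (∏ i ∈ range N, runLen B i))
      ≤ ascCount N (A ∪ B) * N.factorial *
        ((∏ i ∈ range N, runLen (A ∪ B) i) * L ^ (A ∩ B).card) := Nat.mul_le_mul_left _ key
    _ = (ascCount N (A ∪ B) * ∏ i ∈ range N, runLen (A ∪ B) i) * N.factorial *
          L ^ (A ∩ B).card := by ring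
    _ = (ascCount N A * ∏ i ∈ range N, runLen A i) *
        (ascCount N B * ∏ i ∈ range N, runLen B i) * L ^ (A ∩ B).card := by rw [hU, hA, hB']
    _ = _ := by ring

/-- The run ending at `i` is stopped by the last edge before `i` that is missing from `A`. Only the
insertion of that edge lengthens the run, so at most one of `e` and `f` does. -/
theorem runLen_insert (A : Finset ℕ) {e f : ℕ} (hef : e ≠ f) (i : ℕ) :
    (runLen (insert e A) i = runLen A i ∧
        runLen (insert f A) i ≤ runLen (insert e (insert f A)) i) ∨
      (runLen (insert f A) i = runLen A i ∧
        runLen (insert e A) i ≤ runLen (insert e (insert f A)) i) := by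
  have m1 : insert f A ⊆ insert e (insert f A) := subset_insert _ _
  have m2 : insert e A ⊆ insert e (insert f A) := insert_subset_insert _ (subset_insert _ _)
  induction i with
  | zero => simp [runLen]
  | succ i ih =>
    have h1 := runLen_mono m1 (i + 1)
    have h2 := runLen_mono m2 (i + 1)
    by_cases hA : i ∈ A
    · simp only [runLen, mem_insert, hA, or_true, if_true]
      omega
    · by_cases he : i = e
      · refine Or.inr ⟨?_, h2⟩
        simp [runLen, hA, he ▸ hef]
      · refine Or.inl ⟨?_, h1⟩
        simp [runLen, hA, he]

/-- Ascents along distinct edges are negatively correlated. -/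
theorem ascCount_insert_insert_mul_le (N : ℕ) (A : Finset ℕ) {e f : ℕ} (hef : e ≠ f) :
    ascCount N (insert e (insert f A)) * ascCount N A ≤
      ascCount N (insert e A) * ascCount N (insert f A) := by
  have h0 := ascCount_mul_prod_runLen N A
  have h1 := ascCount_mul_prod_runLen N (insert e A)
  have h2 := ascCount_mul_prod_runLen N (insert f A)
  have h3 := ascCount_mul_prod_runLen N (insert e (insert f A))
  have key : (∏ i ∈ range N, runLen (insert e A) i) * (∏ i ∈ range N, runLen (insert f A) i) ≤
      (∏ i ∈ range N, runLen (insert e (insert f A)) i) * (∏ i ∈ range N, runLen A i) := by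
    rw [← prod_mul_distrib, ← prod_mul_distrib]
    refine prod_le_prod' fun i _ => ?_
    rcases runLen_insert A hef i with ⟨h, h'⟩ | ⟨h, h'⟩
    · rw [h, mul_comm]; exact Nat.mul_le_mul_right _ h'
    · rw [h]; exact Nat.mul_le_mul_right _ h'
  have hp := Nat.mul_pos (prod_runLen_pos N (insert e A)) (prod_runLen_pos N (insert f A))
  refine Nat.le_of_mul_le_mul_right ?_ hp
  calc ascCount N (insert e (insert f A)) * ascCount N A *
        ((∏ i ∈ range N, runLen (insert e A) i) * (∏ i ∈ range N, runLen (insert f A) i))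
      ≤ ascCount N (insert e (insert f A)) * ascCount N A *
        ((∏ i ∈ range N, runLen (insert e (insert f A)) i) * (∏ i ∈ range N, runLen A i)) :=
          Nat.mul_le_mul_left _ key
    _ = (ascCount N (insert e (insert f A)) * ∏ i ∈ range N, runLen (insert e (insert f A)) i) *
        (ascCount N A * ∏ i ∈ range N, runLen A i) := by ring
    _ = (ascCount N (insert e A) * ∏ i ∈ range N, runLen (insert e A) i) *
        (ascCount N (insert f A) * ∏ i ∈ range N, runLen (insert f A) i) := by
          rw [h0, h1, h2, h3]
    _ = _ := by ring

/-! ### The second moment bound -/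

open Classical in
/-- The probability that sorting independent labels gives the permutation `π`. -/
noncomputable def sortLaw {T : ℕ} (q : Fin T → ℝ) (N : ℕ) (π : Equiv.Perm (Fin N)) : ℝ :=
  ∑ s ∈ sortedSeqs N T, (∏ i, q (s i)) * if Ascends (edges s) π then 1 else 0

theorem tvDist_eq {k : ℕ} [NeZero k] (p : Fin k → ℝ) (N K : ℕ) :
    tvDist p N K = 1 / 2 * ∑ π : Equiv.Perm (Fin N),
      |sortLaw (fun x : Fin (k ^ K) => wordMass p K x) N π - 1 / (N.factorial : ℝ)| := by
  rw [tvDist]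
  congr 1
  have : ∀ π : Equiv.Perm (Fin N), sortLaw (fun x : Fin (k ^ K) => wordMass p K x) N π =
      deckProb p N K π.symm := fun π => (deckProb_eq_sum_sorted p N K π).symm
  simp_rw [this]
  exact (Equiv.sum_comp (Equiv.inv (Equiv.Perm (Fin N)))
    (fun σ => |deckProb p N K σ - 1 / (N.factorial : ℝ)|)).symm

theorem ascends_union {N : ℕ} (A B : Finset ℕ) (π : Equiv.Perm (Fin N)) :
    Ascends (A ∪ B) π ↔ Ascends A π ∧ Ascends B π := by
  simp only [Ascends, mem_union]
  constructor
  · exact fun h => ⟨fun i j hij hi => h i j hij (Or.inl hi), fun i j hij hi => h i j hij (Or.inr hi)⟩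
  · rintro ⟨h1, h2⟩ i j hij (hi | hi)
    · exact h1 i j hij hi
    · exact h2 i j hij hi

open Classical in
theorem sum_ite_ascends (N : ℕ) (A : Finset ℕ) :
    ∑ π : Equiv.Perm (Fin N), (if Ascends A π then (1 : ℝ) else 0) = ascCount N A := by
  rw [Finset.sum_boole, ascCount]

-- A truncated second moment. The part of the law coming from `G` is compared with the uniform law
-- in `L²`, where pairs of sequences from `G` enter through their common edges; the remaining part
-- enters only through its total mass.
open Classical in
theorem sum_abs_sortLaw_sub_le {N T L : ℕ} {q : Fin T → ℝ} (hq : ∀ x, 0 ≤ q x)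
    (hq1 : ∑ x, q x = 1) (hL : 1 ≤ L) {G : Finset (Fin N → Fin T)} (hG : G ⊆ sortedSeqs N T)
    (hrun : ∀ s ∈ G, ∀ i < N, runLen (edges s) i ≤ L) {γ β : ℝ}
    (hβ : ∑ s ∈ sortedSeqs N T \ G, sortedMass q s ≤ β)
    (hγ : ∑ s ∈ G, ∑ s' ∈ G, sortedMass q s * sortedMass q s' *
      ((L : ℝ) ^ (edges s ∩ edges s').card - 1) ≤ γ) :
    ∑ π : Equiv.Perm (Fin N), |sortLaw q N π - 1 / (N.factorial : ℝ)| ≤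
      √(γ + β ^ 2) + β := by
  set g : Equiv.Perm (Fin N) → ℝ := fun π =>
    ∑ s ∈ G, (∏ i, q (s i)) * if Ascends (edges s) π then 1 else 0 with hg
  set b : Equiv.Perm (Fin N) → ℝ := fun π =>
    ∑ s ∈ sortedSeqs N T \ G, (∏ i, q (s i)) * if Ascends (edges s) π then 1 else 0 with hb
  have hsplit : ∀ π, sortLaw q N π = g π + b π := by
    intro π
    rw [sortLaw, ← Finset.sum_sdiff hG, add_comm]
  have hb0 : ∀ π, 0 ≤ b π := by
    intro π
    refine sum_nonneg fun s _ => mul_nonneg (prod_nonneg fun _ _ => hq _) ?_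
    split_ifs <;> norm_num
  have hmass : ∀ F : Finset (Fin N → Fin T), ∑ π : Equiv.Perm (Fin N),
      (∑ s ∈ F, (∏ i, q (s i)) * if Ascends (edges s) π then (1 : ℝ) else 0) =
      ∑ s ∈ F, sortedMass q s := by
    intro F
    rw [sum_comm]
    refine sum_congr rfl fun s _ => ?_
    rw [← mul_sum, sum_ite_ascends, sortedMass]
  have hbs : ∑ π, b π ≤ β := by rw [hb, hmass]; exact hβ
  have hPG : ∑ s ∈ G, sortedMass q s = 1 - ∑ s ∈ sortedSeqs N T \ G, sortedMass q s := by
    rw [← sum_sortedMass (N := N) hq1, ← Finset.sum_sdiff hG]; ring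
  have hPB0 : 0 ≤ ∑ s ∈ sortedSeqs N T \ G, sortedMass q s :=
    sum_nonneg fun s _ => sortedMass_nonneg hq s
  set n : ℝ := (N.factorial : ℝ) with hn
  have hnpos : 0 < n := by positivity
  have hsq : n * ∑ π, g π ^ 2 ≤ γ + (∑ s ∈ G, sortedMass q s) ^ 2 := by
    have h1 : ∑ π, g π ^ 2 = ∑ s ∈ G, ∑ s' ∈ G, (∏ i, q (s i)) * (∏ i, q (s' i)) *
        ascCount N (edges s ∪ edges s') := by
      simp_rw [hg, sq, sum_mul_sum]
      rw [sum_comm]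
      refine sum_congr rfl fun s _ => ?_
      rw [sum_comm]
      refine sum_congr rfl fun s' _ => ?_
      rw [← sum_ite_ascends, mul_sum]
      refine sum_congr rfl fun π _ => ?_
      simp only [ascends_union]
      by_cases h1 : Ascends (edges s) π <;> by_cases h2 : Ascends (edges s') π <;> simp [h1, h2]
    have h2 : (∑ s ∈ G, sortedMass q s) ^ 2 =
        ∑ s ∈ G, ∑ s' ∈ G, sortedMass q s * sortedMass q s' := by
      rw [sq, sum_mul_sum]
    refine le_trans ?_ (add_le_add_left hγ _)
    rw [h1, h2, ← sum_add_distrib, mul_sum]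
    refine sum_le_sum fun s _ => ?_
    rw [← sum_add_distrib, mul_sum]
    refine sum_le_sum fun s' hs' => ?_
    have h3 := ascCount_union_mul_le (A := edges s) hL (hrun s' hs')
    have h4 : (ascCount N (edges s ∪ edges s') : ℝ) * n ≤
        ascCount N (edges s) * ascCount N (edges s') * (L : ℝ) ^ (edges s ∩ edges s').card := by
      rw [hn]; exact_mod_cast h3
    have h5 : 0 ≤ (∏ i, q (s i)) * (∏ i, q (s' i)) :=
      mul_nonneg (prod_nonneg fun _ _ => hq _) (prod_nonneg fun _ _ => hq _)
    have h6 := mul_le_mul_of_nonneg_left h4 h5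
    simp only [sortedMass]
    linarith
  have hg1 : ∑ π : Equiv.Perm (Fin N), |g π - 1 / n| ≤ √(γ + β ^ 2) := by
    apply Real.le_sqrt_of_sq_le
    have hcs := sq_sum_le_card_mul_sum_sq (s := (univ : Finset (Equiv.Perm (Fin N))))
      (f := fun π => |g π - 1 / n|)
    have hcard : ((univ : Finset (Equiv.Perm (Fin N))).card : ℝ) = n := by
      rw [card_univ, Fintype.card_perm, Fintype.card_fin]
    rw [hcard] at hcs
    refine hcs.trans ?_
    simp_rw [sq_abs, sub_sq]
    rw [sum_add_distrib, sum_sub_distrib, sum_const, nsmul_eq_mul, hcard, ← sum_mul, ← mul_sum,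
      hg, hmass, ← hg]
    -- With `m` the mass of `G`, the right side is at most `γ + m² - 2 m + 1 = γ + (1 - m)²`, and `1
    -- - m ≤ β`.
    have e : n * (∑ π, g π ^ 2 - 2 * (∑ s ∈ G, sortedMass q s) * (1 / n) + n * (1 / n) ^ 2) =
        n * ∑ π, g π ^ 2 - 2 * (∑ s ∈ G, sortedMass q s) + 1 := by
      field_simp
    rw [e]
    nlinarith
  calc ∑ π, |sortLaw q N π - 1 / n| ≤ ∑ π, (|g π - 1 / n| + b π) := by
        refine sum_le_sum fun π _ => ?_
        rw [hsplit, add_sub_right_comm]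
        refine (abs_add_le _ _).trans ?_
        rw [abs_of_nonneg (hb0 π)]
    _ ≤ _ := by
        rw [sum_add_distrib]
        exact add_le_add hg1 hbs

/-! ### Sums over separated lists -/

/-- The sum of `F` over the lists of `r` elements of `[t, h)`, consecutive ones differing by more
than `L`. -/
def sepSum (h L : ℕ) : ℕ → ℕ → (List ℕ → ℝ) → ℝ
  | 0, _, F => F []
  | r + 1, t, F => ∑ e ∈ Ico t h, sepSum h L r (e + L + 1) fun S => F (e :: S)

/-- Lists of elements of `[t, h)`, consecutive ones differing by more than `L`. -/
def IsSep (h L : ℕ) : ℕ → List ℕ → Prop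
  | _, [] => True
  | t, e :: S => t ≤ e ∧ e < h ∧ IsSep h L (e + L + 1) S

theorem IsSep.le_of_mem {h L : ℕ} : ∀ {S : List ℕ} {t e : ℕ}, IsSep h L t S → e ∈ S →
    t ≤ e ∧ e < h
  | [], t, e, _, he => by simp at he
  | a :: S, t, e, hS, he => by
      obtain ⟨h1, h2, h3⟩ := hS
      rcases List.mem_cons.mp he with rfl | he
      · exact ⟨h1, h2⟩
      · have := h3.le_of_mem he
        omega

theorem IsSep.mono {h L : ℕ} {S : List ℕ} {t t' : ℕ} (hS : IsSep h L t S) (ht : t' ≤ t) :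
    IsSep h L t' S := by
  cases S with
  | nil => trivial
  | cons e S => exact ⟨ht.trans hS.1, hS.2⟩

theorem sepSum_le_sepSum {h L : ℕ} : ∀ {r t : ℕ} {F G : List ℕ → ℝ},
    (∀ S, IsSep h L t S → F S ≤ G S) → sepSum h L r t F ≤ sepSum h L r t G
  | 0, _, _, _, hFG => hFG [] trivial
  | r + 1, t, F, G, hFG => by
      refine sum_le_sum fun e he => sepSum_le_sepSum fun S hS => hFG _ ?_
      rw [mem_Ico] at he
      exact ⟨he.1, he.2, hS⟩

theorem sepSum_nonneg {h L : ℕ} : ∀ {r t : ℕ} {F : List ℕ → ℝ}, (∀ S, 0 ≤ F S) →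
    0 ≤ sepSum h L r t F
  | 0, _, _, hF => hF []
  | _ + 1, _, _, hF => sum_nonneg fun _ _ => sepSum_nonneg fun _ => hF _

theorem sepSum_sum_mul {h L : ℕ} {ι : Type*} (I : Finset ι) (c : ι → ℝ) :
    ∀ {r t : ℕ} (F : ι → List ℕ → ℝ),
      sepSum h L r t (fun S => ∑ i ∈ I, c i * F i S) = ∑ i ∈ I, c i * sepSum h L r t (F i)
  | 0, _, _ => rfl
  | r + 1, t, F => by
      simp only [sepSum]
      simp_rw [mul_sum]
      rw [sum_comm]
      refine sum_congr rfl fun e _ => ?_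
      exact sepSum_sum_mul I c fun i S => F i (e :: S)

theorem sepSum_const_mul {h L : ℕ} (c : ℝ) {r t : ℕ} (F : List ℕ → ℝ) :
    sepSum h L r t (fun S => c * F S) = c * sepSum h L r t F := by
  have := sepSum_sum_mul (h := h) (L := L) ({()} : Finset Unit) (fun _ => c) (r := r) (t := t)
    (fun _ => F)
  simpa using this

/-- Greedy extraction: the first element of `Z` and the `L` positions after it contribute at most `C
^ (L + 1)`, and the rest of `Z` starts beyond them. The gaps larger than `L` force the chosen edges
into different cells once no cell holds more than `L` cards. -/
theorem pow_card_filter_le_sum_sepSum {h L : ℕ} {C : ℝ} (hC : 1 ≤ C) (Z : Finset ℕ) :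
    ∀ m t, h ≤ t + m → C ^ (Z.filter fun e => t ≤ e ∧ e < h).card ≤
      ∑ r ∈ range (m + 1), (C ^ (L + 1)) ^ r *
        sepSum h L r t (fun S => if ∀ e ∈ S, e ∈ Z then 1 else 0) := by
  have hC0 : 0 ≤ C := by linarith
  have hnn : ∀ r t, 0 ≤ (C ^ (L + 1)) ^ r *
      sepSum h L r t (fun S => if ∀ e ∈ S, e ∈ Z then 1 else 0) := fun r t =>
    mul_nonneg (by positivity) (sepSum_nonneg fun S => by split_ifs <;> norm_num)
  intro m
  induction m with
  | zero =>
    intro t ht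
    rw [filter_false_of_mem (fun e _ he => by omega)]
    simp [sepSum]
  | succ m ih =>
    intro t ht
    rcases (Z.filter fun e => t ≤ e ∧ e < h).eq_empty_or_nonempty with hZ | hZ
    · rw [hZ, sum_range_succ']
      have := sum_nonneg fun r (_ : r ∈ range (m + 1)) => hnn (r + 1) t
      simp only [card_empty, pow_zero, sepSum] at this ⊢
      simp only [List.not_mem_nil, false_imp_iff, implies_true, if_true]
      linarith
    · set e := (Z.filter fun e => t ≤ e ∧ e < h).min' hZ with he
      have hmem := (Z.filter fun e => t ≤ e ∧ e < h).min'_mem hZ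
      rw [← he, mem_filter] at hmem
      obtain ⟨heZ, hte, heh⟩ := hmem
      have hcard : (Z.filter fun e => t ≤ e ∧ e < h).card ≤
          (L + 1) + (Z.filter fun e' => e + L + 1 ≤ e' ∧ e' < h).card := by
        have hsub : (Z.filter fun e => t ≤ e ∧ e < h) ⊆
            Ico e (e + (L + 1)) ∪ (Z.filter fun e' => e + L + 1 ≤ e' ∧ e' < h) := by
          intro x hx
          have hex := (Z.filter fun e => t ≤ e ∧ e < h).min'_le x hx
          rw [← he] at hex
          rw [mem_filter] at hx
          rw [mem_union, mem_Ico, mem_filter]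
          by_cases hxe : x < e + (L + 1)
          · exact Or.inl ⟨hex, hxe⟩
          · exact Or.inr ⟨hx.1, by omega, hx.2.2⟩
        have := (card_le_card hsub).trans (card_union_le _ _)
        simpa using this
      calc C ^ (Z.filter fun e => t ≤ e ∧ e < h).card
          ≤ C ^ ((L + 1) + (Z.filter fun e' => e + L + 1 ≤ e' ∧ e' < h).card) :=
            pow_le_pow_right₀ hC hcard
        _ = C ^ (L + 1) * C ^ (Z.filter fun e' => e + L + 1 ≤ e' ∧ e' < h).card := pow_add _ _ _
        _ ≤ C ^ (L + 1) * ∑ r ∈ range (m + 1), (C ^ (L + 1)) ^ r *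
              sepSum h L r (e + L + 1) (fun S => if ∀ e ∈ S, e ∈ Z then 1 else 0) :=
            mul_le_mul_of_nonneg_left (ih _ (by omega)) (by positivity)
        _ ≤ ∑ r ∈ range (m + 1), (C ^ (L + 1)) ^ (r + 1) *
              sepSum h L (r + 1) t (fun S => if ∀ e ∈ S, e ∈ Z then 1 else 0) := by
            rw [mul_sum]
            refine sum_le_sum fun r _ => ?_
            rw [← mul_assoc, ← pow_succ']
            refine mul_le_mul_of_nonneg_left ?_ (by positivity)
            rw [sepSum]
            refine le_trans ?_ (single_le_sum (fun e' _ => sepSum_nonneg fun S => by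
              split_ifs <;> norm_num) (mem_Ico.mpr ⟨hte, heh⟩))
            refine sepSum_le_sepSum fun S _ => ?_
            simp [heZ]
        _ ≤ _ := by
            rw [sum_range_succ' _ (m + 1)]
            exact le_add_of_nonneg_right (hnn 0 t)

/-! ### Poisson weights -/

/-- The Poisson mass function. -/
noncomputable def pois (a : ℝ) (n : ℕ) : ℝ := Real.exp (-a) * (a ^ n / n.factorial)

theorem pois_nonneg {a : ℝ} (ha : 0 ≤ a) (n : ℕ) : 0 ≤ pois a n := by
  unfold pois; positivity

theorem sum_pow_div_factorial_mul (a b : ℝ) (n : ℕ) :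
    ∑ i ∈ range (n + 1), a ^ i / i.factorial * (b ^ (n - i) / (n - i).factorial) =
      (a + b) ^ n / n.factorial := by
  rw [add_pow, sum_div]
  refine sum_congr rfl fun i hi => ?_
  have hi' : i ≤ n := Nat.lt_succ_iff.mp (mem_range.mp hi)
  have := Nat.choose_mul_factorial_mul_factorial hi'
  have h : (n.choose i : ℝ) * i.factorial * (n - i).factorial = n.factorial := by exact_mod_cast this
  have h1 : (i.factorial : ℝ) ≠ 0 := by positivity
  have h2 : ((n - i).factorial : ℝ) ≠ 0 := by positivity
  have h3 : (n.factorial : ℝ) ≠ 0 := by positivity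
  rw [← h]
  have h4 : (n.choose i : ℝ) ≠ 0 := by
    have := Nat.choose_pos hi'; positivity
  field_simp

theorem sum_pois_mul_pois (a b : ℝ) (n : ℕ) :
    ∑ i ∈ range (n + 1), pois a i * pois b (n - i) = pois (a + b) n := by
  unfold pois
  rw [← sum_pow_div_factorial_mul, mul_sum]
  refine sum_congr rfl fun i _ => ?_
  rw [neg_add, Real.exp_add]
  ring

/-! ### The chain bound -/

/-- A bound for the probability that all the edges in a separated list are realised by cells
`x ∈ [y, T₁)` with independent Poisson contents of means `lam x`, the cell `y` starting at
position `t`. -/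
noncomputable def chainBound (lam : ℕ → ℝ) (T₁ L : ℕ) : ℕ → ℕ → List ℕ → ℝ
  | _, _, [] => 1
  -- Here `c.1` is the cell containing the edge `e`; it starts at `e - c.2.1` and the next cell
  -- starts at `e + c.2.2`. The Poisson weight makes the cells before `c.1` fill the gap exactly,
  -- and `lam c.1 ^ 2` bounds the weight of any content of at least two cards.
  | y, t, e :: S => ∑ c ∈ Ico y T₁ ×ˢ range (L + 1) ×ˢ range (L + 1),
      (if t + c.2.1 ≤ e then pois (∑ z ∈ Ico y c.1, lam z) (e - t - c.2.1) * lam c.1 ^ 2 else 0) *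
        chainBound lam T₁ L (c.1 + 1) (e + c.2.2) S

theorem chainBound_nonneg {lam : ℕ → ℝ} (hlam : ∀ x, 0 ≤ lam x) (T₁ L : ℕ) :
    ∀ (S : List ℕ) (y t : ℕ), 0 ≤ chainBound lam T₁ L y t S
  | [], _, _ => zero_le_one
  | e :: S, y, t => by
      rw [chainBound]
      refine sum_nonneg fun c _ => mul_nonneg ?_ (chainBound_nonneg hlam T₁ L S _ _)
      split_ifs
      · exact mul_nonneg (pois_nonneg (sum_nonneg fun z _ => hlam z) _) (sq_nonneg _)
      · exact le_rfl

/-- The end offset is free and gives `(L + 1) ^ 2` after squaring. Cauchy-Schwarz over the start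
offset gives one more factor, the sum over that offset another; for a fixed offset, `e` becomes a
distance `d`. -/
theorem sum_sq_chain_step {lam : ℕ → ℝ} {T₁ L : ℕ} {η : ℝ} {y : ℕ}
    (hη : ∀ D, ∑ d ∈ range D, (∑ x ∈ Ico y T₁,
      pois (∑ z ∈ Ico y x, lam z) d * lam x ^ 2) ^ 2 ≤ η) (t h : ℕ) (I : Finset ℕ) :
    (∀ e ∈ I, e < h) →
    ∑ e ∈ I, (∑ c ∈ Ico y T₁ ×ˢ range (L + 1) ×ˢ range (L + 1),
      (if t + c.2.1 ≤ e then pois (∑ z ∈ Ico y c.1, lam z) (e - t - c.2.1) * lam c.1 ^ 2 else 0)) ^ 2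
      ≤ (L + 1) ^ 4 * η := by
  intro hI
  set f : ℕ → ℝ := fun d => ∑ x ∈ Ico y T₁, pois (∑ z ∈ Ico y x, lam z) d * lam x ^ 2 with hf
  have h1 : ∀ e, ∑ c ∈ Ico y T₁ ×ˢ range (L + 1) ×ˢ range (L + 1),
      (if t + c.2.1 ≤ e then pois (∑ z ∈ Ico y c.1, lam z) (e - t - c.2.1) * lam c.1 ^ 2 else 0) =
      (L + 1) * ∑ i ∈ range (L + 1), if t + i ≤ e then f (e - t - i) else 0 := by
    intro e
    rw [sum_product]
    simp_rw [sum_product]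
    simp only [sum_const, card_range, nsmul_eq_mul]
    rw [sum_comm, mul_sum]
    refine sum_congr rfl fun i _ => ?_
    rw [← mul_sum]
    push_cast
    congr 1
    split_ifs
    · rfl
    · simp
  simp_rw [h1]
  have h2 : ∀ e, ((L + 1 : ℝ) * ∑ i ∈ range (L + 1), if t + i ≤ e then f (e - t - i) else 0) ^ 2 ≤
      (L + 1) ^ 3 * ∑ i ∈ range (L + 1), if t + i ≤ e then f (e - t - i) ^ 2 else 0 := by
    intro e
    have := sq_sum_le_card_mul_sum_sq (s := range (L + 1))
      (f := fun i => if t + i ≤ e then f (e - t - i) else 0)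
    rw [card_range] at this
    push_cast at this
    rw [mul_pow, pow_succ (_ : ℝ) 2, mul_assoc]
    refine mul_le_mul_of_nonneg_left ?_ (by positivity)
    refine this.trans (le_of_eq ?_)
    congr 1
    refine sum_congr rfl fun i _ => ?_
    split_ifs <;> simp
  refine (sum_le_sum fun e _ => h2 e).trans ?_
  rw [← mul_sum, sum_comm]
  have h3 : ∀ i ∈ range (L + 1), ∑ e ∈ I, (if t + i ≤ e then f (e - t - i) ^ 2 else 0) ≤ η := by
    intro i _
    refine le_trans ?_ (hη h)
    rw [← sum_filter]
    rw [← sum_image (s := I.filter fun e => t + i ≤ e) (g := fun e => e - t - i)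
      (f := fun d => f d ^ 2)]
    · refine sum_le_sum_of_subset_of_nonneg ?_ fun d _ _ => sq_nonneg _
      intro d hd
      obtain ⟨e, he, rfl⟩ := mem_image.mp hd
      have := hI e (mem_filter.mp he).1
      rw [mem_range]; omega
    · intro a ha b hb hab
      have h4 := (mem_filter.mp ha).2
      have h5 := (mem_filter.mp hb).2
      simp only at hab
      omega
  calc (L + 1 : ℝ) ^ 3 * ∑ i ∈ range (L + 1), ∑ e ∈ I, (if t + i ≤ e then f (e - t - i) ^ 2 else 0)
      ≤ (L + 1 : ℝ) ^ 3 * ∑ i ∈ range (L + 1), η :=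
        mul_le_mul_of_nonneg_left (sum_le_sum h3) (by positivity)
    _ = _ := by
        rw [sum_const, card_range, nsmul_eq_mul]; push_cast; ring

/-- Cauchy-Schwarz with the step weights, `(∑ w g)² ≤ (∑ w) (∑ w g²)`, moves the square onto the
tail of the chain. As the hypothesis on `η` is uniform in the starting cell, each link contributes
one factor. -/
theorem sepSum_chainBound_sq_le {lam : ℕ → ℝ} (hlam : ∀ x, 0 ≤ lam x) {T₁ L h : ℕ} {η : ℝ}
    (hη : ∀ y D, ∑ d ∈ range D, (∑ x ∈ Ico y T₁,
      pois (∑ z ∈ Ico y x, lam z) d * lam x ^ 2) ^ 2 ≤ η) :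
    ∀ r y t t', sepSum h L r t (fun S => chainBound lam T₁ L y t' S ^ 2) ≤
      ((L + 1) ^ 4 * η) ^ r := by
  have hη0 : 0 ≤ η := by simpa using hη 0 0
  intro r
  induction r with
  | zero => intro y t t'; simp [sepSum, chainBound]
  | succ r ih =>
    intro y t t'
    rw [sepSum]
    set I := Ico y T₁ ×ˢ range (L + 1) ×ˢ range (L + 1) with hI
    set w : ℕ → ℕ × ℕ × ℕ → ℝ := fun e c => if t' + c.2.1 ≤ e then
      pois (∑ z ∈ Ico y c.1, lam z) (e - t' - c.2.1) * lam c.1 ^ 2 else 0 with hw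
    have hw0 : ∀ e c, 0 ≤ w e c := by
      intro e c
      simp only [hw]
      split_ifs
      · exact mul_nonneg (pois_nonneg (sum_nonneg fun z _ => hlam z) _) (sq_nonneg _)
      · exact le_rfl
    have h1 : ∀ e ∈ Ico t h, sepSum h L r (e + L + 1)
        (fun S => chainBound lam T₁ L y t' (e :: S) ^ 2) ≤
        (∑ c ∈ I, w e c) ^ 2 * ((L + 1) ^ 4 * η) ^ r := by
      intro e _
      calc sepSum h L r (e + L + 1) (fun S => chainBound lam T₁ L y t' (e :: S) ^ 2)
          ≤ sepSum h L r (e + L + 1) (fun S => (∑ c ∈ I, w e c) *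
              ∑ c ∈ I, w e c * chainBound lam T₁ L (c.1 + 1) (e + c.2.2) S ^ 2) := by
            refine sepSum_le_sepSum fun S _ => ?_
            rw [chainBound]
            refine sum_sq_le_sum_mul_sum_of_sq_le_mul _ (fun c _ => hw0 e c)
              (fun c _ => mul_nonneg (hw0 e c) (sq_nonneg _)) fun c _ => le_of_eq ?_
            simp only [hw]
            ring
        _ = (∑ c ∈ I, w e c) * ∑ c ∈ I, w e c * sepSum h L r (e + L + 1)
              (fun S => chainBound lam T₁ L (c.1 + 1) (e + c.2.2) S ^ 2) := by
            rw [sepSum_const_mul, sepSum_sum_mul]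
        _ ≤ (∑ c ∈ I, w e c) * ∑ c ∈ I, w e c * ((L + 1) ^ 4 * η) ^ r := by
            refine mul_le_mul_of_nonneg_left ?_ (sum_nonneg fun c _ => hw0 e c)
            exact sum_le_sum fun c _ => mul_le_mul_of_nonneg_left (ih _ _ _) (hw0 e c)
        _ = _ := by rw [← sum_mul]; ring
    refine (sum_le_sum h1).trans ?_
    rw [← sum_mul, pow_succ' (((L : ℝ) + 1) ^ 4 * η) r]
    refine mul_le_mul_of_nonneg_right ?_ (pow_nonneg (mul_nonneg (by positivity) hη0) r)
    exact sum_sq_chain_step (hη y) t' h _ fun e he => (mem_Ico.mp he).2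

/-! ### Comparison of multinomial and Poisson cell contents -/

-- The multinomial theorem; capping the contents at `N` is harmless because their total `n` is at
-- most `N`.
open Classical in
theorem sum_counts_eq (T N : ℕ) : ∀ (a : ℕ → ℝ) (n : ℕ), n ≤ N →
    ∑ c : Fin T → Fin (N + 1), (if ∑ x, (c x : ℕ) = n then
      ∏ x : Fin T, a x ^ (c x : ℕ) / ((c x : ℕ).factorial : ℝ) else 0) =
      (∑ x ∈ range T, a x) ^ n / n.factorial := by
  induction T with
  | zero =>
    intro a n _
    rcases Nat.eq_zero_or_pos n with h | h
    · subst h; simp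
    · simp [h.ne, h.ne']
  | succ T ih =>
    intro a n hn
    rw [← (Fin.consEquiv fun _ : Fin (T + 1) => Fin (N + 1)).sum_comp, Fintype.sum_prod_type,
      sum_range_succ', add_comm (∑ x ∈ range T, a (x + 1)), ← sum_pow_div_factorial_mul]
    have h1 : ∀ c0 : Fin (N + 1), ∑ c : Fin T → Fin (N + 1),
        (if ∑ x, ((Fin.consEquiv fun _ : Fin (T + 1) => Fin (N + 1)) (c0, c) x : ℕ) = n then
          ∏ x : Fin (T + 1), a x ^ ((Fin.consEquiv fun _ : Fin (T + 1) => Fin (N + 1)) (c0, c) x : ℕ)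
            / (((Fin.consEquiv fun _ : Fin (T + 1) => Fin (N + 1)) (c0, c) x : ℕ).factorial : ℝ)
          else 0) =
        if (c0 : ℕ) ∈ range (n + 1) then a 0 ^ (c0 : ℕ) / ((c0 : ℕ).factorial : ℝ) *
          ((∑ x ∈ range T, a (x + 1)) ^ (n - c0) / (n - c0).factorial) else 0 := by
      intro c0
      simp only [Fin.consEquiv, Equiv.coe_fn_mk, Fin.sum_univ_succ, Fin.prod_univ_succ,
        Fin.cons_zero, Fin.cons_succ]
      split_ifs with h
      · rw [mem_range] at h
        rw [← ih (fun x => a (x + 1)) (n - c0) (by omega), mul_sum]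
        refine sum_congr rfl fun c _ => ?_
        rw [mul_ite, mul_zero]
        refine if_congr (by omega) ?_ rfl
        simp
      · rw [mem_range] at h
        refine sum_eq_zero fun c _ => if_neg (by omega)
    rw [sum_congr rfl fun c0 _ => h1 c0,
      Fin.sum_univ_eq_sum_range (fun i => if i ∈ range (n + 1) then a 0 ^ i / (i.factorial : ℝ) *
          ((∑ x ∈ range T, a (x + 1)) ^ (n - i) / (n - i).factorial) else 0) (N + 1),
      sum_ite_mem]
    congr 1
    rw [inter_eq_right]
    exact range_subset_range.mpr (by omega)

/-- The contents `c` of consecutive cells, the first one starting at position `t`, have total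
`N - t`; the first `m` cells have at most `L` elements and contain all the edges in `S`. -/
def Realises {T N : ℕ} (m L t : ℕ) (S : List ℕ) (c : Fin T → Fin (N + 1)) : Prop :=
  t + ∑ x, (c x : ℕ) = N ∧ (∀ x : Fin T, (x : ℕ) < m → (c x : ℕ) ≤ L) ∧
    ∀ e ∈ S, ∃ x : Fin T, (x : ℕ) < m ∧ t + (∑ y, if y < x then (c y : ℕ) else 0) ≤ e ∧
      e + 1 < t + ∑ y, if y ≤ x then (c y : ℕ) else 0

/-- The first cell has at most `L` elements and the edges of `S` are more than `L` apart, so it can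
contain only the first edge; and an edge starting in the cell must also end in it. -/
theorem Realises.of_cons {T N m L t h : ℕ} {S : List ℕ} {c0 : Fin (N + 1)}
    {c : Fin T → Fin (N + 1)} (hS : IsSep h L t S)
    (hc : Realises (T := T + 1) (m + 1) L t S (Fin.cons c0 c : Fin (T + 1) → Fin (N + 1))) :
    (c0 : ℕ) ≤ L ∧ ((S = [] ∧ Realises m L (t + c0) [] c) ∨
      ∃ e S', S = e :: S' ∧ ((t + c0 ≤ e ∧ Realises m L (t + c0) S c) ∨
        (e + 1 < t + c0 ∧ Realises m L (t + c0) S' c))) := by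
  obtain ⟨h1, h2, h3⟩ := hc
  have hc0 : (c0 : ℕ) ≤ L := by simpa using h2 0 (by simp)
  have h1' : t + c0 + ∑ x, (c x : ℕ) = N := by
    rw [Fin.sum_univ_succ] at h1
    simp only [Fin.cons_zero, Fin.cons_succ] at h1
    omega
  have h2' : ∀ x : Fin T, (x : ℕ) < m → (c x : ℕ) ≤ L := by
    intro x hx
    simpa using h2 x.succ (by simpa using hx)
  have h3' : ∀ e ∈ S, e + 1 < t + c0 ∨ (t + c0 ≤ e ∧ ∃ x : Fin T, (x : ℕ) < m ∧
      t + c0 + (∑ y, if y < x then (c y : ℕ) else 0) ≤ e ∧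
      e + 1 < t + c0 + ∑ y, if y ≤ x then (c y : ℕ) else 0) := by
    intro e he
    obtain ⟨x, hx, ha, hb⟩ := h3 e he
    rw [Fin.sum_univ_succ] at ha hb
    simp only [Fin.cons_zero, Fin.cons_succ] at ha hb
    induction x using Fin.cases with
    | zero => left; simpa using hb
    | succ x =>
      right
      simp only [Fin.succ_pos, if_true, Fin.succ_lt_succ_iff, Fin.succ_le_succ_iff,
        Fin.zero_le] at ha hb
      exact ⟨by omega, x, by simpa using hx, by omega, by omega⟩
  refine ⟨hc0, ?_⟩
  match S, hS with
  | [], _ => exact Or.inl ⟨rfl, h1', h2', by simp⟩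
  | e :: S', hS =>
    refine Or.inr ⟨e, S', rfl, ?_⟩
    obtain ⟨hte, heh, hS'⟩ := hS
    rcases h3' e (by simp) with h | ⟨h, _⟩
    · refine Or.inr ⟨h, h1', h2', fun e' he' => ?_⟩
      have := hS'.le_of_mem he'
      exact ((h3' e' (by simp [he'])).resolve_left (by omega)).2
    · refine Or.inl ⟨h, h1', h2', fun e' he' => ?_⟩
      have : e ≤ e' := by
        rcases List.mem_cons.mp he' with rfl | h'
        · exact le_rfl
        · have := hS'.le_of_mem h'; omega
      exact ((h3' e' he').resolve_left (by omega)).2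

/-- The chain bound accounts for the first cell: either it ends before the first edge or it
contains it. -/
theorem chainBound_step {lam : ℕ → ℝ} (hlam : ∀ x, 0 ≤ lam x) (hlam1 : ∀ x, lam x ≤ 1)
    {T₁ L y t e : ℕ} (hy : y < T₁) (hte : t ≤ e) (S : List ℕ) (N : ℕ) :
    ∑ n ∈ range (N + 1), (if n ≤ L then pois (lam y) n *
      ((if t + n ≤ e then chainBound lam T₁ L (y + 1) (t + n) (e :: S) else 0) +
        if e + 1 < t + n then chainBound lam T₁ L (y + 1) (t + n) S else 0) else 0) ≤
      chainBound lam T₁ L y t (e :: S) := by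
  have hcb := fun S y t => chainBound_nonneg hlam T₁ L S y t
  have hp := fun x n => pois_nonneg (hlam x) n
  have hΛ : ∀ a b, 0 ≤ ∑ z ∈ Ico a b, lam z := fun a b => sum_nonneg fun z _ => hlam z
  rw [chainBound]
  simp_rw [sum_product]
  -- The term of cell `y` itself dominates the contents that cover `e`; the terms of later cells
  -- dominate the contents that stop before `e`.
  rw [← add_sum_Ioo_eq_sum_Ico hy]
  have hsplit : ∀ n, (if n ≤ L then pois (lam y) n *
      ((if t + n ≤ e then chainBound lam T₁ L (y + 1) (t + n) (e :: S) else 0) +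
        if e + 1 < t + n then chainBound lam T₁ L (y + 1) (t + n) S else 0) else 0) ≤
      (if e + 1 < t + n ∧ n ≤ L then
        pois (lam y) n * chainBound lam T₁ L (y + 1) (t + n) S else 0) +
      (if t + n ≤ e then pois (lam y) n * chainBound lam T₁ L (y + 1) (t + n) (e :: S) else 0) := by
    intro n
    have a1 := mul_nonneg (hp y n) (hcb (e :: S) (y + 1) (t + n))
    have a2 := mul_nonneg (hp y n) (hcb S (y + 1) (t + n))
    split_ifs <;> first | omega | simp_all
  refine (sum_le_sum fun n _ => hsplit n).trans ?_
  rw [sum_add_distrib]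
  refine add_le_add ?_ ?_
  · rw [← sum_filter]
    have hin : e - t ∈ range (L + 1) ∨ (∀ n, ¬ (e + 1 < t + n ∧ n ≤ L)) := by
      by_cases h : e - t ≤ L
      · exact Or.inl (mem_range.mpr (by omega))
      · exact Or.inr fun n => by omega
    have hnn : ∀ i ∈ range (L + 1), 0 ≤ ∑ j ∈ range (L + 1), (if t + i ≤ e then
        pois (∑ z ∈ Ico y y, lam z) (e - t - i) * lam y ^ 2 else 0) *
        chainBound lam T₁ L (y + 1) (e + j) S := by
      intro i _
      refine sum_nonneg fun j _ => mul_nonneg ?_ (hcb _ _ _)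
      split_ifs
      · exact mul_nonneg (pois_nonneg (hΛ _ _) _) (sq_nonneg _)
      · exact le_rfl
    rcases hin with hin | hin
    · refine le_trans ?_ (single_le_sum hnn hin)
      have e1 : (if t + (e - t) ≤ e then
          pois (∑ z ∈ Ico y y, lam z) (e - t - (e - t)) * lam y ^ 2 else 0) = lam y ^ 2 := by
        rw [if_pos (by omega), Nat.sub_self]
        simp [pois]
      simp only [e1]
      calc ∑ n ∈ (range (N + 1)).filter (fun n => e + 1 < t + n ∧ n ≤ L),
            pois (lam y) n * chainBound lam T₁ L (y + 1) (t + n) S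
          ≤ ∑ n ∈ (range (N + 1)).filter (fun n => e + 1 < t + n ∧ n ≤ L),
            lam y ^ 2 * chainBound lam T₁ L (y + 1) (t + n) S := by
            refine sum_le_sum fun n hn => mul_le_mul_of_nonneg_right ?_ (hcb _ _ _)
            have hn' := (mem_filter.mp hn).2
            have h2n : 2 ≤ n := by omega
            unfold pois
            have e2 : Real.exp (-lam y) ≤ 1 := Real.exp_le_one_iff.mpr (by linarith [hlam y])
            have e3 : lam y ^ n / (n.factorial : ℝ) ≤ lam y ^ n :=
              div_le_self (pow_nonneg (hlam y) n) (by exact_mod_cast Nat.factorial_pos n)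
            have e4 : lam y ^ n ≤ lam y ^ 2 := pow_le_pow_of_le_one (hlam y) (hlam1 y) h2n
            have e5 : 0 ≤ lam y ^ n / (n.factorial : ℝ) :=
              div_nonneg (pow_nonneg (hlam y) n) (by positivity)
            nlinarith [Real.exp_pos (-lam y)]
        _ = ∑ j ∈ ((range (N + 1)).filter (fun n => e + 1 < t + n ∧ n ≤ L)).image
              (fun n => t + n - e), lam y ^ 2 * chainBound lam T₁ L (y + 1) (e + j) S := by
            rw [sum_image]
            · refine sum_congr rfl fun n hn => ?_
              have hn' := (mem_filter.mp hn).2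
              congr 2
              omega
            · intro a ha b hb hab
              have h1 := (mem_filter.mp ha).2
              have h2 := (mem_filter.mp hb).2
              simp only at hab
              omega
        _ ≤ _ := by
            refine sum_le_sum_of_subset_of_nonneg ?_ fun j _ _ =>
              mul_nonneg (sq_nonneg _) (hcb _ _ _)
            intro j hj
            obtain ⟨n, hn, rfl⟩ := mem_image.mp hj
            have hn' := (mem_filter.mp hn).2
            rw [mem_range]
            omega
    · rw [filter_false_of_mem fun n _ => hin n, sum_empty]
      exact sum_nonneg hnn
  · simp_rw [chainBound, sum_product]
    have hI : Ico (y + 1) T₁ = Ioo y T₁ := by ext; simp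
    rw [hI]
    simp_rw [mul_sum]
    have hswap : ∀ f : ℕ → ℕ → ℕ → ℕ → ℝ,
        ∑ n ∈ range (N + 1), (if t + n ≤ e then ∑ x ∈ Ioo y T₁, ∑ i ∈ range (L + 1),
          ∑ j ∈ range (L + 1), f n x i j else 0) =
        ∑ x ∈ Ioo y T₁, ∑ i ∈ range (L + 1), ∑ j ∈ range (L + 1),
          ∑ n ∈ range (N + 1), (if t + n ≤ e then f n x i j else 0) := by
      intro f
      have : ∀ n, (if t + n ≤ e then ∑ x ∈ Ioo y T₁, ∑ i ∈ range (L + 1),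
          ∑ j ∈ range (L + 1), f n x i j else 0) = ∑ x ∈ Ioo y T₁, ∑ i ∈ range (L + 1),
          ∑ j ∈ range (L + 1), (if t + n ≤ e then f n x i j else 0) := by
        intro n; split_ifs <;> simp
      simp_rw [this]
      rw [sum_comm]
      refine sum_congr rfl fun x _ => ?_
      rw [sum_comm]
      refine sum_congr rfl fun i _ => ?_
      rw [sum_comm]
    rw [hswap]
    refine sum_le_sum fun x hx => sum_le_sum fun i _ => sum_le_sum fun j _ => ?_
    have hyx : y < x := (mem_Ioo.mp hx).1
    set c := chainBound lam T₁ L (x + 1) (e + j) S with hc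
    have hc0 : 0 ≤ c := hcb _ _ _
    by_cases hti : t + i ≤ e
    · rw [if_pos hti]
      -- Summing over the content of cell `y` only adds `lam y` to the mean of the cells to be
      -- crossed.
      have hconv := sum_pois_mul_pois (lam y) (∑ z ∈ Ico (y + 1) x, lam z) (e - t - i)
      have hΛ' : lam y + ∑ z ∈ Ico (y + 1) x, lam z = ∑ z ∈ Ico y x, lam z :=
        (sum_eq_sum_Ico_succ_bot hyx _).symm
      rw [hΛ'] at hconv
      rw [← hconv]
      have hterm : ∀ n, (if t + n ≤ e then pois (lam y) n * ((if t + n + i ≤ e then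
          pois (∑ z ∈ Ico (y + 1) x, lam z) (e - (t + n) - i) * lam x ^ 2 else 0) * c) else 0) =
          if n ∈ range (e - t - i + 1) then pois (lam y) n *
            pois (∑ z ∈ Ico (y + 1) x, lam z) (e - t - i - n) * lam x ^ 2 * c else 0 := by
        intro n
        by_cases h : t + n + i ≤ e
        · rw [if_pos (by omega), if_pos h, if_pos (mem_range.mpr (by omega))]
          have : e - (t + n) - i = e - t - i - n := by omega
          rw [this]; ring
        · rw [if_neg h, zero_mul, mul_zero, ite_self, if_neg]
          intro hm
          have := mem_range.mp hm
          omega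
      rw [sum_congr rfl fun n _ => hterm n, sum_ite_mem, sum_mul, sum_mul]
      refine sum_le_sum_of_subset_of_nonneg inter_subset_right fun n _ _ => ?_
      exact mul_nonneg (mul_nonneg (mul_nonneg (hp _ _) (pois_nonneg (hΛ _ _) _)) (sq_nonneg _)) hc0
    · rw [if_neg hti, zero_mul]
      refine le_of_eq (sum_eq_zero fun n _ => ?_)
      split_ifs
      · omega
      · simp
      · rfl

-- Unnormalised Poisson weights make the cells independent apart from the fixed total. The first `m`
-- cells are peeled off one by one, each releasing a factor `exp lam`; the `m₂` last cells absorb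
-- whatever total remains, and `C₁` bounds their weight for every such total.
open Classical in
theorem sum_realises_le {lam : ℕ → ℝ} (hlam : ∀ x, 0 ≤ lam x) (hlam1 : ∀ x, lam x ≤ 1)
    {N L h T₁ m₂ : ℕ} {C₁ : ℝ}
    (hC₁ : ∀ n ≤ N, (∑ x ∈ range m₂, lam (T₁ + x)) ^ n / (n.factorial : ℝ) ≤ C₁) :
    ∀ (m y t : ℕ) (S : List ℕ), y + m = T₁ → IsSep h L t S →
      ∑ c : Fin (m₂ + m) → Fin (N + 1), (if Realises m L t S c then
        ∏ x : Fin _, lam (y + x) ^ (c x : ℕ) / ((c x : ℕ).factorial : ℝ) else 0) ≤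
      C₁ * Real.exp (∑ z ∈ Ico y T₁, lam z) * chainBound lam T₁ L y t S := by
  have hC0 : 0 ≤ C₁ := by
    refine le_trans ?_ (hC₁ 0 (Nat.zero_le _)); simp
  intro m
  induction m with
  | zero =>
    intro y t S hy hS
    rw [add_zero] at hy
    subst hy
    match S with
    | e :: S' =>
      rw [sum_eq_zero]
      · exact mul_nonneg (mul_nonneg hC0 (Real.exp_pos _).le) (chainBound_nonneg hlam _ _ _ _ _)
      · intro c _
        rw [if_neg]
        rintro ⟨_, _, h3⟩
        obtain ⟨x, hx, _⟩ := h3 e (by simp)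
        omega
    | [] =>
      simp only [Ico_self, sum_empty, Real.exp_zero, mul_one, chainBound]
      by_cases ht : t ≤ N
      · refine le_trans (le_of_eq ?_) (hC₁ (N - t) (Nat.sub_le _ _))
        rw [← sum_counts_eq m₂ N (fun x => lam (y + x)) (N - t) (Nat.sub_le _ _)]
        refine sum_congr rfl fun c _ => if_congr ?_ rfl rfl
        simp only [Realises, Nat.not_lt_zero, false_imp_iff, implies_true, List.not_mem_nil,
          and_true]
        change t + ∑ x : Fin m₂, (c x : ℕ) = N ↔ ∑ x : Fin m₂, (c x : ℕ) = N - t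
        omega
      · rw [sum_eq_zero]
        · exact hC0
        · intro c _
          rw [if_neg]
          rintro ⟨h1, _⟩
          omega
  | succ m ih =>
    intro y t S hy hS
    have hyT : y < T₁ := by omega
    have hexp : Real.exp (∑ z ∈ Ico y T₁, lam z) =
        Real.exp (lam y) * Real.exp (∑ z ∈ Ico (y + 1) T₁, lam z) := by
      rw [← Real.exp_add, sum_eq_sum_Ico_succ_bot hyT]
    set E := C₁ * Real.exp (∑ z ∈ Ico (y + 1) T₁, lam z) with hE
    have hE0 : 0 ≤ E := mul_nonneg hC0 (Real.exp_pos _).le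
    set R : ℕ → List ℕ → ℝ := fun t S => ∑ c : Fin (m₂ + m) → Fin (N + 1),
      (if Realises m L t S c then
        ∏ x : Fin _, lam (y + 1 + x) ^ (c x : ℕ) / ((c x : ℕ).factorial : ℝ) else 0) with hR
    have hprod0 : ∀ c : Fin (m₂ + m) → Fin (N + 1),
        0 ≤ ∏ x : Fin _, lam (y + 1 + x) ^ (c x : ℕ) / ((c x : ℕ).factorial : ℝ) := fun c =>
      prod_nonneg fun x _ => div_nonneg (pow_nonneg (hlam _) _) (by positivity)
    have hpos : ∀ n : ℕ, 0 ≤ lam y ^ n / (n.factorial : ℝ) := fun n =>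
      div_nonneg (pow_nonneg (hlam _) _) (by positivity)
    have hpois : ∀ n : ℕ, lam y ^ n / (n.factorial : ℝ) = Real.exp (lam y) * pois (lam y) n := by
      intro n
      rw [pois, ← mul_assoc, ← Real.exp_add]; simp
    have hLHS : ∑ c : Fin (m₂ + (m + 1)) → Fin (N + 1), (if Realises (m + 1) L t S c then
        ∏ x : Fin _, lam (y + x) ^ (c x : ℕ) / ((c x : ℕ).factorial : ℝ) else 0) =
        ∑ c0 : Fin (N + 1), lam y ^ (c0 : ℕ) / ((c0 : ℕ).factorial : ℝ) *
          ∑ c : Fin (m₂ + m) → Fin (N + 1), (if Realises (T := m₂ + m + 1) (m + 1) L t S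
            (Fin.cons c0 c : Fin (m₂ + m + 1) → Fin (N + 1)) then
            ∏ x : Fin _, lam (y + 1 + x) ^ (c x : ℕ) / ((c x : ℕ).factorial : ℝ) else 0) := by
      refine (Equiv.sum_comp (Fin.consEquiv fun _ : Fin (m₂ + m + 1) => Fin (N + 1)) _).symm.trans ?_
      rw [Fintype.sum_prod_type]
      refine sum_congr rfl fun c0 _ => ?_
      rw [mul_sum]
      refine sum_congr rfl fun c _ => ?_
      simp only [Fin.consEquiv, Equiv.coe_fn_mk]
      rw [mul_ite, mul_zero]
      refine if_congr Iff.rfl ?_ rfl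
      refine (Fin.prod_univ_succ (n := m₂ + m) _).trans ?_
      simp only [Fin.cons_zero, Fin.cons_succ, Fin.val_zero, add_zero, Fin.val_succ]
      congr 1
      refine prod_congr rfl fun x _ => ?_
      rw [add_assoc, add_comm 1]
    rw [hLHS, hexp]
    match S, hS with
    | [], hS =>
      have h1 : ∀ c0 : Fin (N + 1), ∑ c : Fin (m₂ + m) → Fin (N + 1),
          (if Realises (T := m₂ + m + 1) (m + 1) L t []
            (Fin.cons c0 c : Fin (m₂ + m + 1) → Fin (N + 1)) then
            ∏ x : Fin _, lam (y + 1 + x) ^ (c x : ℕ) / ((c x : ℕ).factorial : ℝ) else 0) ≤ E := by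
        intro c0
        have := ih (y + 1) (t + c0) [] (by omega) trivial
        rw [chainBound, mul_one] at this
        refine le_trans (sum_le_sum fun c _ => ?_) this
        by_cases hc : Realises (T := m₂ + m + 1) (m + 1) L t []
            (Fin.cons c0 c : Fin (m₂ + m + 1) → Fin (N + 1))
        · obtain ⟨_, ⟨_, h2⟩ | ⟨e, S', h2, _⟩⟩ := hc.of_cons hS
          · rw [if_pos hc, if_pos h2]
          · simp at h2
        · rw [if_neg hc]
          split_ifs
          · exact hprod0 c
          · exact le_rfl
      calc _ ≤ ∑ c0 : Fin (N + 1), lam y ^ (c0 : ℕ) / ((c0 : ℕ).factorial : ℝ) * E :=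
            sum_le_sum fun c0 _ => mul_le_mul_of_nonneg_left (h1 c0) (hpos _)
        _ = (∑ n ∈ range (N + 1), lam y ^ n / (n.factorial : ℝ)) * E := by
            rw [← sum_mul, Fin.sum_univ_eq_sum_range fun n => lam y ^ n / (n.factorial : ℝ)]
        _ ≤ Real.exp (lam y) * E :=
            mul_le_mul_of_nonneg_right (Real.sum_le_exp_of_nonneg (hlam y) _) hE0
        _ = _ := by rw [chainBound, hE]; ring
    | e :: S', hS =>
      have h1 : ∀ c0 : Fin (N + 1), ∑ c : Fin (m₂ + m) → Fin (N + 1),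
          (if Realises (T := m₂ + m + 1) (m + 1) L t (e :: S')
            (Fin.cons c0 c : Fin (m₂ + m + 1) → Fin (N + 1)) then
            ∏ x : Fin _, lam (y + 1 + x) ^ (c x : ℕ) / ((c x : ℕ).factorial : ℝ) else 0) ≤
          E * (if (c0 : ℕ) ≤ L then
            (if t + c0 ≤ e then chainBound lam T₁ L (y + 1) (t + c0) (e :: S') else 0) +
            (if e + 1 < t + c0 then chainBound lam T₁ L (y + 1) (t + c0) S' else 0) else 0) := by
        intro c0
        have hbound : ∑ c : Fin (m₂ + m) → Fin (N + 1),
          (if Realises (T := m₂ + m + 1) (m + 1) L t (e :: S')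
            (Fin.cons c0 c : Fin (m₂ + m + 1) → Fin (N + 1)) then
            ∏ x : Fin _, lam (y + 1 + x) ^ (c x : ℕ) / ((c x : ℕ).factorial : ℝ) else 0) ≤
            if (c0 : ℕ) ≤ L then (if t + c0 ≤ e then R (t + c0) (e :: S') else 0) +
              (if e + 1 < t + c0 then R (t + c0) S' else 0) else 0 := by
          by_cases hL : (c0 : ℕ) ≤ L
          · rw [if_pos hL]
            have e1 : ∀ (P : Prop) [Decidable P] (S : List ℕ), (if P then R (t + c0) S else 0) =
                ∑ c : Fin (m₂ + m) → Fin (N + 1), (if P then (if Realises m L (t + c0) S c then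
                ∏ x : Fin _, lam (y + 1 + x) ^ (c x : ℕ) / ((c x : ℕ).factorial : ℝ) else 0) else 0) := by
              intro P _ S
              split_ifs
              · rfl
              · simp
            rw [e1, e1, ← sum_add_distrib]
            refine sum_le_sum fun c _ => ?_
            have hc0 := hprod0 c
            by_cases hc : Realises (T := m₂ + m + 1) (m + 1) L t (e :: S')
                (Fin.cons c0 c : Fin (m₂ + m + 1) → Fin (N + 1))
            · obtain ⟨_, ⟨h2, _⟩ | ⟨e', S'', h2, h3⟩⟩ := hc.of_cons hS
              · simp at h2
              · rw [List.cons.injEq] at h2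
                obtain ⟨rfl, rfl⟩ := h2
                rw [if_pos hc]
                rcases h3 with ⟨h3, h4⟩ | ⟨h3, h4⟩
                · rw [if_pos h3, if_pos h4]
                  refine le_add_of_nonneg_right ?_
                  split_ifs <;> first | exact hc0 | exact le_rfl
                · rw [if_pos h3, if_pos h4]
                  refine le_add_of_nonneg_left ?_
                  split_ifs <;> first | exact hc0 | exact le_rfl
            · rw [if_neg hc]
              refine add_nonneg ?_ ?_ <;> split_ifs <;> first | exact hc0 | exact le_rfl
          · rw [if_neg hL]
            refine le_of_eq (sum_eq_zero fun c _ => ?_)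
            rw [if_neg]
            exact fun hc => hL (hc.of_cons hS).1
        refine hbound.trans ?_
        split_ifs with h2 h3 h4 h4
        · omega
        · simp only [add_zero]
          refine ih (y + 1) (t + c0) (e :: S') (by omega) ?_
          exact ⟨h3, hS.2⟩
        · simp only [zero_add]
          refine ih (y + 1) (t + c0) S' (by omega) ?_
          exact hS.2.2.mono (by have := hS.1; omega)
        · simp
        · simp
      calc _ ≤ ∑ c0 : Fin (N + 1), lam y ^ (c0 : ℕ) / ((c0 : ℕ).factorial : ℝ) *
            (E * (if (c0 : ℕ) ≤ L then
            (if t + c0 ≤ e then chainBound lam T₁ L (y + 1) (t + c0) (e :: S') else 0) +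
            (if e + 1 < t + c0 then chainBound lam T₁ L (y + 1) (t + c0) S' else 0) else 0)) :=
            sum_le_sum fun c0 _ => mul_le_mul_of_nonneg_left (h1 c0) (hpos _)
        _ = Real.exp (lam y) * E * ∑ n ∈ range (N + 1), (if n ≤ L then pois (lam y) n *
            ((if t + n ≤ e then chainBound lam T₁ L (y + 1) (t + n) (e :: S') else 0) +
            if e + 1 < t + n then chainBound lam T₁ L (y + 1) (t + n) S' else 0) else 0) := by
            rw [Fin.sum_univ_eq_sum_range (fun n => lam y ^ n / (n.factorial : ℝ) *
              (E * (if n ≤ L then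
              (if t + n ≤ e then chainBound lam T₁ L (y + 1) (t + n) (e :: S') else 0) +
              (if e + 1 < t + n then chainBound lam T₁ L (y + 1) (t + n) S' else 0) else 0)))
              (N + 1), mul_sum]
            refine sum_congr rfl fun n _ => ?_
            rw [hpois]
            split_ifs <;> ring
        _ ≤ Real.exp (lam y) * E * chainBound lam T₁ L y t (e :: S') :=
            mul_le_mul_of_nonneg_left (chainBound_step hlam hlam1 hyT hS.1 S' N)
              (mul_nonneg (Real.exp_pos _).le hE0)
        _ = _ := by rw [hE]; ring

/-! ### Stirling bounds -/

theorem factorial_le_stirling {n : ℕ} (hn : 1 ≤ n) :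
    (n.factorial : ℝ) ≤ Real.exp 1 * √n * (n / Real.exp 1) ^ n := by
  obtain ⟨m, rfl⟩ : ∃ m, n = m + 1 := ⟨n - 1, by omega⟩
  have h := Stirling.stirlingSeq'_antitone (Nat.zero_le m)
  simp only [Function.comp_apply, Nat.succ_eq_add_one, zero_add, Stirling.stirlingSeq_one] at h
  rw [Stirling.stirlingSeq, div_le_iff₀ (by positivity)] at h
  refine h.trans (le_of_eq ?_)
  rw [Real.sqrt_mul (by norm_num)]
  have : √(2 : ℝ) ≠ 0 := by positivity
  field_simp

theorem pois_le_pois_succ {a : ℝ} (ha : 0 ≤ a) {n : ℕ} (hn : (n + 1 : ℝ) ≤ a) :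
    pois a n ≤ pois a (n + 1) := by
  unfold pois
  refine mul_le_mul_of_nonneg_left ?_ (Real.exp_pos _).le
  rw [Nat.factorial_succ, pow_succ, div_le_div_iff₀ (by positivity) (by positivity)]
  push_cast
  have h1 : 0 ≤ a ^ n := by positivity
  have h2 : (0 : ℝ) < n.factorial := by positivity
  nlinarith [mul_nonneg h1 h2.le]

theorem pois_le_one {a : ℝ} (ha : 0 ≤ a) (n : ℕ) : pois a n ≤ 1 := by
  have h : a ^ n / n.factorial ≤ Real.exp a := by
    have := Real.sum_le_exp_of_nonneg ha (n + 1)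
    refine le_trans ?_ this
    exact single_le_sum (f := fun i => a ^ i / (i.factorial : ℝ)) (fun i _ => by positivity)
      (mem_range.mpr (Nat.lt_succ_self n))
  unfold pois
  calc Real.exp (-a) * (a ^ n / n.factorial) ≤ Real.exp (-a) * Real.exp a :=
        mul_le_mul_of_nonneg_left h (Real.exp_pos _).le
    _ = 1 := by rw [← Real.exp_add]; simp

theorem pois_le_of_half_le {a : ℝ} (ha : 0 < a) {n : ℕ} (hn : a / 2 ≤ n) :
    pois a n ≤ 1 / √a := by
  have hn0 : (0 : ℝ) < n := by linarith
  have h1 := Stirling.le_factorial_stirling n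
  have h2 : √a ≤ √(2 * Real.pi * n) := by
    apply Real.sqrt_le_sqrt
    nlinarith [Real.pi_gt_three]
  have h3 : a ^ n ≤ Real.exp a * (n / Real.exp 1) ^ n := by
    have h4 : a / n ≤ Real.exp (a / n - 1) := by
      have := Real.add_one_le_exp (a / n - 1); linarith
    have h5 := pow_le_pow_left₀ (by positivity) h4 n
    rw [← Real.exp_nat_mul, div_pow, div_le_iff₀ (by positivity)] at h5
    refine h5.trans (le_of_eq ?_)
    rw [div_pow, ← Real.exp_nat_mul, mul_sub, mul_div_cancel₀ _ hn0.ne', Real.exp_sub]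
    field_simp
  unfold pois
  rw [Real.exp_neg, ← div_eq_inv_mul, div_div, div_le_div_iff₀ (by positivity) (by positivity)]
  calc a ^ n * √a ≤ (Real.exp a * (n / Real.exp 1) ^ n) * √(2 * Real.pi * n) := by gcongr
    _ = Real.exp a * (√(2 * Real.pi * n) * (n / Real.exp 1) ^ n) := by ring
    _ ≤ 1 * (n.factorial * Real.exp a) := by
        rw [one_mul, mul_comm]
        exact mul_le_mul_of_nonneg_right h1 (Real.exp_pos _).le

/-- Stirling covers `n ≥ a / 2`. Below that, the mass function increases up to `⌊a⌋₊`, which is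
itself at least `a / 2` when `a ≥ 1`. -/
theorem pois_le {a : ℝ} (ha : 0 < a) (n : ℕ) : pois a n ≤ 1 / √a := by
  rcases lt_or_ge a 1 with h1 | h1
  · refine (pois_le_one ha.le n).trans ?_
    rw [le_div_iff₀ (by positivity), one_mul, ← Real.sqrt_one]
    exact Real.sqrt_le_sqrt h1.le
  rcases le_or_gt (a / 2) n with h2 | h2
  · exact pois_le_of_half_le ha h2
  · have hfl : (⌊a⌋₊ : ℝ) ≤ a := Nat.floor_le ha.le
    have hfl2 : a / 2 ≤ ⌊a⌋₊ := by
      have h3 := Nat.lt_floor_add_one a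
      have h4 : (1 : ℝ) ≤ ⌊a⌋₊ := by exact_mod_cast Nat.le_floor (by simpa using h1)
      linarith
    have key : ∀ d, (n + d : ℕ) ≤ ⌊a⌋₊ → pois a n ≤ pois a (n + d) := by
      intro d
      induction d with
      | zero => intro _; exact le_rfl
      | succ d ih =>
        intro hd
        refine (ih (by omega)).trans (pois_le_pois_succ ha.le ?_)
        have : ((n + (d + 1) : ℕ) : ℝ) ≤ ⌊a⌋₊ := by exact_mod_cast hd
        push_cast at this ⊢
        linarith
    have hn : n ≤ ⌊a⌋₊ := by
      have : (n : ℝ) ≤ ⌊a⌋₊ := h2.le.trans hfl2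
      exact_mod_cast this
    have := key (⌊a⌋₊ - n) (by omega)
    rw [Nat.add_sub_cancel' hn] at this
    exact this.trans (pois_le_of_half_le ha hfl2)

/-! ### Edges of sorted sequences -/

/-- The contents of the cells. -/
def cellCount {N T : ℕ} (s : Fin N → Fin T) (x : Fin T) : Fin (N + 1) :=
  ⟨(univ.filter fun i => s i = x).card, by
    have := card_filter_le (univ : Finset (Fin N)) (fun i => s i = x)
    rw [card_univ, Fintype.card_fin] at this
    omega⟩

theorem sum_cellCount_lt {N T : ℕ} (s : Fin N → Fin T) (x : Fin T) :
    (∑ y, if y < x then (cellCount s y : ℕ) else 0) = (univ.filter fun i => s i < x).card := by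
  rw [← sum_filter, card_eq_sum_card_fiberwise (f := s) (t := univ.filter fun y => y < x)]
  · refine sum_congr rfl fun y hy => ?_
    simp only [cellCount]
    congr 1
    ext i
    simp only [mem_filter, mem_univ, true_and] at hy ⊢
    exact ⟨fun h => ⟨h ▸ hy, h⟩, fun h => h.2⟩
  · intro i hi
    simpa using hi

theorem sum_cellCount_le {N T : ℕ} (s : Fin N → Fin T) (x : Fin T) :
    (∑ y, if y ≤ x then (cellCount s y : ℕ) else 0) = (univ.filter fun i => s i ≤ x).card := by
  rw [← sum_filter, card_eq_sum_card_fiberwise (f := s) (t := univ.filter fun y => y ≤ x)]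
  · refine sum_congr rfl fun y hy => ?_
    simp only [cellCount]
    congr 1
    ext i
    simp only [mem_filter, mem_univ, true_and] at hy ⊢
    exact ⟨fun h => ⟨h ▸ hy, h⟩, fun h => h.2⟩
  · intro i hi
    simpa using hi

theorem sum_cellCount {N T : ℕ} (s : Fin N → Fin T) : ∑ y, (cellCount s y : ℕ) = N := by
  have := card_eq_sum_card_fiberwise (f := s) (s := univ) (t := univ) (by simp)
  rw [card_univ, Fintype.card_fin] at this
  exact this.symm

theorem cellCount_injOn (N T : ℕ) :
    Set.InjOn (cellCount (N := N) (T := T)) (sortedSeqs N T : Set (Fin N → Fin T)) := by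
  intro s hs s' hs' h
  have hs1 : Monotone s := mem_sortedSeqs.mp hs
  have hs2 : Monotone s' := mem_sortedSeqs.mp hs'
  have key : ∀ i x, s i < x ↔ s' i < x := by
    intro i x
    rw [← Tuple.lt_card_lt_iff_apply_lt_of_monotone (j := i) hs1,
      ← Tuple.lt_card_lt_iff_apply_lt_of_monotone (j := i) hs2, ← sum_cellCount_lt,
      ← sum_cellCount_lt, h]
  funext i
  refine le_antisymm ?_ ?_
  · by_contra hlt
    exact lt_irrefl _ ((key i _).mpr (not_le.mp hlt))
  · by_contra hlt
    exact lt_irrefl _ ((key i _).mp (not_le.mp hlt))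

theorem realises_cellCount {N T T₁ L h : ℕ} {s : Fin N → Fin T} (hs : Monotone s)
    (hL : ∀ x, (cellCount s x : ℕ) ≤ L) (hT₁ : ∀ i : Fin N, (i : ℕ) < h → (s i : ℕ) < T₁)
    {S : List ℕ} (hS : ∀ e ∈ S, e < h ∧ e ∈ edges s) : Realises T₁ L 0 S (cellCount s) := by
  refine ⟨by rw [zero_add, sum_cellCount], fun x _ => hL x, fun e he => ?_⟩
  obtain ⟨heh, hee⟩ := hS e he
  obtain ⟨i, j, hi, hj, hij⟩ := mem_edges.mp hee
  refine ⟨s i, hT₁ i (by omega), ?_, ?_⟩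
  · rw [zero_add, sum_cellCount_lt]
    have := (Tuple.lt_card_lt_iff_apply_lt_of_monotone (j := i) (a := s i) hs).not.mpr (lt_irrefl _)
    omega
  · rw [zero_add, sum_cellCount_le]
    have := (Tuple.lt_card_le_iff_apply_le_of_monotone (j := j) (a := s i) hs).mpr hij.ge
    omega

theorem runLen_edges_le_cellCount {N T L : ℕ} {s : Fin N → Fin T} (hs : Monotone s)
    (hL : ∀ x, (cellCount s x : ℕ) ≤ L) (i : ℕ) (hi : i < N) : runLen (edges s) i ≤ L := by
  have := runLen_edges hs ⟨i, hi⟩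
  simp only at this
  rw [this]
  have h2 : (univ.filter fun j => s j = s ⟨i, hi⟩).card ≤ L := hL (s ⟨i, hi⟩)
  refine le_trans (card_le_card ?_) h2
  intro j
  simp +contextual

theorem sortedMass_eq {N T : ℕ} (hN : 1 ≤ N) {s : Fin N → Fin T} (hs : Monotone s) (q : ℕ → ℝ) :
    sortedMass (fun x : Fin T => q x) s = (N.factorial : ℝ) / (N : ℝ) ^ N *
      ∏ x : Fin T, (N * q x) ^ (cellCount s x : ℕ) / ((cellCount s x : ℕ).factorial : ℝ) := by
  have h1 := ascCount_edges_mul hs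
  have h2 : (ascCount N (edges s) : ℝ) * ∏ x, ((cellCount s x : ℕ).factorial : ℝ) = N.factorial := by
    rw [← h1]; push_cast; rfl
  have h3 : (∏ x : Fin T, ((cellCount s x : ℕ).factorial : ℝ)) ≠ 0 :=
    prod_ne_zero_iff.mpr fun x _ => by positivity
  have h4 : ∏ i, q (s i) = ∏ x : Fin T, q x ^ (cellCount s x : ℕ) := by
    rw [← prod_fiberwise univ s (fun i => q (s i))]
    refine prod_congr rfl fun x _ => ?_
    have : ∀ i ∈ univ.filter (fun i => s i = x), q (s i) = q x := fun i hi => by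
      rw [(mem_filter.mp hi).2]
    rw [prod_congr rfl this, prod_const, cellCount]
  have h5 : ∏ x : Fin T, (N : ℝ) ^ (cellCount s x : ℕ) = (N : ℝ) ^ N := by
    rw [prod_pow_eq_pow_sum, sum_cellCount]
  rw [sortedMass, h4, prod_div_distrib]
  simp_rw [mul_pow]
  rw [prod_mul_distrib, h5, ← h2]
  have h6 : (N : ℝ) ^ N ≠ 0 := by
    have : (0 : ℝ) < N := by exact_mod_cast hN
    positivity
  field_simp

-- Passing from multinomial to Poisson contents costs only the constant `e / √ρ`. The normalisation
-- `N! e ^ N / N ^ N` is at most `e √N`, while the cells from `T₁` on have total mean at least `ρ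
-- N`, so they meet a prescribed total with probability at most `1 / √(ρ N)`.
open Classical in
theorem sum_sortedMass_subset_edges_le {N T T₁ L h : ℕ} {q : ℕ → ℝ} {ρ : ℝ} (hN : 1 ≤ N)
    (hT : T₁ ≤ T) (hq : ∀ x, 0 ≤ q x) (hq1 : ∀ x, N * q x ≤ 1) (hsum : ∑ x ∈ range T, q x = 1)
    (hρ : 0 < ρ) (hρ' : ρ ≤ ∑ x ∈ Ico T₁ T, q x) {G : Finset (Fin N → Fin T)}
    (hG : G ⊆ sortedSeqs N T) (hGL : ∀ s ∈ G, ∀ x, (cellCount s x : ℕ) ≤ L)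
    (hGh : ∀ s ∈ G, ∀ i : Fin N, (i : ℕ) < h → (s i : ℕ) < T₁) {S : List ℕ}
    (hS : IsSep h L 0 S) :
    ∑ s ∈ G, sortedMass (fun x : Fin T => q x) s * (if ∀ e ∈ S, e ∈ edges s then 1 else 0) ≤
      Real.exp 1 / √ρ * chainBound (fun x => N * q x) T₁ L 0 0 S := by
  obtain ⟨m₂, rfl⟩ : ∃ m₂, T = m₂ + T₁ := ⟨T - T₁, by omega⟩
  have hN0 : (0 : ℝ) < N := by exact_mod_cast hN
  set R : ℝ := N * ∑ x ∈ Ico T₁ (m₂ + T₁), q x with hR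
  have hRρ : N * ρ ≤ R := mul_le_mul_of_nonneg_left hρ' hN0.le
  have hR0 : 0 < R := lt_of_lt_of_le (mul_pos hN0 hρ) hRρ
  have hlam : ∀ x, 0 ≤ N * q x := fun x => mul_nonneg hN0.le (hq x)
  have hRsum : ∑ x ∈ range m₂, N * q (T₁ + x) = R := by
    rw [hR, ← mul_sum, sum_Ico_eq_sum_range, Nat.add_sub_cancel]
  have hC₁ : ∀ n ≤ N, (∑ x ∈ range m₂, N * q (T₁ + x)) ^ n / (n.factorial : ℝ) ≤
      Real.exp R / √R := by
    intro n _
    rw [hRsum]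
    have := pois_le hR0 n
    rw [pois, Real.exp_neg, inv_mul_le_iff₀ (Real.exp_pos _)] at this
    refine this.trans (le_of_eq ?_); ring
  have key := sum_realises_le (N := N) hlam hq1 hC₁ T₁ 0 0 S (zero_add _) hS
  have hQ : ∑ z ∈ Ico 0 T₁, (N : ℝ) * q z = N - R := by
    have : ∑ x ∈ range T₁, q x + ∑ x ∈ Ico T₁ (m₂ + T₁), q x = 1 := by
      rw [sum_range_add_sum_Ico _ hT, hsum]
    rw [← mul_sum, hR, ← Finset.range_eq_Ico]
    linear_combination (N : ℝ) * this
  rw [hQ] at key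
  simp only [zero_add] at key
  have hfac : (0 : ℝ) ≤ (N.factorial : ℝ) / (N : ℝ) ^ N := by positivity
  calc ∑ s ∈ G, sortedMass (fun x : Fin (m₂ + T₁) => q x) s *
        (if ∀ e ∈ S, e ∈ edges s then (1 : ℝ) else 0)
      ≤ ∑ s ∈ G, (N.factorial : ℝ) / (N : ℝ) ^ N * (if Realises T₁ L 0 S (cellCount s) then
          ∏ x : Fin (m₂ + T₁), (N * q x) ^ (cellCount s x : ℕ) /
            ((cellCount s x : ℕ).factorial : ℝ) else 0) := by
        refine sum_le_sum fun s hs => ?_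
        have hs' := mem_sortedSeqs.mp (hG hs)
        rw [sortedMass_eq hN hs']
        split_ifs with h1 h2 h2
        · rw [mul_one]
        · exact absurd (realises_cellCount hs' (hGL s hs) (hGh s hs) fun e he =>
            ⟨(hS.le_of_mem he).2, h1 e he⟩) h2
        · rw [mul_zero]
          exact mul_nonneg hfac (prod_nonneg fun x _ =>
            div_nonneg (pow_nonneg (hlam x) _) (by positivity))
        · simp
    _ = (N.factorial : ℝ) / (N : ℝ) ^ N * ∑ c ∈ G.image cellCount, (if Realises T₁ L 0 S c then
          ∏ x : Fin (m₂ + T₁), (N * q x) ^ (c x : ℕ) / ((c x : ℕ).factorial : ℝ) else 0) := by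
        rw [← mul_sum, sum_image]
        exact (cellCount_injOn N (m₂ + T₁)).mono (by exact_mod_cast hG)
    _ ≤ (N.factorial : ℝ) / (N : ℝ) ^ N * (Real.exp R / √R * Real.exp (N - R) *
          chainBound (fun x => N * q x) T₁ L 0 0 S) := by
        refine mul_le_mul_of_nonneg_left (le_trans ?_ key) hfac
        refine sum_le_sum_of_subset_of_nonneg (subset_univ _) fun c _ _ => ?_
        split_ifs
        · exact prod_nonneg fun x _ => div_nonneg (pow_nonneg (hlam x) _) (by positivity)
        · exact le_rfl
    _ = (N.factorial : ℝ) / (N : ℝ) ^ N * (Real.exp N / √R) *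
          chainBound (fun x => N * q x) T₁ L 0 0 S := by
        rw [Real.exp_sub]
        have := (Real.exp_pos R).ne'
        field_simp
    _ ≤ _ := by
        refine mul_le_mul_of_nonneg_right ?_ (chainBound_nonneg hlam _ _ _ _ _)
        have h1 := factorial_le_stirling hN
        have h2 : √N * √ρ ≤ √R := by
          rw [← Real.sqrt_mul hN0.le]; exact Real.sqrt_le_sqrt hRρ
        have h3 : (N / Real.exp 1) ^ N * Real.exp N = (N : ℝ) ^ N := by
          rw [div_pow, ← Real.exp_nat_mul, mul_one]
          field_simp
        have h4 : 0 < √R := Real.sqrt_pos.mpr hR0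
        have h5 : 0 < √ρ := Real.sqrt_pos.mpr hρ
        have h6 : (0 : ℝ) < (N : ℝ) ^ N := by positivity
        rw [div_mul_div_comm, div_le_div_iff₀ (by positivity) h5]
        calc (N.factorial : ℝ) * Real.exp N * √ρ
            ≤ Real.exp 1 * √N * (N / Real.exp 1) ^ N * Real.exp N * √ρ := by gcongr
          _ = Real.exp 1 * ((N / Real.exp 1) ^ N * Real.exp N) * (√N * √ρ) := by ring
          _ ≤ Real.exp 1 * ((N / Real.exp 1) ^ N * Real.exp N) * √R := by gcongr
          _ = _ := by rw [h3]; ring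

-- Expand the power over separated lists `S`; subtracting `1` removes the empty list. For
-- independent `s` and `s'` the event that both contain `S` has a squared probability, bounded by
-- the squared chain, and the lengths of the lists give a geometric series of ratio at most `1 / 2`.
open Classical in
theorem sum_pow_inter_sub_one_le {N T T₁ L h : ℕ} {q : ℕ → ℝ} {ρ C η : ℝ} (hN : 1 ≤ N)
    (hT : T₁ ≤ T) (hq : ∀ x, 0 ≤ q x) (hq1 : ∀ x, N * q x ≤ 1) (hsum : ∑ x ∈ range T, q x = 1)
    (hρ : 0 < ρ) (hρ' : ρ ≤ ∑ x ∈ Ico T₁ T, q x) {G : Finset (Fin N → Fin T)}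
    (hG : G ⊆ sortedSeqs N T) (hGL : ∀ s ∈ G, ∀ x, (cellCount s x : ℕ) ≤ L)
    (hGh : ∀ s ∈ G, ∀ i : Fin N, (i : ℕ) < h → (s i : ℕ) < T₁) (hC : 1 ≤ C)
    (hη : ∀ y D, ∑ d ∈ range D, (∑ x ∈ Ico y T₁,
      pois (∑ z ∈ Ico y x, N * q z) d * (N * q x) ^ 2) ^ 2 ≤ η)
    (hζ : C ^ (L + 1) * ((L + 1) ^ 4 * η) ≤ 1 / 2) :
    ∑ s ∈ G, ∑ s' ∈ G, sortedMass (fun x : Fin T => q x) s * sortedMass (fun x : Fin T => q x) s' *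
      (C ^ ((edges s ∩ edges s').filter fun e => e < h).card - 1) ≤
      2 * Real.exp 1 ^ 2 / ρ * (C ^ (L + 1) * ((L + 1) ^ 4 * η)) := by
  have hN0 : (0 : ℝ) < N := by exact_mod_cast hN
  have hlam : ∀ x, 0 ≤ N * q x := fun x => mul_nonneg hN0.le (hq x)
  have hη0 : 0 ≤ η := by simpa using hη 0 0
  set B := C ^ (L + 1) with hB
  have hB0 : 0 ≤ B := by positivity
  set P : (Fin N → Fin T) → ℝ := sortedMass (fun x : Fin T => q x) with hP
  have hP0 : ∀ s, 0 ≤ P s := fun s => sortedMass_nonneg (fun x => hq x) s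
  set W : List ℕ → ℝ := fun S => ∑ s ∈ G, P s * (if ∀ e ∈ S, e ∈ edges s then 1 else 0) with hW
  have hstep : ∀ s s' : Fin N → Fin T, C ^ ((edges s ∩ edges s').filter fun e => e < h).card - 1 ≤
      ∑ r ∈ range h, B ^ (r + 1) * sepSum h L (r + 1) 0
        (fun S => (if ∀ e ∈ S, e ∈ edges s then (1 : ℝ) else 0) *
          (if ∀ e ∈ S, e ∈ edges s' then 1 else 0)) := by
    intro s s'
    have := pow_card_filter_le_sum_sepSum (h := h) (L := L) hC (edges s ∩ edges s') h 0 (by omega)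
    rw [sum_range_succ'] at this
    simp only [Nat.zero_le, true_and, pow_zero, sepSum, List.not_mem_nil, false_imp_iff,
      implies_true, if_true, mul_one] at this
    have e : ∀ S : List ℕ, (if ∀ e ∈ S, e ∈ edges s ∩ edges s' then (1 : ℝ) else 0) =
        (if ∀ e ∈ S, e ∈ edges s then (1 : ℝ) else 0) *
          (if ∀ e ∈ S, e ∈ edges s' then 1 else 0) := by
      intro S
      simp only [mem_inter]
      by_cases h1 : ∀ e ∈ S, e ∈ edges s
      · by_cases h2 : ∀ e ∈ S, e ∈ edges s'
        · rw [if_pos h1, if_pos h2, if_pos fun e he => ⟨h1 e he, h2 e he⟩, one_mul]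
        · rw [if_neg h2, if_neg fun h3 => h2 fun e he => (h3 e he).2, mul_zero]
      · rw [if_neg h1, if_neg fun h3 => h1 fun e he => (h3 e he).1, zero_mul]
    simp_rw [e] at this
    simp only [sepSum]
    linarith
  have hswap : ∑ s ∈ G, ∑ s' ∈ G, P s * P s' * (∑ r ∈ range h, B ^ (r + 1) * sepSum h L (r + 1) 0
        (fun S => (if ∀ e ∈ S, e ∈ edges s then (1 : ℝ) else 0) *
          (if ∀ e ∈ S, e ∈ edges s' then 1 else 0))) =
      ∑ r ∈ range h, B ^ (r + 1) * sepSum h L (r + 1) 0 (fun S => W S ^ 2) := by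
    have e1 : ∀ r, sepSum h L (r + 1) 0 (fun S => W S ^ 2) = ∑ s ∈ G, P s * ∑ s' ∈ G, P s' *
        sepSum h L (r + 1) 0 (fun S => (if ∀ e ∈ S, e ∈ edges s then (1 : ℝ) else 0) *
          (if ∀ e ∈ S, e ∈ edges s' then 1 else 0)) := by
      intro r
      have : (fun S => W S ^ 2) = fun S => ∑ s ∈ G, P s * ∑ s' ∈ G, P s' *
          ((if ∀ e ∈ S, e ∈ edges s then (1 : ℝ) else 0) *
          (if ∀ e ∈ S, e ∈ edges s' then 1 else 0)) := by
        funext S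
        simp only [hW]
        rw [sq, sum_mul_sum]
        refine sum_congr rfl fun s _ => ?_
        rw [mul_sum]
        refine sum_congr rfl fun s' _ => ?_
        ring
      rw [this, sepSum_sum_mul]
      refine sum_congr rfl fun s _ => ?_
      rw [sepSum_sum_mul]
    simp_rw [e1, mul_sum]
    rw [sum_congr rfl fun s _ => sum_comm, sum_comm]
    refine sum_congr rfl fun r _ => sum_congr rfl fun s _ => sum_congr rfl fun s' _ => ?_
    ring
  calc ∑ s ∈ G, ∑ s' ∈ G, P s * P s' *
        (C ^ ((edges s ∩ edges s').filter fun e => e < h).card - 1)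
      ≤ ∑ s ∈ G, ∑ s' ∈ G, P s * P s' * (∑ r ∈ range h, B ^ (r + 1) * sepSum h L (r + 1) 0
        (fun S => (if ∀ e ∈ S, e ∈ edges s then (1 : ℝ) else 0) *
          (if ∀ e ∈ S, e ∈ edges s' then 1 else 0))) :=
        sum_le_sum fun s _ => sum_le_sum fun s' _ =>
          mul_le_mul_of_nonneg_left (hstep s s') (mul_nonneg (hP0 s) (hP0 s'))
    _ = ∑ r ∈ range h, B ^ (r + 1) * sepSum h L (r + 1) 0 (fun S => W S ^ 2) := hswap
    _ ≤ ∑ r ∈ range h, B ^ (r + 1) *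
          ((Real.exp 1 / √ρ) ^ 2 * ((L + 1) ^ 4 * η) ^ (r + 1)) := by
        refine sum_le_sum fun r _ => mul_le_mul_of_nonneg_left ?_ (by positivity)
        refine le_trans ?_ (mul_le_mul_of_nonneg_left
          (sepSum_chainBound_sq_le hlam (h := h) hη (r + 1) 0 0 0) (sq_nonneg _))
        rw [← sepSum_const_mul]
        refine sepSum_le_sepSum fun S hS => ?_
        rw [← mul_pow]
        refine pow_le_pow_left₀ ?_
          (sum_sortedMass_subset_edges_le hN hT hq hq1 hsum hρ hρ' hG hGL hGh hS) 2
        refine sum_nonneg fun s _ => mul_nonneg (hP0 s) ?_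
        split_ifs <;> norm_num
    _ = Real.exp 1 ^ 2 / ρ * ∑ r ∈ range h, (B * ((L + 1) ^ 4 * η)) ^ (r + 1) := by
        rw [mul_sum]
        refine sum_congr rfl fun r _ => ?_
        rw [div_pow, Real.sq_sqrt hρ.le, mul_pow B]
        ring
    _ ≤ Real.exp 1 ^ 2 / ρ * (B * ((L + 1) ^ 4 * η) * 2) := by
        refine mul_le_mul_of_nonneg_left ?_ (by positivity)
        have hz : 0 ≤ B * ((L + 1) ^ 4 * η) := by positivity
        calc ∑ r ∈ range h, (B * ((L + 1) ^ 4 * η)) ^ (r + 1)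
            ≤ ∑ r ∈ range h, B * ((L + 1) ^ 4 * η) * (1 / 2) ^ r := by
              refine sum_le_sum fun r _ => ?_
              rw [pow_succ']
              exact mul_le_mul_of_nonneg_left (pow_le_pow_left₀ hz hζ r) hz
          _ ≤ _ := by
              rw [← mul_sum]
              exact mul_le_mul_of_nonneg_left (sum_geometric_two_le h) hz
    _ = _ := by ring

/-! ### Reversal and the upper bound for general labels -/

/-- Reading a sorted sequence from the other end, with the order of the labels reversed. -/
def revSeq {N T : ℕ} (s : Fin N → Fin T) : Fin N → Fin T := fun i => Fin.rev (s (Fin.rev i))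

theorem revSeq_revSeq {N T : ℕ} (s : Fin N → Fin T) : revSeq (revSeq s) = s := by
  funext i; simp [revSeq]

theorem revSeq_mono {N T : ℕ} {s : Fin N → Fin T} (hs : Monotone s) : Monotone (revSeq s) := by
  intro i j hij
  exact Fin.rev_le_rev.mpr (hs (Fin.rev_le_rev.mpr hij))

theorem cellCount_revSeq {N T : ℕ} (s : Fin N → Fin T) (x : Fin T) :
    cellCount (revSeq s) x = cellCount s (Fin.rev x) := by
  apply Fin.ext
  simp only [cellCount]
  refine card_bij (fun i _ => Fin.rev i) ?_ ?_ ?_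
  · intro i hi
    rw [mem_filter] at hi ⊢
    refine ⟨mem_univ _, ?_⟩
    rw [← hi.2, revSeq, Fin.rev_rev]
  · intro a _ b _ hab
    exact Fin.rev_injective hab
  · intro b hb
    refine ⟨Fin.rev b, ?_, Fin.rev_rev b⟩
    rw [mem_filter] at hb ⊢
    refine ⟨mem_univ _, ?_⟩
    rw [revSeq, Fin.rev_rev, hb.2, Fin.rev_rev]

theorem mem_edges_revSeq {N T : ℕ} {s : Fin N → Fin T} {e : ℕ} (he : e ∈ edges s) :
    e + 2 ≤ N ∧ N - 2 - e ∈ edges (revSeq s) := by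
  obtain ⟨i, j, rfl, hj, hij⟩ := mem_edges.mp he
  have := j.2
  refine ⟨by omega, mem_edges.mpr ⟨Fin.rev j, Fin.rev i, ?_, ?_, ?_⟩⟩
  · rw [Fin.val_rev]; omega
  · rw [Fin.val_rev]; omega
  · simp [revSeq, hij]

theorem card_inter_edges_revSeq {N T h : ℕ} (s s' : Fin N → Fin T) :
    ((edges s ∩ edges s').filter fun e => ¬ e < h).card ≤
      ((edges (revSeq s) ∩ edges (revSeq s')).filter fun e => e < N - 1 - h).card := by
  refine card_le_card_of_injOn (fun e => N - 2 - e) ?_ ?_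
  · intro e he
    rw [mem_coe, mem_filter, mem_inter] at he
    obtain ⟨⟨h1, h2⟩, h3⟩ := he
    obtain ⟨h4, h5⟩ := mem_edges_revSeq h1
    rw [mem_coe, mem_filter, mem_inter]
    exact ⟨⟨h5, (mem_edges_revSeq h2).2⟩, by dsimp only; omega⟩
  · intro a ha b hb hab
    rw [mem_coe, mem_filter, mem_inter] at ha hb
    have h1 := (mem_edges_revSeq ha.1.1).1
    have h2 := (mem_edges_revSeq hb.1.1).1
    simp only at hab
    omega

theorem sortedMass_revSeq {N T : ℕ} (hN : 1 ≤ N) {s : Fin N → Fin T} (hs : Monotone s)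
    {q q' : ℕ → ℝ} (hq : ∀ x < T, q' x = q (T - 1 - x)) :
    sortedMass (fun x : Fin T => q' x) (revSeq s) = sortedMass (fun x : Fin T => q x) s := by
  rw [sortedMass_eq hN hs, sortedMass_eq hN (revSeq_mono hs)]
  congr 1
  rw [← Equiv.prod_comp Fin.revPerm]
  refine prod_congr rfl fun x _ => ?_
  rw [cellCount_revSeq, Fin.revPerm_apply, Fin.rev_rev, hq _ (Fin.rev x).2]
  congr 4
  rw [Fin.val_rev]
  have := x.2
  omega

open Classical in
/-- The sorted sequences with at most `L` elements in every cell, the first `h` elements in cells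
below `T₁` and those after position `h` in cells from `T₂` on. -/
noncomputable def goodSeqs (N T L h T₁ T₂ : ℕ) : Finset (Fin N → Fin T) :=
  (sortedSeqs N T).filter fun s => (∀ x, (cellCount s x : ℕ) ≤ L) ∧
    (∀ i : Fin N, (i : ℕ) < h → (s i : ℕ) < T₁) ∧ ∀ i : Fin N, h < (i : ℕ) → T₂ ≤ (s i : ℕ)

/-- The Poisson comparison needs mass `ρ` outside the cells being followed, so it cannot reach the
far end of the deck. Edges before `h` are followed from the left, the others from the right after
reversal. -/
theorem sum_abs_sortLaw_sub_le_of_good {N T L h T₁ T₂ : ℕ} {q q' : ℕ → ℝ} {ρ η β : ℝ} (hN : 1 ≤ N)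
    (hL : 1 ≤ L) (hT₁ : T₁ ≤ T) (hT₂ : T₂ ≤ T) (hq : ∀ x, 0 ≤ q x) (hq1 : ∀ x, N * q x ≤ 1)
    (hq0 : ∀ x, 0 ≤ q' x) (hq1' : ∀ x, N * q' x ≤ 1)
    (hsum : ∑ x ∈ range T, q x = 1) (hqq : ∀ x < T, q' x = q (T - 1 - x))
    (hρ : 0 < ρ) (hρ₁ : ρ ≤ ∑ x ∈ Ico T₁ T, q x) (hρ₂ : ρ ≤ ∑ x ∈ range T₂, q x)
    (hη : ∀ y D, ∑ d ∈ range D, (∑ x ∈ Ico y T₁,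
      pois (∑ z ∈ Ico y x, N * q z) d * (N * q x) ^ 2) ^ 2 ≤ η)
    (hη' : ∀ y D, ∑ d ∈ range D, (∑ x ∈ Ico y (T - T₂),
      pois (∑ z ∈ Ico y x, N * q' z) d * (N * q' x) ^ 2) ^ 2 ≤ η)
    (hζ : ((L : ℝ) ^ 2) ^ (L + 1) * ((L + 1) ^ 4 * η) ≤ 1 / 2)
    (hβ : ∑ s ∈ sortedSeqs N T \ goodSeqs N T L h T₁ T₂,
      sortedMass (fun x : Fin T => q x) s ≤ β) :
    ∑ π : Equiv.Perm (Fin N), |sortLaw (fun x : Fin T => q x) N π - 1 / (N.factorial : ℝ)| ≤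
      √(2 * Real.exp 1 ^ 2 / ρ * (((L : ℝ) ^ 2) ^ (L + 1) * ((L + 1) ^ 4 * η)) + β ^ 2) + β := by
  classical
  set G := goodSeqs N T L h T₁ T₂ with hGdef
  have hL1 : (1 : ℝ) ≤ L := by exact_mod_cast hL
  have hC : (1 : ℝ) ≤ (L : ℝ) ^ 2 := one_le_pow₀ hL1
  have hG : G ⊆ sortedSeqs N T := filter_subset _ _
  have hmem : ∀ s ∈ G, Monotone s ∧ (∀ x, (cellCount s x : ℕ) ≤ L) ∧
      (∀ i : Fin N, (i : ℕ) < h → (s i : ℕ) < T₁) ∧ ∀ i : Fin N, h < (i : ℕ) → T₂ ≤ (s i : ℕ) :=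
    fun s hs => ⟨mem_sortedSeqs.mp (hG hs), (mem_filter.mp hs).2⟩
  set P : (Fin N → Fin T) → ℝ := sortedMass (fun x : Fin T => q x) with hP
  have hP0 : ∀ s, 0 ≤ P s := fun s => sortedMass_nonneg (fun x => hq x) s
  have hleft := sum_pow_inter_sub_one_le hN hT₁ hq hq1 hsum hρ hρ₁ hG
    (fun s hs => (hmem s hs).2.1) (fun s hs => (hmem s hs).2.2.1) hC hη hζ
  have hsum' : ∑ x ∈ range T, q' x = 1 := by
    rw [← hsum, ← sum_range_reflect]
    exact sum_congr rfl fun x hx => by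
      rw [hqq _ (by have := mem_range.mp hx; omega)]
      congr 1
      have := mem_range.mp hx
      omega
  have hρ₂' : ρ ≤ ∑ x ∈ Ico (T - T₂) T, q' x := by
    refine hρ₂.trans (le_of_eq ?_)
    symm
    refine sum_nbij' (fun x => T - 1 - x) (fun x => T - 1 - x) ?_ ?_ ?_ ?_ ?_
    · intro x hx; rw [mem_Ico] at hx; rw [mem_range]; omega
    · intro x hx; rw [mem_range] at hx; rw [mem_Ico]; omega
    · intro x hx; rw [mem_Ico] at hx; omega
    · intro x hx; rw [mem_range] at hx; omega
    · intro x hx; rw [mem_Ico] at hx; exact hqq x (by omega)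
  have hinj : Set.InjOn (revSeq (N := N) (T := T)) (G : Set (Fin N → Fin T)) :=
    fun a _ b _ hab => by rw [← revSeq_revSeq a, hab, revSeq_revSeq]
  have hright := sum_pow_inter_sub_one_le (T₁ := T - T₂) (h := N - 1 - h) (L := L)
    (G := G.image revSeq) (ρ := ρ) (C := (L : ℝ) ^ 2) hN (Nat.sub_le T T₂) hq0 hq1' hsum' hρ hρ₂'
    (by
      intro s hs
      obtain ⟨a, ha, rfl⟩ := mem_image.mp hs
      exact mem_sortedSeqs.mpr (revSeq_mono (hmem a ha).1))
    (by
      intro s hs x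
      obtain ⟨a, ha, rfl⟩ := mem_image.mp hs
      rw [cellCount_revSeq]
      exact (hmem a ha).2.1 _)
    (by
      intro s hs i hi
      obtain ⟨a, ha, rfl⟩ := mem_image.mp hs
      have h1 := (hmem a ha).2.2.2 (Fin.rev i) (by rw [Fin.val_rev]; omega)
      have h2 := (a (Fin.rev i)).2
      rw [revSeq, Fin.val_rev]
      omega)
    hC hη' hζ
  rw [sum_image hinj] at hright
  have hright' : ∑ s ∈ G, ∑ s' ∈ G, P s * P s' *
      (((L : ℝ) ^ 2) ^ ((edges s ∩ edges s').filter fun e => ¬ e < h).card - 1) ≤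
      2 * Real.exp 1 ^ 2 / ρ * (((L : ℝ) ^ 2) ^ (L + 1) * ((L + 1) ^ 4 * η)) := by
    refine le_trans (sum_le_sum fun s hs => ?_) hright
    rw [sum_image hinj]
    refine sum_le_sum fun s' hs' => ?_
    rw [sortedMass_revSeq hN (hmem s hs).1 hqq, sortedMass_revSeq hN (hmem s' hs').1 hqq]
    refine mul_le_mul_of_nonneg_left ?_ (mul_nonneg (hP0 s) (hP0 s'))
    exact sub_le_sub_right (pow_le_pow_right₀ hC (card_inter_edges_revSeq s s')) 1
  refine sum_abs_sortLaw_sub_le (fun x => hq x) ?_ hL hG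
    (fun s hs => runLen_edges_le_cellCount (hmem s hs).1 (hmem s hs).2.1) hβ ?_
  · rw [← hsum, Finset.sum_range]
  · calc ∑ s ∈ G, ∑ s' ∈ G, P s * P s' * ((L : ℝ) ^ (edges s ∩ edges s').card - 1)
        ≤ ∑ s ∈ G, ∑ s' ∈ G, (1 / 2 * (P s * P s' *
            (((L : ℝ) ^ 2) ^ ((edges s ∩ edges s').filter fun e => e < h).card - 1)) +
            1 / 2 * (P s * P s' *
            (((L : ℝ) ^ 2) ^ ((edges s ∩ edges s').filter fun e => ¬ e < h).card - 1))) := by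
          refine sum_le_sum fun s _ => sum_le_sum fun s' _ => ?_
          -- With `a` and `b` the powers of `L` for the two halves, `a b - 1 ≤ (a² - 1) / 2 + (b² -
          -- 1) / 2`; this decoupling is why the base is `L ^ 2`.
          rw [← card_filter_add_card_filter_not (fun e => e < h) (s := edges s ∩ edges s'), pow_add,
            ← pow_mul, ← pow_mul, mul_comm 2, mul_comm 2, pow_mul, pow_mul]
          set a := (L : ℝ) ^ ((edges s ∩ edges s').filter fun e => e < h).card
          set b := (L : ℝ) ^ ((edges s ∩ edges s').filter fun e => ¬ e < h).card
          have : 0 ≤ P s * P s' := mul_nonneg (hP0 s) (hP0 s')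
          nlinarith [mul_nonneg this (sq_nonneg (a - b))]
      _ ≤ _ := by
          simp_rw [sum_add_distrib, ← mul_sum]
          linarith

/-! ### Independent labels -/

/-- The expectation of a function of `N` independent labels with law `q`. -/
noncomputable def expect {T : ℕ} (q : Fin T → ℝ) (N : ℕ) (F : (Fin N → Fin T) → ℝ) : ℝ :=
  ∑ u, (∏ i, q (u i)) * F u

theorem expect_mono {N T : ℕ} {q : Fin T → ℝ} (hq : ∀ x, 0 ≤ q x) {F G : (Fin N → Fin T) → ℝ}
    (h : ∀ u, F u ≤ G u) : expect q N F ≤ expect q N G :=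
  sum_le_sum fun u _ => mul_le_mul_of_nonneg_left (h u) (prod_nonneg fun _ _ => hq _)

theorem expect_add {N T : ℕ} (q : Fin T → ℝ) (F G : (Fin N → Fin T) → ℝ) :
    expect q N (fun u => F u + G u) = expect q N F + expect q N G := by
  simp only [expect, mul_add, sum_add_distrib]

theorem expect_const_mul {N T : ℕ} (q : Fin T → ℝ) (c : ℝ) (F : (Fin N → Fin T) → ℝ) :
    expect q N (fun u => c * F u) = c * expect q N F := by
  simp only [expect, mul_sum]
  exact sum_congr rfl fun u _ => by ring

theorem expect_sum {N T : ℕ} {ι : Type*} (q : Fin T → ℝ) (I : Finset ι)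
    (F : ι → (Fin N → Fin T) → ℝ) :
    expect q N (fun u => ∑ i ∈ I, F i u) = ∑ i ∈ I, expect q N (F i) := by
  simp only [expect, mul_sum]
  rw [sum_comm]

theorem expect_prod {N T : ℕ} (q : Fin T → ℝ) (f : Fin N → Fin T → ℝ) :
    expect q N (fun u => ∏ i, f i (u i)) = ∏ i, ∑ x, q x * f i x := by
  rw [prod_univ_sum, Fintype.piFinset_univ, expect]
  exact sum_congr rfl fun u _ => prod_mul_distrib.symm

theorem expect_one {N T : ℕ} {q : Fin T → ℝ} (hq : ∑ x, q x = 1) :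
    expect q N (fun _ => 1) = 1 := by
  have := expect_prod (N := N) q (fun _ _ => 1)
  simpa [hq] using this

/-- Labels prescribed at the indices of `I`. -/
theorem expect_prod_ite {N T : ℕ} {q : Fin T → ℝ} (hq : ∑ x, q x = 1) (I : Finset (Fin N))
    (c : Fin N → Fin T) :
    expect q N (fun u => ∏ i ∈ I, if u i = c i then 1 else 0) = ∏ i ∈ I, q (c i) := by
  have h := expect_prod (N := N) q (fun i x => if i ∈ I then (if x = c i then 1 else 0) else 1)
  have e1 : ∀ u : Fin N → Fin T, (∏ i, if i ∈ I then (if u i = c i then (1 : ℝ) else 0) else 1) =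
      ∏ i ∈ I, if u i = c i then 1 else 0 := by
    intro u
    rw [prod_ite_mem, univ_inter]
  have e2 : ∀ i, (∑ x, q x * if i ∈ I then (if x = c i then (1 : ℝ) else 0) else 1) =
      if i ∈ I then q (c i) else 1 := by
    intro i
    split_ifs <;> simp [hq]
  simp_rw [e1, e2] at h
  rw [h, prod_ite_mem, univ_inter]

open Classical in
theorem expect_le_exp {N T : ℕ} {q : Fin T → ℝ} (hq : ∀ x, 0 ≤ q x) (hq1 : ∑ x, q x = 1)
    (F : Finset (Fin T)) {a : ℝ} (ha : 0 ≤ a) (haN : a ≤ 2 * N) :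
    expect q N (fun u => if N * (∑ x ∈ F, q x) + a ≤ (univ.filter fun i => u i ∈ F).card
      then 1 else 0) ≤ Real.exp (-(a ^ 2 / (4 * N))) := by
  rcases Nat.eq_zero_or_pos N with hN | hN
  · subst hN
    have : a = 0 := le_antisymm (by simpa using haN) ha
    subst this
    have h1 := expect_one (N := 0) hq1
    refine (expect_mono hq (G := fun _ => 1) fun u => by split_ifs <;> norm_num).trans ?_
    rw [h1]; simp
  have hN0 : (0 : ℝ) < N := by exact_mod_cast hN
  set Q := ∑ x ∈ F, q x with hQ
  have hQ0 : 0 ≤ Q := sum_nonneg fun x _ => hq x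
  have hQ1 : Q ≤ 1 := by
    rw [← hq1]; exact sum_le_sum_of_subset_of_nonneg (subset_univ _) fun x _ _ => hq x
  -- The minimiser of the Chernoff exponent `-t a + N t²`; the assumption `a ≤ 2 N` keeps `t ≤ 1`,
  -- where `exp t ≤ 1 + t + t²`.
  set t := a / (2 * N) with ht
  have ht0 : 0 ≤ t := by positivity
  have ht1 : t ≤ 1 := by rw [ht, div_le_one (by positivity)]; exact haN
  have hmgf : expect q N (fun u => Real.exp (t * (univ.filter fun i => u i ∈ F).card)) ≤
      Real.exp (N * (Q * t + Q * t ^ 2)) := by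
    have h := expect_prod (N := N) q (fun _ x => Real.exp (if x ∈ F then t else 0))
    have e1 : ∀ u : Fin N → Fin T, ∏ i, Real.exp (if u i ∈ F then t else 0) =
        Real.exp (t * (univ.filter fun i => u i ∈ F).card) := by
      intro u
      rw [← Real.exp_sum, ← sum_filter, sum_const, nsmul_eq_mul, mul_comm]
    simp_rw [e1] at h
    rw [h, prod_const, card_univ, Fintype.card_fin, Real.exp_nat_mul]
    refine pow_le_pow_left₀ (sum_nonneg fun x _ => mul_nonneg (hq x) (Real.exp_pos _).le) ?_ N
    have e2 : ∑ x, q x * Real.exp (if x ∈ F then t else 0) = 1 + Q * (Real.exp t - 1) := by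
      have : ∀ x, q x * Real.exp (if x ∈ F then t else 0) =
          q x + (if x ∈ F then q x * (Real.exp t - 1) else 0) := by
        intro x
        split_ifs
        · ring
        · simp
      simp_rw [this]
      rw [sum_add_distrib, hq1, sum_ite_mem, univ_inter, ← sum_mul]
    rw [e2]
    have e3 : Real.exp t - 1 ≤ t + t ^ 2 := by
      have := Real.abs_exp_sub_one_sub_id_le (x := t) (by rw [abs_of_nonneg ht0]; exact ht1)
      have := (abs_le.mp this).2
      linarith
    have e4 := Real.add_one_le_exp (Q * t + Q * t ^ 2)
    nlinarith
  have hmark : expect q N (fun u => if N * Q + a ≤ (univ.filter fun i => u i ∈ F).card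
      then 1 else 0) ≤ expect q N (fun u => Real.exp (-(t * (N * Q + a))) *
        Real.exp (t * (univ.filter fun i => u i ∈ F).card)) := by
    refine expect_mono hq fun u => ?_
    split_ifs with h
    · rw [← Real.exp_add]
      apply Real.one_le_exp
      nlinarith
    · positivity
  rw [expect_const_mul] at hmark
  refine hmark.trans ((mul_le_mul_of_nonneg_left hmgf (Real.exp_pos _).le).trans ?_)
  rw [← Real.exp_add]
  apply Real.exp_le_exp.mpr
  have h1 : N * t ^ 2 * Q ≤ N * t ^ 2 := by
    have : 0 ≤ N * t ^ 2 := by positivity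
    nlinarith
  have h2 : -(t * a) + N * t ^ 2 = -(a ^ 2 / (4 * N)) := by
    rw [ht]; field_simp; ring
  nlinarith

-- A cell with at least `M` cards contains at least `M.choose r` sets of `r` cards with equal
-- labels, and the expected number of such sets is at most the right side.
open Classical in
theorem expect_exists_le {N T M r : ℕ} {q : Fin T → ℝ} (hq : ∀ x, 0 ≤ q x) (hq1 : ∑ x, q x = 1) :
    (M.choose r : ℝ) * expect q N (fun u => if ∃ x, M ≤ (cellCount u x : ℕ) then 1 else 0) ≤
      (N : ℝ) ^ r * ∑ x, q x ^ r := by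
  rw [← expect_const_mul]
  have h1 : ∀ u : Fin N → Fin T, (M.choose r : ℝ) *
      (if ∃ x, M ≤ (cellCount u x : ℕ) then 1 else 0) ≤
      ∑ x, ∑ I ∈ powersetCard r (univ : Finset (Fin N)), ∏ i ∈ I, if u i = x then (1 : ℝ) else 0 := by
    intro u
    have hnn : ∀ x : Fin T, 0 ≤ ∑ I ∈ powersetCard r (univ : Finset (Fin N)),
        ∏ i ∈ I, (if u i = x then (1 : ℝ) else 0) := fun x =>
      sum_nonneg fun I _ => prod_nonneg fun i _ => by split_ifs <;> norm_num
    split_ifs with h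
    · obtain ⟨x, hx⟩ := h
      refine le_trans ?_ (single_le_sum (fun x _ => hnn x) (mem_univ x))
      rw [mul_one]
      have h2 : ∀ I : Finset (Fin N), ∏ i ∈ I, (if u i = x then (1 : ℝ) else 0) =
          if I ⊆ univ.filter (fun i => u i = x) then 1 else 0 := by
        intro I
        rw [prod_ite_zero]
        simp only [prod_const_one]
        refine if_congr ?_ rfl rfl
        simp [subset_iff]
      simp_rw [h2]
      rw [sum_boole]
      have h3 : (powersetCard r (univ : Finset (Fin N))).filter
          (fun I => I ⊆ univ.filter (fun i => u i = x)) =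
          powersetCard r (univ.filter (fun i => u i = x)) := by
        ext I
        simp only [mem_filter, mem_powersetCard, subset_univ, true_and]
        tauto
      rw [h3, card_powersetCard]
      exact_mod_cast Nat.choose_le_choose r hx
    · rw [mul_zero]
      exact sum_nonneg fun x _ => hnn x
  refine (expect_mono hq h1).trans ?_
  rw [expect_sum, mul_sum]
  refine sum_le_sum fun x _ => ?_
  rw [expect_sum]
  have h4 : ∀ I ∈ powersetCard r (univ : Finset (Fin N)),
      expect q N (fun u => ∏ i ∈ I, if u i = x then (1 : ℝ) else 0) = q x ^ r := by
    intro I hI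
    rw [expect_prod_ite hq1 I (fun _ => x), prod_const, (mem_powersetCard.mp hI).2]
  rw [sum_congr rfl h4, sum_const, card_powersetCard, card_univ, Fintype.card_fin, nsmul_eq_mul]
  refine mul_le_mul_of_nonneg_right ?_ (pow_nonneg (hq x) r)
  exact_mod_cast Nat.choose_le_pow N r

theorem cellCount_comp_perm {N T : ℕ} (u : Fin N → Fin T) (π : Equiv.Perm (Fin N)) (x : Fin T) :
    cellCount (u ∘ π) x = cellCount u x := by
  apply Fin.ext
  simp only [cellCount]
  refine card_bij (fun i _ => π i) ?_ ?_ ?_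
  · intro i hi
    rw [mem_filter] at hi ⊢
    exact ⟨mem_univ _, hi.2⟩
  · intro a _ b _ hab
    exact π.injective hab
  · intro b hb
    refine ⟨π.symm b, ?_, by simp⟩
    rw [mem_filter] at hb ⊢
    exact ⟨mem_univ _, by simpa using hb.2⟩

theorem card_filter_comp_perm {N T : ℕ} (u : Fin N → Fin T) (π : Equiv.Perm (Fin N))
    (p : Fin T → Prop) [DecidablePred p] :
    (univ.filter fun i => p ((u ∘ π) i)).card = (univ.filter fun i => p (u i)).card := by
  refine card_bij (fun i _ => π i) ?_ ?_ ?_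
  · intro i hi
    rw [mem_filter] at hi ⊢
    exact ⟨mem_univ _, hi.2⟩
  · intro a _ b _ hab
    exact π.injective hab
  · intro b hb
    refine ⟨π.symm b, ?_, by simp⟩
    rw [mem_filter] at hb ⊢
    exact ⟨mem_univ _, by simpa using hb.2⟩

theorem sum_sortedMass_mul_eq_expect {N T : ℕ} (q : Fin T → ℝ) (F : (Fin N → Fin T) → ℝ) :
    ∑ s ∈ sortedSeqs N T, sortedMass q s * F s = expect q N (fun u => F (u ∘ Tuple.sort u)) :=
  sum_sortedMass_mul q F

-- After sorting, the position conditions are conditions on how many labels fall below `T₁` and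
-- below `T₂`. Each of these fails by a deviation of `a`; a crowded cell is excluded by a first
-- moment over sets of `L + 1` cards.
open Classical in
theorem sum_sdiff_goodSeqs_le {N T L h T₁ T₂ : ℕ} {q : ℕ → ℝ} (hq : ∀ x, 0 ≤ q x)
    (hq1 : ∑ x ∈ range T, q x = 1) (hT₁ : T₁ ≤ T) (hT₂ : T₂ ≤ T) {a : ℝ} (ha : 0 ≤ a)
    (haN : a ≤ 2 * N) (h₁ : h + a ≤ N * ∑ x ∈ range T₁, q x)
    (h₂ : N * ∑ x ∈ range T₂, q x + a ≤ h) :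
    ∑ s ∈ sortedSeqs N T \ goodSeqs N T L h T₁ T₂, sortedMass (fun x : Fin T => q x) s ≤
      (N : ℝ) ^ (L + 1) * ∑ x ∈ range T, q x ^ (L + 1) + 2 * Real.exp (-(a ^ 2 / (4 * N))) := by
  set qT : Fin T → ℝ := fun x => q x with hqT
  have hqT0 : ∀ x, 0 ≤ qT x := fun x => hq x
  have hqT1 : ∑ x, qT x = 1 := by rw [← hq1, Finset.sum_range]
  have hsumF : ∀ T' ≤ T, ∑ x ∈ univ.filter (fun x : Fin T => (x : ℕ) < T'), qT x =
      ∑ x ∈ range T', q x := by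
    intro T' hT'
    rw [sum_filter, Fin.sum_univ_eq_sum_range (fun x => if x < T' then q x else 0) T, ← sum_filter]
    congr 1
    ext x; simp only [mem_filter, mem_range]; omega
  set F₁ : Finset (Fin T) := univ.filter fun x : Fin T => ¬ (x : ℕ) < T₁ with hF₁
  set F₂ : Finset (Fin T) := univ.filter fun x : Fin T => (x : ℕ) < T₂ with hF₂
  have hQ₁ : ∑ x ∈ F₁, qT x = 1 - ∑ x ∈ range T₁, q x := by
    rw [← hsumF T₁ hT₁, ← hqT1, ← sum_filter_add_sum_filter_not univ (fun x : Fin T => (x : ℕ) < T₁)]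
    ring
  have hQ₂ : ∑ x ∈ F₂, qT x = ∑ x ∈ range T₂, q x := hsumF T₂ hT₂
  have e1 := expect_le_exp (N := N) hqT0 hqT1 F₁ ha haN
  have e2 := expect_le_exp (N := N) hqT0 hqT1 F₂ ha haN
  have e3 := expect_exists_le (N := N) (M := L + 1) (r := L + 1) hqT0 hqT1
  rw [Nat.choose_self, Nat.cast_one, one_mul] at e3
  have hsum3 : ∑ x, qT x ^ (L + 1) = ∑ x ∈ range T, q x ^ (L + 1) :=
    (Finset.sum_range fun x => q x ^ (L + 1)).symm
  rw [hsum3] at e3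
  have hlhs : ∑ s ∈ sortedSeqs N T \ goodSeqs N T L h T₁ T₂, sortedMass qT s =
      ∑ s ∈ sortedSeqs N T, sortedMass qT s * (if s ∈ goodSeqs N T L h T₁ T₂ then 0 else 1) := by
    rw [sdiff_eq_filter, sum_filter]
    refine sum_congr rfl fun s _ => ?_
    split_ifs <;> simp
  rw [hlhs, sum_sortedMass_mul_eq_expect]
  refine le_trans ?_ (add_le_add e3 ((add_le_add e1 e2).trans (two_mul _).ge))
  rw [← expect_add, ← expect_add]
  refine expect_mono hqT0 fun u => ?_
  have n1 : ∀ (P : Prop) [Decidable P], (0 : ℝ) ≤ if P then 1 else 0 := fun P _ => by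
    split_ifs <;> norm_num
  by_cases c1 : ∃ x, L + 1 ≤ (cellCount u x : ℕ)
  · rw [if_pos c1]
    have : (if u ∘ Tuple.sort u ∈ goodSeqs N T L h T₁ T₂ then (0 : ℝ) else 1) ≤ 1 := by
      split_ifs <;> norm_num
    exact this.trans (le_add_of_nonneg_right (add_nonneg (n1 _) (n1 _)))
  by_cases c2 : N * (∑ x ∈ F₁, qT x) + a ≤ (univ.filter fun i => u i ∈ F₁).card
  · rw [if_pos c2]
    have : (if u ∘ Tuple.sort u ∈ goodSeqs N T L h T₁ T₂ then (0 : ℝ) else 1) ≤ 1 := by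
      split_ifs <;> norm_num
    exact this.trans ((le_add_of_nonneg_right (n1 _)).trans (le_add_of_nonneg_left (n1 _)))
  by_cases c3 : N * (∑ x ∈ F₂, qT x) + a ≤ (univ.filter fun i => u i ∈ F₂).card
  · rw [if_pos c3]
    have : (if u ∘ Tuple.sort u ∈ goodSeqs N T L h T₁ T₂ then (0 : ℝ) else 1) ≤ 1 := by
      split_ifs <;> norm_num
    exact this.trans ((le_add_of_nonneg_left (n1 _)).trans (le_add_of_nonneg_left (n1 _)))
  have hgood : u ∘ Tuple.sort u ∈ goodSeqs N T L h T₁ T₂ := by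
    have hm := Tuple.monotone_sort u
    rw [goodSeqs, mem_filter, mem_sortedSeqs]
    refine ⟨hm, ?_, ?_, ?_⟩
    · intro x
      rw [cellCount_comp_perm]
      by_contra hx
      exact c1 ⟨x, by omega⟩
    · intro i hi
      have hcard : h ≤ (univ.filter fun j => ((u ∘ Tuple.sort u) j : ℕ) < T₁).card := by
        rw [card_filter_comp_perm u _ (fun x => (x : ℕ) < T₁)]
        have hc := card_filter_add_card_filter_not (fun j => (u j : ℕ) < T₁)
          (s := (univ : Finset (Fin N)))
        rw [card_univ, Fintype.card_fin] at hc
        have hF : (univ.filter fun i => u i ∈ F₁) = univ.filter fun j => ¬ (u j : ℕ) < T₁ := by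
          ext j; simp [hF₁]
        rw [hF, hQ₁] at c2
        have hc' : ((univ.filter fun j => (u j : ℕ) < T₁).card : ℝ) +
          (univ.filter fun j => ¬ (u j : ℕ) < T₁).card = N := by exact_mod_cast hc
        have : (h : ℝ) ≤ (univ.filter fun j => (u j : ℕ) < T₁).card := by linarith
        exact_mod_cast this
      exact (Fin.lt_card_filter_univ_iff_apply_of_imp (fun j => ((u ∘ Tuple.sort u) j : ℕ) < T₁)
        (by intro a b hab hb
            exact lt_of_le_of_lt (hm hab) hb)).mp (lt_of_lt_of_le hi hcard)
    · intro i hi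
      by_contra hlt
      have h1 := (Fin.lt_card_filter_univ_iff_apply_of_imp (j := i)
        (fun j => ((u ∘ Tuple.sort u) j : ℕ) < T₂)
        (by intro a b hab hb
            exact lt_of_le_of_lt (hm hab) hb)).mpr (not_le.mp hlt)
      rw [card_filter_comp_perm u _ (fun x => (x : ℕ) < T₂)] at h1
      have hF : (univ.filter fun i => u i ∈ F₂) = univ.filter fun j => (u j : ℕ) < T₂ := by
        ext j; simp [hF₂]
      rw [hF, hQ₂] at c3
      have : ((univ.filter fun j => (u j : ℕ) < T₂).card : ℝ) < h := by linarith
      have : (univ.filter fun j => (u j : ℕ) < T₂).card < h := by exact_mod_cast this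
      omega
  rw [if_pos hgood]
  exact add_nonneg (n1 _) (add_nonneg (n1 _) (n1 _))

/-! ### Masses of words and of cylinders -/

section WordMass

variable {k : ℕ} [NeZero k]

theorem wordMass_nonneg {g : Fin k → ℝ} (hg : ∀ i, 0 ≤ g i) (K x : ℕ) : 0 ≤ wordMass g K x := by
  induction K generalizing x with
  | zero => simp [wordMass_zero]
  | succ K ih => rw [wordMass_succ]; exact mul_nonneg (ih _) (hg _)

theorem wordMass_pos {g : Fin k → ℝ} (hg : ∀ i, 0 < g i) (K x : ℕ) : 0 < wordMass g K x := by
  induction K generalizing x with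
  | zero => simp [wordMass_zero]
  | succ K ih => rw [wordMass_succ]; exact mul_pos (ih _) (hg _)

theorem wordMass_le_pow {g : Fin k → ℝ} (hg : ∀ i, 0 ≤ g i) {c : ℝ} (hc : ∀ i, g i ≤ c)
    (K x : ℕ) : wordMass g K x ≤ c ^ K := by
  induction K generalizing x with
  | zero => simp [wordMass_zero]
  | succ K ih =>
    rw [wordMass_succ, pow_succ]
    exact mul_le_mul (ih _) (hc _) (hg _) ((wordMass_nonneg hg K _).trans (ih (x / k)))

/-- Splitting a word into its first `L` and its last `M` letters. -/
theorem wordMass_add (g : Fin k → ℝ) (L M x : ℕ) :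
    wordMass g (L + M) x = wordMass g L (x / k ^ M) * wordMass g M x := by
  induction M generalizing x with
  | zero => simp [wordMass_zero]
  | succ M ih =>
    rw [← add_assoc, wordMass_succ, ih, wordMass_succ, Nat.div_div_eq_div_mul, ← pow_succ']
    ring

theorem ofNat_mul_add (a b : ℕ) : Fin.ofNat k (a * k + b) = Fin.ofNat k b := by
  apply Fin.ext; simp [Fin.ofNat]

theorem wordMass_mul_add (g : Fin k → ℝ) (M v y : ℕ) :
    wordMass g M (v * k ^ M + y) = wordMass g M y := by
  induction M generalizing y with
  | zero => simp [wordMass_zero]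
  | succ M ih =>
    rw [wordMass_succ, wordMass_succ, pow_succ, ← mul_assoc, ofNat_mul_add]
    congr 1
    rw [← ih (y / k)]
    congr 1
    rw [add_comm, Nat.add_mul_div_right _ _ (Nat.pos_of_neZero k), add_comm]

theorem sum_range_mul {f : ℕ → ℝ} (a b : ℕ) :
    ∑ x ∈ range (a * b), f x = ∑ v ∈ range a, ∑ y ∈ range b, f (v * b + y) := by
  induction a with
  | zero => simp
  | succ a ih => rw [Nat.succ_mul, sum_range_add, ih, sum_range_succ]

theorem sum_wordMass (g : Fin k → ℝ) (K : ℕ) :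
    ∑ x ∈ range (k ^ K), wordMass g K x = (∑ i, g i) ^ K := by
  induction K with
  | zero => simp [wordMass_zero]
  | succ K ih =>
    rw [pow_succ, sum_range_mul, pow_succ, ← ih, sum_mul]
    refine sum_congr rfl fun v _ => ?_
    rw [← Fin.sum_univ_eq_sum_range (fun y => wordMass g (K + 1) (v * k + y)), mul_sum]
    refine sum_congr rfl fun i _ => ?_
    rw [wordMass_succ, ofNat_mul_add, mul_comm v k, Nat.mul_add_div (Nat.pos_of_neZero k),
      Nat.div_eq_of_lt i.2, add_zero]
    congr 1
    exact congrArg g (Fin.ext (Nat.mod_eq_of_lt i.2))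

theorem wordMass_rpow {g : Fin k → ℝ} (hg : ∀ i, 0 ≤ g i) (t : ℝ) (K x : ℕ) :
    wordMass (fun i => g i ^ t) K x = wordMass g K x ^ t := by
  induction K generalizing x with
  | zero => simp [wordMass_zero]
  | succ K ih =>
    rw [wordMass_succ, ih, wordMass_succ, Real.mul_rpow (wordMass_nonneg hg _ _) (hg _)]

theorem wordMass_div_const (g : Fin k → ℝ) (c : ℝ) (K x : ℕ) :
    wordMass (fun i => g i / c) K x = wordMass g K x / c ^ K := by
  induction K generalizing x with
  | zero => simp [wordMass_zero]
  | succ K ih =>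
    rw [wordMass_succ, ih, wordMass_succ, pow_succ, div_mul_div_comm]

theorem sum_wordMass_rpow {g : Fin k → ℝ} (hg : ∀ i, 0 ≤ g i) (t : ℝ) (K : ℕ) :
    ∑ x ∈ range (k ^ K), wordMass g K x ^ t = phi g t ^ K := by
  simp_rw [← wordMass_rpow hg]
  exact sum_wordMass _ K

theorem sum_wordMass_pow {g : Fin k → ℝ} (hg : ∀ i, 0 ≤ g i) (r K : ℕ) :
    ∑ x ∈ range (k ^ K), wordMass g K x ^ r = phi g r ^ K := by
  rw [← sum_wordMass_rpow hg]
  exact sum_congr rfl fun x _ => (Real.rpow_natCast _ _).symm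

/-- Subtraction from `k ^ K - 1` complements every base `k` digit, without borrowing. -/
theorem wordMass_rev (g : Fin k → ℝ) {K x : ℕ} (hx : x < k ^ K) :
    wordMass (g ∘ Fin.rev) K x = wordMass g K (k ^ K - 1 - x) := by
  induction K generalizing x with
  | zero => simp [wordMass_zero]
  | succ K ih =>
    have hk := Nat.pos_of_neZero k
    have hxk : x / k < k ^ K := by
      rw [Nat.div_lt_iff_lt_mul hk, ← pow_succ]; exact hx
    have hm := Nat.mod_lt x hk
    have hd := Nat.div_add_mod x k
    have e : k ^ (K + 1) - 1 - x = (k ^ K - 1 - x / k) * k + (k - 1 - x % k) := by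
      obtain ⟨c, hc⟩ := Nat.exists_eq_add_of_lt hxk
      have h1 : k ^ K - 1 - x / k = c := by omega
      have h2 : k ^ (K + 1) = k * (x / k) + c * k + k := by rw [pow_succ, hc]; ring
      rw [h1, h2]
      omega
    rw [wordMass_succ, wordMass_succ, ih hxk, e, ofNat_mul_add]
    congr 1
    · congr 1
      rw [mul_comm, Nat.mul_add_div hk, Nat.div_eq_of_lt (by omega : k - 1 - x % k < k), add_zero]
    · refine congrArg g (Fin.ext ?_)
      simp only [Fin.val_rev, Fin.ofNat]
      rw [Nat.mod_eq_of_lt (by omega : k - 1 - x % k < k)]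
      omega

/-- The words with a given prefix form an interval. -/
theorem filter_div_eq {K M v : ℕ} (hM : M ≤ K) (hv : v < k ^ M) :
    (range (k ^ K)).filter (fun z => z / k ^ (K - M) = v) =
      (range (k ^ (K - M))).image (fun y => v * k ^ (K - M) + y) := by
  have hpos : 0 < k ^ (K - M) := pow_pos (Nat.pos_of_neZero k) _
  ext z
  simp only [mem_filter, mem_range, mem_image]
  constructor
  · rintro ⟨_, rfl⟩
    exact ⟨z % k ^ (K - M), Nat.mod_lt _ hpos, by rw [mul_comm]; exact Nat.div_add_mod _ _⟩
  · rintro ⟨y, hy, rfl⟩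
    constructor
    · calc v * k ^ (K - M) + y < v * k ^ (K - M) + k ^ (K - M) := by omega
        _ = (v + 1) * k ^ (K - M) := by ring
        _ ≤ k ^ M * k ^ (K - M) := Nat.mul_le_mul_right _ hv
        _ = k ^ K := by rw [← pow_add, Nat.add_sub_cancel' hM]
    · rw [mul_comm, Nat.mul_add_div hpos, Nat.div_eq_of_lt hy, add_zero]

theorem sum_cylinder (g : Fin k → ℝ) {K M v : ℕ} (hM : M ≤ K) (hv : v < k ^ M) :
    ∑ z ∈ (range (k ^ K)).filter (fun z => z / k ^ (K - M) = v), wordMass g K z =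
      wordMass g M v * (∑ i, g i) ^ (K - M) := by
  have hpos : 0 < k ^ (K - M) := pow_pos (Nat.pos_of_neZero k) _
  rw [filter_div_eq hM hv, sum_image (by intro a _ b _ h; simpa using h), ← sum_wordMass, mul_sum]
  refine sum_congr rfl fun y hy => ?_
  have h := wordMass_add g M (K - M) (v * k ^ (K - M) + y)
  rwa [Nat.add_sub_cancel' hM, wordMass_mul_add, mul_comm v, Nat.mul_add_div hpos,
    Nat.div_eq_of_lt (mem_range.mp hy), add_zero, mul_comm _ v] at h

/-! ### Stopping prefixes -/

/-- The length of the shortest prefix of the word `x` whose mass is at most `τ`. -/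
noncomputable def stopDepth (p : Fin k → ℝ) (K : ℕ) (τ : ℝ) (x : ℕ) : ℕ :=
  sInf {m | wordMass p m (x / k ^ (K - m)) ≤ τ ∨ K ≤ m}

/-- The shortest prefix of mass at most `τ`, with its length. -/
noncomputable def stopPrefix (p : Fin k → ℝ) (K : ℕ) (τ : ℝ) (x : ℕ) : ℕ × ℕ :=
  (stopDepth p K τ x, x / k ^ (K - stopDepth p K τ x))

variable {p : Fin k → ℝ} {K : ℕ} {τ : ℝ}

theorem stopDepth_spec (p : Fin k → ℝ) (K : ℕ) (τ : ℝ) (x : ℕ) :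
    wordMass p (stopDepth p K τ x) (x / k ^ (K - stopDepth p K τ x)) ≤ τ ∨
      K ≤ stopDepth p K τ x :=
  Nat.sInf_mem (s := {m | wordMass p m (x / k ^ (K - m)) ≤ τ ∨ K ≤ m}) ⟨K, Or.inr le_rfl⟩

theorem stopDepth_le (p : Fin k → ℝ) (K : ℕ) (τ : ℝ) (x : ℕ) : stopDepth p K τ x ≤ K :=
  Nat.sInf_le (Or.inr le_rfl)

theorem lt_wordMass_of_lt_stopDepth {x m : ℕ} (h : m < stopDepth p K τ x) :
    τ < wordMass p m (x / k ^ (K - m)) := by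
  have := Nat.notMem_of_lt_sInf h
  rw [Set.mem_ofPred_eq, not_or] at this
  exact not_le.mp this.1

theorem wordMass_stopDepth_le {x : ℕ} (hx : wordMass p K x ≤ τ) :
    wordMass p (stopDepth p K τ x) (x / k ^ (K - stopDepth p K τ x)) ≤ τ := by
  rcases stopDepth_spec p K τ x with h | h
  · exact h
  · have : stopDepth p K τ x = K := le_antisymm (stopDepth_le _ _ _ _) h
    rw [this]; simpa using hx

/-- One letter earlier the prefix still had mass above `τ`, and a letter costs at most the factor
`c`. Stopping prefixes therefore have comparable masses, whatever their lengths. -/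
theorem le_wordMass_stopDepth (hp : ∀ i, 0 ≤ p i) {c : ℝ} (hc0 : 0 ≤ c) (hc1 : c ≤ 1)
    (hc : ∀ i, c ≤ p i) (hτ : τ ≤ 1) (x : ℕ) :
    c * τ ≤ wordMass p (stopDepth p K τ x) (x / k ^ (K - stopDepth p K τ x)) := by
  rcases Nat.eq_zero_or_pos (stopDepth p K τ x) with h | h
  · rw [h, wordMass_zero]; nlinarith
  · have hle := stopDepth_le p K τ x
    have h1 := lt_wordMass_of_lt_stopDepth (p := p) (K := K) (τ := τ) (x := x)
      (Nat.sub_lt h one_pos)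
    obtain ⟨m, hm⟩ : ∃ m, stopDepth p K τ x = m + 1 := ⟨_, (Nat.succ_pred_eq_of_pos h).symm⟩
    rw [hm] at hle h1 ⊢
    rw [Nat.add_sub_cancel] at h1
    rw [wordMass_succ, Nat.div_div_eq_div_mul, ← pow_succ,
      (by omega : K - (m + 1) + 1 = K - m), mul_comm]
    exact mul_le_mul h1.le (hc _) hc0 (wordMass_nonneg hp _ _)

theorem le_pow_stopDepth (hp : ∀ i, 0 ≤ p i) {c : ℝ} (hc : ∀ i, p i ≤ c) (hτ : τ ≤ 1) (x : ℕ) :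
    τ ≤ c ^ (stopDepth p K τ x - 1) := by
  rcases Nat.eq_zero_or_pos (stopDepth p K τ x) with h | h
  · rw [h]; simpa using hτ
  · exact (lt_wordMass_of_lt_stopDepth (Nat.sub_lt h one_pos)).le.trans (wordMass_le_pow hp hc _ _)

/-- Whether to stop depends only on the prefix read so far. The stopping prefixes are thus
prefix-free and cut the words into disjoint cylinders. -/
theorem stopDepth_eq_of_div_eq {x z : ℕ}
    (h : z / k ^ (K - stopDepth p K τ x) = x / k ^ (K - stopDepth p K τ x)) :
    stopDepth p K τ z = stopDepth p K τ x := by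
  have hpre : ∀ m ≤ stopDepth p K τ x, z / k ^ (K - m) = x / k ^ (K - m) := by
    intro m hm
    have hle := stopDepth_le p K τ x
    have e : k ^ (K - m) = k ^ (K - stopDepth p K τ x) * k ^ (stopDepth p K τ x - m) := by
      rw [← pow_add]; congr 1; omega
    rw [e, ← Nat.div_div_eq_div_mul, h, Nat.div_div_eq_div_mul]
  apply le_antisymm
  · refine Nat.sInf_le ?_
    rw [Set.mem_ofPred_eq, h]
    exact stopDepth_spec p K τ x
  · by_contra hlt
    rw [not_le] at hlt
    have h1 := lt_wordMass_of_lt_stopDepth hlt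
    rcases stopDepth_spec p K τ z with h2 | h2
    · rw [hpre _ hlt.le] at h2
      exact absurd h2 (not_le.mpr h1)
    · exact absurd (h2.trans_lt hlt) (not_lt.mpr (stopDepth_le _ _ _ _))

theorem stopPrefix_eq_iff {x z : ℕ} : stopPrefix p K τ z = stopPrefix p K τ x ↔
    z / k ^ (K - stopDepth p K τ x) = x / k ^ (K - stopDepth p K τ x) := by
  constructor
  · intro h
    have h1 := congrArg Prod.fst h
    have h2 := congrArg Prod.snd h
    simp only [stopPrefix] at h1 h2
    rw [h1] at h2; exact h2
  · intro h
    have := stopDepth_eq_of_div_eq h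
    simp only [stopPrefix, this, h]

theorem div_pow_lt {x M : ℕ} (hM : M ≤ K) (hx : x < k ^ K) : x / k ^ (K - M) < k ^ M := by
  rw [Nat.div_lt_iff_lt_mul (pow_pos (Nat.pos_of_neZero k) _), ← pow_add, Nat.add_sub_cancel' hM]
  exact hx

/-- The mass of the words that share the stopping prefix of `x`. -/
theorem sum_stopPrefix_eq (g : Fin k → ℝ) {x : ℕ} (hx : x < k ^ K) :
    ∑ z ∈ (range (k ^ K)).filter (fun z => stopPrefix p K τ z = stopPrefix p K τ x),
      wordMass g K z =
    wordMass g (stopDepth p K τ x) (x / k ^ (K - stopDepth p K τ x)) *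
      (∑ i, g i) ^ (K - stopDepth p K τ x) := by
  simp_rw [stopPrefix_eq_iff]
  exact sum_cylinder g (stopDepth_le _ _ _ _) (div_pow_lt (stopDepth_le _ _ _ _) hx)

theorem sum_Ico_le_of_stopPrefix_eq (hp : ∀ i, 0 ≤ p i) (hp1 : ∑ i, p i = 1) {x z : ℕ}
    (hz : z < k ^ K) (hzτ : wordMass p K x ≤ τ)
    (h : stopPrefix p K τ z = stopPrefix p K τ x) :
    ∑ w ∈ Ico x z, wordMass p K w ≤ τ := by
  rcases le_or_gt z x with hzx | hxz
  · rw [Ico_eq_empty (by omega), sum_empty]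
    exact (wordMass_nonneg hp _ _).trans hzτ
  have h1 := sum_stopPrefix_eq (p := p) (τ := τ) p (hxz.trans hz)
  rw [hp1, one_pow, mul_one] at h1
  refine le_trans ?_ (h1.le.trans (wordMass_stopDepth_le hzτ))
  refine sum_le_sum_of_subset_of_nonneg ?_ fun w _ _ => wordMass_nonneg hp _ _
  intro w hw
  rw [mem_Ico] at hw
  rw [mem_filter, mem_range]
  refine ⟨hw.2.trans hz, stopPrefix_eq_iff.mpr ?_⟩
  rw [stopPrefix_eq_iff] at h
  exact le_antisymm (h ▸ Nat.div_le_div_right hw.2.le) (Nat.div_le_div_right hw.1)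

end WordMass

/-- The interval spanned by `X` has mass at most `hi - lo` up to its last point, which adds at most
`ℓ`. -/
theorem sum_le_of_window {f : ℕ → ℝ} (hf : ∀ x, 0 ≤ f x) {ℓ lo hi : ℝ} (hℓ : ∀ x, f x ≤ ℓ)
    (hlo : lo ≤ hi) {X : Finset ℕ}
    (hX : ∀ x ∈ X, lo ≤ ∑ z ∈ range x, f z ∧ ∑ z ∈ range x, f z ≤ hi) :
    ∑ x ∈ X, f x ≤ hi - lo + ℓ := by
  rcases X.eq_empty_or_nonempty with rfl | hne
  · have := (hf 0).trans (hℓ 0)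
    rw [sum_empty]; linarith
  · have hmin := hX _ (X.min'_mem hne)
    have hmax := hX _ (X.max'_mem hne)
    have h1 : ∑ x ∈ X, f x ≤ ∑ x ∈ Ico (X.min' hne) (X.max' hne + 1), f x := by
      refine sum_le_sum_of_subset_of_nonneg (fun x hx => ?_) fun x _ _ => hf x
      rw [mem_Ico]
      exact ⟨X.min'_le x hx, Nat.lt_succ_of_le (X.le_max' x hx)⟩
    rw [sum_Ico_eq_sub _ ((X.min'_le_max' hne).trans (Nat.le_succ _)), sum_range_succ] at h1
    have := hℓ (X.max' hne)
    linarith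

theorem abs_sub_le_of_stopPrefix_eq {k : ℕ} [NeZero k] {p : Fin k → ℝ} {K : ℕ} {τ : ℝ}
    (hp : ∀ i, 0 ≤ p i) (hp1 : ∑ i, p i = 1) (hτ : ∀ x, wordMass p K x ≤ τ) {x z : ℕ}
    (hx : x < k ^ K) (hz : z < k ^ K) (h : stopPrefix p K τ z = stopPrefix p K τ x) :
    |∑ w ∈ range z, wordMass p K w - ∑ w ∈ range x, wordMass p K w| ≤ τ := by
  rcases le_total x z with hxz | hxz
  · rw [← sum_Ico_eq_sub _ hxz, abs_of_nonneg (sum_nonneg fun _ _ => wordMass_nonneg hp _ _)]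
    exact sum_Ico_le_of_stopPrefix_eq hp hp1 hz (hτ x) h
  · rw [abs_sub_comm, ← sum_Ico_eq_sub _ hxz,
      abs_of_nonneg (sum_nonneg fun _ _ => wordMass_nonneg hp _ _)]
    exact sum_Ico_le_of_stopPrefix_eq hp hp1 hx (hτ z) h.symm

/-- The number of stopping prefixes of the words in a window. -/
theorem card_image_stopPrefix_mul_le {k : ℕ} [NeZero k] {p : Fin k → ℝ} {K : ℕ} {τ : ℝ}
    (hp : ∀ i, 0 ≤ p i) (hp1 : ∑ i, p i = 1) {c : ℝ} (hc0 : 0 ≤ c) (hc1 : c ≤ 1)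
    (hc : ∀ i, c ≤ p i) (hτ1 : τ ≤ 1) (hτ : ∀ x, wordMass p K x ≤ τ)
    {X : Finset ℕ} (hXK : X ⊆ range (k ^ K)) {lo hi : ℝ} (hlo : lo ≤ hi)
    (hX : ∀ x ∈ X, lo ≤ ∑ w ∈ range x, wordMass p K w ∧ ∑ w ∈ range x, wordMass p K w ≤ hi) :
    (X.image (stopPrefix p K τ)).card * (c * τ) ≤ hi - lo + 3 * τ := by
  classical
  set B := X.image (stopPrefix p K τ) with hB
  have h1 : (B.card : ℝ) * (c * τ) ≤ ∑ b ∈ B,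
      ∑ z ∈ (range (k ^ K)).filter (fun z => stopPrefix p K τ z = b), wordMass p K z := by
    rw [← nsmul_eq_mul]
    refine card_nsmul_le_sum _ _ _ fun b hb => ?_
    obtain ⟨x, hx, rfl⟩ := mem_image.mp hb
    rw [sum_stopPrefix_eq p (mem_range.mp (hXK hx)), hp1, one_pow, mul_one]
    exact le_wordMass_stopDepth hp hc0 hc1 hc hτ1 x
  refine h1.trans ?_
  have h2 : ∑ b ∈ B, ∑ z ∈ (range (k ^ K)).filter (fun z => stopPrefix p K τ z = b),
      wordMass p K z =
      ∑ z ∈ (range (k ^ K)).filter (fun z => stopPrefix p K τ z ∈ B), wordMass p K z := by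
    rw [← sum_fiberwise_of_maps_to (s := (range (k ^ K)).filter (fun z => stopPrefix p K τ z ∈ B))
      (t := B) (g := stopPrefix p K τ) (fun z hz => (mem_filter.mp hz).2)]
    refine sum_congr rfl fun b hb => sum_congr ?_ fun _ _ => rfl
    ext z
    simp only [mem_filter]
    constructor
    · rintro ⟨h, rfl⟩; exact ⟨⟨h, hb⟩, rfl⟩
    · rintro ⟨⟨h, _⟩, rfl⟩; exact ⟨h, rfl⟩
  rw [h2]
  have hτ0 := (wordMass_nonneg hp K 0).trans (hτ 0)
  -- A cylinder meeting the window may stick out by `τ` on either side, and the last word of the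
  -- enlarged window adds `τ` again: `3 * τ` in all.
  have h3 := sum_le_of_window (f := wordMass p K) (wordMass_nonneg hp K) hτ
    (lo := lo - τ) (hi := hi + τ) (by linarith)
    (X := (range (k ^ K)).filter (fun z => stopPrefix p K τ z ∈ B)) (by
      intro z hz
      rw [mem_filter, hB, mem_image] at hz
      obtain ⟨hz, x, hx, hxz⟩ := hz
      have := abs_le.mp (abs_sub_le_of_stopPrefix_eq hp hp1 hτ (mem_range.mp (hXK hx))
        (mem_range.mp hz) hxz.symm)
      have := hX x hx
      constructor <;> linarith)
  linarith

/-! ### Tails of the Poisson distribution -/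

/-- Write the weight as `exp (-a) (a / d) ^ d (d ^ d / d!)`. The last factor is at most `exp d`, and
`(√a / √d) ^ (2 d) ≤ exp (2 √a √d - 2 d)`; the exponents complete a square. -/
theorem pois_le_exp {a : ℝ} (ha : 0 ≤ a) (d : ℕ) :
    pois a d ≤ Real.exp (-(√a - √d) ^ 2) := by
  rcases Nat.eq_zero_or_pos d with rfl | hd
  · simp [pois, Real.sq_sqrt ha]
  have hd0 : (0 : ℝ) < d := by exact_mod_cast hd
  rcases ha.eq_or_lt with rfl | ha
  · simp only [pois, zero_pow hd.ne', zero_div, mul_zero]; exact (Real.exp_pos _).le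
  have hf : (0 : ℝ) < d.factorial := by exact_mod_cast d.factorial_pos
  have h1 : (d : ℝ) ^ d / d.factorial ≤ Real.exp d := Real.pow_div_factorial_le_exp _ hd0.le d
  have h2 : (a / d) ^ d ≤ Real.exp (2 * (√a * √d) - 2 * d) := by
    have e1 : a / d = (√a / √d) ^ 2 := by rw [div_pow, Real.sq_sqrt ha.le, Real.sq_sqrt hd0.le]
    have e2 := Real.add_one_le_exp (√a / √d - 1)
    rw [sub_add_cancel] at e2
    rw [e1, ← pow_mul]
    refine (pow_le_pow_left₀ (by positivity) e2 _).trans ?_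
    rw [← Real.exp_nat_mul]
    apply Real.exp_le_exp.mpr
    have e3 : √a / √d * d = √a * √d := by
      rw [div_mul_eq_mul_div, div_eq_iff (Real.sqrt_pos.mpr hd0).ne', mul_assoc,
        Real.mul_self_sqrt hd0.le]
    push_cast
    nlinarith
  have h3 : a ^ d / d.factorial = (a / d) ^ d * ((d : ℝ) ^ d / d.factorial) := by
    rw [div_pow]; field_simp
  rw [pois, h3]
  calc Real.exp (-a) * ((a / d) ^ d * ((d : ℝ) ^ d / d.factorial))
      ≤ Real.exp (-a) * (Real.exp (2 * (√a * √d) - 2 * d) * Real.exp d) := by gcongr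
    _ = Real.exp (-(√a - √d) ^ 2) := by
      rw [← Real.exp_add, ← Real.exp_add]
      congr 1
      have := Real.sq_sqrt ha.le
      have := Real.sq_sqrt hd0.le
      nlinarith

/-- With `t = |a - d|` one has `(√a - √d)² (√a + √d)² = t²` and `(√a + √d)² ≤ 2 t + 8 D`. Both `W t`
and `W D` are at most `t²`, whence the constant `10`. -/
theorem pois_le_exp_of_far {a D W : ℝ} {d : ℕ} (ha : 0 ≤ a) (hD : 1 ≤ D) (hW : 1 ≤ W)
    (hd : d ≤ 2 * D) (h : W * √D ≤ |a - d|) : pois a d ≤ Real.exp (-(W / 10)) := by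
  refine (pois_le_exp ha d).trans (Real.exp_le_exp.mpr (neg_le_neg ?_))
  have hd0 : (0 : ℝ) ≤ d := d.cast_nonneg
  have hs := Real.sq_sqrt ha
  have hs' := Real.sq_sqrt hd0
  have hsD : 1 ≤ √D := Real.one_le_sqrt.mpr hD
  have hsD' := Real.sq_sqrt (zero_le_one.trans hD)
  set t := |a - d| with ht
  have ht0 : 0 < t := lt_of_lt_of_le (by positivity) h
  have hfac : (√a - √d) ^ 2 * (√a + √d) ^ 2 = t ^ 2 := by
    rw [ht, sq_abs, ← mul_pow]; congr 1; nlinarith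
  have hsum : (√a + √d) ^ 2 ≤ 2 * t + 8 * D := by
    have h1 : a ≤ t + d := by have := le_abs_self (a - d); linarith
    nlinarith [sq_nonneg (√a - √d)]
  have hpos : 0 < 2 * t + 8 * D := by positivity
  have key : W / 10 * (2 * t + 8 * D) ≤ t ^ 2 := by
    have h1 : W * 1 ≤ W * √D := by gcongr
    have h2 : W * t ≤ t * t := mul_le_mul_of_nonneg_right (by linarith) ht0.le
    have h3 : W * D ≤ t ^ 2 := by
      have : (W * √D) ^ 2 ≤ t ^ 2 := pow_le_pow_left₀ (by positivity) h 2
      rw [mul_pow, hsD'] at this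
      nlinarith
    nlinarith
  have : W / 10 * (2 * t + 8 * D) ≤ (√a - √d) ^ 2 * (2 * t + 8 * D) :=
    key.trans (hfac ▸ mul_le_mul_of_nonneg_left hsum (sq_nonneg _))
  exact le_of_mul_le_mul_right this hpos

/-- As a function of the mean, the weight at `d` is largest at `a = d`. Unlike `pois_le`, the bound
depends on the distance and not on the mean. -/
theorem pois_le_one_div_sqrt {a D : ℝ} {d : ℕ} (ha : 0 ≤ a) (hD : 0 < D) (hd : D ≤ max (d : ℝ) 1) :
    pois a d ≤ 1 / √D := by
  rcases Nat.eq_zero_or_pos d with rfl | hpos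
  · refine (pois_le_one ha 0).trans ?_
    rw [le_div_iff₀ (Real.sqrt_pos.mpr hD), one_mul]
    exact Real.sqrt_le_one.mpr (by simpa using hd)
  have hd0 : (0 : ℝ) < d := by exact_mod_cast hpos
  have hd1 : (1 : ℝ) ≤ d := by exact_mod_cast hpos
  rw [max_eq_left hd1] at hd
  have h1 : pois a d ≤ pois d d := by
    rw [pois, pois, ← mul_div_assoc, ← mul_div_assoc]
    refine div_le_div_of_nonneg_right ?_ (Nat.cast_nonneg _)
    have e2 := Real.add_one_le_exp (a / d - 1)
    rw [sub_add_cancel] at e2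
    have e3 : (a / d) ^ d ≤ Real.exp (a - d) := by
      refine (pow_le_pow_left₀ (by positivity) e2 _).trans ?_
      rw [← Real.exp_nat_mul]
      apply Real.exp_le_exp.mpr
      rw [mul_sub, mul_div_cancel₀ _ hd0.ne', mul_one]
    have e4 : a ^ d = (a / d) ^ d * d ^ d := by rw [div_pow, div_mul_cancel₀ _ (by positivity)]
    rw [e4, ← mul_assoc]
    refine mul_le_mul_of_nonneg_right ?_ (by positivity)
    calc Real.exp (-a) * (a / d) ^ d ≤ Real.exp (-a) * Real.exp (a - d) := by gcongr
      _ = Real.exp (-d) := by rw [← Real.exp_add]; congr 1; ring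
  exact h1.trans ((pois_le hd0 d).trans (one_div_le_one_div_of_le (Real.sqrt_pos.mpr hD)
    (Real.sqrt_le_sqrt hd)))

theorem card_le_of_abs_sub_le {S : Finset ℕ} {L : ℝ} (hL : 0 ≤ L)
    (h : ∀ d ∈ S, ∀ e ∈ S, |(d : ℝ) - e| ≤ L) : (S.card : ℝ) ≤ L + 1 := by
  rcases S.eq_empty_or_nonempty with rfl | hne
  · simp; linarith
  · have h1 : S ⊆ Icc (S.min' hne) (S.max' hne) := fun x hx =>
      mem_Icc.mpr ⟨S.min'_le x hx, S.le_max' x hx⟩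
    have h2 := card_le_card h1
    rw [Nat.card_Icc] at h2
    have h3 := (abs_le.mp (h _ (S.max'_mem hne) _ (S.min'_mem hne))).2
    have h4 : (S.card : ℝ) + (S.min' hne) ≤ (S.max' hne) + 1 := by
      have := S.min'_le_max' hne
      exact_mod_cast (by omega : S.card + S.min' hne ≤ S.max' hne + 1)
    linarith

/-! ### Cylinders of stopping prefixes and the tilted law -/

section Blocks

variable {k : ℕ} [NeZero k] {p : Fin k → ℝ} {K : ℕ} {c τ N s : ℝ}

/-- Cauchy-Schwarz over the blocks of words sharing a stopping prefix. -/
theorem sum_near_sq_le (hp1 : ∑ i, p i = 1) (hc0 : 0 < c) (hc1 : c ≤ 1)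
    (hc : ∀ i, c ≤ p i) (hτ1 : τ ≤ 1) (hτ : ∀ x, wordMass p K x ≤ τ) (hN : 0 < N)
    {X : Finset ℕ} (hX : X ⊆ range (k ^ K)) {f : ℕ → ℝ} (hf : ∀ x, 0 ≤ f x) {W : ℝ} (hW : 0 ≤ W)
    (S : Finset ℕ) {B : Finset (ℕ × ℕ)}
    (hB : ∀ d ∈ S, ∀ x ∈ X, |N * (∑ w ∈ range x, wordMass p K w) - s - d| ≤ W * (N * τ) →
      stopPrefix p K τ x ∈ B) :
    ∑ d ∈ S, (∑ x ∈ X.filter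
        (fun x => |N * (∑ w ∈ range x, wordMass p K w) - s - d| ≤ W * (N * τ)), f x) ^ 2 ≤
      (2 * W + 3) / c * ((2 * W + 1) * (N * τ) + 1) *
        ∑ b ∈ B, (∑ z ∈ (range (k ^ K)).filter (fun z => stopPrefix p K τ z = b), f z) ^ 2 := by
  classical
  have hp : ∀ i, 0 ≤ p i := fun i => hc0.le.trans (hc i)
  have hτ0 : 0 < τ := (wordMass_pos (fun i => hc0.trans_le (hc i)) K 0).trans_le (hτ 0)
  set key := stopPrefix p K τ with hkey
  set A : ℕ → ℝ := fun x => N * (∑ w ∈ range x, wordMass p K w) - s with hA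
  set near : ℕ → Finset ℕ := fun d => X.filter fun x => |A x - d| ≤ W * (N * τ) with hnear
  set m : ℕ × ℕ → ℝ := fun b => ∑ z ∈ (range (k ^ K)).filter (fun z => key z = b), f z with hm
  have hBd : ∀ d ∈ S, (near d).image key ⊆ B := by
    intro d hd b hb
    obtain ⟨x, hx, rfl⟩ := mem_image.mp hb
    exact hB d hd x (mem_filter.mp hx).1 (mem_filter.mp hx).2
  -- A window of `2 W N τ` positions meets boundedly many blocks; this is the Cauchy-Schwarz
  -- constant.
  have hcard : ∀ d : ℕ, (((near d).image key).card : ℝ) ≤ (2 * W + 3) / c := by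
    intro d
    have h := card_image_stopPrefix_mul_le hp hp1 hc0.le hc1 hc hτ1 hτ
      (X := near d) (lo := (d + s) / N - W * τ) (hi := (d + s) / N + W * τ)
      ((filter_subset _ _).trans hX) (by nlinarith) (by
        intro x hx
        have := abs_le.mp (mem_filter.mp hx).2
        simp only [hA] at this
        constructor
        · rw [sub_le_iff_le_add, div_le_iff₀ hN]; nlinarith
        · rw [← sub_le_iff_le_add, le_div_iff₀ hN]; nlinarith)
    rw [le_div_iff₀ hc0]
    have h2 : ((near d).image key).card * c * τ ≤ (2 * W + 3) * τ := by rw [mul_assoc]; linarith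
    exact le_of_mul_le_mul_right h2 hτ0
  have hsq : ∀ d, (∑ x ∈ near d, f x) ^ 2 ≤
      (2 * W + 3) / c * ∑ b ∈ (near d).image key, m b ^ 2 := by
    intro d
    have h1 : ∑ x ∈ near d, f x ≤ ∑ b ∈ (near d).image key, m b := by
      rw [hm, sum_fiberwise_eq_sum_filter]
      refine sum_le_sum_of_subset_of_nonneg ?_ fun x _ _ => hf x
      intro x hx
      rw [mem_filter]
      exact ⟨hX (mem_filter.mp hx).1, mem_image_of_mem _ hx⟩
    refine (pow_le_pow_left₀ (sum_nonneg fun x _ => hf x) h1 2).trans ?_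
    refine sq_sum_le_card_mul_sum_sq.trans ?_
    exact mul_le_mul_of_nonneg_right (hcard d) (sum_nonneg fun _ _ => sq_nonneg _)
  -- Conversely a block spans at most `N τ` positions, so it is near only distances `d` within a
  -- range of length `(2 W + 1) N τ`.
  have hnum : ∀ b, ((S.filter fun d => b ∈ (near d).image key).card : ℝ) ≤
      (2 * W + 1) * (N * τ) + 1 := by
    intro b
    refine card_le_of_abs_sub_le (by positivity) ?_
    intro d hd e he
    obtain ⟨x, hx, hxb⟩ := mem_image.mp (mem_filter.mp hd).2
    obtain ⟨z, hz, hzb⟩ := mem_image.mp (mem_filter.mp he).2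
    rw [hnear, mem_filter] at hx hz
    have h1 := abs_le.mp hx.2
    have h2 := abs_le.mp hz.2
    have h3 := abs_le.mp (abs_sub_le_of_stopPrefix_eq hp hp1 hτ (mem_range.mp (hX hx.1))
      (mem_range.mp (hX hz.1)) (hzb.trans hxb.symm))
    have h4 : N * (∑ w ∈ range z, wordMass p K w - ∑ w ∈ range x, wordMass p K w) ≤ N * τ :=
      mul_le_mul_of_nonneg_left h3.2 hN.le
    have h5 : N * -τ ≤ N * (∑ w ∈ range z, wordMass p K w - ∑ w ∈ range x, wordMass p K w) :=
      mul_le_mul_of_nonneg_left h3.1 hN.le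
    simp only [hA] at h1 h2
    rw [abs_le]
    constructor <;> nlinarith
  calc ∑ d ∈ S, (∑ x ∈ near d, f x) ^ 2
      ≤ ∑ d ∈ S, (2 * W + 3) / c * ∑ b ∈ B, if b ∈ (near d).image key then m b ^ 2 else 0 := by
        refine sum_le_sum fun d hd => (hsq d).trans_eq ?_
        rw [← sum_filter, filter_mem_eq_inter, inter_eq_right.mpr (hBd d hd)]
    _ = (2 * W + 3) / c * ∑ b ∈ B, (S.filter fun d => b ∈ (near d).image key).card * m b ^ 2 := by
        rw [← mul_sum, sum_comm]
        congr 1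
        refine sum_congr rfl fun b _ => ?_
        rw [← sum_filter, sum_const, nsmul_eq_mul]
    _ ≤ (2 * W + 3) / c * ∑ b ∈ B, ((2 * W + 1) * (N * τ) + 1) * m b ^ 2 := by
        gcongr with b _
        exact hnum b
    _ = _ := by rw [← mul_sum, mul_assoc]

variable {θ : ℝ}

/-- The letter probabilities tilted by the exponent `θ`. -/
noncomputable def tilt {k : ℕ} (p : Fin k → ℝ) (θ : ℝ) (i : Fin k) : ℝ := p i ^ θ / phi p θ

theorem phi_pos (hp : ∀ i, 0 < p i) (t : ℝ) : 0 < phi p t :=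
  sum_pos (fun i _ => Real.rpow_pos_of_pos (hp i) t) univ_nonempty

theorem sum_tilt (hp : ∀ i, 0 < p i) (θ : ℝ) : ∑ i, tilt p θ i = 1 := by
  simp only [tilt]
  rw [← sum_div]
  exact div_self (phi_pos hp θ).ne'

theorem tilt_pos (hp : ∀ i, 0 < p i) (θ : ℝ) (i : Fin k) : 0 < tilt p θ i :=
  div_pos (Real.rpow_pos_of_pos (hp i) θ) (phi_pos hp θ)

theorem wordMass_tilt (hp : ∀ i, 0 ≤ p i) (θ : ℝ) (M v : ℕ) :
    wordMass (tilt p θ) M v = wordMass p M v ^ θ / phi p θ ^ M := by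
  rw [← wordMass_rpow hp, ← wordMass_div_const]
  rfl

/-- The square-sum in a block is controlled by the tilted mass of the block. -/
theorem sum_block_sq_le (hc0 : 0 < c) (hc1 : c ≤ 1)
    (hc : ∀ i, c ≤ p i) (hτ1 : τ ≤ 1) (hτ : ∀ x, wordMass p K x ≤ τ) (hN : 0 < N)
    (hθ0 : 0 ≤ θ) (hθ : phi p θ = phi p 2 ^ 2) {x : ℕ} (hx : x < k ^ K) :
    (∑ z ∈ (range (k ^ K)).filter (fun z => stopPrefix p K τ z = stopPrefix p K τ x),
      (N * wordMass p K z) ^ 2) ^ 2 ≤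
    (N * τ) ^ 4 * phi p 2 ^ (2 * K) * (1 / (c * τ)) ^ θ *
      ∑ z ∈ (range (k ^ K)).filter (fun z => stopPrefix p K τ z = stopPrefix p K τ x),
        wordMass (tilt p θ) K z := by
  have hp0 : ∀ i, 0 < p i := fun i => hc0.trans_le (hc i)
  have hp : ∀ i, 0 ≤ p i := fun i => (hp0 i).le
  have hτ0 : 0 < τ := (wordMass_pos hp0 K 0).trans_le (hτ 0)
  have hφ := phi_pos hp0 2
  have hlow := le_wordMass_stopDepth (K := K) hp hc0.le hc1 hc hτ1 x
  have hup := wordMass_stopDepth_le (hτ x)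
  have hM := stopDepth_le p K τ x
  -- With `P` the prefix mass and `M` its length, the block square-sum is `N² P² φ(2) ^ (K - M)` and
  -- the tilted mass is `P ^ θ φ(2) ^ (-2 M)`. This is where the equation for `θ` matters: the
  -- square of the former over the latter is `N⁴ P ^ (4 - θ) φ(2) ^ (2 K)`, free of `M`, and `c τ ≤
  -- P ≤ τ`.
  rw [sum_stopPrefix_eq _ hx, sum_tilt hp0, one_pow, mul_one, wordMass_tilt hp, hθ]
  have e1 : ∑ z ∈ (range (k ^ K)).filter (fun z => stopPrefix p K τ z = stopPrefix p K τ x),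
      (N * wordMass p K z) ^ 2 = N ^ 2 * (wordMass p (stopDepth p K τ x)
        (x / k ^ (K - stopDepth p K τ x)) ^ 2 * phi p 2 ^ (K - stopDepth p K τ x)) := by
    have h := sum_stopPrefix_eq (p := p) (τ := τ) (fun i => p i ^ (2 : ℝ)) hx
    simp only [wordMass_rpow hp] at h
    simp only [Real.rpow_two] at h
    simp_rw [mul_pow]
    rw [← mul_sum, h]
    simp only [phi, Real.rpow_two]
  rw [e1]
  set M := stopDepth p K τ x
  set P := wordMass p M (x / k ^ (K - M))
  have hP : 0 < P := wordMass_pos hp0 _ _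
  have h1 : 1 ≤ (1 / (c * τ)) ^ θ * P ^ θ := by
    rw [← Real.mul_rpow (by positivity) hP.le]
    refine Real.one_le_rpow ?_ hθ0
    rw [one_div_mul_eq_div, le_div_iff₀ (by positivity), one_mul]
    exact hlow
  have e2 : phi p 2 ^ (2 * K) = (phi p 2 ^ (K - M)) ^ 2 * (phi p 2 ^ 2) ^ M := by
    rw [← pow_mul, ← pow_mul, ← pow_add]; congr 1; omega
  have e3 : (N * τ) ^ 4 * phi p 2 ^ (2 * K) * (1 / (c * τ)) ^ θ * (P ^ θ / (phi p 2 ^ 2) ^ M) =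
      ((N * τ) ^ 2 * phi p 2 ^ (K - M)) ^ 2 * ((1 / (c * τ)) ^ θ * P ^ θ) := by
    rw [e2]; field_simp
  rw [e3]
  have h2 : N ^ 2 * (P ^ 2 * phi p 2 ^ (K - M)) ≤ (N * τ) ^ 2 * phi p 2 ^ (K - M) := by
    rw [← mul_assoc, ← mul_pow]; gcongr
  calc _ ≤ ((N * τ) ^ 2 * phi p 2 ^ (K - M)) ^ 2 := pow_le_pow_left₀ (by positivity) h2 2
    _ ≤ _ := le_mul_of_one_le_right (by positivity) h1

/-- The tilted mass of a window, through its stopping prefixes. -/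
theorem sum_tilt_window_le (hp1 : ∑ i, p i = 1) (hc0 : 0 < c) (hc1 : c ≤ 1)
    (hc : ∀ i, c ≤ p i) (hτ1 : τ ≤ 1) (hτ : ∀ x, wordMass p K x ≤ τ)
    (hθ0 : 0 ≤ θ) {b : ℝ} (hb : ∀ i, p i ≤ b) (hb1 : b < 1) (hb0 : 0 < b)
    (hφ1 : phi p θ ≤ 1)
    {X : Finset ℕ} (hXK : X ⊆ range (k ^ K)) {lo hi : ℝ} (hlo : lo ≤ hi)
    (hX : ∀ x ∈ X, lo ≤ ∑ w ∈ range x, wordMass p K w ∧ ∑ w ∈ range x, wordMass p K w ≤ hi) :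
    ∑ x ∈ X, wordMass (tilt p θ) K x ≤ (hi - lo + 3 * τ) / (c * τ) *
      (τ ^ θ * Real.exp (-Real.log (phi p θ) * (1 + Real.log (1 / τ) / Real.log (1 / b)))) := by
  classical
  have hp0 : ∀ i, 0 < p i := fun i => hc0.trans_le (hc i)
  have hp : ∀ i, 0 ≤ p i := fun i => (hp0 i).le
  have hτ0 : 0 < τ := (wordMass_pos hp0 K 0).trans_le (hτ 0)
  have hφ := phi_pos hp0 θ
  have hcard := card_image_stopPrefix_mul_le hp hp1 hc0.le hc1 hc hτ1 hτ hXK hlo hX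
  rw [← le_div_iff₀ (by positivity)] at hcard
  refine le_trans ?_ (mul_le_mul_of_nonneg_right hcard (by positivity))
  have h1 : ∑ x ∈ X, wordMass (tilt p θ) K x ≤ ∑ v ∈ X.image (stopPrefix p K τ),
      ∑ z ∈ (range (k ^ K)).filter (fun z => stopPrefix p K τ z = v), wordMass (tilt p θ) K z := by
    rw [sum_fiberwise_eq_sum_filter]
    refine sum_le_sum_of_subset_of_nonneg ?_
      fun x _ _ => wordMass_nonneg (fun i => (tilt_pos hp0 θ i).le) _ _
    intro x hx
    rw [mem_filter]
    exact ⟨hXK hx, mem_image_of_mem _ hx⟩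
  refine h1.trans ?_
  rw [← nsmul_eq_mul]
  refine sum_le_card_nsmul _ _ _ fun v hv => ?_
  obtain ⟨x, hx, rfl⟩ := mem_image.mp hv
  rw [sum_stopPrefix_eq _ (mem_range.mp (hXK hx)), sum_tilt hp0, one_pow, mul_one,
    wordMass_tilt hp, div_eq_mul_inv]
  refine mul_le_mul (Real.rpow_le_rpow (wordMass_nonneg hp _ _) (wordMass_stopDepth_le (hτ x)) hθ0)
    ?_ (by positivity) (by positivity)
  -- The factor `φ(θ) ^ (-M)` grows with the length, so the worst stopping prefix is the longest,
  -- the one whose letters all have mass near `b`.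
  have hd := le_pow_stopDepth (K := K) hp hb hτ1 x
  set M := stopDepth p K τ x
  have e1 : (phi p θ ^ M)⁻¹ = Real.exp (-Real.log (phi p θ) * M) := by
    rw [neg_mul, Real.exp_neg, mul_comm, Real.exp_nat_mul, Real.exp_log hφ]
  rw [e1]
  apply Real.exp_le_exp.mpr
  refine mul_le_mul_of_nonneg_left ?_ (neg_nonneg.mpr (Real.log_nonpos hφ.le hφ1))
  have hlb : 0 < Real.log (1 / b) := Real.log_pos (by rw [lt_div_iff₀ hb0]; linarith)
  have h2 : Real.log τ ≤ (M - 1 : ℕ) * Real.log b := by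
    rw [← Real.log_pow]; exact Real.log_le_log hτ0 hd
  have h3 : ((M - 1 : ℕ) : ℝ) ≤ Real.log (1 / τ) / Real.log (1 / b) := by
    rw [le_div_iff₀ hlb, one_div, one_div, Real.log_inv, Real.log_inv]
    linarith
  have h4 : (M : ℝ) ≤ 1 + (M - 1 : ℕ) := by exact_mod_cast (by omega : M ≤ 1 + (M - 1))
  linarith

end Blocks

/-! ### The collision sum of a window -/

section Collision

variable {k : ℕ} [NeZero k] {p : Fin k → ℝ} {K : ℕ} {c b θ N : ℝ}

/-- At distance `D` the Poisson fluctuation is `√D` cards, so blocks of mass `τ = √D / N`, holding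
about `√D` cards, are as fine as positions can resolve. The tilted mass of all relevant blocks is
then estimated with coarser prefixes. -/
theorem sum_near_sq_le_of_scale (hp1 : ∑ i, p i = 1) (hc0 : 0 < c) (hc1 : c ≤ 1)
    (hc : ∀ i, c ≤ p i) (hb : ∀ i, p i ≤ b) (hb1 : b < 1) (hb0 : 0 < b)
    (hθ0 : 0 ≤ θ) (hθ : phi p θ = phi p 2 ^ 2) (hφ1 : phi p 2 ≤ 1) (hN : 8 ≤ N)
    (hK : N * b ^ K ≤ 1) {D W : ℝ} (hD : 1 ≤ D) (hDN : D ≤ 8 * N) (hW : 1 ≤ W)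
    (S : Finset ℕ) (hS : ∀ d ∈ S, (d : ℝ) ≤ 2 * D) {y T₁ : ℕ} (hT₁ : T₁ ≤ k ^ K) :
    ∑ d ∈ S, (∑ x ∈ (Ico y T₁).filter
        (fun x => |(∑ w ∈ Ico y x, N * wordMass p K w) - d| ≤ W * √D),
          (N * wordMass p K x) ^ 2) ^ 2 ≤
      860 * W ^ 3 / c ^ 2 * (√D ^ 5 * (√D / c) ^ θ) * (phi p 2 ^ (2 * K) *
        Real.exp (-(2 * Real.log (phi p 2)) * (1 + Real.log (8 * N / D) / Real.log (1 / b)))) := by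
  classical
  have hp0 : ∀ i, 0 < p i := fun i => hc0.trans_le (hc i)
  have hp : ∀ i, 0 ≤ p i := fun i => (hp0 i).le
  have hN0 : 0 < N := by linarith
  have hD0 : 0 < D := by linarith
  have hφ := phi_pos hp0 2
  have hs1 : 1 ≤ √D := Real.one_le_sqrt.mpr hD
  have hsq : √D ^ 2 = D := Real.sq_sqrt hD0.le
  have hsD : √D ≤ D := by nlinarith
  have hsN : √D ≤ N := by
    rw [Real.sqrt_le_left hN0.le]; nlinarith
  have hmass : ∀ x, wordMass p K x ≤ 1 / N := fun x => by
    rw [le_div_iff₀ hN0, mul_comm]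
    exact (mul_le_mul_of_nonneg_left (wordMass_le_pow hp hb K x) hN0.le).trans hK
  have hlogφ : Real.log (phi p 2) ≤ 0 := Real.log_nonpos hφ.le hφ1
  have hlb : 0 < Real.log (1 / b) := Real.log_pos (by rw [lt_div_iff₀ hb0]; linarith)
  set τ := √D / N with hτdef
  have hNτ : N * τ = √D := by rw [hτdef]; field_simp
  have hτ0 : 0 < τ := by positivity
  have hτ1 : τ ≤ 1 := by rw [hτdef, div_le_one hN0]; exact hsN
  have hτ : ∀ x, wordMass p K x ≤ τ := fun x =>
    (hmass x).trans (div_le_div_of_nonneg_right hs1 hN0.le)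
  set A : ℕ → ℝ := fun x => ∑ w ∈ range x, wordMass p K w with hA
  have hAx : ∀ x ∈ Ico y T₁, ∑ w ∈ Ico y x, N * wordMass p K w = N * A x - N * A y := by
    intro x hx
    rw [← mul_sum, sum_Ico_eq_sub _ (mem_Ico.mp hx).1, mul_sub]
  set Y := (Ico y T₁).filter fun x => N * A x - N * A y ≤ 3 * W * D with hY
  set B := Y.image (stopPrefix p K τ) with hB
  have hXK : Ico y T₁ ⊆ range (k ^ K) := fun x hx =>
    mem_range.mpr ((mem_Ico.mp hx).2.trans_le hT₁)
  have h1 := sum_near_sq_le hp1 hc0 hc1 hc hτ1 hτ hN0 hXK (f := fun x => (N * wordMass p K x) ^ 2)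
    (s := N * A y) (fun x => sq_nonneg _) (W := W) (by linarith) S (B := B) (by
      intro d hd x hx h
      refine mem_image_of_mem _ (mem_filter.mpr ⟨hx, ?_⟩)
      have h2 := (abs_le.mp h).2
      have h3 := hS d hd
      rw [hNτ] at h2
      have h4 : W * √D ≤ W * D := by gcongr
      have h5 : 1 * D ≤ W * D := by gcongr
      change N * A x - N * A y - d ≤ W * √D at h2
      linarith)
  rw [hNτ] at h1
  have hlhs : ∑ d ∈ S, (∑ x ∈ (Ico y T₁).filter
        (fun x => |(∑ w ∈ Ico y x, N * wordMass p K w) - d| ≤ W * √D),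
          (N * wordMass p K x) ^ 2) ^ 2 =
      ∑ d ∈ S, (∑ x ∈ (Ico y T₁).filter (fun x => |N * A x - N * A y - d| ≤ W * √D),
          (N * wordMass p K x) ^ 2) ^ 2 := by
    refine sum_congr rfl fun d _ => ?_
    congr 2
    refine filter_congr fun x hx => ?_
    rw [hAx x hx]
  rw [hlhs]
  refine h1.trans ?_
  have h2 : ∑ v ∈ B, (∑ z ∈ (range (k ^ K)).filter (fun z => stopPrefix p K τ z = v),
      (N * wordMass p K z) ^ 2) ^ 2 ≤
      √D ^ 4 * phi p 2 ^ (2 * K) * (1 / (c * τ)) ^ θ *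
        ∑ x ∈ (range (k ^ K)).filter (fun z => stopPrefix p K τ z ∈ B),
          wordMass (tilt p θ) K x := by
    rw [← sum_fiberwise_eq_sum_filter, mul_sum]
    refine sum_le_sum fun v hv => ?_
    obtain ⟨x, hx, rfl⟩ := mem_image.mp hv
    rw [← hNτ]
    exact sum_block_sq_le hc0 hc1 hc hτ1 hτ hN0 hθ0 hθ
      (mem_range.mp (hXK (mem_filter.mp hx).1))
  -- The relevant words occupy a stretch of mass of order `W D / N`, hence only of order `W / c`
  -- prefixes of mass about `D / N`. The minimum keeps the threshold a probability; as `D ≤ 8 N`, it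
  -- costs a factor `8`.
  set τ' := min (D / N) 1 with hτ'
  have hτ'0 : 0 < τ' := lt_min (by positivity) one_pos
  have hτ'D : τ' ≤ D / N := min_le_left _ _
  have hDτ' : D / N ≤ 8 * τ' := by
    rw [hτ', mul_min_of_nonneg _ _ (by norm_num : (0 : ℝ) ≤ 8)]
    refine le_min ?_ ?_
    · have : 0 ≤ D / N := by positivity
      linarith
    · rw [mul_one, div_le_iff₀ hN0]; exact hDN
  have hττ' : τ ≤ D / N := div_le_div_of_nonneg_right hsD hN0.le
  have hWDN : 0 ≤ 3 * W * D / N := by positivity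
  have h3 := sum_tilt_window_le hp1 hc0 hc1 hc (min_le_right _ _ : τ' ≤ 1)
    (fun x => le_min ((hmass x).trans (div_le_div_of_nonneg_right hD hN0.le))
      ((hmass x).trans (by rw [div_le_one hN0]; linarith))) hθ0 hb hb1 hb0
      (by rw [hθ]; exact pow_le_one₀ hφ.le hφ1)
      (X := (range (k ^ K)).filter (fun z => stopPrefix p K τ z ∈ B)) (filter_subset _ _)
      (lo := A y - τ) (hi := A y + 3 * W * D / N + τ) (by linarith) (by
        intro z hz
        rw [mem_filter, hB, mem_image] at hz
        obtain ⟨hz, x, hx, hxz⟩ := hz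
        rw [hY, mem_filter] at hx
        have h4 := abs_le.mp (abs_sub_le_of_stopPrefix_eq hp hp1 hτ
          (mem_range.mp (hXK hx.1)) (mem_range.mp hz) hxz.symm)
        have h5 : A x ≤ A y + 3 * W * D / N := by
          rw [← sub_le_iff_le_add', le_div_iff₀ hN0]; linarith [hx.2]
        have h6 : A y ≤ A x := by
          refine sum_le_sum_of_subset_of_nonneg ?_ fun w _ _ => wordMass_nonneg hp _ _
          exact range_subset_range.mpr (mem_Ico.mp hx.1).1
        change -τ ≤ A z - A x ∧ A z - A x ≤ τ at h4
        constructor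
        · change A y - τ ≤ A z; linarith
        · change A z ≤ _; linarith)
  have h4 : (A y + 3 * W * D / N + τ - (A y - τ) + 3 * τ') / (c * τ') ≤ 43 * W / c := by
    rw [div_le_div_iff₀ (by positivity) hc0]
    have e1 : 3 * W * D / N ≤ 24 * W * τ' := by
      have := mul_le_mul_of_nonneg_left hDτ' (by positivity : 0 ≤ 3 * W)
      calc 3 * W * D / N = 3 * W * (D / N) := by ring
        _ ≤ 3 * W * (8 * τ') := this
        _ = _ := by ring
    have e2 : 1 * τ' ≤ W * τ' := by gcongr
    have e3 : A y + 3 * W * D / N + τ - (A y - τ) + 3 * τ' ≤ 43 * W * τ' := by linarith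
    nlinarith
  have h5 : τ' ^ θ * (1 / (c * τ)) ^ θ ≤ (√D / c) ^ θ := by
    rw [← Real.mul_rpow hτ'0.le (by positivity)]
    refine Real.rpow_le_rpow (by positivity) ?_ hθ0
    have e : √D / c = D / N * (1 / (c * τ)) := by
      rw [hτdef]; field_simp; exact hsq
    rw [e]
    gcongr
  have h6 : Real.log (1 / τ') ≤ Real.log (8 * N / D) := by
    refine Real.log_le_log (by positivity) ?_
    rw [div_le_div_iff₀ hτ'0 hD0]
    rw [div_le_iff₀ hN0] at hDτ'
    linarith
  have h7 : Real.exp (-Real.log (phi p θ) * (1 + Real.log (1 / τ') / Real.log (1 / b))) ≤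
      Real.exp (-(2 * Real.log (phi p 2)) * (1 + Real.log (8 * N / D) / Real.log (1 / b))) := by
    apply Real.exp_le_exp.mpr
    rw [hθ, Real.log_pow]
    push_cast
    refine mul_le_mul_of_nonneg_left ?_ (by linarith)
    gcongr
  set E := Real.exp (-(2 * Real.log (phi p 2)) * (1 + Real.log (8 * N / D) / Real.log (1 / b)))
  have h8 : (2 * W + 3) / c ≤ 5 * W / c := div_le_div_of_nonneg_right (by linarith) hc0.le
  have h9 : (2 * W + 1) * √D + 1 ≤ 4 * W * √D := by nlinarith
  calc _ ≤ 5 * W / c * (4 * W * √D) * (√D ^ 4 * phi p 2 ^ (2 * K) * (1 / (c * τ)) ^ θ *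
        (43 * W / c * (τ' ^ θ * E))) := by
        refine mul_le_mul (mul_le_mul h8 h9 (by positivity) (by positivity)) (h2.trans ?_)
          (sum_nonneg fun _ _ => sq_nonneg _) (by positivity)
        refine mul_le_mul_of_nonneg_left (h3.trans ?_) (by positivity)
        refine mul_le_mul h4 (mul_le_mul_of_nonneg_left h7 (by positivity)) (by positivity)
          (by positivity)
    _ = 860 * W ^ 3 / c ^ 2 * (√D ^ 5 * (τ' ^ θ * (1 / (c * τ)) ^ θ)) *
          (phi p 2 ^ (2 * K) * E) := by field_simp; ring
    _ ≤ _ := by gcongr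

theorem sum_pois_le_one {a : ℝ} (ha : 0 ≤ a) (D : ℕ) : ∑ d ∈ range D, pois a d ≤ 1 := by
  simp only [pois]
  rw [← mul_sum, Real.exp_neg, inv_mul_le_iff₀ (Real.exp_pos _), mul_one]
  exact Real.sum_le_exp_of_nonneg ha D

/-- The collision sum, split into scales and a negligible far part. -/
theorem sum_collision_le {n : ℕ} (hp1 : ∑ i, p i = 1) (hp : ∀ i, 0 < p i) (hb : ∀ i, p i ≤ b)
    (hn : 1 ≤ n) (hK : n * b ^ K ≤ 1) {W H : ℝ} (hW : 1 ≤ W) (hWn : W ^ 2 ≤ n) {y T₁ : ℕ}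
    (hT₁ : T₁ ≤ k ^ K)
    (hH : ∀ D : ℝ, 1 ≤ D → D ≤ 8 * n → ∀ S : Finset ℕ, (∀ d ∈ S, (d : ℝ) ≤ 2 * D) →
      ∑ d ∈ S, (∑ x ∈ (Ico y T₁).filter
        (fun x => |(∑ w ∈ Ico y x, n * wordMass p K w) - d| ≤ W * √D),
          (n * wordMass p K x) ^ 2) ^ 2 ≤ D * H) (D' : ℕ) :
    ∑ d ∈ range D', (∑ x ∈ Ico y T₁, pois (∑ w ∈ Ico y x, n * wordMass p K w) d *
        (n * wordMass p K x) ^ 2) ^ 2 ≤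
      2 * ((Nat.log 2 (8 * n) + 1) * H) + 2 * (n ^ 2 * Real.exp (-(W / 10))) := by
  classical
  have hp' : ∀ i, 0 ≤ p i := fun i => (hp i).le
  have hn0 : (1 : ℝ) ≤ n := by exact_mod_cast hn
  set a : ℕ → ℝ := fun x => ∑ w ∈ Ico y x, n * wordMass p K w with ha
  set ℓ : ℕ → ℝ := fun x => (n * wordMass p K x) ^ 2 with hℓ
  have hℓ0 : ∀ x, 0 ≤ ℓ x := fun x => sq_nonneg _
  have hw0 : ∀ x, 0 ≤ n * wordMass p K x := fun x =>
    mul_nonneg n.cast_nonneg (wordMass_nonneg hp' K x)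
  have hw1 : ∀ x, n * wordMass p K x ≤ 1 := fun x =>
    (mul_le_mul_of_nonneg_left (wordMass_le_pow hp' hb K x) n.cast_nonneg).trans hK
  have ha0 : ∀ x, 0 ≤ a x := fun x => sum_nonneg fun w _ => hw0 w
  have htot : ∀ x ≤ k ^ K, ∑ w ∈ Ico y x, n * wordMass p K w ≤ n := by
    intro x hx
    rw [← mul_sum]
    refine mul_le_of_le_one_right n.cast_nonneg ?_
    have h := sum_wordMass p K
    rw [hp1, one_pow] at h
    rw [← h]
    refine sum_le_sum_of_subset_of_nonneg (fun w hw => ?_) fun w _ _ => wordMass_nonneg hp' _ _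
    exact mem_range.mpr ((mem_Ico.mp hw).2.trans_le hx)
  have han : ∀ x ∈ Ico y T₁, a x ≤ n := fun x hx => htot x ((mem_Ico.mp hx).2.le.trans hT₁)
  have hℓn : ∑ x ∈ Ico y T₁, ℓ x ≤ n := by
    refine le_trans (sum_le_sum fun x _ => ?_) (htot T₁ hT₁)
    simp only [hℓ, sq]
    exact mul_le_of_le_one_right (hw0 x) (hw1 x)
  -- The dyadic scale of `d`; since `Nat.log 2 0 = 0`, the distance `0` has scale `1`.
  set sc : ℕ → ℝ := fun d => (2 : ℝ) ^ Nat.log 2 d with hsc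
  have hsc1 : ∀ d, 1 ≤ sc d := fun d => one_le_pow₀ one_le_two
  have hsc2 : ∀ d, sc d ≤ max (d : ℝ) 1 := by
    intro d
    rcases Nat.eq_zero_or_pos d with rfl | hd
    · simp [hsc]
    · refine le_max_of_le_left ?_
      simp only [hsc]
      exact_mod_cast Nat.pow_log_le_self 2 hd.ne'
  have hsc3 : ∀ d : ℕ, (d : ℝ) ≤ 2 * sc d := by
    intro d
    have := (Nat.lt_pow_succ_log_self (by norm_num : 1 < 2) d).le
    rw [pow_succ'] at this
    simp only [hsc]
    exact_mod_cast this
  set near : ℕ → Finset ℕ := fun d => (Ico y T₁).filter fun x => |a x - d| ≤ W * √(sc d)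
    with hnear
  set far : ℕ → Finset ℕ := fun d => (Ico y T₁).filter fun x => ¬ |a x - d| ≤ W * √(sc d)
    with hfar
  set P : ℕ → ℝ := fun d => ∑ x ∈ near d, pois (a x) d * ℓ x with hP
  set R : ℕ → ℝ := fun d => ∑ x ∈ far d, pois (a x) d * ℓ x with hR
  have hP0 : ∀ d, 0 ≤ P d := fun d => sum_nonneg fun x _ => mul_nonneg (pois_nonneg (ha0 x) d) (hℓ0 x)
  have hR0 : ∀ d, 0 ≤ R d := fun d => sum_nonneg fun x _ => mul_nonneg (pois_nonneg (ha0 x) d) (hℓ0 x)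
  have hsplit : ∀ d, (∑ x ∈ Ico y T₁, pois (a x) d * ℓ x) ^ 2 ≤ 2 * P d ^ 2 + 2 * R d ^ 2 := by
    intro d
    rw [← sum_filter_add_sum_filter_not (Ico y T₁) (fun x => |a x - d| ≤ W * √(sc d))]
    change (P d + R d) ^ 2 ≤ _
    nlinarith [sq_nonneg (P d - R d)]
  -- One factor `R d` is bounded by the Poisson tail, the other is summed over `d` using that
  -- Poisson weights add up to at most `1`.
  have hRsum : ∑ d ∈ range D', R d ^ 2 ≤ n ^ 2 * Real.exp (-(W / 10)) := by
    have h1 : ∀ d, R d ≤ n * Real.exp (-(W / 10)) := by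
      intro d
      calc R d ≤ ∑ x ∈ far d, Real.exp (-(W / 10)) * ℓ x := by
            refine sum_le_sum fun x hx => mul_le_mul_of_nonneg_right ?_ (hℓ0 x)
            exact pois_le_exp_of_far (ha0 x) (hsc1 d) hW (hsc3 d) (not_le.mp (mem_filter.mp hx).2).le
        _ ≤ Real.exp (-(W / 10)) * ∑ x ∈ Ico y T₁, ℓ x := by
            rw [← mul_sum]
            refine mul_le_mul_of_nonneg_left ?_ (Real.exp_pos _).le
            exact sum_le_sum_of_subset_of_nonneg (filter_subset _ _) fun x _ _ => hℓ0 x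
        _ ≤ _ := by rw [mul_comm]; gcongr
    have h2 : ∑ d ∈ range D', R d ≤ n := by
      calc ∑ d ∈ range D', R d ≤ ∑ d ∈ range D', ∑ x ∈ Ico y T₁, pois (a x) d * ℓ x :=
            sum_le_sum fun d _ => sum_le_sum_of_subset_of_nonneg (filter_subset _ _)
              fun x _ _ => mul_nonneg (pois_nonneg (ha0 x) d) (hℓ0 x)
        _ = ∑ x ∈ Ico y T₁, (∑ d ∈ range D', pois (a x) d) * ℓ x := by
            rw [sum_comm]; simp_rw [sum_mul]
        _ ≤ ∑ x ∈ Ico y T₁, 1 * ℓ x := by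
            refine sum_le_sum fun x _ => mul_le_mul_of_nonneg_right ?_ (hℓ0 x)
            exact sum_pois_le_one (ha0 x) D'
        _ ≤ n := by simpa using hℓn
    calc ∑ d ∈ range D', R d ^ 2 ≤ ∑ d ∈ range D', n * Real.exp (-(W / 10)) * R d := by
          refine sum_le_sum fun d _ => ?_
          rw [sq]
          exact mul_le_mul_of_nonneg_right (h1 d) (hR0 d)
      _ ≤ n * Real.exp (-(W / 10)) * n := by
          rw [← mul_sum]; gcongr
      _ = _ := by ring
  have hPnear : ∀ d, P d ^ 2 ≤ 1 / sc d * (∑ x ∈ near d, ℓ x) ^ 2 := by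
    intro d
    have h1 : P d ≤ 1 / √(sc d) * ∑ x ∈ near d, ℓ x := by
      rw [mul_sum]
      refine sum_le_sum fun x _ => mul_le_mul_of_nonneg_right ?_ (hℓ0 x)
      exact pois_le_one_div_sqrt (ha0 x) (zero_lt_one.trans_le (hsc1 d)) (hsc2 d)
    refine (pow_le_pow_left₀ (hP0 d) h1 2).trans_eq ?_
    rw [mul_pow, div_pow, one_pow, Real.sq_sqrt (zero_le_one.trans (hsc1 d))]
  -- All means are at most `n` and `W² ≤ n`, so no mean is within `W √(sc d)` of such a `d`. Only
  -- logarithmically many scales remain.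
  have hPfar : ∀ d, 8 * n < sc d → P d = 0 := by
    intro d hd
    have : near d = ∅ := by
      refine filter_eq_empty_iff.mpr fun x hx h => ?_
      have h1 := han x hx
      have h2 := (abs_le.mp h).1
      have h3 : sc d ≤ d := by
        have := hsc2 d
        rcases le_max_iff.mp this with h | h
        · exact h
        · linarith
      have hs := Real.sq_sqrt (zero_le_one.trans (hsc1 d))
      have hs0 := Real.sqrt_nonneg (sc d)
      have h4 : 7 / 8 * sc d < W * √(sc d) := by linarith
      have h5 : (7 / 8 * sc d) ^ 2 < (W * √(sc d)) ^ 2 :=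
        pow_lt_pow_left₀ h4 (by linarith [hsc1 d]) (by norm_num)
      rw [mul_pow W, hs, mul_pow] at h5
      have h6 : sc d * (49 / 64 * sc d) < sc d * W ^ 2 := by nlinarith
      have h7 := lt_of_mul_lt_mul_left h6 (zero_le_one.trans (hsc1 d))
      linarith
    rw [hP]; simp only [this, sum_empty]
  have hH0 : 0 ≤ H := by
    have := hH 1 le_rfl (by linarith) ∅ (by simp)
    simpa using this
  have hPsum : ∑ d ∈ range D', P d ^ 2 ≤ (Nat.log 2 (8 * n) + 1) * H := by
    have h1 : ∑ d ∈ range D', P d ^ 2 =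
        ∑ d ∈ (range D').filter (fun d => Nat.log 2 d ∈ range (Nat.log 2 (8 * n) + 1)),
          P d ^ 2 := by
      refine (sum_filter_of_ne fun d _ hne => ?_).symm
      by_contra hlt
      rw [mem_range, not_lt] at hlt
      refine hne ?_
      rw [hPfar d, zero_pow two_ne_zero]
      have h2 : 8 * n < 2 ^ Nat.log 2 d :=
        (Nat.lt_pow_succ_log_self (by norm_num : 1 < 2) _).trans_le
          (Nat.pow_le_pow_right (by norm_num) hlt)
      simp only [hsc]
      exact_mod_cast h2
    rw [h1, ← sum_fiberwise_eq_sum_filter]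
    have h2 : ∀ j ∈ range (Nat.log 2 (8 * n) + 1),
        ∑ d ∈ (range D').filter (fun d => Nat.log 2 d = j), P d ^ 2 ≤ H := by
      intro j hj
      have hj' : (2 : ℝ) ^ j ≤ 8 * n := by
        have : 2 ^ j ≤ 8 * n := (Nat.pow_le_pow_right (by norm_num)
          (Nat.lt_succ_iff.mp (mem_range.mp hj))).trans (Nat.pow_log_le_self 2 (by omega))
        exact_mod_cast this
      have h3 := hH (2 ^ j) (one_le_pow₀ one_le_two) hj'
        ((range D').filter (fun d => Nat.log 2 d = j)) (by
          intro d hd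
          have := hsc3 d
          rw [hsc] at this
          simp only [(mem_filter.mp hd).2] at this
          exact this)
      have hpos : (0 : ℝ) < 2 ^ j := by positivity
      calc ∑ d ∈ (range D').filter (fun d => Nat.log 2 d = j), P d ^ 2
          ≤ ∑ d ∈ (range D').filter (fun d => Nat.log 2 d = j),
              1 / 2 ^ j * (∑ x ∈ (Ico y T₁).filter (fun x => |a x - d| ≤ W * √(2 ^ j)), ℓ x) ^ 2 := by
            refine sum_le_sum fun d hd => ?_
            have h4 := hPnear d
            simp only [hnear, hsc, (mem_filter.mp hd).2] at h4
            exact h4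
        _ ≤ 1 / 2 ^ j * (2 ^ j * H) := by
            rw [← mul_sum]
            exact mul_le_mul_of_nonneg_left h3 (by positivity)
        _ = H := by field_simp
    refine (sum_le_sum h2).trans_eq ?_
    rw [sum_const, card_range, nsmul_eq_mul]
    push_cast
    ring
  calc ∑ d ∈ range D', (∑ x ∈ Ico y T₁, pois (a x) d * ℓ x) ^ 2
      ≤ ∑ d ∈ range D', (2 * P d ^ 2 + 2 * R d ^ 2) := sum_le_sum fun d _ => hsplit d
    _ = 2 * ∑ d ∈ range D', P d ^ 2 + 2 * ∑ d ∈ range D', R d ^ 2 := by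
        rw [sum_add_distrib, mul_sum, mul_sum]
    _ ≤ _ := by gcongr

end Collision

/-! ### The letter probabilities and the cutoff constant -/

section Letters

variable {k : ℕ} {p : Fin k → ℝ}

theorem le_pMax (p : Fin k → ℝ) (i : Fin k) : p i ≤ pMax p :=
  le_ciSup (Set.finite_range p).bddAbove i

theorem exists_eq_pMax [NeZero k] (p : Fin k → ℝ) : ∃ i, p i = pMax p :=
  exists_eq_ciSup_of_finite

theorem pMax_pos [NeZero k] (hp : ∀ i, 0 < p i) : 0 < pMax p :=
  (hp 0).trans_le (le_pMax p 0)

theorem lt_one_of_sum_eq_one (hk : 2 ≤ k) (hp : ∀ i, 0 < p i) (hp1 : ∑ i, p i = 1) (i : Fin k) :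
    p i < 1 := by
  have : Nontrivial (Fin k) := Fin.nontrivial_iff_two_le.mpr hk
  obtain ⟨j, hj⟩ := exists_ne i
  have h := sum_le_sum_of_subset_of_nonneg (f := p) (subset_univ {i, j}) fun x _ _ => (hp x).le
  rw [sum_pair hj.symm, hp1] at h
  linarith [hp j]

theorem pMax_lt_one [NeZero k] (hk : 2 ≤ k) (hp : ∀ i, 0 < p i) (hp1 : ∑ i, p i = 1) :
    pMax p < 1 := by
  obtain ⟨i, hi⟩ := exists_eq_pMax p
  exact hi ▸ lt_one_of_sum_eq_one hk hp hp1 i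

theorem phi_add_one_le [NeZero k] (hp : ∀ i, 0 < p i) (hp1 : ∑ i, p i = 1) (r : ℕ) :
    phi p (r + 1 : ℕ) ≤ pMax p ^ r := by
  simp only [phi, Real.rpow_natCast]
  calc ∑ i, p i ^ (r + 1) ≤ ∑ i, pMax p ^ r * p i := by
        refine sum_le_sum fun i _ => ?_
        rw [pow_succ]
        exact mul_le_mul_of_nonneg_right (pow_le_pow_left₀ (hp i).le (le_pMax p i) r) (hp i).le
    _ = _ := by rw [← mul_sum, hp1, mul_one]

theorem phi_two_le [NeZero k] (hp : ∀ i, 0 < p i) (hp1 : ∑ i, p i = 1) : phi p 2 ≤ pMax p := by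
  have := phi_add_one_le hp hp1 1
  rw [pow_one] at this
  exact_mod_cast this

theorem psi_two_pos [NeZero k] (hk : 2 ≤ k) (hp : ∀ i, 0 < p i) (hp1 : ∑ i, p i = 1) :
    0 < psi p 2 :=
  neg_pos.mpr (Real.log_neg (phi_pos hp 2) ((phi_two_le hp hp1).trans_lt (pMax_lt_one hk hp hp1)))

theorem exists_pos_le [NeZero k] (hp : ∀ i, 0 < p i) : ∃ c, 0 < c ∧ ∀ i, c ≤ p i := by
  obtain ⟨i, hi⟩ := Finite.exists_min p
  exact ⟨p i, hp i, hi⟩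

theorem log_inv_pMax_pos [NeZero k] (hk : 2 ≤ k) (hp : ∀ i, 0 < p i) (hp1 : ∑ i, p i = 1) :
    0 < Real.log (1 / pMax p) :=
  Real.log_pos (by rw [lt_div_iff₀ (pMax_pos hp), one_mul]; exact pMax_lt_one hk hp hp1)

theorem cutoffConst_pos [NeZero k] (hk : 2 ≤ k) (hp : ∀ i, 0 < p i) (hp1 : ∑ i, p i = 1) (θ : ℝ) :
    0 < cutoffConst p θ :=
  lt_max_of_lt_left (one_div_pos.mpr (log_inv_pMax_pos hk hp hp1))

theorem phi_eq_sq_of_psi_eq [NeZero k] (hp : ∀ i, 0 < p i) {θ : ℝ}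
    (h : psi p θ = 2 * psi p 2) : phi p θ = phi p 2 ^ 2 := by
  have h1 : Real.log (phi p θ) = Real.log (phi p 2 ^ 2) := by
    rw [Real.log_pow]; simp only [psi] at h; push_cast; linarith
  exact Real.log_injOn_pos (phi_pos hp θ) (pow_pos (phi_pos hp 2) 2) h1

theorem phi_rev (p : Fin k → ℝ) (t : ℝ) : phi (p ∘ Fin.rev) t = phi p t :=
  Equiv.sum_comp Fin.revPerm fun i => p i ^ t

theorem psi_rev (p : Fin k → ℝ) (t : ℝ) : psi (p ∘ Fin.rev) t = psi p t := by
  rw [psi, phi_rev, psi]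

theorem pMax_rev (p : Fin k → ℝ) : pMax (p ∘ Fin.rev) = pMax p :=
  Equiv.iSup_comp (g := p) Fin.revPerm

theorem cutoffConst_rev (p : Fin k → ℝ) (θ : ℝ) : cutoffConst (p ∘ Fin.rev) θ = cutoffConst p θ := by
  rw [cutoffConst, pMax_rev, psi_rev, cutoffConst]

theorem scale_exponent_le {θ κ Λ ℓ : ℝ} {M : ℕ} (hψ : 0 < psi p 2)
    (hM : κ * Λ < M + 1) (hℓ0 : 0 ≤ ℓ) (hℓ : ℓ ≤ Real.log 8 + Λ) :
    (5 + θ) / 2 * ℓ - 2 * psi p 2 * M + 2 * psi p 2 * (1 + (Real.log 8 + Λ - ℓ) /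
      Real.log (1 / pMax p)) ≤
    ℓ + 2 * psi p 2 * (2 + cutoffConst p θ * Real.log 8) -
      2 * psi p 2 * (κ - cutoffConst p θ) * Λ := by
  have h1 : 1 / Real.log (1 / pMax p) ≤ cutoffConst p θ := le_max_left _ _
  have h2 : (3 + θ) / (4 * psi p 2) ≤ cutoffConst p θ := le_max_right _ _
  have h3 : (3 + θ) / (4 * psi p 2) * ℓ + (Real.log 8 + Λ - ℓ) * (1 / Real.log (1 / pMax p)) ≤
      cutoffConst p θ * (Real.log 8 + Λ) := by nlinarith
  have h4 : (3 + θ) / 2 * ℓ = 2 * psi p 2 * ((3 + θ) / (4 * psi p 2) * ℓ) := by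
    field_simp; ring
  have h5 := mul_le_mul_of_nonneg_left h3 (by positivity : 0 ≤ 2 * psi p 2)
  have h6 := mul_le_mul_of_nonneg_left hM.le (by positivity : 0 ≤ 2 * psi p 2)
  rw [div_eq_mul_one_div (Real.log 8 + Λ - ℓ)]
  nlinarith

end Letters

/-! ### The collision sum above the cutoff -/

section Supercritical

open Filter Topology

variable {k : ℕ} [NeZero k] {p : Fin k → ℝ}

theorem tendsto_log_natCast_atTop : Tendsto (fun n : ℕ => Real.log n) atTop atTop :=
  Real.tendsto_log_atTop.comp tendsto_natCast_atTop_atTop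

/-- The expected number of cards with a given label tends to zero. -/
theorem eventually_mul_pMax_pow_le (hk : 2 ≤ k) (hp : ∀ i, 0 < p i) (hp1 : ∑ i, p i = 1) {κ s : ℝ}
    (hs : s < κ * Real.log (1 / pMax p)) :
    ∀ᶠ n : ℕ in atTop, (n : ℝ) ^ s * pMax p ^ ⌊κ * Real.log n⌋₊ ≤ 1 := by
  have hlb := log_inv_pMax_pos hk hp hp1
  have hb0 := pMax_pos hp
  have hlim := tendsto_log_natCast_atTop.const_mul_atTop (sub_pos.mpr hs)
  filter_upwards [hlim.eventually_ge_atTop (Real.log (1 / pMax p)), eventually_ge_atTop 1]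
    with n hn hn1
  have hn0 : (0 : ℝ) < n := by exact_mod_cast hn1
  rw [← Real.log_nonpos_iff (by positivity), Real.log_mul (by positivity) (by positivity),
    Real.log_pow, Real.log_rpow hn0]
  have h1 := Nat.lt_floor_add_one (κ * Real.log n)
  have e : Real.log (pMax p) = -Real.log (1 / pMax p) := by rw [one_div, Real.log_inv, neg_neg]
  rw [e]
  nlinarith

theorem exists_collision_bound (hk : 2 ≤ k) (hp : ∀ i, 0 < p i) (hp1 : ∑ i, p i = 1) {θ κ : ℝ}
    (hθ0 : 0 < θ) (hθ : phi p θ = phi p 2 ^ 2) (hκ : cutoffConst p θ < κ) :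
    ∃ η : ℕ → ℝ, Tendsto η atTop (𝓝 0) ∧ ∀ᶠ n : ℕ in atTop, ∀ y T₁ D' : ℕ,
      T₁ ≤ k ^ ⌊κ * Real.log n⌋₊ →
      ∑ d ∈ range D', (∑ x ∈ Ico y T₁,
        pois (∑ w ∈ Ico y x, n * wordMass p ⌊κ * Real.log n⌋₊ w) d *
          (n * wordMass p ⌊κ * Real.log n⌋₊ x) ^ 2) ^ 2 ≤ η n := by
  obtain ⟨c, hc0, hc⟩ := exists_pos_le hp
  have hc1 : c ≤ 1 := (hc 0).trans (lt_one_of_sum_eq_one hk hp hp1 0).le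
  have hψ := psi_two_pos hk hp hp1
  have hφ := phi_pos hp 2
  have hb0 := pMax_pos hp
  have hb1 := pMax_lt_one hk hp hp1
  have hlb := log_inv_pMax_pos hk hp hp1
  have hC := cutoffConst_pos hk hp hp1 θ
  have hκ1 : 1 / Real.log (1 / pMax p) < κ := (le_max_left _ _).trans_lt hκ
  set δ := 2 * psi p 2 * (κ - cutoffConst p θ) with hδdef
  have hδ : 0 < δ := mul_pos (by positivity) (sub_pos.mpr hκ)
  -- The tolerance will be `W = n ^ δ'`. The bound `δ / 6` lets `W ^ 3` consume at most half of the
  -- gain `n ^ (-δ)`, and `1 / 2` ensures `W ^ 2 ≤ n`.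
  set δ' := min (δ / 6) (1 / 2) with hδ'def
  have hδ' : 0 < δ' := by positivity
  set A := 860 / c ^ 2 * (1 / c) ^ θ *
    Real.exp (2 * psi p 2 * (2 + cutoffConst p θ * Real.log 8)) with hA
  have hA0 : 0 < A := by positivity
  refine ⟨fun n => 2 * (((Real.log 8 + Real.log n) / Real.log 2 + 1) *
    (A * (n : ℝ) ^ (-(δ / 2)))) + 2 * ((n : ℝ) ^ 2 * Real.exp (-((n : ℝ) ^ δ' / 10))), ?_, ?_⟩
  · have t0 : Tendsto (fun n : ℕ => (n : ℝ)) atTop atTop := tendsto_natCast_atTop_atTop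
    have t1 : Tendsto (fun n : ℕ => (n : ℝ) ^ (-(δ / 2))) atTop (𝓝 0) :=
      (tendsto_rpow_neg_atTop (by positivity)).comp t0
    have t2 : Tendsto (fun n : ℕ => Real.log n * (n : ℝ) ^ (-(δ / 2))) atTop (𝓝 0) := by
      have h := ((isLittleO_log_rpow_atTop (by positivity : 0 < δ / 2)).tendsto_div_nhds_zero).comp t0
      refine h.congr fun n => ?_
      simp only [Function.comp_apply]
      rw [Real.rpow_neg n.cast_nonneg, div_eq_mul_inv]
    have t3 : Tendsto (fun n : ℕ => (n : ℝ) ^ 2 * Real.exp (-((n : ℝ) ^ δ' / 10))) atTop (𝓝 0) := by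
      have h := (tendsto_rpow_mul_exp_neg_mul_atTop_nhds_zero (2 / δ') (1 / 10) (by norm_num)).comp
        ((tendsto_rpow_atTop hδ').comp t0)
      refine h.congr fun n => ?_
      simp only [Function.comp_apply]
      rw [← Real.rpow_mul n.cast_nonneg, mul_div_cancel₀ _ hδ'.ne', Real.rpow_two]
      congr 2
      ring
    have t4 := ((t1.const_mul ((Real.log 8 / Real.log 2 + 1) * A)).add
      (t2.const_mul (A / Real.log 2))).const_mul 2
    have t5 := t4.add (t3.const_mul 2)
    simp only [mul_zero, add_zero] at t5
    refine t5.congr fun n => ?_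
    ring
  · have e1 := eventually_mul_pMax_pow_le hk hp hp1 (s := 1) (by
      rwa [div_lt_iff₀ hlb] at hκ1)
    filter_upwards [e1, eventually_ge_atTop 8] with n hnK hn8 y T₁ D' hT₁
    set M := ⌊κ * Real.log n⌋₊
    have hn8' : (8 : ℝ) ≤ n := by exact_mod_cast hn8
    have hn1 : (1 : ℝ) ≤ n := by linarith
    have hn0 : (0 : ℝ) < n := by linarith
    rw [Real.rpow_one] at hnK
    have hW1 : 1 ≤ (n : ℝ) ^ δ' := Real.one_le_rpow hn1 hδ'.le
    have hW2 : ((n : ℝ) ^ δ') ^ 2 ≤ n := by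
      rw [← Real.rpow_natCast, ← Real.rpow_mul hn0.le]
      conv_rhs => rw [← Real.rpow_one (n : ℝ)]
      refine Real.rpow_le_rpow_of_exponent_le hn1 ?_
      have := min_le_right (δ / 6) (1 / 2)
      push_cast; linarith
    have hW3 : ((n : ℝ) ^ δ') ^ 3 * (n : ℝ) ^ (-δ) ≤ (n : ℝ) ^ (-(δ / 2)) := by
      rw [← Real.rpow_natCast, ← Real.rpow_mul hn0.le, ← Real.rpow_add hn0]
      refine Real.rpow_le_rpow_of_exponent_le hn1 ?_
      have := min_le_left (δ / 6) (1 / 2)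
      push_cast; linarith
    refine (sum_collision_le (b := pMax p) (H := A * (n : ℝ) ^ (-(δ / 2))) hp1 hp (le_pMax p)
      (by omega) hnK hW1 hW2 hT₁ ?_ D').trans ?_
    · intro D hD1 hD8 S hS
      have hD0 : 0 < D := by linarith
      refine (sum_near_sq_le_of_scale hp1 hc0 hc1 hc (le_pMax p) hb1 hb0 hθ0.le hθ
        ((phi_two_le hp hp1).trans hb1.le) hn8' hnK hD1 hD8 hW1 S hS hT₁).trans ?_
      have hsd : 0 < √D := Real.sqrt_pos.mpr hD0
      have hexp : √D ^ 5 * √D ^ θ * (phi p 2 ^ (2 * M) * Real.exp (-(2 * Real.log (phi p 2)) *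
          (1 + Real.log (8 * n / D) / Real.log (1 / pMax p)))) ≤
          D * (Real.exp (2 * psi p 2 * (2 + cutoffConst p θ * Real.log 8)) * (n : ℝ) ^ (-δ)) := by
        have hs : √D = Real.exp (Real.log D / 2) := by
          rw [← Real.log_sqrt hD0.le, Real.exp_log hsd]
        have hl : Real.log (8 * n / D) = Real.log 8 + Real.log n - Real.log D := by
          rw [Real.log_div (by positivity) hD0.ne', Real.log_mul (by norm_num) hn0.ne']
        have hφe : phi p 2 ^ (2 * M) = Real.exp (-(2 * psi p 2 * M)) := by
          rw [psi]
          have : -(2 * -Real.log (phi p 2) * M) = (2 * M : ℕ) * Real.log (phi p 2) := by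
            push_cast; ring
          rw [this, Real.exp_nat_mul, Real.exp_log hφ]
        have hDe : D = Real.exp (Real.log D) := (Real.exp_log hD0).symm
        have e5 : √D ^ 5 * √D ^ θ = Real.exp ((5 + θ) / 2 * Real.log D) := by
          rw [hs, ← Real.exp_nat_mul, ← Real.exp_mul, ← Real.exp_add]
          congr 1; push_cast; ring
        have h := scale_exponent_le (p := p) (θ := θ) (κ := κ) (Λ := Real.log n)
          (ℓ := Real.log D) (M := M) hψ (Nat.lt_floor_add_one _) (Real.log_nonneg hD1) (by
            rw [← Real.log_mul (by norm_num) hn0.ne']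
            exact Real.log_le_log hD0 hD8)
        rw [e5, hφe, hl, Real.rpow_def_of_pos hn0, ← Real.exp_add, ← Real.exp_add, ← Real.exp_add]
        conv_rhs => rw [hDe, ← Real.exp_add]
        apply Real.exp_le_exp.mpr
        have e6 : -(2 * Real.log (phi p 2)) = 2 * psi p 2 := by rw [psi]; ring
        rw [e6]
        linarith
      rw [Real.div_rpow hsd.le hc0.le]
      calc _ = 860 * ((n : ℝ) ^ δ') ^ 3 / c ^ 2 * (1 / c) ^ θ * (√D ^ 5 * √D ^ θ *
            (phi p 2 ^ (2 * M) * Real.exp (-(2 * Real.log (phi p 2)) *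
              (1 + Real.log (8 * n / D) / Real.log (1 / pMax p))))) := by
            rw [Real.div_rpow zero_le_one hc0.le, Real.one_rpow]; ring
        _ ≤ 860 * ((n : ℝ) ^ δ') ^ 3 / c ^ 2 * (1 / c) ^ θ * (D *
            (Real.exp (2 * psi p 2 * (2 + cutoffConst p θ * Real.log 8)) * (n : ℝ) ^ (-δ))) := by
            gcongr
        _ = D * (A * (((n : ℝ) ^ δ') ^ 3 * (n : ℝ) ^ (-δ))) := by rw [hA]; ring
        _ ≤ _ := by gcongr
    · have hl : (Nat.log 2 (8 * n) : ℝ) ≤ (Real.log 8 + Real.log n) / Real.log 2 := by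
        have := Real.natLog_le_logb (8 * n) 2
        rw [Real.logb] at this
        push_cast at this
        rwa [Real.log_mul (by norm_num) hn0.ne'] at this
      gcongr

end Supercritical

/-! ### Mixing above the cutoff -/

section Upper

open Filter Topology

theorem exists_range_sum_between {f : ℕ → ℝ} {T : ℕ} {ε α : ℝ} (hfε : ∀ x, f x ≤ ε)
    (hα : 0 < α) (h : α ≤ ∑ x ∈ range T, f x) :
    ∃ T' ≤ T, α ≤ ∑ x ∈ range T', f x ∧ ∑ x ∈ range T', f x ≤ α + ε := by
  classical
  have hex : ∃ T', α ≤ ∑ x ∈ range T', f x := ⟨T, h⟩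
  refine ⟨Nat.find hex, Nat.find_min' hex h, Nat.find_spec hex, ?_⟩
  rcases Nat.eq_zero_or_pos (Nat.find hex) with h0 | h0
  · have := Nat.find_spec hex
    rw [h0, sum_range_zero] at this
    linarith
  · have h1 := Nat.find_min hex (Nat.sub_lt h0 one_pos)
    rw [not_le] at h1
    obtain ⟨m, hm⟩ := Nat.exists_eq_add_of_lt h0
    rw [zero_add] at hm
    rw [hm, Nat.add_sub_cancel] at h1
    rw [hm, sum_range_succ]
    linarith [hfε m]

variable {k : ℕ} [NeZero k] {p : Fin k → ℝ}

theorem tvDist_le_of_collision_le (hp : ∀ i, 0 < p i) (hp1 : ∑ i, p i = 1) {N K L : ℕ}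
    (hN : 16 ≤ N) (hL : 1 ≤ L) (hK : N * pMax p ^ K ≤ 1) {η : ℝ}
    (hη : ∀ y T₁ D, T₁ ≤ k ^ K → ∑ d ∈ range D, (∑ x ∈ Ico y T₁,
      pois (∑ w ∈ Ico y x, N * wordMass p K w) d * (N * wordMass p K x) ^ 2) ^ 2 ≤ η)
    (hη' : ∀ y T₁ D, T₁ ≤ k ^ K → ∑ d ∈ range D, (∑ x ∈ Ico y T₁,
      pois (∑ w ∈ Ico y x, N * wordMass (p ∘ Fin.rev) K w) d *
        (N * wordMass (p ∘ Fin.rev) K x) ^ 2) ^ 2 ≤ η)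
    (hζ : ((L : ℝ) ^ 2) ^ (L + 1) * ((L + 1 : ℝ) ^ 4 * η) ≤ 1 / 2) {β : ℝ}
    (hβ : (N : ℝ) ^ (L + 1) * phi p (L + 1 : ℕ) ^ K + 2 * Real.exp (-(N / 1024 : ℝ)) ≤ β) :
    tvDist p N K ≤ 1 / 2 * (√(8 * Real.exp 1 ^ 2 *
      (((L : ℝ) ^ 2) ^ (L + 1) * ((L + 1 : ℝ) ^ 4 * η)) + β ^ 2) + β) := by
  have hp' : ∀ i, 0 ≤ p i := fun i => (hp i).le
  have hN' : (16 : ℝ) ≤ N := by exact_mod_cast hN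
  have hN0 : (0 : ℝ) < N := by linarith
  set T := k ^ K with hT
  set q : ℕ → ℝ := fun x => if x < T then wordMass p K x else 0 with hq
  set q' : ℕ → ℝ := fun x => if x < T then wordMass (p ∘ Fin.rev) K x else 0 with hq'
  have hqw : ∀ x < T, q x = wordMass p K x := fun x hx => if_pos hx
  have hqw' : ∀ x < T, q' x = wordMass (p ∘ Fin.rev) K x := fun x hx => if_pos hx
  have hq0 : ∀ x, 0 ≤ q x := fun x => by
    simp only [hq]; split_ifs
    exacts [wordMass_nonneg hp' _ _, le_rfl]
  have hq0' : ∀ x, 0 ≤ q' x := fun x => by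
    simp only [hq']; split_ifs
    exacts [wordMass_nonneg (fun i => hp' _) _ _, le_rfl]
  have hq1 : ∀ x, N * q x ≤ 1 := fun x => by
    simp only [hq]; split_ifs
    · exact (mul_le_mul_of_nonneg_left (wordMass_le_pow hp' (le_pMax p) K x) hN0.le).trans hK
    · simp
  have hq1' : ∀ x, N * q' x ≤ 1 := fun x => by
    simp only [hq']; split_ifs
    · exact (mul_le_mul_of_nonneg_left (wordMass_le_pow (fun i => hp' _)
        (fun i => le_pMax p _) K x) hN0.le).trans hK
    · simp
  have hqε : ∀ x, q x ≤ 1 / 16 := fun x => by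
    have : q x * 16 ≤ 1 := by nlinarith [hq1 x, hq0 x]
    linarith
  have hsum : ∑ x ∈ range T, q x = 1 := by
    rw [sum_congr rfl fun x hx => hqw x (mem_range.mp hx), sum_wordMass, hp1, one_pow]
  -- Cumulative masses lie in `[5/8, 11/16]` at `T₁` and in `[1/4, 5/16]` at `T₂`. Each leaves mass
  -- at least `ρ = 1 / 4` on its far side, and the middle position `N / 2` is away from both by more
  -- than the deviation `N / 16`.
  obtain ⟨T₁, hT₁, hT₁l, hT₁u⟩ := exists_range_sum_between (T := T) (α := 5 / 8) hqε
    (by norm_num) (by rw [hsum]; norm_num)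
  obtain ⟨T₂, hT₂, hT₂l, hT₂u⟩ := exists_range_sum_between (T := T) (α := 1 / 4) hqε
    (by norm_num) (by rw [hsum]; norm_num)
  set h := N / 2 with hh
  have hh1 : (h : ℝ) ≤ N / 2 := by rw [hh]; exact_mod_cast Nat.cast_div_le
  have hh2 : (N : ℝ) / 2 - 1 ≤ h := by
    have : N ≤ 2 * h + 1 := by omega
    have : (N : ℝ) ≤ 2 * h + 1 := by exact_mod_cast this
    linarith
  have hbad := sum_sdiff_goodSeqs_le (N := N) (L := L) (h := h) hq0 hsum hT₁ hT₂
    (a := N / 16) (by positivity) (by linarith) (by nlinarith) (by nlinarith)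
  have hpow : ∑ x ∈ range T, q x ^ (L + 1) = phi p (L + 1 : ℕ) ^ K := by
    rw [sum_congr rfl fun x hx => by rw [hqw x (mem_range.mp hx)], sum_wordMass_pow hp']
  have hexp : -(((N : ℝ) / 16) ^ 2 / (4 * N)) = -(N / 1024) := by field_simp; norm_num
  rw [hpow, hexp] at hbad
  have key := sum_abs_sortLaw_sub_le_of_good (ρ := 1 / 4) (η := η) (q := q) (q' := q')
    (by omega) hL hT₁ hT₂ hq0 hq1 hq0' hq1' hsum (by
      intro x hx
      rw [hqw' x hx, hqw _ (by omega), wordMass_rev p hx]) (by norm_num) (by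
      rw [sum_Ico_eq_sub _ hT₁, hsum]; linarith) (by linarith) (by
      intro y D
      refine le_of_eq_of_le ?_ (hη y T₁ D hT₁)
      refine sum_congr rfl fun d _ => ?_
      congr 1
      refine sum_congr rfl fun x hx => ?_
      have hxT := (mem_Ico.mp hx).2.trans_le hT₁
      rw [hqw x hxT]
      congr 2
      exact sum_congr rfl fun w hw => by rw [hqw w ((mem_Ico.mp hw).2.trans hxT)]) (by
      intro y D
      refine le_of_eq_of_le ?_ (hη' y (T - T₂) D (Nat.sub_le _ _))
      refine sum_congr rfl fun d _ => ?_
      congr 1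
      refine sum_congr rfl fun x hx => ?_
      have hxT := (mem_Ico.mp hx).2.trans_le (Nat.sub_le T T₂)
      rw [hqw' x hxT]
      congr 2
      exact sum_congr rfl fun w hw => by rw [hqw' w ((mem_Ico.mp hw).2.trans hxT)]) hζ
      (hbad.trans hβ)
  rw [tvDist_eq]
  have hfun : (fun x : Fin (k ^ K) => wordMass p K x) = fun x : Fin T => q x :=
    funext fun x => (hqw x x.2).symm
  rw [hfun]
  refine mul_le_mul_of_nonneg_left (key.trans_eq ?_) (by norm_num)
  norm_num
  ring_nf

theorem tendsto_tvDist_zero (hk : 2 ≤ k) (hp : ∀ i, 0 < p i) (hp1 : ∑ i, p i = 1) {θ κ : ℝ}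
    (hθ0 : 0 < θ) (hθ : phi p θ = phi p 2 ^ 2) (hκ : cutoffConst p θ < κ) :
    Tendsto (fun N : ℕ => tvDist p N ⌊κ * Real.log N⌋₊) atTop (𝓝 0) := by
  obtain ⟨η₁, hη₁, hη₁'⟩ := exists_collision_bound hk hp hp1 hθ0 hθ hκ
  obtain ⟨η₂, hη₂, hη₂'⟩ := exists_collision_bound (p := p ∘ Fin.rev) hk (fun i => hp _)
    ((Equiv.sum_comp Fin.revPerm p).trans hp1) hθ0 (by rw [phi_rev, phi_rev, hθ])
    (by rwa [cutoffConst_rev])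
  have hη := hη₁.max hη₂
  rw [max_self] at hη
  have hlb := log_inv_pMax_pos hk hp hp1
  have hb0 := pMax_pos hp
  have hκ1 : 1 < κ * Real.log (1 / pMax p) := by
    rw [← div_lt_iff₀ hlb]; exact (le_max_left _ _).trans_lt hκ
  set s := (1 + κ * Real.log (1 / pMax p)) / 2 with hs
  have hs1 : 1 < s := by linarith
  -- Word masses are at most `N ^ (-s)` with `s > 1`, so the crowded cell bound is at most `N ^ (L +
  -- 1 - s L)`. With `L (s - 1) ≥ 2` this is at most `1 / N`, for a fixed `L`.
  obtain ⟨L₀, hL₀⟩ := exists_nat_gt (2 / (s - 1))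
  set L := L₀ + 1 with hL
  have hLs : (2 : ℝ) ≤ L * (s - 1) := by
    rw [div_lt_iff₀ (by linarith)] at hL₀
    push_cast [hL]; nlinarith
  set ζ : ℕ → ℝ := fun N => ((L : ℝ) ^ 2) ^ (L + 1) * ((L + 1 : ℝ) ^ 4 * max (η₁ N) (η₂ N))
  have hζ : Tendsto ζ atTop (𝓝 0) := by
    have := (hη.const_mul ((L + 1 : ℝ) ^ 4)).const_mul (((L : ℝ) ^ 2) ^ (L + 1))
    simpa only [mul_zero] using this
  set β : ℕ → ℝ := fun N => (N : ℝ)⁻¹ + 2 * Real.exp (-(N / 1024 : ℝ))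
  have hβ : Tendsto β atTop (𝓝 0) := by
    have h1 : Tendsto (fun N : ℕ => (N : ℝ) / 1024) atTop atTop :=
      tendsto_natCast_atTop_atTop.atTop_div_const (by norm_num)
    have := (tendsto_inv_atTop_nhds_zero_nat (𝕜 := ℝ)).add
      ((Real.tendsto_exp_neg_atTop_nhds_zero.comp h1).const_mul 2)
    simp only [mul_zero, add_zero] at this
    exact this
  have hbound : Tendsto (fun N => 1 / 2 * (√(8 * Real.exp 1 ^ 2 * ζ N + β N ^ 2) + β N)) atTop
      (𝓝 0) := by
    have h1 := (((hζ.const_mul (8 * Real.exp 1 ^ 2)).add (hβ.pow 2)).sqrt.add hβ).const_mul (1 / 2)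
    simpa using h1
  refine squeeze_zero' (Eventually.of_forall fun N => ?_) ?_ hbound
  · exact mul_nonneg (by norm_num) (sum_nonneg fun _ _ => abs_nonneg _)
  filter_upwards [hη₁', hη₂', eventually_ge_atTop 16, hζ.eventually_le_const one_half_pos,
    eventually_mul_pMax_pow_le hk hp hp1 (s := 1) hκ1,
    eventually_mul_pMax_pow_le hk hp hp1 (κ := κ) (s := s)
      (by linarith)] with N h₁ h₂ hN hζN hK1 hKs
  rw [Real.rpow_one] at hK1
  have hN0 : (0 : ℝ) < N := by exact_mod_cast (by omega : 0 < N)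
  have hN1 : (1 : ℝ) ≤ N := by exact_mod_cast (by omega : 1 ≤ N)
  refine tvDist_le_of_collision_le hp hp1 hN (by omega) hK1
    (fun y T₁ D hT => (h₁ y T₁ D hT).trans (le_max_left _ _))
    (fun y T₁ D hT => (h₂ y T₁ D hT).trans (le_max_right _ _)) hζN ?_
  refine add_le_add_left ?_ _
  set K := ⌊κ * Real.log N⌋₊
  have h3 : phi p (L + 1 : ℕ) ^ K ≤ (pMax p ^ K) ^ L := by
    rw [← pow_mul, mul_comm K L, pow_mul]
    exact pow_le_pow_left₀ (phi_pos hp _).le (phi_add_one_le hp hp1 L) K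
  have h4 : pMax p ^ K ≤ (N : ℝ) ^ (-s) := by
    rw [Real.rpow_neg hN0.le, ← one_div, le_div_iff₀ (by positivity), mul_comm]
    exact hKs
  calc (N : ℝ) ^ (L + 1) * phi p (L + 1 : ℕ) ^ K ≤ (N : ℝ) ^ (L + 1) * ((N : ℝ) ^ (-s)) ^ L := by
        gcongr
        exact h3.trans (pow_le_pow_left₀ (by positivity) h4 L)
    _ = (N : ℝ) ^ ((L + 1 : ℕ) + -s * L) := by
        rw [← Real.rpow_natCast, ← Real.rpow_natCast _ L, ← Real.rpow_mul hN0.le,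
          ← Real.rpow_add hN0]
    _ ≤ (N : ℝ) ^ (-1 : ℝ) := by
        refine Real.rpow_le_rpow_of_exponent_le hN1 ?_
        push_cast; nlinarith
    _ = _ := Real.rpow_neg_one _

end Upper

/-! ### Lower bounds by test events -/

theorem sum_sortLaw_mul {N T : ℕ} (q : Fin T → ℝ) (E : Finset (Equiv.Perm (Fin N))) :
    ∑ π ∈ E, sortLaw q N π = ∑ s ∈ sortedSeqs N T, (∏ i, q (s i)) *
      (∑ π ∈ E, open Classical in if Ascends (edges s) π then (1 : ℝ) else 0) := by
  simp only [sortLaw, mul_sum]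
  rw [sum_comm]

theorem sum_sortLaw {N T : ℕ} {q : Fin T → ℝ} (hq1 : ∑ x, q x = 1) :
    ∑ π : Equiv.Perm (Fin N), sortLaw q N π = 1 := by
  rw [sum_sortLaw_mul]
  refine Eq.trans ?_ (sum_sortedMass (N := N) hq1)
  exact sum_congr rfl fun s _ => by rw [sum_ite_ascends, sortedMass]

theorem sortLaw_nonneg {N T : ℕ} {q : Fin T → ℝ} (hq : ∀ x, 0 ≤ q x) (π : Equiv.Perm (Fin N)) :
    0 ≤ sortLaw q N π :=
  sum_nonneg fun s _ => mul_nonneg (prod_nonneg fun _ _ => hq _) (by split_ifs <;> norm_num)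

theorem sum_inv_factorial (N : ℕ) :
    ∑ _π : Equiv.Perm (Fin N), 1 / (N.factorial : ℝ) = 1 := by
  rw [sum_const, card_univ, Fintype.card_perm, Fintype.card_fin, nsmul_eq_mul]
  exact mul_one_div_cancel (by positivity)

theorem tvDist_le_one {k : ℕ} [NeZero k] {p : Fin k → ℝ} (hp : ∀ i, 0 ≤ p i)
    (hp1 : ∑ i, p i = 1) (N K : ℕ) : tvDist p N K ≤ 1 := by
  have hsum : ∑ x : Fin (k ^ K), wordMass p K x = 1 := by
    rw [Fin.sum_univ_eq_sum_range (fun x => wordMass p K x), sum_wordMass, hp1, one_pow]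
  rw [tvDist_eq]
  have h : ∑ π : Equiv.Perm (Fin N),
      |sortLaw (fun x : Fin (k ^ K) => wordMass p K x) N π - 1 / (N.factorial : ℝ)| ≤
      ∑ π : Equiv.Perm (Fin N),
        (sortLaw (fun x : Fin (k ^ K) => wordMass p K x) N π + 1 / (N.factorial : ℝ)) := by
    refine sum_le_sum fun π _ => ?_
    have h1 := sortLaw_nonneg (q := fun x : Fin (k ^ K) => wordMass p K x)
      (fun x => wordMass_nonneg hp K x) π
    have h2 : (0 : ℝ) ≤ 1 / (N.factorial : ℝ) := by positivity
    rw [abs_le]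
    constructor <;> linarith
  rw [sum_add_distrib, sum_sortLaw hsum, sum_inv_factorial] at h
  linarith

-- Given `s`, the permutation is uniform among those ascending along its edges, so the hypothesis on
-- `E` says that the test succeeds with conditional probability at least `1 - α`; the bound is its
-- power minus its size under the uniform law.
open Classical in
theorem le_sum_abs_sortLaw_sub {N T : ℕ} {q : Fin T → ℝ} (hq : ∀ x, 0 ≤ q x)
    (hq1 : ∑ x, q x = 1) (E : Finset (Equiv.Perm (Fin N))) {G : Finset (Fin N → Fin T)}
    (hG : G ⊆ sortedSeqs N T) {α β γ : ℝ} (hα : α ≤ 1)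
    (hE : ∀ s ∈ G, (1 - α) * ascCount N (edges s) ≤
      ∑ π ∈ E, if Ascends (edges s) π then (1 : ℝ) else 0)
    (hβ : 1 - β ≤ ∑ s ∈ G, sortedMass q s) (hγ : (E.card : ℝ) ≤ γ * N.factorial) :
    (1 - α) * (1 - β) - γ ≤
      1 / 2 * ∑ π : Equiv.Perm (Fin N), |sortLaw q N π - 1 / (N.factorial : ℝ)| := by
  have hN : (0 : ℝ) < N.factorial := by positivity
  have h1 : (1 - α) * (1 - β) ≤ ∑ π ∈ E, sortLaw q N π := by
    rw [sum_sortLaw_mul]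
    calc (1 - α) * (1 - β) ≤ (1 - α) * ∑ s ∈ G, sortedMass q s :=
          mul_le_mul_of_nonneg_left hβ (by linarith)
      _ ≤ ∑ s ∈ G, (∏ i, q (s i)) * ∑ π ∈ E, if Ascends (edges s) π then (1 : ℝ) else 0 := by
          rw [mul_sum]
          refine sum_le_sum fun s hs => ?_
          rw [sortedMass, mul_left_comm]
          exact mul_le_mul_of_nonneg_left (hE s hs) (prod_nonneg fun _ _ => hq _)
      _ ≤ _ := by
          refine sum_le_sum_of_subset_of_nonneg hG fun s _ _ =>
            mul_nonneg (prod_nonneg fun _ _ => hq _) (sum_nonneg fun π _ => ?_)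
          split_ifs <;> norm_num
  have h2 : ∑ _π ∈ E, 1 / (N.factorial : ℝ) ≤ γ := by
    rw [sum_const, nsmul_eq_mul, mul_one_div, div_le_iff₀ hN]
    exact hγ
  set f : Equiv.Perm (Fin N) → ℝ := fun π => sortLaw q N π - 1 / (N.factorial : ℝ) with hf
  have h3 : ∑ π ∈ E, f π + ∑ π ∈ Eᶜ, f π = 0 := by
    rw [sum_add_sum_compl, hf, sum_sub_distrib, sum_sortLaw hq1, sum_inv_factorial, sub_self]
  have h4 : ∑ π ∈ E, f π ≤ ∑ π ∈ E, |f π| := sum_le_sum fun π _ => le_abs_self _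
  have h5 : ∑ π ∈ Eᶜ, -f π ≤ ∑ π ∈ Eᶜ, |f π| := sum_le_sum fun π _ => neg_le_abs _
  rw [sum_neg_distrib] at h5
  have h6 : ∑ π ∈ E, f π = ∑ π ∈ E, sortLaw q N π - ∑ _π ∈ E, 1 / (N.factorial : ℝ) := by
    rw [hf, sum_sub_distrib]
  have h7 := sum_add_sum_compl E fun π => |f π|
  linarith

/-! ### Long ascending runs -/

theorem add_one_le_runLen_Ico {j B t : ℕ} (ht : t < B) :
    t + 1 ≤ runLen (Ico j (j + B - 1)) (j + t) := by
  induction t with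
  | zero => exact one_le_runLen _ _
  | succ t ih =>
    rw [← add_assoc, runLen, if_pos (mem_Ico.mpr (by omega))]
    exact Nat.succ_le_succ (ih (by omega))

theorem ascCount_Ico_mul_factorial_le {N j B : ℕ} (h : j + B ≤ N) :
    ascCount N (Ico j (j + B - 1)) * B.factorial ≤ N.factorial := by
  rw [← ascCount_mul_prod_runLen N (Ico j (j + B - 1))]
  refine Nat.mul_le_mul_left _ ?_
  calc B.factorial = ∏ t ∈ range B, (t + 1) := (prod_range_add_one_eq_factorial B).symm
    _ ≤ ∏ t ∈ range B, runLen (Ico j (j + B - 1)) (j + t) :=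
        prod_le_prod' fun t ht => add_one_le_runLen_Ico (mem_range.mp ht)
    _ = ∏ i ∈ (range B).image (fun t => j + t), runLen (Ico j (j + B - 1)) i :=
        (prod_image (by intro a _ b _ hab; simpa using hab)).symm
    _ ≤ _ := by
        refine prod_le_prod_of_subset_of_one_le' ?_ fun i _ _ => one_le_runLen _ _
        intro i hi
        obtain ⟨t, ht, rfl⟩ := mem_image.mp hi
        rw [mem_range] at ht ⊢
        omega

theorem Ascends.mono {N : ℕ} {A B : Finset ℕ} {π : Equiv.Perm (Fin N)} (h : Ascends B π)
    (hAB : A ⊆ B) : Ascends A π := fun i j hij hi => h i j hij (hAB hi)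

theorem exists_Ico_subset_edges {N T B : ℕ} {s : Fin N → Fin T} (hs : Monotone s) {x : Fin T}
    (hB : B ≤ (cellCount s x : ℕ)) :
    ∃ j, j + B ≤ N ∧ Ico j (j + B - 1) ⊆ edges s := by
  have hcard : (univ.filter fun i => s i ≤ x).card =
      (univ.filter fun i => s i < x).card + (univ.filter fun i => s i = x).card := by
    rw [← card_union_of_disjoint]
    · congr 1
      ext i
      simp only [mem_filter, mem_univ, true_and, mem_union]
      exact le_iff_lt_or_eq
    · rw [disjoint_filter]
      intro i _ h1 h2
      exact h1.ne h2
  have hle := card_filter_le (univ : Finset (Fin N)) fun i => s i ≤ x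
  rw [card_univ, Fintype.card_fin] at hle
  simp only [cellCount] at hB
  have hval : ∀ i : Fin N, (univ.filter fun i => s i < x).card ≤ (i : ℕ) →
      (i : ℕ) < (univ.filter fun i => s i < x).card + B → s i = x := by
    intro i h1 h2
    refine le_antisymm ?_ ?_
    · exact (Tuple.lt_card_le_iff_apply_le_of_monotone (j := i) (a := x) hs).mp (by omega)
    · have := (Tuple.lt_card_lt_iff_apply_lt_of_monotone (j := i) (a := x) hs).not.mp (by omega)
      exact not_lt.mp this
  refine ⟨(univ.filter fun i => s i < x).card, by omega, fun e he => ?_⟩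
  rw [mem_Ico] at he
  refine mem_edges.mpr ⟨⟨e, by omega⟩, ⟨e + 1, by omega⟩, rfl, rfl, ?_⟩
  rw [hval ⟨e, by omega⟩ he.1 (by simp only; omega),
    hval ⟨e + 1, by omega⟩ (by simp only; omega) (by simp only; omega)]

/-- Markov's inequality for `exp (-count)`, with `1 - exp (-1) ≥ 1 / 2`. -/
theorem expect_cellCount_lt_le {N T : ℕ} {q : Fin T → ℝ} (hq : ∀ x, 0 ≤ q x)
    (hq1 : ∑ x, q x = 1) (x : Fin T) (B : ℕ) :
    expect q N (fun u => if (cellCount u x : ℕ) < B then 1 else 0) ≤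
      Real.exp (B - N * q x / 2) := by
  have h := expect_prod (N := N) q (fun _ y => Real.exp (if y = x then -1 else 0))
  have e1 : ∀ u : Fin N → Fin T, ∏ i, Real.exp (if u i = x then (-1 : ℝ) else 0) =
      Real.exp (-(cellCount u x : ℕ)) := by
    intro u
    rw [← Real.exp_sum, ← sum_filter, sum_const, nsmul_eq_mul, mul_neg_one, cellCount]
  have e2 : ∑ y, q y * Real.exp (if y = x then (-1 : ℝ) else 0) = 1 - q x * (1 - Real.exp (-1)) := by
    have : ∀ y, q y * Real.exp (if y = x then (-1 : ℝ) else 0) =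
        q y - if y = x then q y * (1 - Real.exp (-1)) else 0 := by
      intro y
      split_ifs
      · ring
      · simp
    simp_rw [this]
    rw [sum_sub_distrib, hq1]
    simp
  simp_rw [e1, e2] at h
  rw [prod_const, card_univ, Fintype.card_fin] at h
  have h1 : expect q N (fun u => if (cellCount u x : ℕ) < B then 1 else 0) ≤
      expect q N (fun u => Real.exp B * Real.exp (-(cellCount u x : ℕ))) := by
    refine expect_mono hq fun u => ?_
    split_ifs with hu
    · rw [← Real.exp_add]
      apply Real.one_le_exp
      have : ((cellCount u x : ℕ) : ℝ) ≤ B := by exact_mod_cast hu.le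
      linarith
    · positivity
  rw [expect_const_mul, h] at h1
  refine h1.trans ?_
  have h2 : Real.exp (-1) ≤ 1 / 2 := by
    rw [Real.exp_neg, ← one_div]
    exact one_div_le_one_div_of_le (by norm_num) (by have := Real.add_one_le_exp (1 : ℝ); linarith)
  have hx1 : q x ≤ 1 := hq1 ▸ single_le_sum (fun y _ => hq y) (mem_univ x)
  have h3 : 1 - q x * (1 - Real.exp (-1)) ≤ Real.exp (-(q x / 2)) := by
    have := Real.add_one_le_exp (-(q x / 2))
    nlinarith [hq x]
  have h4 : 0 ≤ 1 - q x * (1 - Real.exp (-1)) := by nlinarith [hq x, Real.exp_pos (-1)]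
  calc Real.exp B * (1 - q x * (1 - Real.exp (-1))) ^ N
      ≤ Real.exp B * Real.exp (-(q x / 2)) ^ N := by gcongr
    _ = _ := by rw [← Real.exp_nat_mul, ← Real.exp_add]; congr 1; ring

theorem sum_filter_sortedMass_eq_expect {N T : ℕ} (q : Fin T → ℝ) (P : (Fin N → Fin T) → Prop)
    [DecidablePred P] :
    ∑ s ∈ (sortedSeqs N T).filter P, sortedMass q s =
      expect q N (fun u => if P (u ∘ Tuple.sort u) then 1 else 0) := by
  rw [← sum_sortedMass_mul_eq_expect q (fun s => if P s then 1 else 0), sum_filter]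
  exact sum_congr rfl fun s _ => by split_ifs <;> simp

/-- The test asks for `B` consecutive positions on which the permutation ascends: a word repeated
`B` times forces them, while a uniform permutation has them with probability at most `N / B!`. -/
theorem le_tvDist_of_large_cell {k : ℕ} [NeZero k] {p : Fin k → ℝ} (hp : ∀ i, 0 ≤ p i)
    (hp1 : ∑ i, p i = 1) {N K B : ℕ} (hB : 1 ≤ B) (x : Fin (k ^ K)) :
    1 - Real.exp (B - N * wordMass p K x / 2) - N / B.factorial ≤ tvDist p N K := by
  classical
  set q : Fin (k ^ K) → ℝ := fun x => wordMass p K x with hq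
  have hq0 : ∀ x, 0 ≤ q x := fun x => wordMass_nonneg hp K x
  have hq1 : ∑ x, q x = 1 := by
    rw [hq, Fin.sum_univ_eq_sum_range (fun x => wordMass p K x), sum_wordMass, hp1, one_pow]
  rw [tvDist_eq]
  set E : Finset (Equiv.Perm (Fin N)) :=
    univ.filter fun π => ∃ j, j + B ≤ N ∧ Ascends (Ico j (j + B - 1)) π with hE
  have hcard : (E.card : ℝ) ≤ N / B.factorial * N.factorial := by
    have h1 : E ⊆ (range N).biUnion fun j => if j + B ≤ N then
        univ.filter fun π : Equiv.Perm (Fin N) => Ascends (Ico j (j + B - 1)) π else ∅ := by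
      intro π hπ
      obtain ⟨j, hj, h⟩ := (mem_filter.mp hπ).2
      refine mem_biUnion.mpr ⟨j, mem_range.mpr (by omega), ?_⟩
      rw [if_pos hj]
      exact mem_filter.mpr ⟨mem_univ _, h⟩
    have h2 : E.card * B.factorial ≤ N * N.factorial := by
      calc E.card * B.factorial ≤ (∑ j ∈ range N, (if j + B ≤ N then
            univ.filter fun π : Equiv.Perm (Fin N) => Ascends (Ico j (j + B - 1)) π
              else ∅).card) * B.factorial :=
            Nat.mul_le_mul_right _ ((card_le_card h1).trans card_biUnion_le)
        _ ≤ ∑ j ∈ range N, N.factorial := by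
            rw [sum_mul]
            refine sum_le_sum fun j _ => ?_
            split_ifs with hj
            · exact ascCount_Ico_mul_factorial_le hj
            · simp
        _ = _ := by simp
    rw [div_mul_eq_mul_div, le_div_iff₀ (by positivity)]
    exact_mod_cast h2
  have key := le_sum_abs_sortLaw_sub hq0 hq1 E
    (G := (sortedSeqs N (k ^ K)).filter fun s => ¬ (cellCount s x : ℕ) < B) (filter_subset _ _)
    (α := 0) (β := Real.exp (B - N * wordMass p K x / 2)) zero_le_one (by
      intro s hs
      rw [mem_filter, mem_sortedSeqs, not_lt] at hs
      obtain ⟨j, hj, hsub⟩ := exists_Ico_subset_edges hs.1 hs.2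
      rw [sub_zero, one_mul, ← sum_ite_ascends]
      refine le_of_eq (sum_subset (subset_univ E) fun π _ hπ => ?_).symm
      rw [if_neg]
      intro hasc
      exact hπ (mem_filter.mpr ⟨mem_univ _, j, hj, hasc.mono hsub⟩)) (by
      have h1 := sum_filter_add_sum_filter_not (sortedSeqs N (k ^ K))
        (fun s => (cellCount s x : ℕ) < B) (sortedMass q)
      rw [sum_sortedMass hq1, sum_filter_sortedMass_eq_expect] at h1
      simp only [cellCount_comp_perm] at h1
      have h2 := expect_cellCount_lt_le (N := N) hq0 hq1 x B
      linarith) hcard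
  rwa [sub_zero, one_mul] at key

/-! ### No mixing while the likeliest word is repeated often -/

section Lower

open Filter Topology

variable {k : ℕ} [NeZero k] {p : Fin k → ℝ}

theorem exists_wordMass_eq_pMax_pow (p : Fin k → ℝ) (K : ℕ) :
    ∃ x < k ^ K, wordMass p K x = pMax p ^ K := by
  obtain ⟨i, hi⟩ := exists_eq_pMax p
  induction K with
  | zero => exact ⟨0, by simp, by simp [wordMass_zero]⟩
  | succ K ih =>
    obtain ⟨x, hx, h⟩ := ih
    refine ⟨x * k + i, ?_, ?_⟩
    · calc x * k + i < x * k + k := by omega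
        _ = (x + 1) * k := by ring
        _ ≤ k ^ K * k := Nat.mul_le_mul_right _ hx
        _ = _ := (pow_succ _ _).symm
    · rw [wordMass_succ, ofNat_mul_add, mul_comm x k, Nat.mul_add_div (Nat.pos_of_neZero k),
        Nat.div_eq_of_lt i.2, add_zero, h, pow_succ, ← hi]
      congr 2
      exact Fin.ext (Nat.mod_eq_of_lt i.2)

theorem tendsto_tvDist_one_of_lt (hk : 2 ≤ k) (hp : ∀ i, 0 < p i) (hp1 : ∑ i, p i = 1) {κ : ℝ}
    (hκ : κ < 1 / Real.log (1 / pMax p)) :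
    Tendsto (fun N : ℕ => tvDist p N ⌊κ * Real.log N⌋₊) atTop (𝓝 1) := by
  have hlb := log_inv_pMax_pos hk hp hp1
  have hb0 := pMax_pos hp
  -- A nonpositive `κ` means no shuffle for large decks, because of the natural floor; the maximum
  -- with `0` treats it together with the other values.
  set δ := 1 - max κ 0 * Real.log (1 / pMax p) with hδdef
  have hδ : 0 < δ := by
    rw [hδdef, sub_pos, ← lt_div_iff₀ hlb]
    exact max_lt hκ (by positivity)
  have t0 : Tendsto (fun n : ℕ => (n : ℝ)) atTop atTop := tendsto_natCast_atTop_atTop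
  have tδ : Tendsto (fun n : ℕ => (n : ℝ) ^ δ) atTop atTop := (tendsto_rpow_atTop hδ).comp t0
  set B : ℕ → ℕ := fun N => ⌊(N : ℝ) ^ δ / 4⌋₊ with hB
  have tB : Tendsto B atTop atTop :=
    tendsto_nat_floor_atTop.comp (tδ.atTop_div_const (by norm_num))
  have h1 : Tendsto (fun N : ℕ => Real.exp (-((N : ℝ) ^ δ / 4))) atTop (𝓝 0) :=
    Real.tendsto_exp_neg_atTop_nhds_zero.comp (tδ.atTop_div_const (by norm_num))
  -- Since `B` is of order `N ^ δ`, the choice `c δ > 1` bounds `N` by a power of `B`, hence by a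
  -- geometric sequence in `B`, which the factorial dominates.
  obtain ⟨c, hc⟩ := exists_nat_gt (1 / δ)
  have hcδ : 1 < c * δ := by rwa [div_lt_iff₀ hδ] at hc
  have h2 : Tendsto (fun N : ℕ => (8 : ℝ) ^ c * ((8 : ℝ) ^ c) ^ B N / (B N).factorial) atTop (𝓝 0) := by
    have h := ((FloorSemiring.tendsto_pow_div_factorial_atTop ((8 : ℝ) ^ c)).comp tB).const_mul
      ((8 : ℝ) ^ c)
    rw [mul_zero] at h
    exact h.congr fun N => by simp only [Function.comp_apply]; ring
  have hlim : Tendsto (fun N : ℕ => 1 - Real.exp (-((N : ℝ) ^ δ / 4)) -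
      (8 : ℝ) ^ c * ((8 : ℝ) ^ c) ^ B N / (B N).factorial) atTop (𝓝 1) := by
    simpa using (h1.const_sub 1).sub h2
  refine tendsto_of_tendsto_of_tendsto_of_le_of_le' hlim tendsto_const_nhds ?_
    (Eventually.of_forall fun N => tvDist_le_one (fun i => (hp i).le) hp1 _ _)
  filter_upwards [tB.eventually_ge_atTop 1, eventually_ge_atTop 1] with N hBN hN
  have hN1 : (1 : ℝ) ≤ N := by exact_mod_cast hN
  have hN0 : (0 : ℝ) < N := by linarith
  set K := ⌊κ * Real.log N⌋₊
  obtain ⟨x, hx, hxm⟩ := exists_wordMass_eq_pMax_pow p K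
  have h3 := le_tvDist_of_large_cell (N := N) (fun i => (hp i).le) hp1 hBN ⟨x, hx⟩
  refine le_trans ?_ h3
  simp only [hxm]
  have hlogN : 0 ≤ Real.log N := Real.log_nonneg hN1
  have hK : (K : ℝ) ≤ max κ 0 * Real.log N := by
    rcases le_or_gt 0 (κ * Real.log N) with h | h
    · exact (Nat.floor_le h).trans (mul_le_mul_of_nonneg_right (le_max_left _ _) hlogN)
    · rw [show K = 0 from Nat.floor_of_nonpos h.le, Nat.cast_zero]
      positivity
  have hmass : (N : ℝ) ^ δ ≤ N * pMax p ^ K := by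
    rw [← Real.log_le_log_iff (by positivity) (by positivity), Real.log_rpow hN0,
      Real.log_mul hN0.ne' (by positivity), Real.log_pow]
    have e : Real.log (pMax p) = -Real.log (1 / pMax p) := by rw [one_div, Real.log_inv, neg_neg]
    rw [e, hδdef]
    nlinarith
  have hBle : (B N : ℝ) ≤ (N : ℝ) ^ δ / 4 := Nat.floor_le (by positivity)
  have hBlt : (N : ℝ) ^ δ / 4 < B N + 1 := Nat.lt_floor_add_one _
  have hexp : Real.exp (B N - N * pMax p ^ K / 2) ≤ Real.exp (-((N : ℝ) ^ δ / 4)) := by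
    apply Real.exp_le_exp.mpr
    linarith
  have hNB : (N : ℝ) ≤ (8 : ℝ) ^ c * ((8 : ℝ) ^ c) ^ B N := by
    have e1 : (N : ℝ) ≤ ((N : ℝ) ^ δ) ^ c := by
      rw [← Real.rpow_natCast, ← Real.rpow_mul hN0.le]
      conv_lhs => rw [← Real.rpow_one (N : ℝ)]
      exact Real.rpow_le_rpow_of_exponent_le hN1 (by linarith)
    have e2 : (N : ℝ) ^ δ ≤ 8 ^ (B N + 1) := by
      have e3 := one_add_mul_le_pow (by norm_num : (-2 : ℝ) ≤ 7) (B N + 1)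
      norm_num at e3
      linarith
    refine e1.trans ((pow_le_pow_left₀ (by positivity) e2 c).trans_eq ?_)
    rw [← pow_mul, ← pow_mul, ← pow_add]
    congr 1; ring
  have hdiv : (N : ℝ) / (B N).factorial ≤
      (8 : ℝ) ^ c * ((8 : ℝ) ^ c) ^ B N / (B N).factorial := by gcongr
  linarith

end Lower

/-! ### Adding one ascent to a set of prescribed ascents -/

theorem runLen_insert_of_le {A : Finset ℕ} {e i : ℕ} (hi : i ≤ e) :
    runLen (insert e A) i = runLen A i := by
  induction i with
  | zero => rfl
  | succ i ih =>
    rw [runLen, runLen, ih (by omega)]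
    have : i ∈ insert e A ↔ i ∈ A := by
      rw [mem_insert, or_iff_right]; omega
    simp only [this]

theorem runLen_of_Ioc_subset {A : Finset ℕ} {e t : ℕ} (he : e ∉ A) (ht : Ioc e (e + t) ⊆ A) :
    runLen A (e + 1 + t) = t + 1 ∧ runLen (insert e A) (e + 1 + t) = runLen A e + 1 + t := by
  induction t with
  | zero =>
    rw [add_zero, runLen, runLen, if_neg he, if_pos (mem_insert_self _ _), runLen_insert_of_le le_rfl]
    exact ⟨rfl, rfl⟩
  | succ t ih =>
    have h := ih ((Ioc_subset_Ioc_right (by omega)).trans ht)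
    have hm : e + 1 + t ∈ A := ht (mem_Ioc.mpr (by omega))
    rw [← add_assoc, runLen, runLen, if_pos hm, if_pos (mem_insert_of_mem hm), h.1, h.2]
    exact ⟨rfl, rfl⟩

theorem runLen_insert_of_gt {A : Finset ℕ} {e m i : ℕ} (hm : m ∉ A) (hem : e < m) (hi : m < i) :
    runLen (insert e A) i = runLen A i := by
  induction i with
  | zero => omega
  | succ i ih =>
    have hiff : i ∈ insert e A ↔ i ∈ A := by
      rw [mem_insert, or_iff_right]; omega
    rcases (Nat.lt_succ_iff.mp hi).eq_or_lt with rfl | h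
    · rw [runLen, runLen, if_neg hm, if_neg (hiff.not.mpr hm)]
    · rw [runLen, runLen, ih h]
      simp only [hiff]

/-- The new edge glues the run before it to the `r` edges after it. Only the positions `e + 1, …, e
+ 1 + r` change their run lengths, so the chance of the new ascent is the inverse of a binomial
coefficient. -/
theorem prod_runLen_insert {N : ℕ} {A : Finset ℕ} (hA : A ⊆ range (N - 1)) {e r : ℕ} (he : e ∉ A)
    (heN : e + 1 < N) (hr : Ioc e (e + r) ⊆ A) (hr' : e + r + 1 ∉ A) :
    (∏ i ∈ range N, runLen (insert e A) i) * ∏ t ∈ range (r + 1), (t + 1) =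
      (∏ i ∈ range N, runLen A i) * ∏ t ∈ range (r + 1), (runLen A e + 1 + t) := by
  set S := (range (r + 1)).image fun t => e + 1 + t with hS
  have hSN : S ⊆ range N := by
    intro i hi
    obtain ⟨t, ht, rfl⟩ := mem_image.mp hi
    rw [mem_range] at ht ⊢
    rcases Nat.eq_zero_or_pos r with rfl | hpos
    · omega
    · have := mem_range.mp (hA (hr (mem_Ioc.mpr (by omega : e < e + r ∧ e + r ≤ e + r))))
      omega
  have hsub : ∀ t ∈ range (r + 1), Ioc e (e + t) ⊆ A := fun t ht =>
    (Ioc_subset_Ioc_right (by rw [mem_range] at ht; omega)).trans hr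
  have hinj : Set.InjOn (fun t => e + 1 + t) (range (r + 1) : Set ℕ) := by
    intro a _ b _ hab; simpa using hab
  have h1 : ∏ i ∈ S, runLen (insert e A) i = ∏ t ∈ range (r + 1), (runLen A e + 1 + t) := by
    rw [hS, prod_image hinj]
    exact prod_congr rfl fun t ht => (runLen_of_Ioc_subset he (hsub t ht)).2
  have h2 : ∏ i ∈ S, runLen A i = ∏ t ∈ range (r + 1), (t + 1) := by
    rw [hS, prod_image hinj]
    exact prod_congr rfl fun t ht => (runLen_of_Ioc_subset he (hsub t ht)).1
  have h3 : ∏ i ∈ range N \ S, runLen (insert e A) i = ∏ i ∈ range N \ S, runLen A i := by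
    refine prod_congr rfl fun i hi => ?_
    rw [mem_sdiff] at hi
    rcases le_or_gt i e with h | h
    · exact runLen_insert_of_le h
    · refine runLen_insert_of_gt hr' (by omega) ?_
      by_contra hle
      refine hi.2 (mem_image.mpr ⟨i - (e + 1), ?_, ?_⟩)
      · rw [mem_range]; omega
      · omega
  rw [← prod_sdiff hSN (f := runLen (insert e A)), ← prod_sdiff hSN (f := runLen A), h1, h2, h3]
  ring

/-- The number of prescribed ascents following `e` without gap, up to three. -/
def rightCharge (A : Finset ℕ) (e : ℕ) : Finset ℕ := (Icc 1 3).filter fun i => Ioc e (e + i) ⊆ A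

/-- The number of prescribed ascents preceding `e` without gap, up to three. -/
def leftCharge (A : Finset ℕ) (e : ℕ) : Finset ℕ :=
  (Icc 1 3).filter fun i => i ≤ e ∧ Ico (e - i) e ⊆ A

theorem card_filter_Icc_three (P : ℕ → Prop) [DecidablePred P] :
    ((Icc 1 3).filter P).card =
      (if P 1 then 1 else 0) + (if P 2 then 1 else 0) + (if P 3 then 1 else 0) := by
  rw [card_filter, (by decide : (Icc 1 3 : Finset ℕ) = {1, 2, 3}), sum_insert (by decide),
    sum_insert (by decide), sum_singleton, add_assoc]

theorem exists_rightCharge {A : Finset ℕ} {e : ℕ} (h : (rightCharge A e).card < 3) :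
    Ioc e (e + (rightCharge A e).card) ⊆ A ∧ e + (rightCharge A e).card + 1 ∉ A := by
  have i1 : Ioc e (e + 1) ⊆ A ↔ e + 1 ∈ A := by
    constructor
    · exact fun h => h (mem_Ioc.mpr (by omega))
    · intro h x hx
      rw [mem_Ioc] at hx
      rwa [(by omega : x = e + 1)]
  have i2 : Ioc e (e + 2) ⊆ A ↔ e + 1 ∈ A ∧ e + 2 ∈ A := by
    constructor
    · exact fun h => ⟨h (mem_Ioc.mpr (by omega)), h (mem_Ioc.mpr (by omega))⟩
    · rintro ⟨h1, h2⟩ x hx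
      rw [mem_Ioc] at hx
      rcases (by omega : x = e + 1 ∨ x = e + 2) with rfl | rfl
      exacts [h1, h2]
  have i3 : Ioc e (e + 3) ⊆ A ↔ e + 1 ∈ A ∧ e + 2 ∈ A ∧ e + 3 ∈ A := by
    constructor
    · exact fun h => ⟨h (mem_Ioc.mpr (by omega)), h (mem_Ioc.mpr (by omega)),
        h (mem_Ioc.mpr (by omega))⟩
    · rintro ⟨h1, h2, h3⟩ x hx
      rw [mem_Ioc] at hx
      rcases (by omega : x = e + 1 ∨ x = e + 2 ∨ x = e + 3) with rfl | rfl | rfl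
      exacts [h1, h2, h3]
  have hc : (rightCharge A e).card = _ := card_filter_Icc_three fun i => Ioc e (e + i) ⊆ A
  simp only [i1, i2, i3] at hc
  by_cases h1 : e + 1 ∈ A
  · by_cases h2 : e + 2 ∈ A
    · by_cases h3 : e + 3 ∈ A
      · simp [h1, h2, h3] at hc
        omega
      · have hv : (rightCharge A e).card = 2 := by rw [hc]; simp [h1, h2, h3]
        rw [hv]
        exact ⟨i2.mpr ⟨h1, h2⟩, h3⟩
    · have hv : (rightCharge A e).card = 1 := by rw [hc]; simp [h1, h2]
      rw [hv]
      exact ⟨i1.mpr h1, h2⟩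
  · have hv : (rightCharge A e).card = 0 := by rw [hc]; simp [h1]
    rw [hv]
    exact ⟨by simp, h1⟩

theorem runLen_of_leftCharge {A : Finset ℕ} {e : ℕ} (h : (leftCharge A e).card < 3) :
    runLen A e = (leftCharge A e).card + 1 := by
  have hc : (leftCharge A e).card = _ := card_filter_Icc_three fun i => i ≤ e ∧ Ico (e - i) e ⊆ A
  rw [hc] at h ⊢
  rcases e with _ | e
  · simp [runLen]
  have i1 : (1 ≤ e + 1 ∧ Ico (e + 1 - 1) (e + 1) ⊆ A) ↔ e ∈ A := by
    constructor
    · exact fun h => h.2 (mem_Ico.mpr (by omega))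
    · refine fun h => ⟨by omega, fun x hx => ?_⟩
      rw [mem_Ico] at hx
      rwa [(by omega : x = e)]
  rw [runLen]
  simp only [i1] at h ⊢
  by_cases h1 : e ∈ A
  swap
  · have n2 : ¬ (2 ≤ e + 1 ∧ Ico (e + 1 - 2) (e + 1) ⊆ A) := fun hh =>
      h1 (hh.2 (mem_Ico.mpr (by omega)))
    have n3 : ¬ (3 ≤ e + 1 ∧ Ico (e + 1 - 3) (e + 1) ⊆ A) := fun hh =>
      h1 (hh.2 (mem_Ico.mpr (by omega)))
    rw [if_neg h1, if_neg h1, if_neg n2, if_neg n3]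
  rcases e with _ | e
  · simp [runLen, h1]
  have i2 : (2 ≤ e + 1 + 1 ∧ Ico (e + 1 + 1 - 2) (e + 1 + 1) ⊆ A) ↔ e ∈ A := by
    constructor
    · exact fun h => h.2 (mem_Ico.mpr (by omega))
    · refine fun h => ⟨by omega, fun x hx => ?_⟩
      rw [mem_Ico] at hx
      rcases (by omega : x = e ∨ x = e + 1) with rfl | rfl
      exacts [h, h1]
  rw [runLen]
  simp only [i2] at h ⊢
  by_cases h2 : e ∈ A
  swap
  · have n3 : ¬ (3 ≤ e + 1 + 1 ∧ Ico (e + 1 + 1 - 3) (e + 1 + 1) ⊆ A) := fun hh =>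
      h2 (hh.2 (mem_Ico.mpr (by omega)))
    rw [if_pos h1, if_pos h1, if_neg h2, if_neg h2, if_neg n3]
  rcases e with _ | e
  · simp [runLen, h1, h2]
  have i3 : (3 ≤ e + 1 + 1 + 1 ∧ Ico (e + 1 + 1 + 1 - 3) (e + 1 + 1 + 1) ⊆ A) ↔ e ∈ A := by
    constructor
    · exact fun h => h.2 (mem_Ico.mpr (by omega))
    · refine fun h => ⟨by omega, fun x hx => ?_⟩
      rw [mem_Ico] at hx
      rcases (by omega : x = e ∨ x = e + 1 ∨ x = e + 1 + 1) with rfl | rfl | rfl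
      exacts [h, h2, h1]
  rw [runLen]
  simp only [i3] at h ⊢
  by_cases h3 : e ∈ A
  · simp [h1, h2, h3] at h
  · simp [h1, h2, h3]

/-- The chance of an ascent at `e` given prescribed ascents elsewhere. -/
theorem ascCount_insert_ge {N : ℕ} {A : Finset ℕ} (hA : A ⊆ range (N - 1)) {e : ℕ} (he : e ∉ A)
    (heN : e + 1 < N) :
    3 * ascCount N A ≤ 6 * ascCount N (insert e A) +
      ((rightCharge A e).card + (leftCharge A e).card) * ascCount N A := by
  by_cases h3 : 3 ≤ (rightCharge A e).card + (leftCharge A e).card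
  · exact (Nat.mul_le_mul_right _ h3).trans (Nat.le_add_left _ _)
  obtain ⟨hr, hr'⟩ := exists_rightCharge (A := A) (e := e) (by omega)
  have hl := runLen_of_leftCharge (A := A) (e := e) (by omega)
  have hprod := prod_runLen_insert hA he heN hr hr'
  have h0 := ascCount_mul_prod_runLen N A
  have h1 := ascCount_mul_prod_runLen N (insert e A)
  have hP := prod_runLen_pos N A
  have hP' := prod_runLen_pos N (insert e A)
  rw [hl] at hprod
  set P := ∏ i ∈ range N, runLen A i
  set P' := ∏ i ∈ range N, runLen (insert e A) i
  set r := (rightCharge A e).card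
  set l := (leftCharge A e).card
  have key : ∀ c d : ℕ, c + d = 3 → c * P' ≤ 6 * P →
      3 * ascCount N A ≤ 6 * ascCount N (insert e A) + d * ascCount N A := by
    intro c d hcd hcP
    have h2 : c * ascCount N A ≤ 6 * ascCount N (insert e A) := by
      refine Nat.le_of_mul_le_mul_right ?_ hP
      calc c * ascCount N A * P = ascCount N (insert e A) * (c * P') := by
            rw [mul_assoc, h0, ← h1]; ring
        _ ≤ ascCount N (insert e A) * (6 * P) := Nat.mul_le_mul_left _ hcP
        _ = _ := by ring
    rw [← hcd, add_mul]
    omega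
  -- The chance is `1 / (l + r + 2).choose (r + 1)`, that is `1/2`, `1/3`, `1/4` or `1/6` here,
  -- always at least `1/2 - (r + l) / 6`. From `r + l = 3` on this bound is trivial, which is why
  -- charges stop at three.
  rcases (by omega : (r = 0 ∧ l = 0) ∨ (r = 0 ∧ l = 1) ∨ (r = 0 ∧ l = 2) ∨ (r = 1 ∧ l = 0) ∨
    (r = 1 ∧ l = 1) ∨ (r = 2 ∧ l = 0)) with ⟨hr0, hl0⟩ | ⟨hr0, hl0⟩ | ⟨hr0, hl0⟩ | ⟨hr0, hl0⟩ |
    ⟨hr0, hl0⟩ | ⟨hr0, hl0⟩ <;>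
  rw [hr0, hl0] at hprod ⊢ <;>
  simp only [prod_range_succ, prod_range_zero] at hprod
  · exact key 3 0 rfl (by omega)
  · exact key 2 1 rfl (by omega)
  · exact key 1 2 rfl (by omega)
  · exact key 2 1 rfl (by omega)
  · exact key 1 2 rfl (by omega)
  · exact key 1 2 rfl (by omega)

/-- An element of `A` is charged by at most one `e`: of two candidates `e < e'`, the gapless stretch
from `e` would contain `e'`, which is not in `A`. Boundary positions may charge outside `J` and are
paid for at three each. -/
theorem sum_card_rightCharge_le {A J Bd : Finset ℕ} (hJ : ∀ e ∈ J, e ∉ Bd → ∀ i ∈ Icc 1 3,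
    e + i ∈ A → e + i ∈ J) :
    ∑ e ∈ J \ A, (rightCharge A e).card ≤ (A ∩ J).card + 3 * Bd.card := by
  have h1 : ∑ e ∈ (J \ A) \ Bd, (rightCharge A e).card ≤ (A ∩ J).card := by
    rw [← card_sigma]
    refine card_le_card_of_injOn (fun x => x.1 + x.2) ?_ ?_
    · rintro ⟨e, i⟩ hx
      simp only [mem_coe, mem_sigma, mem_sdiff, rightCharge, mem_filter] at hx
      have hm : e + i ∈ A := hx.2.2 (mem_Ioc.mpr (by have := mem_Icc.mp hx.2.1; omega))
      exact mem_inter.mpr ⟨hm, hJ e hx.1.1.1 hx.1.2 i hx.2.1 hm⟩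
    · rintro ⟨e, i⟩ hx ⟨e', i'⟩ hx' heq
      simp only [mem_coe, mem_sigma, mem_sdiff, rightCharge, mem_filter] at hx hx' heq
      have p1 := mem_Icc.mp hx.2.1
      have p2 := mem_Icc.mp hx'.2.1
      have he : e = e' := by
        rcases lt_trichotomy e e' with h | h | h
        · exact absurd (hx.2.2 (mem_Ioc.mpr ⟨h, by omega⟩)) hx'.1.1.2
        · exact h
        · exact absurd (hx'.2.2 (mem_Ioc.mpr ⟨h, by omega⟩)) hx.1.1.2
      subst he
      rw [Nat.add_left_cancel heq]
  have h2 : ∑ e ∈ (J \ A) ∩ Bd, (rightCharge A e).card ≤ 3 * Bd.card := by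
    calc _ ≤ ∑ e ∈ (J \ A) ∩ Bd, 3 := sum_le_sum fun e _ => card_filter_le _ _
      _ ≤ _ := by
        rw [sum_const, smul_eq_mul, mul_comm]
        exact Nat.mul_le_mul_left _ (card_le_card inter_subset_right)
  rw [← sum_inter_add_sum_sdiff (J \ A) Bd]
  omega

theorem sum_card_leftCharge_le {A J Bd : Finset ℕ} (hJ : ∀ e ∈ J, e ∉ Bd → ∀ i ∈ Icc 1 3,
    i ≤ e → e - i ∈ A → e - i ∈ J) :
    ∑ e ∈ J \ A, (leftCharge A e).card ≤ (A ∩ J).card + 3 * Bd.card := by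
  have h1 : ∑ e ∈ (J \ A) \ Bd, (leftCharge A e).card ≤ (A ∩ J).card := by
    rw [← card_sigma]
    refine card_le_card_of_injOn (fun x => x.1 - x.2) ?_ ?_
    · rintro ⟨e, i⟩ hx
      simp only [mem_coe, mem_sigma, mem_sdiff, leftCharge, mem_filter] at hx
      have hi := mem_Icc.mp hx.2.1
      have hm : e - i ∈ A := hx.2.2.2 (mem_Ico.mpr (by omega))
      exact mem_inter.mpr ⟨hm, hJ e hx.1.1.1 hx.1.2 i hx.2.1 hx.2.2.1 hm⟩
    · rintro ⟨e, i⟩ hx ⟨e', i'⟩ hx' heq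
      simp only [mem_coe, mem_sigma, mem_sdiff, leftCharge, mem_filter] at hx hx' heq
      have p1 := mem_Icc.mp hx.2.1
      have p2 := mem_Icc.mp hx'.2.1
      have q1 := hx.2.2.1
      have q2 := hx'.2.2.1
      have he : e = e' := by
        rcases lt_trichotomy e e' with h | h | h
        · exact absurd (hx'.2.2.2 (mem_Ico.mpr ⟨by omega, h⟩)) hx.1.1.2
        · exact h
        · exact absurd (hx.2.2.2 (mem_Ico.mpr ⟨by omega, h⟩)) hx'.1.1.2
      subst he
      rw [(by omega : i = i')]
  have h2 : ∑ e ∈ (J \ A) ∩ Bd, (leftCharge A e).card ≤ 3 * Bd.card := by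
    calc _ ≤ ∑ e ∈ (J \ A) ∩ Bd, 3 := sum_le_sum fun e _ => card_filter_le _ _
      _ ≤ _ := by
        rw [sum_const, smul_eq_mul, mul_comm]
        exact Nat.mul_le_mul_left _ (card_le_card inter_subset_right)
  rw [← sum_inter_add_sum_sdiff (J \ A) Bd]
  omega

/-- Prescribed ascents make the expected number of ascents in a union of intervals larger. -/
theorem sum_ascCount_insert_ge {N : ℕ} {A J Bd : Finset ℕ} (hA : A ⊆ range (N - 1))
    (hJN : J ⊆ range (N - 1))
    (hJr : ∀ e ∈ J, e ∉ Bd → ∀ i ∈ Icc 1 3, e + i ∈ A → e + i ∈ J)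
    (hJl : ∀ e ∈ J, e ∉ Bd → ∀ i ∈ Icc 1 3, i ≤ e → e - i ∈ A → e - i ∈ J) :
    ((J.card : ℝ) / 2 + (A ∩ J).card / 6 - Bd.card) * ascCount N A ≤
      ∑ e ∈ J, (ascCount N (insert e A) : ℝ) := by
  -- A prescribed ascent in `J` counts `1` instead of `1 / 2` and is charged `1 / 6` at most once
  -- from each side, a net gain of `1 / 6`. A boundary position may charge three times on each side,
  -- costing `1`.
  have h1 := sum_card_rightCharge_le hJr
  have h2 := sum_card_leftCharge_le hJl
  have h3 : ∑ e ∈ J \ A, 3 * ascCount N A ≤ ∑ e ∈ J \ A, (6 * ascCount N (insert e A) +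
      ((rightCharge A e).card + (leftCharge A e).card) * ascCount N A) := by
    refine sum_le_sum fun e he => ?_
    rw [mem_sdiff] at he
    have := mem_range.mp (hJN he.1)
    exact ascCount_insert_ge hA he.2 (by omega)
  rw [sum_const, smul_eq_mul, sum_add_distrib, ← mul_sum, ← sum_mul, sum_add_distrib] at h3
  have h4 : ∑ e ∈ J, ascCount N (insert e A) =
      (A ∩ J).card * ascCount N A + ∑ e ∈ J \ A, ascCount N (insert e A) := by
    rw [← sum_inter_add_sum_sdiff J A, inter_comm]
    congr 1
    rw [← smul_eq_mul, ← sum_const]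
    exact sum_congr rfl fun e he => by rw [insert_eq_of_mem (mem_inter.mp he).1]
  have h5 : (J \ A).card + (A ∩ J).card = J.card := by
    rw [inter_comm]; exact card_sdiff_add_card_inter J A
  have h6 : ((J \ A).card : ℝ) + (A ∩ J).card = J.card := by exact_mod_cast h5
  have h7 : (∑ e ∈ J, (ascCount N (insert e A) : ℝ)) =
      (A ∩ J).card * ascCount N A + ∑ e ∈ J \ A, (ascCount N (insert e A) : ℝ) := by
    exact_mod_cast h4
  have h8 : ((J \ A).card : ℝ) * (3 * ascCount N A) ≤
      6 * ∑ e ∈ J \ A, (ascCount N (insert e A) : ℝ) +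
      (((∑ e ∈ J \ A, (rightCharge A e).card : ℕ) : ℝ) +
        ((∑ e ∈ J \ A, (leftCharge A e).card : ℕ) : ℝ)) * ascCount N A := by
    exact_mod_cast h3
  have h9 : ((∑ e ∈ J \ A, (rightCharge A e).card : ℕ) : ℝ) +
      ((∑ e ∈ J \ A, (leftCharge A e).card : ℕ) : ℝ) ≤ 2 * (A ∩ J).card + 6 * Bd.card := by
    exact_mod_cast (by omega : _ + _ ≤ 2 * (A ∩ J).card + 6 * Bd.card)
  have h10 := mul_le_mul_of_nonneg_right h9 (Nat.cast_nonneg (α := ℝ) (ascCount N A))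
  rw [h7, ← h6]
  nlinarith

/-! ### Counting ascents -/

open Classical in
/-- The number of ascents of `π` in `J`. -/
noncomputable def ascents {N : ℕ} (J : Finset ℕ) (π : Equiv.Perm (Fin N)) : ℝ :=
  ∑ e ∈ J, if Ascends {e} π then 1 else 0

theorem ascends_insert {N : ℕ} (A : Finset ℕ) (e : ℕ) (π : Equiv.Perm (Fin N)) :
    Ascends (insert e A) π ↔ Ascends {e} π ∧ Ascends A π := by
  rw [← ascends_union]; rfl

open Classical in
theorem sum_ite_ascends_mul (N : ℕ) (A : Finset ℕ) (e : ℕ) :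
    ∑ π : Equiv.Perm (Fin N), (if Ascends A π then (1 : ℝ) else 0) *
      (if Ascends {e} π then 1 else 0) = ascCount N (insert e A) := by
  rw [← sum_ite_ascends]
  refine sum_congr rfl fun π _ => ?_
  simp only [ascends_insert]
  split_ifs <;> simp_all

open Classical in
theorem sum_ite_ascends_mul_mul (N : ℕ) (A : Finset ℕ) (e f : ℕ) :
    ∑ π : Equiv.Perm (Fin N), (if Ascends A π then (1 : ℝ) else 0) *
      ((if Ascends {e} π then 1 else 0) * (if Ascends {f} π then 1 else 0)) =
      ascCount N (insert e (insert f A)) := by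
  rw [← sum_ite_ascends]
  refine sum_congr rfl fun π _ => ?_
  simp only [ascends_insert]
  split_ifs <;> simp_all

open Classical in
/-- The number of ascents concentrates, since distinct ascents are negatively correlated. -/
theorem sum_ascents_sub_sq_le (N : ℕ) (A J : Finset ℕ) {m : ℝ}
    (hm : ∑ e ∈ J, (ascCount N (insert e A) : ℝ) = m * ascCount N A) :
    ∑ π : Equiv.Perm (Fin N), (if Ascends A π then (1 : ℝ) else 0) * (ascents J π - m) ^ 2 ≤
      J.card / 4 * ascCount N A := by
  have ha : (0 : ℝ) < ascCount N A := by exact_mod_cast ascCount_pos N A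
  set a : ℝ := (ascCount N A : ℝ) with hadef
  set ρ : ℕ → ℝ := fun e => ascCount N (insert e A) / a with hρ
  have hρa : ∀ e, (ascCount N (insert e A) : ℝ) = ρ e * a := fun e => by
    rw [hρ]; field_simp
  have hmρ : ∑ e ∈ J, ρ e = m := by
    have : (∑ e ∈ J, ρ e) * a = m * a := by
      rw [sum_mul, ← hm]; exact sum_congr rfl fun e _ => (hρa e).symm
    exact mul_right_cancel₀ ha.ne' this
  have e1 : ∑ π : Equiv.Perm (Fin N), (if Ascends A π then (1 : ℝ) else 0) * ascents J π = m * a := by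
    simp only [ascents, mul_sum]
    rw [sum_comm, ← hm]
    exact sum_congr rfl fun e _ => sum_ite_ascends_mul N A e
  have e2 : ∑ π : Equiv.Perm (Fin N), (if Ascends A π then (1 : ℝ) else 0) * ascents J π ^ 2 =
      ∑ e ∈ J, ∑ f ∈ J, (ascCount N (insert e (insert f A)) : ℝ) := by
    simp only [ascents, sq]
    simp_rw [sum_mul_sum, mul_sum]
    rw [sum_comm]
    refine sum_congr rfl fun e _ => ?_
    rw [sum_comm]
    exact sum_congr rfl fun f _ => sum_ite_ascends_mul_mul N A e f
  have e3 : ∑ π : Equiv.Perm (Fin N), (if Ascends A π then (1 : ℝ) else 0) * (ascents J π - m) ^ 2 =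
      (∑ e ∈ J, ∑ f ∈ J, (ascCount N (insert e (insert f A)) : ℝ)) - m ^ 2 * a := by
    have : ∀ π : Equiv.Perm (Fin N), (if Ascends A π then (1 : ℝ) else 0) * (ascents J π - m) ^ 2 =
        (if Ascends A π then (1 : ℝ) else 0) * ascents J π ^ 2 -
        2 * m * ((if Ascends A π then (1 : ℝ) else 0) * ascents J π) +
        m ^ 2 * (if Ascends A π then (1 : ℝ) else 0) := fun π => by ring
    simp_rw [this]
    rw [sum_add_distrib, sum_sub_distrib, ← mul_sum, ← mul_sum, e1, e2, sum_ite_ascends]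
    ring
  rw [e3]
  have h1 : ∀ e ∈ J, ∀ f ∈ J, (ascCount N (insert e (insert f A)) : ℝ) ≤
      ρ e * ρ f * a + if e = f then (ρ e - ρ e ^ 2) * a else 0 := by
    intro e _ f _
    split_ifs with hef
    · subst hef
      rw [insert_eq_of_mem (mem_insert_self _ _), hρa]
      exact le_of_eq (by ring)
    · have h := ascCount_insert_insert_mul_le N A hef
      have h' : (ascCount N (insert e (insert f A)) : ℝ) * a ≤
          ascCount N (insert e A) * ascCount N (insert f A) := by
        rw [hadef]; exact_mod_cast h
      rw [hρa, hρa] at h'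
      rw [add_zero]
      exact le_of_mul_le_mul_right (h'.trans_eq (by ring)) ha
  have h2 : ∑ e ∈ J, ∑ f ∈ J, (ascCount N (insert e (insert f A)) : ℝ) ≤
      m ^ 2 * a + ∑ e ∈ J, (ρ e - ρ e ^ 2) * a := by
    refine (sum_le_sum fun e he => sum_le_sum fun f hf => h1 e he f hf).trans_eq ?_
    simp_rw [sum_add_distrib]
    congr 1
    · rw [← hmρ, sq, sum_mul_sum, sum_mul]
      exact sum_congr rfl fun e _ => (sum_mul _ _ _).symm
    · exact sum_congr rfl fun e he => by rw [sum_ite_eq, if_pos he]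
  have h3 : ∑ e ∈ J, (ρ e - ρ e ^ 2) * a ≤ ∑ e ∈ J, 1 / 4 * a :=
    sum_le_sum fun e _ => mul_le_mul_of_nonneg_right (by nlinarith [sq_nonneg (ρ e - 1 / 2)]) ha.le
  rw [sum_const, nsmul_eq_mul] at h3
  linarith

open Classical in
/-- Counting ascents as a test for the uniform distribution. -/
theorem le_sum_abs_of_ascents {N T : ℕ} {q : Fin T → ℝ} (hq : ∀ x, 0 ≤ q x)
    (hq1 : ∑ x, q x = 1) {J Bd : Finset ℕ} (hJN : J ⊆ range (N - 1))
    (hJr : ∀ e ∈ J, e ∉ Bd → ∀ i ∈ Icc 1 3, e + i < N - 1 → e + i ∈ J)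
    (hJl : ∀ e ∈ J, e ∉ Bd → ∀ i ∈ Icc 1 3, i ≤ e → e - i ∈ J) {t β : ℝ} (ht : 0 < t)
    (hJt : J.card ≤ 4 * t ^ 2) {G : Finset (Fin N → Fin T)} (hG : G ⊆ sortedSeqs N T)
    (hGt : ∀ s ∈ G, 2 * t ≤ (edges s ∩ J).card / 6 - Bd.card)
    (hβ : 1 - β ≤ ∑ s ∈ G, sortedMass q s) :
    (1 - J.card / (4 * t ^ 2)) * (1 - β) - J.card / (4 * t ^ 2) ≤
      1 / 2 * ∑ π : Equiv.Perm (Fin N), |sortLaw q N π - 1 / (N.factorial : ℝ)| := by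
  have ht2 : 0 < 4 * t ^ 2 := by positivity
  -- The threshold `|J| / 2 + t` is at least `t` above the mean under the uniform law and at least
  -- `t` below the mean given a good `s`. The variance is at most `|J| / 4` in both cases, so
  -- Chebyshev applies twice.
  refine le_sum_abs_sortLaw_sub hq hq1
    (univ.filter fun π => (J.card : ℝ) / 2 + t ≤ ascents J π) hG
    ((div_le_one ht2).mpr hJt) ?_ hβ ?_
  · intro s hs
    set A := edges s with hA
    have ha : (0 : ℝ) < ascCount N A := by exact_mod_cast ascCount_pos N A
    have hAN : A ⊆ range (N - 1) := by
      intro e he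
      obtain ⟨i, j, hi, hj, _⟩ := mem_edges.mp he
      have := j.2
      exact mem_range.mpr (by omega)
    have h1 := sum_ascCount_insert_ge hAN hJN
      (fun e he hb i hi h => hJr e he hb i hi (mem_range.mp (hAN h)))
      (fun e he hb i hi hie _ => hJl e he hb i hi hie)
    set m := (∑ e ∈ J, (ascCount N (insert e A) : ℝ)) / ascCount N A with hm
    have hm' : ∑ e ∈ J, (ascCount N (insert e A) : ℝ) = m * ascCount N A := by
      rw [hm]; field_simp
    have hmJ : (J.card : ℝ) / 2 + 2 * t ≤ m := by
      rw [hm, le_div_iff₀ ha]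
      refine le_trans (mul_le_mul_of_nonneg_right ?_ ha.le) h1
      linarith [hGt s hs]
    have h2 := sum_ascents_sub_sq_le N A J hm'
    have h3 : ∑ π ∈ univ.filter (fun π : Equiv.Perm (Fin N) => ¬ (J.card : ℝ) / 2 + t ≤ ascents J π),
        (if Ascends A π then (1 : ℝ) else 0) * t ^ 2 ≤ J.card / 4 * ascCount N A := by
      refine le_trans ?_ (h2.trans' (sum_le_sum_of_subset_of_nonneg (filter_subset
        (fun π : Equiv.Perm (Fin N) => ¬ (J.card : ℝ) / 2 + t ≤ ascents J π) univ)
        fun π _ _ => mul_nonneg (by split_ifs <;> norm_num) (sq_nonneg _)))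
      refine sum_le_sum fun π hπ => mul_le_mul_of_nonneg_left ?_ (by split_ifs <;> norm_num)
      have := not_le.mp (mem_filter.mp hπ).2
      nlinarith
    rw [← sum_mul] at h3
    have h4 := sum_filter_add_sum_filter_not univ
      (fun π : Equiv.Perm (Fin N) => (J.card : ℝ) / 2 + t ≤ ascents J π)
      (fun π => if Ascends A π then (1 : ℝ) else 0)
    rw [sum_ite_ascends] at h4
    have h5 : ∑ π ∈ univ.filter (fun π : Equiv.Perm (Fin N) => ¬ (J.card : ℝ) / 2 + t ≤ ascents J π),
        (if Ascends A π then (1 : ℝ) else 0) ≤ J.card / (4 * t ^ 2) * ascCount N A := by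
      rw [← le_div_iff₀ (by positivity)] at h3
      refine h3.trans_eq ?_
      ring
    linarith
  · set m := (∑ e ∈ J, (ascCount N (insert e ∅) : ℝ)) / ascCount N ∅ with hm
    have ha : (0 : ℝ) < ascCount N ∅ := by exact_mod_cast ascCount_pos N ∅
    have hm' : ∑ e ∈ J, (ascCount N (insert e ∅) : ℝ) = m * ascCount N ∅ := by
      rw [hm]; field_simp
    have hE : ascCount N ∅ = N.factorial := by
      have h := ascCount_mul_prod_runLen N ∅
      rwa [prod_eq_one, mul_one] at h
      intro i _
      cases i <;> simp [runLen]
    have hmJ : m ≤ J.card / 2 := by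
      rw [hm, hE, div_le_iff₀ (by positivity)]
      calc ∑ e ∈ J, (ascCount N (insert e ∅) : ℝ) ≤ ∑ e ∈ J, (N.factorial : ℝ) / 2 := by
            refine sum_le_sum fun e he => ?_
            have h := ascCount_Ico_mul_factorial_le (N := N) (j := e) (B := 2)
              (by have := mem_range.mp (hJN he); omega)
            have hI : Ico e (e + 2 - 1) = insert e ∅ := by
              ext x; simp only [mem_Ico, mem_insert, notMem_empty, or_false]; omega
            rw [hI, Nat.factorial_two] at h
            have h' : (ascCount N (insert e ∅) : ℝ) * 2 ≤ N.factorial := by exact_mod_cast h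
            linarith
        _ = _ := by rw [sum_const, nsmul_eq_mul]; ring
    have h2 := sum_ascents_sub_sq_le N ∅ J hm'
    have hall : ∀ π : Equiv.Perm (Fin N), Ascends ∅ π := fun π i j _ h => absurd h (notMem_empty _)
    simp only [hall, if_true, one_mul] at h2
    rw [hE] at h2
    have h3 : ∑ _π ∈ univ.filter (fun π : Equiv.Perm (Fin N) => (J.card : ℝ) / 2 + t ≤ ascents J π),
        t ^ 2 ≤ J.card / 4 * N.factorial := by
      refine le_trans ?_ (h2.trans' (sum_le_sum_of_subset_of_nonneg (filter_subset
        (fun π : Equiv.Perm (Fin N) => (J.card : ℝ) / 2 + t ≤ ascents J π) univ)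
        fun π _ _ => sq_nonneg _))
      refine sum_le_sum fun π hπ => ?_
      have := (mem_filter.mp hπ).2
      nlinarith
    rw [sum_const, nsmul_eq_mul, ← le_div_iff₀ (by positivity)] at h3
    refine h3.trans_eq ?_
    ring

/-! ### Repeated labels -/

section Sightings

variable {N T : ℕ} {q : Fin T → ℝ}

theorem expect_prod_mul_ite (hq1 : ∑ x, q x = 1) {I S : Finset (Fin N)} (hIS : Disjoint I S)
    (h : Fin T → ℝ) (c : Fin N → Fin T) :
    expect q N (fun u => (∏ i ∈ I, h (u i)) * ∏ j ∈ S, if u j = c j then 1 else 0) =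
      (∑ x, q x * h x) ^ I.card * ∏ j ∈ S, q (c j) := by
  have e0 := expect_prod (N := N) q (fun i x => (if i ∈ I then h x else 1) *
    if i ∈ S then (if x = c i then 1 else 0) else 1)
  have e1 : ∀ u : Fin N → Fin T, (∏ i, (if i ∈ I then h (u i) else 1) *
      if i ∈ S then (if u i = c i then (1 : ℝ) else 0) else 1) =
      (∏ i ∈ I, h (u i)) * ∏ j ∈ S, if u j = c j then 1 else 0 := by
    intro u
    rw [prod_mul_distrib, prod_ite_mem, prod_ite_mem, univ_inter, univ_inter]
  have e2 : ∀ i, (∑ x, q x * ((if i ∈ I then h x else 1) *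
      if i ∈ S then (if x = c i then (1 : ℝ) else 0) else 1)) =
      (if i ∈ I then ∑ x, q x * h x else 1) * if i ∈ S then q (c i) else 1 := by
    intro i
    by_cases hI : i ∈ I
    · have hS : i ∉ S := disjoint_left.mp hIS hI
      simp [hI, hS]
    · by_cases hS : i ∈ S <;> simp [hI, hS, hq1]
  simp_rw [e1, e2] at e0
  rw [e0, prod_mul_distrib, prod_ite_mem, prod_ite_mem, univ_inter, univ_inter, prod_const]

/-- Indicator that the label `x` occurs in `I`. -/
noncomputable def seen (I : Finset (Fin N)) (x : Fin T) (u : Fin N → Fin T) : ℝ :=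
  1 - ∏ i ∈ I, if u i = x then 0 else 1

theorem seen_eq (I : Finset (Fin N)) (x : Fin T) (u : Fin N → Fin T) :
    seen I x u = if ∃ i ∈ I, u i = x then 1 else 0 := by
  rw [seen]
  split_ifs with h
  · obtain ⟨i, hi, hx⟩ := h
    have h0 : ∏ i ∈ I, (if u i = x then (0 : ℝ) else 1) = 0 := prod_eq_zero hi (if_pos hx)
    rw [h0, sub_zero]
  · rw [prod_eq_one, sub_self]
    intro i hi
    exact if_neg fun hx => h ⟨i, hi, hx⟩

/-- The probability that the label `x` occurs among `m` cards. -/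
noncomputable def seenProb (q : Fin T → ℝ) (m : ℕ) (x : Fin T) : ℝ := 1 - (1 - q x) ^ m

theorem sum_mul_ite_ne (hq1 : ∑ x, q x = 1) (x : Fin T) :
    ∑ z, q z * (if z = x then (0 : ℝ) else 1) = 1 - q x := by
  have : ∀ z, q z * (if z = x then (0 : ℝ) else 1) = q z - if z = x then q z else 0 := by
    intro z; split_ifs <;> simp
  simp_rw [this]
  rw [sum_sub_distrib, hq1, sum_ite_eq' univ x, if_pos (mem_univ x)]

theorem expect_seen (hq1 : ∑ x, q x = 1) {I : Finset (Fin N)} {j : Fin N} (hj : j ∉ I)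
    (x : Fin T) :
    expect q N (fun u => if u j = x then seen I x u else 0) = q x * seenProb q I.card x := by
  have hd : Disjoint I {j} := disjoint_singleton_right.mpr hj
  have h1 := expect_prod_mul_ite hq1 hd (fun z => if z = x then 0 else 1) (fun _ => x)
  have h0 := expect_prod_mul_ite hq1 hd (fun _ => 1) (fun _ => x)
  simp only [prod_singleton, prod_const_one, one_mul, mul_one, hq1, one_pow] at h0 h1
  rw [sum_mul_ite_ne hq1] at h1
  have : ∀ u : Fin N → Fin T, (if u j = x then seen I x u else 0) =
      (if u j = x then (1 : ℝ) else 0) + -1 * ((∏ i ∈ I, if u i = x then (0 : ℝ) else 1) *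
        if u j = x then 1 else 0) := by
    intro u
    rw [seen]
    split_ifs <;> ring
  simp_rw [this]
  rw [expect_add, expect_const_mul, h0, h1, seenProb]
  ring

theorem seenProb_nonneg (hq : ∀ x, 0 ≤ q x) (hq1 : ∑ x, q x = 1) (m : ℕ) (x : Fin T) :
    0 ≤ seenProb q m x := by
  have : q x ≤ 1 := hq1 ▸ single_le_sum (fun y _ => hq y) (mem_univ x)
  exact sub_nonneg.mpr (pow_le_one₀ (by linarith) (by linarith [hq x]))

/-- Occurrences of distinct labels in `I` are negatively correlated, as `1 - q x - q y ≤ (1 - q x)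
(1 - q y)`; equal labels need the diagonal term. -/
theorem expect_seen_mul_seen_le (hq : ∀ x, 0 ≤ q x) (hq1 : ∑ x, q x = 1) {I : Finset (Fin N)}
    {j l : Fin N} (hj : j ∉ I) (hl : l ∉ I) (hjl : j ≠ l) (x y : Fin T) :
    expect q N (fun u => (if u j = x then seen I x u else 0) *
      (if u l = y then seen I y u else 0)) ≤
      q x * q y * (seenProb q I.card x * seenProb q I.card y +
        if x = y then seenProb q I.card x else 0) := by
  have hd : Disjoint I {j, l} := by
    rw [disjoint_insert_right, disjoint_singleton_right]; exact ⟨hj, hl⟩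
  set c : Fin N → Fin T := fun i => if i = j then x else y with hc
  have hcj : c j = x := if_pos rfl
  have hcl : c l = y := if_neg hjl.symm
  have hE := expect_prod_mul_ite hq1 hd
  have h0 := hE (fun _ => 1) c
  have h1 := hE (fun z => if z = x then 0 else 1) c
  have h2 := hE (fun z => if z = y then 0 else 1) c
  have h3 := hE (fun z => (if z = x then 0 else 1) * (if z = y then 0 else 1)) c
  simp only [prod_pair hjl, hcj, hcl, prod_const_one, one_mul, mul_one, hq1, one_pow] at h0 h1 h2 h3
  rw [sum_mul_ite_ne hq1] at h1 h2
  have hexp : ∀ u : Fin N → Fin T, (if u j = x then seen I x u else 0) *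
      (if u l = y then seen I y u else 0) =
      ((if u j = x then (1 : ℝ) else 0) * if u l = y then 1 else 0) +
      (-1 * ((∏ i ∈ I, if u i = x then (0 : ℝ) else 1) *
        ((if u j = x then (1 : ℝ) else 0) * if u l = y then 1 else 0)) +
      (-1 * ((∏ i ∈ I, if u i = y then (0 : ℝ) else 1) *
        ((if u j = x then (1 : ℝ) else 0) * if u l = y then 1 else 0)) +
      (∏ i ∈ I, (if u i = x then (0 : ℝ) else 1) * (if u i = y then 0 else 1)) *
        ((if u j = x then (1 : ℝ) else 0) * if u l = y then 1 else 0))) := by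
    intro u
    rw [seen, seen, prod_mul_distrib]
    split_ifs <;> ring
  simp_rw [hexp]
  rw [expect_add, expect_add, expect_add, expect_const_mul, expect_const_mul, h0, h1, h2, h3]
  have hqq : 0 ≤ q x * q y := mul_nonneg (hq x) (hq y)
  have hx1 : q x ≤ 1 := hq1 ▸ single_le_sum (fun y _ => hq y) (mem_univ x)
  have hb : (∑ z, q z * ((if z = x then (0 : ℝ) else 1) * if z = y then 0 else 1)) ^ I.card ≤
      (1 - q x) ^ I.card * (1 - q y) ^ I.card +
        if x = y then seenProb q I.card x else 0 := by
    by_cases hxy : x = y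
    · subst hxy
      have : ∀ z, (if z = x then (0 : ℝ) else 1) * (if z = x then 0 else 1) =
          if z = x then 0 else 1 := fun z => by split_ifs <;> simp
      simp_rw [this]
      rw [sum_mul_ite_ne hq1, if_pos trivial, seenProb]
      nlinarith [sq_nonneg ((1 - q x) ^ I.card - 1)]
    · rw [if_neg hxy, add_zero, ← mul_pow]
      have hs : ∑ z, q z * ((if z = x then (0 : ℝ) else 1) * if z = y then 0 else 1) =
          1 - q x - q y := by
        have : ∀ z, q z * ((if z = x then (0 : ℝ) else 1) * if z = y then 0 else 1) =
            q z * (if z = x then (0 : ℝ) else 1) - if z = y then q z else 0 := by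
          intro z
          by_cases hz : z = x
          · subst hz; simp [hxy]
          · by_cases hz' : z = y
            · subst hz'; simp [hz]
            · simp [hz, hz']
        simp_rw [this]
        rw [sum_sub_distrib, sum_mul_ite_ne hq1, sum_ite_eq' univ y, if_pos (mem_univ y)]
      rw [hs]
      refine pow_le_pow_left₀ ?_ (by nlinarith) _
      have := sum_le_sum_of_subset_of_nonneg (f := q) (subset_univ {x, y}) fun z _ _ => hq z
      rw [sum_pair hxy, hq1] at this
      linarith
  have h4 := mul_le_mul_of_nonneg_right hb hqq
  rw [seenProb, seenProb] at *
  nlinarith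

/-- The number of indices outside `I` whose label lies in `V` and occurs in `I`. -/
noncomputable def sightings (I : Finset (Fin N)) (V : Finset (Fin T)) (u : Fin N → Fin T) : ℝ :=
  ∑ j ∈ Iᶜ, ∑ x ∈ V, if u j = x then seen I x u else 0

theorem sightings_eq (I : Finset (Fin N)) (V : Finset (Fin T)) (u : Fin N → Fin T) :
    sightings I V u = (Iᶜ.filter fun j => u j ∈ V ∧ ∃ i ∈ I, u i = u j).card := by
  rw [card_filter, sightings]
  push_cast
  refine sum_congr rfl fun j _ => ?_
  rw [sum_ite_eq]
  by_cases hV : u j ∈ V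
  · simp only [hV, if_true, true_and, seen_eq]
  · simp [hV]

theorem expect_sightings (hq1 : ∑ x, q x = 1) (I : Finset (Fin N)) (V : Finset (Fin T)) :
    expect q N (sightings I V) = Iᶜ.card * ∑ x ∈ V, q x * seenProb q I.card x := by
  have : (sightings I V : (Fin N → Fin T) → ℝ) = fun u => ∑ j ∈ Iᶜ, ∑ x ∈ V,
    if u j = x then seen I x u else 0 := rfl
  rw [this, expect_sum]
  simp_rw [expect_sum]
  rw [← nsmul_eq_mul, ← sum_const]
  refine sum_congr rfl fun j hj => sum_congr rfl fun x _ => ?_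
  exact expect_seen hq1 (mem_compl.mp hj) x

/-- The variance is at most `1 + ℓ` times the mean: the pairs `j = l` give the mean itself, and
distinct indices with a common label give at most `ℓ` times it. -/
theorem expect_sightings_sq_le (hq : ∀ x, 0 ≤ q x) (hq1 : ∑ x, q x = 1) (I : Finset (Fin N))
    (V : Finset (Fin T)) {ℓ : ℝ} (hℓ : ∀ x, N * q x ≤ ℓ) :
    expect q N (fun u => sightings I V u ^ 2) ≤
      expect q N (sightings I V) ^ 2 + (1 + ℓ) * expect q N (sightings I V) := by
  set μ := ∑ x ∈ V, q x * seenProb q I.card x with hμ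
  set n : ℝ := (Iᶜ.card : ℝ) with hn
  have hn0 : 0 ≤ n := Nat.cast_nonneg _
  have hr := seenProb_nonneg hq hq1 I.card
  have hμ0 : 0 ≤ μ := sum_nonneg fun x _ => mul_nonneg (hq x) (hr x)
  have hnN : n ≤ N := by
    rw [hn]
    have := card_le_univ (Iᶜ)
    rw [Fintype.card_fin] at this
    exact_mod_cast this
  rw [expect_sightings hq1, ← hμ, ← hn]
  set ν := ∑ x ∈ V, q x * (q x * seenProb q I.card x) with hν
  have hν0 : 0 ≤ ν := sum_nonneg fun x _ => mul_nonneg (hq x) (mul_nonneg (hq x) (hr x))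
  have hNν : n * ν ≤ ℓ * μ := by
    rw [hν, hμ, mul_sum, mul_sum]
    refine sum_le_sum fun x _ => ?_
    rw [← mul_assoc]
    refine mul_le_mul_of_nonneg_right ?_ (mul_nonneg (hq x) (hr x))
    exact (mul_le_mul_of_nonneg_right hnN (hq x)).trans (hℓ x)
  have hsq : ∀ u : Fin N → Fin T, sightings I V u ^ 2 = ∑ j ∈ Iᶜ, ∑ l ∈ Iᶜ, ∑ x ∈ V, ∑ y ∈ V,
      (if u j = x then seen I x u else 0) * (if u l = y then seen I y u else 0) := by
    intro u
    rw [sightings, sq, sum_mul_sum]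
    refine sum_congr rfl fun j _ => sum_congr rfl fun l _ => ?_
    rw [sum_mul_sum]
  simp_rw [hsq]
  rw [expect_sum]
  simp_rw [expect_sum]
  have hpair : ∀ j ∈ Iᶜ, ∀ l ∈ Iᶜ, ∑ x ∈ V, ∑ y ∈ V, expect q N (fun u =>
      (if u j = x then seen I x u else 0) * (if u l = y then seen I y u else 0)) ≤
      (μ ^ 2 + ν) + if j = l then μ else 0 := by
    intro j hj l hl
    rw [mem_compl] at hj hl
    by_cases hjl : j = l
    · subst hjl
      rw [if_pos rfl]
      refine le_trans (le_of_eq ?_) (le_add_of_nonneg_left (add_nonneg (sq_nonneg μ) hν0))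
      rw [hμ]
      refine sum_congr rfl fun x hx => ?_
      rw [← expect_seen hq1 hj x, ← expect_sum]
      congr 1
      funext u
      by_cases hux : u j = x
      · rw [sum_eq_single x, if_pos hux, seen_eq]
        · split_ifs <;> simp
        · intro y _ hyx
          have : u j ≠ y := fun h => hyx (h.symm.trans hux)
          simp [this]
        · exact fun h => absurd hx h
      · rw [if_neg hux]
        simp
    · rw [if_neg hjl, add_zero]
      refine (sum_le_sum fun x _ => sum_le_sum fun y _ =>
        expect_seen_mul_seen_le hq hq1 hj hl hjl x y).trans_eq ?_
      rw [hμ, hν, sq, sum_mul_sum, ← sum_add_distrib]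
      refine sum_congr rfl fun x hx => ?_
      simp_rw [mul_add]
      rw [sum_add_distrib]
      congr 1
      · exact sum_congr rfl fun y _ => by ring
      · rw [sum_eq_single x, if_pos rfl, mul_assoc]
        · intro y _ hyx
          rw [if_neg (Ne.symm hyx), mul_zero]
        · exact fun h => absurd hx h
  refine (sum_le_sum fun j hj => sum_le_sum fun l hl => hpair j hj l hl).trans ?_
  have htot : ∑ j ∈ Iᶜ, ∑ l ∈ Iᶜ, ((μ ^ 2 + ν) + if j = l then μ else 0) =
      n * (n * (μ ^ 2 + ν)) + n * μ := by
    have hin : ∀ j ∈ Iᶜ, ∑ l ∈ Iᶜ, ((μ ^ 2 + ν) + if j = l then μ else 0) =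
        n * (μ ^ 2 + ν) + μ := by
      intro j hj
      rw [sum_add_distrib, sum_const, nsmul_eq_mul, sum_ite_eq, if_pos hj]
    rw [sum_congr rfl hin, sum_const, nsmul_eq_mul, mul_add]
  rw [htot]
  nlinarith [mul_le_mul_of_nonneg_left hNν hn0]

/-- Bernoulli gives `(1 - q) ^ m (1 + m q) ≤ (1 - q²) ^ m ≤ 1`. -/
theorem seenProb_ge (hq : ∀ x, 0 ≤ q x) (hq1 : ∑ x, q x = 1) (m : ℕ) (x : Fin T) {ℓ : ℝ}
    (hℓ : m * q x ≤ ℓ) : m * q x / (1 + ℓ) ≤ seenProb q m x := by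
  have hx1 : q x ≤ 1 := hq1 ▸ single_le_sum (fun y _ => hq y) (mem_univ x)
  have hmq : 0 ≤ m * q x := mul_nonneg m.cast_nonneg (hq x)
  have h1 : (1 - q x) ^ m * (1 + m * q x) ≤ 1 := by
    have h2 : 1 + m * q x ≤ (1 + q x) ^ m := one_add_mul_le_pow (by linarith [hq x]) m
    calc (1 - q x) ^ m * (1 + m * q x) ≤ (1 - q x) ^ m * (1 + q x) ^ m :=
          mul_le_mul_of_nonneg_left h2 (pow_nonneg (by linarith) m)
      _ = (1 - q x ^ 2) ^ m := by rw [← mul_pow]; congr 1; ring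
      _ ≤ 1 := pow_le_one₀ (by nlinarith [hq x]) (by nlinarith [sq_nonneg (q x)])
  have h3 : m * q x / (1 + ℓ) ≤ m * q x / (1 + m * q x) :=
    div_le_div_of_nonneg_left hmq (by linarith) (by linarith)
  refine h3.trans ?_
  rw [seenProb, div_le_iff₀ (by linarith)]
  linarith

open Classical in
theorem expect_sightings_lt_le (hq : ∀ x, 0 ≤ q x) (hq1 : ∑ x, q x = 1) (I : Finset (Fin N))
    (V : Finset (Fin T)) {ℓ : ℝ} (hℓ : ∀ x, N * q x ≤ ℓ)
    (hpos : 0 < expect q N (sightings I V)) :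
    expect q N (fun u => if sightings I V u < expect q N (sightings I V) / 2 then 1 else 0) ≤
      4 * (1 + ℓ) / expect q N (sightings I V) := by
  set M := expect q N (sightings I V) with hM
  have hsq := expect_sightings_sq_le hq hq1 I V hℓ
  rw [← hM] at hsq
  have h1 : expect q N (fun u => (sightings I V u - M) ^ 2) ≤ (1 + ℓ) * M := by
    have : ∀ u : Fin N → Fin T, (sightings I V u - M) ^ 2 =
        sightings I V u ^ 2 + ((-2 * M) * sightings I V u + M ^ 2 * 1) := fun u => by ring
    simp_rw [this]
    rw [expect_add, expect_add, expect_const_mul, expect_const_mul, expect_one hq1]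
    change _ + (-2 * M * M + _) ≤ _
    linarith
  have h2 : M ^ 2 / 4 * expect q N (fun u => if sightings I V u < M / 2 then 1 else 0) ≤
      (1 + ℓ) * M := by
    rw [← expect_const_mul]
    refine (expect_mono hq fun u => ?_).trans h1
    split_ifs with h
    · nlinarith
    · rw [mul_zero]; exact sq_nonneg _
  rw [le_div_iff₀ hpos]
  have h3 : M * (M * expect q N (fun u => if sightings I V u < M / 2 then 1 else 0)) ≤
      M * (4 * (1 + ℓ)) := by linarith
  have h4 := le_of_mul_le_mul_left h3 hpos
  linarith

/-- The edges of `s` with labels in `V`. -/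
def edgesIn (V : Finset (Fin T)) (s : Fin N → Fin T) : Finset ℕ :=
  (edges s).filter fun e => ∃ i : Fin N, (i : ℕ) = e ∧ s i ∈ V

/-- A position with label in `V` either starts an edge or is the last one of its label, and the
latter are determined by their labels. -/
theorem card_filter_mem_le {V : Finset (Fin T)} {s : Fin N → Fin T} (hs : Monotone s) :
    (univ.filter fun i => s i ∈ V).card ≤ (edgesIn V s).card + (univ.image s ∩ V).card := by
  rw [← card_filter_add_card_filter_not (s := univ.filter fun i => s i ∈ V)
    (fun i : Fin N => (i : ℕ) ∈ edges s)]
  refine add_le_add ?_ ?_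
  · refine card_le_card_of_injOn (fun i => (i : ℕ)) ?_ fun a _ b _ h => Fin.ext h
    intro i hi
    simp only [mem_coe, mem_filter, mem_univ, true_and] at hi
    exact mem_filter.mpr ⟨hi.2, i, rfl, hi.1⟩
  · refine card_le_card_of_injOn s ?_ ?_
    · intro i hi
      simp only [mem_coe, mem_filter, mem_univ, true_and] at hi
      exact mem_inter.mpr ⟨mem_image_of_mem s (mem_univ i), hi.1⟩
    · have key : ∀ a b : Fin N, (a : ℕ) ∉ edges s → s a = s b → ¬ a < b := by
        intro a b ha hab hlt
        have hb := b.2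
        have hlt' : (a : ℕ) < b := hlt
        refine ha ((edge_mem_edges (j := ⟨a + 1, by omega⟩) rfl).mpr ?_)
        refine le_antisymm (hs (Fin.le_def.mpr (Nat.le_succ _))) ?_
        rw [hab]
        exact hs (Fin.le_def.mpr hlt')
      intro a ha b hb hab
      simp only [mem_coe, mem_filter, mem_univ, true_and] at ha hb
      exact le_antisymm (not_lt.mp (key b a hb.2 hab.symm)) (not_lt.mp (key a b ha.2 hab))

/-- A label occurring `m` times yields `m - 1` edges, and at least one of its occurrences is not a
sighting. Sightings replace edges because the fixed split of the indices makes their moments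
computable. -/
theorem sightings_le_card_edgesIn (I : Finset (Fin N)) (V : Finset (Fin T)) (u : Fin N → Fin T) :
    sightings I V u ≤ (edgesIn V (u ∘ Tuple.sort u)).card := by
  rw [sightings_eq]
  have h1 := card_filter_mem_le (V := V) (Tuple.monotone_sort u)
  rw [card_filter_comp_perm u (Tuple.sort u) (fun x => x ∈ V)] at h1
  have himg : univ.image (u ∘ Tuple.sort u) = univ.image u := by
    rw [← image_image, image_univ_of_surjective (Tuple.sort u).surjective]
  rw [himg] at h1
  set S := Iᶜ.filter fun j => u j ∈ V ∧ ∃ i ∈ I, u i = u j with hS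
  have hSV : S ⊆ univ.filter fun i => u i ∈ V := fun j hj =>
    mem_filter.mpr ⟨mem_univ _, (mem_filter.mp hj).2.1⟩
  have h2 : (univ.image u ∩ V).card ≤ ((univ.filter fun i => u i ∈ V) \ S).card := by
    refine (card_le_card ?_).trans (card_image_le (f := u))
    intro x hx
    rw [mem_inter, mem_image] at hx
    obtain ⟨⟨j, _, rfl⟩, hV⟩ := hx
    by_cases h : ∃ i ∈ I, u i = u j
    · obtain ⟨i, hi, hij⟩ := h
      refine mem_image.mpr ⟨i, mem_sdiff.mpr ⟨mem_filter.mpr ⟨mem_univ _, hij ▸ hV⟩, ?_⟩, hij⟩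
      exact fun hiS => absurd hi (mem_compl.mp (mem_filter.mp hiS).1)
    · exact mem_image.mpr ⟨j, mem_sdiff.mpr ⟨mem_filter.mpr ⟨mem_univ _, hV⟩,
        fun hjS => h (mem_filter.mp hjS).2.2⟩, rfl⟩
  have h3 := card_sdiff_add_card_eq_card hSV
  exact_mod_cast (by omega : S.card ≤ (edgesIn V (u ∘ Tuple.sort u)).card)

end Sightings

/-! ### Counting ascents in the windows of stopping prefixes -/

section Windows

variable {k : ℕ} [NeZero k] {p : Fin k → ℝ}

/-- The first word with the prefix `b.2` of length `b.1`. -/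
def prefixStart (k K : ℕ) (b : ℕ × ℕ) : ℕ := b.2 * k ^ (K - b.1)

/-- The first word after those with the prefix `b.2` of length `b.1`. -/
def prefixStop (k K : ℕ) (b : ℕ × ℕ) : ℕ := (b.2 + 1) * k ^ (K - b.1)

theorem prefixStart_le {K : ℕ} {τ : ℝ} (x : ℕ) :
    prefixStart k K (stopPrefix p K τ x) ≤ x := Nat.div_mul_le_self _ _

theorem lt_prefixStop {K : ℕ} {τ : ℝ} (x : ℕ) :
    x < prefixStop k K (stopPrefix p K τ x) := by
  simp only [prefixStop, stopPrefix]
  rw [add_mul, one_mul]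
  exact Nat.lt_div_mul_add (pow_pos (Nat.pos_of_neZero k) _)

theorem prefixStop_le {K : ℕ} {τ : ℝ} {x : ℕ} (hx : x < k ^ K) :
    prefixStop k K (stopPrefix p K τ x) ≤ k ^ K := by
  have hM := stopDepth_le p K τ x
  have h := div_pow_lt hM hx
  simp only [prefixStop, stopPrefix]
  calc _ ≤ k ^ stopDepth p K τ x * k ^ (K - stopDepth p K τ x) := Nat.mul_le_mul_right _ h
    _ = k ^ K := by rw [← pow_add, Nat.add_sub_cancel' hM]

theorem sum_prefix_le (hp : ∀ i, 0 ≤ p i) (hp1 : ∑ i, p i = 1) {K : ℕ} {τ : ℝ} {x : ℕ}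
    (hx : x < k ^ K) (hτ : wordMass p K x ≤ τ) :
    ∑ w ∈ Ico (prefixStart k K (stopPrefix p K τ x)) (prefixStop k K (stopPrefix p K τ x)),
      wordMass p K w ≤ τ := by
  have h1 := sum_stopPrefix_eq (p := p) (τ := τ) p hx
  rw [hp1, one_pow, mul_one] at h1
  refine le_trans ?_ (h1.le.trans (wordMass_stopDepth_le hτ))
  refine sum_le_sum_of_subset_of_nonneg (fun w hw => ?_) fun w _ _ => wordMass_nonneg hp _ _
  rw [mem_Ico] at hw
  refine mem_filter.mpr ⟨mem_range.mpr (hw.2.trans_le (prefixStop_le hx)),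
    stopPrefix_eq_iff.mpr ?_⟩
  have h3 := hw.1
  have h4 := hw.2
  simp only [prefixStart, prefixStop, stopPrefix] at h3 h4
  have hpos : 0 < k ^ (K - stopDepth p K τ x) := pow_pos (Nat.pos_of_neZero k) _
  refine le_antisymm (Nat.lt_succ_iff.mp ?_) ?_
  · exact (Nat.div_lt_iff_lt_mul hpos).mpr h4
  · exact (Nat.le_div_iff_mul_le hpos).mpr h3

/-- A window of positions that should contain the cards labelled with the prefix `b`. -/
noncomputable def window (p : Fin k → ℝ) (K N : ℕ) (w : ℝ) (b : ℕ × ℕ) : Finset ℕ :=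
  Ico ⌊N * (∑ x ∈ range (prefixStart k K b), wordMass p K x) - w⌋₊
    ⌈N * (∑ x ∈ range (prefixStop k K b), wordMass p K x) + w⌉₊

theorem card_window_le {K N : ℕ} {w : ℝ} (hw : 0 ≤ w) (hp : ∀ i, 0 ≤ p i) (hp1 : ∑ i, p i = 1)
    {τ : ℝ} {x : ℕ} (hx : x < k ^ K) (hτ : wordMass p K x ≤ τ) :
    ((window p K N w (stopPrefix p K τ x)).card : ℝ) ≤ N * τ + 2 * w + 2 := by
  have hτ0 := (wordMass_nonneg hp K x).trans hτ
  rw [window, Nat.card_Ico]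
  set a := N * (∑ x ∈ range (prefixStart k K (stopPrefix p K τ x)), wordMass p K x) with ha
  set b := N * (∑ x ∈ range (prefixStop k K (stopPrefix p K τ x)), wordMass p K x) with hb
  have hb0 : 0 ≤ b := mul_nonneg N.cast_nonneg (sum_nonneg fun _ _ => wordMass_nonneg hp _ _)
  have h1 : b - a ≤ N * τ := by
    rw [hb, ha, ← mul_sub, ← sum_Ico_eq_sub _
      ((prefixStart_le x).trans (lt_prefixStop x).le)]
    exact mul_le_mul_of_nonneg_left (sum_prefix_le hp hp1 hx hτ) N.cast_nonneg
  have h2 : (⌈b + w⌉₊ : ℝ) < b + w + 1 := Nat.ceil_lt_add_one (by linarith)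
  have h3 : a - w < ⌊a - w⌋₊ + 1 := Nat.lt_floor_add_one _
  rcases le_total ⌊a - w⌋₊ ⌈b + w⌉₊ with h | h
  · rw [Nat.cast_sub h]
    linarith
  · rw [Nat.sub_eq_zero_of_le h, Nat.cast_zero]
    positivity

/-- The positions within three steps of the ends of a window. -/
noncomputable def windowEnds (p : Fin k → ℝ) (K N : ℕ) (w : ℝ) (b : ℕ × ℕ) : Finset ℕ :=
  Ico ⌊N * (∑ x ∈ range (prefixStart k K b), wordMass p K x) - w⌋₊
    (⌊N * (∑ x ∈ range (prefixStart k K b), wordMass p K x) - w⌋₊ + 3) ∪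
  Ico (⌈N * (∑ x ∈ range (prefixStop k K b), wordMass p K x) + w⌉₊ - 3)
    ⌈N * (∑ x ∈ range (prefixStop k K b), wordMass p K x) + w⌉₊

theorem card_windowEnds_le (p : Fin k → ℝ) (K N : ℕ) (w : ℝ) (b : ℕ × ℕ) :
    (windowEnds p K N w b).card ≤ 6 := by
  refine (card_union_le _ _).trans ?_
  rw [Nat.card_Ico, Nat.card_Ico]
  omega

theorem mem_window_add {K N : ℕ} {w : ℝ} {b : ℕ × ℕ} {e i : ℕ} (he : e ∈ window p K N w b)
    (hb : e ∉ windowEnds p K N w b) (hi : i ≤ 3) : e + i ∈ window p K N w b := by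
  rw [window, mem_Ico] at *
  rw [windowEnds, mem_union, mem_Ico, mem_Ico] at hb
  omega

theorem mem_window_sub {K N : ℕ} {w : ℝ} {b : ℕ × ℕ} {e i : ℕ} (he : e ∈ window p K N w b)
    (hb : e ∉ windowEnds p K N w b) (hi : i ≤ 3) : e - i ∈ window p K N w b := by
  rw [window, mem_Ico] at *
  rw [windowEnds, mem_union, mem_Ico, mem_Ico] at hb
  omega

theorem card_filter_lt_monotone {N T : ℕ} {s : Fin N → Fin T} (hs : Monotone s) (a : ℕ)
    (i : Fin N) : (i : ℕ) < (univ.filter fun j => (s j : ℕ) < a).card ↔ (s i : ℕ) < a :=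
  Fin.lt_card_filter_univ_iff_apply_of_imp (fun j => (s j : ℕ) < a)
    fun _ _ hab hb => lt_of_le_of_lt (hs hab) hb

theorem sum_filter_val_lt {T : ℕ} (f : ℕ → ℝ) {a : ℕ} (ha : a ≤ T) :
    ∑ x ∈ univ.filter (fun x : Fin T => (x : ℕ) < a), f x = ∑ x ∈ range a, f x := by
  rw [sum_filter, Fin.sum_univ_eq_sum_range (fun x => if x < a then f x else 0) T, ← sum_filter]
  congr 1
  ext x; simp only [mem_filter, mem_range]; omega

open Classical in
/-- A lower bound on the distance to uniform from the stopping prefixes of length `M`. -/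
theorem le_tvDist_of_prefixes (hp : ∀ i, 0 ≤ p i) (hp1 : ∑ i, p i = 1) {N K M : ℕ} (hN : 2 ≤ N)
    {τ ℓ w D : ℝ} (hτ : ∀ x, wordMass p K x ≤ τ) (hℓ : ∀ x, N * wordMass p K x ≤ ℓ)
    (hw : 0 ≤ w) (hwN : w ≤ 2 * N) {B : Finset (ℕ × ℕ)}
    (hB : B = ((range (k ^ K)).filter fun x => stopDepth p K τ x = M).image (stopPrefix p K τ))
    (hD0 : 0 < D)
    (hD : D ≤ N ^ 2 / (8 * (1 + ℓ)) *
      ∑ x ∈ (range (k ^ K)).filter (fun x => stopDepth p K τ x = M), wordMass p K x ^ 2)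
    (hBD : 144 * B.card ≤ D) :
    1 - (2 * B.card * Real.exp (-(w ^ 2 / (4 * N))) + 4 * (1 + ℓ) / D) -
      2 * (576 * (B.card * (N * τ + 2 * w + 2)) / D ^ 2) ≤ tvDist p N K := by
  set q : Fin (k ^ K) → ℝ := fun x => wordMass p K x with hq
  have hq0 : ∀ x, 0 ≤ q x := fun x => wordMass_nonneg hp K x
  have hq1 : ∑ x, q x = 1 := by
    rw [hq, Fin.sum_univ_eq_sum_range (fun x => wordMass p K x), sum_wordMass, hp1, one_pow]
  have hN0 : (0 : ℝ) < N := by exact_mod_cast (by omega : 0 < N)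
  have hτ0 : 0 ≤ τ := (wordMass_nonneg hp K 0).trans (hτ 0)
  have hℓ0 : 0 ≤ ℓ := (mul_nonneg hN0.le (wordMass_nonneg hp K 0)).trans (hℓ 0)
  set Λ := 576 * (B.card * (N * τ + 2 * w + 2)) / D ^ 2 with hΛ
  set β := 2 * B.card * Real.exp (-(w ^ 2 / (4 * N))) + 4 * (1 + ℓ) / D with hβ
  have hβ0 : 0 ≤ β := by positivity
  have hΛ0 : 0 ≤ Λ := by positivity
  have htv0 : 0 ≤ tvDist p N K := mul_nonneg (by norm_num) (sum_nonneg fun _ _ => abs_nonneg _)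
  -- If the relative variance bound exceeds `1`, the claimed lower bound is negative.
  rcases lt_or_ge 1 Λ with hΛ1 | hΛ1
  · linarith
  set V : Finset (Fin (k ^ K)) := univ.filter fun x => stopDepth p K τ x = M with hV
  -- Half of the indices serve as reference, the other half as test: the number of pairs is at least
  -- `N² / 8`, which explains the constant in the hypothesis on `D`.
  set I : Finset (Fin N) := univ.filter fun i => (i : ℕ) < N / 2 with hI
  have hIc : I.card = N / 2 := by
    rw [hI, Fin.card_filter_val_lt]; omega
  have hIcc : Iᶜ.card = N - N / 2 := by rw [card_compl, Fintype.card_fin, hIc]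
  set Es := expect q N (sightings I V) with hEs
  have hDEs : D ≤ Es := by
    rw [hEs, expect_sightings hq1]
    refine hD.trans ?_
    have hS : ∑ x ∈ (range (k ^ K)).filter (fun x => stopDepth p K τ x = M), wordMass p K x ^ 2 =
        ∑ x ∈ V, q x ^ 2 := by
      rw [hV, sum_filter, sum_filter, Fin.sum_univ_eq_sum_range
        (fun x => if stopDepth p K τ x = M then wordMass p K x ^ 2 else 0)]
    rw [hS, mul_sum, mul_sum]
    refine sum_le_sum fun x _ => ?_
    have hm : (I.card : ℝ) * q x ≤ ℓ := by
      refine le_trans (mul_le_mul_of_nonneg_right ?_ (hq0 x)) (hℓ x)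
      rw [hIc]; exact_mod_cast Nat.div_le_self N 2
    have h1 := seenProb_ge hq0 hq1 I.card x hm
    have h2 : (N : ℝ) ^ 2 / 8 ≤ Iᶜ.card * I.card := by
      rw [hIcc, hIc]
      have h3 : N ^ 2 ≤ 8 * ((N - N / 2) * (N / 2)) := by
        obtain ⟨m, rfl | rfl⟩ : ∃ m, N = 2 * m ∨ N = 2 * m + 1 := ⟨N / 2, by omega⟩
        · have e : 2 * m / 2 = m := by omega
          rw [e, (by omega : 2 * m - m = m)]
          nlinarith
        · have e : (2 * m + 1) / 2 = m := by omega
          rw [e, (by omega : 2 * m + 1 - m = m + 1)]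
          have : 1 ≤ m := by omega
          nlinarith
      have h4 : (N : ℝ) ^ 2 ≤ 8 * (((N - N / 2 : ℕ) : ℝ) * ((N / 2 : ℕ) : ℝ)) := by
        exact_mod_cast h3
      linarith
    calc (N : ℝ) ^ 2 / (8 * (1 + ℓ)) * q x ^ 2 = (N : ℝ) ^ 2 / 8 * (q x ^ 2 / (1 + ℓ)) := by
          field_simp
      _ ≤ Iᶜ.card * I.card * (q x ^ 2 / (1 + ℓ)) :=
          mul_le_mul_of_nonneg_right h2 (by positivity)
      _ = Iᶜ.card * (q x * (I.card * q x / (1 + ℓ))) := by ring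
      _ ≤ _ := mul_le_mul_of_nonneg_left (mul_le_mul_of_nonneg_left h1 (hq0 x)) (Nat.cast_nonneg _)
  have hEs0 : 0 < Es := hD0.trans_le hDEs
  have hBx : ∀ b ∈ B, ∃ x < k ^ K, stopPrefix p K τ x = b := by
    intro b hb
    rw [hB, mem_image] at hb
    obtain ⟨x, hx, rfl⟩ := hb
    exact ⟨x, mem_range.mp (mem_filter.mp hx).1, rfl⟩
  have hBstop : ∀ b ∈ B, prefixStart k K b ≤ k ^ K ∧ prefixStop k K b ≤ k ^ K := by
    intro b hb
    obtain ⟨x, hx, rfl⟩ := hBx b hb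
    exact ⟨(prefixStart_le x).trans hx.le, prefixStop_le hx⟩
  set A : ℕ → ℝ := fun a => ∑ x ∈ range a, wordMass p K x with hA
  set J := (range (N - 1)).filter fun e => ∃ b ∈ B, e ∈ window p K N w b with hJ
  set Bd := B.biUnion (windowEnds p K N w) with hBd
  have hJcard : (J.card : ℝ) ≤ B.card * (N * τ + 2 * w + 2) := by
    have h1 : J ⊆ B.biUnion (window p K N w) := fun e he =>
      let ⟨b, hb, h⟩ := (mem_filter.mp he).2
      mem_biUnion.mpr ⟨b, hb, h⟩
    have h2 := (card_le_card h1).trans card_biUnion_le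
    calc (J.card : ℝ) ≤ ∑ b ∈ B, ((window p K N w b).card : ℝ) := by exact_mod_cast h2
      _ ≤ ∑ b ∈ B, (N * τ + 2 * w + 2) := by
          refine sum_le_sum fun b hb => ?_
          obtain ⟨x, hx, rfl⟩ := hBx b hb
          exact card_window_le hw hp hp1 hx (hτ x)
      _ = _ := by rw [sum_const, nsmul_eq_mul]
  have hBdcard : (Bd.card : ℝ) ≤ 6 * B.card := by
    have h1 : Bd.card ≤ ∑ b ∈ B, 6 :=
      card_biUnion_le.trans (sum_le_sum fun b _ => card_windowEnds_le p K N w b)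
    rw [sum_const, smul_eq_mul, mul_comm] at h1
    exact_mod_cast h1
  -- Good sequences have at least `D / 2` edges in `J`, and the at most `6 |B|` boundary positions
  -- cost at most `D / 24`. The excess `D / 12 - D / 24` equals `2 t`.
  set t := D / 48 with ht
  have ht0 : 0 < t := by positivity
  have h4t : 4 * t ^ 2 = D ^ 2 / 576 := by rw [ht]; ring
  have hJΛ : J.card / (4 * t ^ 2) ≤ Λ := by
    rw [h4t, hΛ, div_div_eq_mul_div]
    refine div_le_div_of_nonneg_right ?_ (by positivity)
    linarith
  have hJt : (J.card : ℝ) ≤ 4 * t ^ 2 := by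
    have := hJΛ.trans hΛ1
    rwa [div_le_one (by positivity)] at this
  -- The first part localises the cards of each prefix within its window, at both ends; the second
  -- provides the edges. Together they place at least `D / 2` edges of `s` in `J`.
  set P : (Fin N → Fin (k ^ K)) → Prop := fun s =>
    (∀ b ∈ B, N * A (prefixStart k K b) - w ≤
        (univ.filter fun j => (s j : ℕ) < prefixStart k K b).card ∧
      ((univ.filter fun j => (s j : ℕ) < prefixStop k K b).card : ℝ) ≤
        N * A (prefixStop k K b) + w) ∧ D / 2 ≤ (edgesIn V s).card with hP
  have key := le_sum_abs_of_ascents (N := N) hq0 hq1 (J := J) (Bd := Bd) (filter_subset _ _) (by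
      intro e he hb i hi heN
      obtain ⟨b, hbB, hmem⟩ := (mem_filter.mp he).2
      refine mem_filter.mpr ⟨mem_range.mpr heN, b, hbB, mem_window_add hmem ?_ (mem_Icc.mp hi).2⟩
      exact fun h => hb (mem_biUnion.mpr ⟨b, hbB, h⟩)) (by
      intro e he hb i hi _
      obtain ⟨b, hbB, hmem⟩ := (mem_filter.mp he).2
      refine mem_filter.mpr ⟨mem_range.mpr ?_, b, hbB, mem_window_sub hmem ?_ (mem_Icc.mp hi).2⟩
      · have := mem_range.mp (mem_filter.mp he).1
        omega
      · exact fun h => hb (mem_biUnion.mpr ⟨b, hbB, h⟩)) ht0 hJt (β := β)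
      (G := (sortedSeqs N (k ^ K)).filter P) (filter_subset _ _) (by
      intro s hs
      rw [mem_filter, mem_sortedSeqs] at hs
      obtain ⟨hmono, hloc, hedge⟩ := hs
      have hsub : edgesIn V s ⊆ edges s ∩ J := by
        intro e he
        rw [edgesIn, mem_filter] at he
        obtain ⟨hee, i, rfl, hiV⟩ := he
        have hdepth : stopDepth p K τ (s i) = M := (mem_filter.mp hiV).2
        have hbB : stopPrefix p K τ (s i) ∈ B := by
          rw [hB]
          exact mem_image_of_mem _ (mem_filter.mpr ⟨mem_range.mpr (s i).2, hdepth⟩)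
        have heN : (i : ℕ) < N - 1 := by
          obtain ⟨_, j, _, hj, _⟩ := mem_edges.mp hee
          have := j.2
          omega
        refine mem_inter.mpr ⟨hee, mem_filter.mpr ⟨mem_range.mpr heN, _, hbB, ?_⟩⟩
        obtain ⟨h1, h2⟩ := hloc _ hbB
        rw [window, mem_Ico]
        constructor
        · have h3 : (univ.filter fun j => (s j : ℕ) <
              prefixStart k K (stopPrefix p K τ (s i))).card ≤ (i : ℕ) := by
            rw [← not_lt, card_filter_lt_monotone hmono]
            exact not_lt.mpr (prefixStart_le _)
          refine Nat.floor_le_of_le (h1.trans ?_)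
          exact_mod_cast h3
        · have h3 := (card_filter_lt_monotone hmono
            (prefixStop k K (stopPrefix p K τ (s i))) i).mpr (lt_prefixStop _)
          rw [Nat.lt_ceil]
          refine lt_of_lt_of_le ?_ h2
          exact_mod_cast h3
      have h1 : ((edgesIn V s).card : ℝ) ≤ (edges s ∩ J).card := by exact_mod_cast card_le_card hsub
      rw [ht]
      linarith) (by
      have h1 := sum_filter_add_sum_filter_not (sortedSeqs N (k ^ K)) P (sortedMass q)
      rw [sum_sortedMass hq1, sum_filter_sortedMass_eq_expect q (fun s => ¬ P s)] at h1
      suffices h : expect q N (fun u => if ¬ P (u ∘ Tuple.sort u) then 1 else 0) ≤ β by linarith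
      set F₁ : ℕ × ℕ → Finset (Fin (k ^ K)) := fun b =>
        univ.filter fun x => ¬ (x : ℕ) < prefixStart k K b with hF₁
      set F₂ : ℕ × ℕ → Finset (Fin (k ^ K)) := fun b =>
        univ.filter fun x => (x : ℕ) < prefixStop k K b with hF₂
      have hs₁ : ∀ b ∈ B, ∑ x ∈ F₁ b, q x = 1 - A (prefixStart k K b) := by
        intro b hb
        change _ = 1 - ∑ x ∈ range (prefixStart k K b), wordMass p K x
        rw [← sum_filter_val_lt (wordMass p K) (hBstop b hb).1, ← hq1,
          ← sum_filter_add_sum_filter_not univ (fun x : Fin (k ^ K) => (x : ℕ) < prefixStart k K b)]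
        ring
      have hs₂ : ∀ b ∈ B, ∑ x ∈ F₂ b, q x = A (prefixStop k K b) := fun b hb =>
        sum_filter_val_lt (wordMass p K) (hBstop b hb).2
      set c₁ : ℕ × ℕ → (Fin N → Fin (k ^ K)) → ℝ := fun b u =>
        if N * (∑ x ∈ F₁ b, q x) + w ≤ (univ.filter fun i => u i ∈ F₁ b).card then 1 else 0
      set c₂ : ℕ × ℕ → (Fin N → Fin (k ^ K)) → ℝ := fun b u =>
        if N * (∑ x ∈ F₂ b, q x) + w ≤ (univ.filter fun i => u i ∈ F₂ b).card then 1 else 0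
      set c₃ : (Fin N → Fin (k ^ K)) → ℝ := fun u => if sightings I V u < Es / 2 then 1 else 0
      have n₁ : ∀ b u, 0 ≤ c₁ b u := fun b u => by simp only [c₁]; split_ifs <;> norm_num
      have n₂ : ∀ b u, 0 ≤ c₂ b u := fun b u => by simp only [c₂]; split_ifs <;> norm_num
      have n₃ : ∀ u, 0 ≤ c₃ u := fun u => by simp only [c₃]; split_ifs <;> norm_num
      have hle : ∀ u : Fin N → Fin (k ^ K), (if ¬ P (u ∘ Tuple.sort u) then (1 : ℝ) else 0) ≤
          ∑ b ∈ B, (c₁ b u + c₂ b u) + c₃ u := by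
        intro u
        have hnn : ∀ b ∈ B, 0 ≤ c₁ b u + c₂ b u := fun b _ => add_nonneg (n₁ b u) (n₂ b u)
        by_cases h : P (u ∘ Tuple.sort u)
        · rw [if_neg (not_not.mpr h)]
          exact add_nonneg (sum_nonneg hnn) (n₃ u)
        rw [if_pos h]
        by_cases h3 : sightings I V u < Es / 2
        · have : c₃ u = 1 := if_pos h3
          have := sum_nonneg hnn
          linarith
        · have hed : D / 2 ≤ (edgesIn V (u ∘ Tuple.sort u)).card := by
            have := sightings_le_card_edgesIn I V u
            linarith
          have hex : ∃ b ∈ B, 1 ≤ c₁ b u + c₂ b u := by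
            by_contra hno
            push Not at hno
            refine h ⟨fun b hb => ?_, hed⟩
            have hlt := hno b hb
            have m₁ : ¬ (N * (∑ x ∈ F₁ b, q x) + w ≤ (univ.filter fun i => u i ∈ F₁ b).card) := by
              intro hh
              have : c₁ b u = 1 := if_pos hh
              linarith [n₂ b u]
            have m₂ : ¬ (N * (∑ x ∈ F₂ b, q x) + w ≤ (univ.filter fun i => u i ∈ F₂ b).card) := by
              intro hh
              have : c₂ b u = 1 := if_pos hh
              linarith [n₁ b u]
            rw [hs₁ b hb] at m₁
            rw [hs₂ b hb] at m₂
            rw [card_filter_comp_perm u _ (fun x => (x : ℕ) < prefixStart k K b),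
              card_filter_comp_perm u _ (fun x => (x : ℕ) < prefixStop k K b)]
            have g₁ : (univ.filter fun i => u i ∈ F₁ b) =
                univ.filter fun i => ¬ (u i : ℕ) < prefixStart k K b := by
              ext i; simp [hF₁]
            have g₂ : (univ.filter fun i => u i ∈ F₂ b) =
                univ.filter fun i => (u i : ℕ) < prefixStop k K b := by
              ext i; simp [hF₂]
            rw [g₁] at m₁
            rw [g₂] at m₂
            have hc := card_filter_add_card_filter_not (fun i => (u i : ℕ) < prefixStart k K b)
              (s := (univ : Finset (Fin N)))
            rw [card_univ, Fintype.card_fin] at hc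
            have hc' : ((univ.filter fun i => (u i : ℕ) < prefixStart k K b).card : ℝ) +
              (univ.filter fun i => ¬ (u i : ℕ) < prefixStart k K b).card = N := by
              exact_mod_cast hc
            constructor <;> linarith
          obtain ⟨b, hb, h1⟩ := hex
          have := single_le_sum hnn hb
          linarith [n₃ u]
      refine (expect_mono hq0 hle).trans ?_
      rw [expect_add, expect_sum, hβ]
      refine add_le_add ?_ ?_
      · calc ∑ b ∈ B, expect q N (fun u => c₁ b u + c₂ b u)
            ≤ ∑ b ∈ B, 2 * Real.exp (-(w ^ 2 / (4 * N))) := by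
              refine sum_le_sum fun b _ => ?_
              rw [expect_add, two_mul]
              exact add_le_add (expect_le_exp hq0 hq1 _ hw hwN) (expect_le_exp hq0 hq1 _ hw hwN)
          _ = _ := by rw [sum_const, nsmul_eq_mul]; ring
      · refine (expect_sightings_lt_le hq0 hq1 I V (fun x => hℓ x) hEs0).trans ?_
        exact div_le_div_of_nonneg_left (by positivity) hD0 hDEs)
  rw [tvDist_eq]
  refine le_trans ?_ key
  have hj0 : 0 ≤ J.card / (4 * t ^ 2) := by positivity
  nlinarith [mul_nonneg hj0 hβ0]

end Windows

/-! ### The lower bound below the collision threshold -/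

section Subcritical

open Filter Topology

variable {k : ℕ} [NeZero k] {p : Fin k → ℝ}

/-- Some length carries a fair share of the tilted mass of the stopping prefixes. -/
theorem exists_stopDepth_large (hp : ∀ i, 0 < p i) {c : ℝ} (hc0 : 0 < c)
    (hc1 : c ≤ 1) (hc : ∀ i, c ≤ p i) {K : ℕ} {τ : ℝ} (hτ1 : τ ≤ 1)
    (hτ : ∀ x, wordMass p K x ≤ τ) {θ : ℝ} (hθ0 : 0 ≤ θ) (hθ : phi p θ = phi p 2 ^ 2) :
    ∃ M ≤ K, ∃ B : Finset (ℕ × ℕ),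
      B = ((range (k ^ K)).filter fun x => stopDepth p K τ x = M).image (stopPrefix p K τ) ∧
      phi p 2 ^ (2 * K) ≤ (K + 1) * (B.card * (τ ^ θ * (phi p 2 ^ (K - M)) ^ 2)) ∧
      B.card * ((c * τ) ^ 2 * phi p 2 ^ (K - M)) ≤
        ∑ x ∈ (range (k ^ K)).filter (fun x => stopDepth p K τ x = M), wordMass p K x ^ 2 := by
  classical
  have hp' : ∀ i, 0 ≤ p i := fun i => (hp i).le
  have hτ0 : 0 < τ := (wordMass_pos hp K 0).trans_le (hτ 0)
  have hφ := phi_pos hp 2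
  set X : ℕ → Finset ℕ := fun M => (range (k ^ K)).filter fun x => stopDepth p K τ x = M with hX
  have fiber : ∀ (M : ℕ) (f : ℕ → ℝ), ∑ x ∈ X M, f x = ∑ b ∈ (X M).image (stopPrefix p K τ),
      ∑ x ∈ (range (k ^ K)).filter (fun x => stopPrefix p K τ x = b), f x := by
    intro M f
    rw [← sum_fiberwise_of_maps_to (s := X M) (t := (X M).image (stopPrefix p K τ))
      (g := stopPrefix p K τ) (fun x hx => mem_image_of_mem _ hx)]
    refine sum_congr rfl fun b hb => sum_congr ?_ fun _ _ => rfl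
    obtain ⟨z, hz, rfl⟩ := mem_image.mp hb
    ext x
    simp only [hX, mem_filter] at hz ⊢
    constructor
    · rintro ⟨⟨h, _⟩, h'⟩; exact ⟨h, h'⟩
    · rintro ⟨h, h'⟩; exact ⟨⟨h, (congrArg Prod.fst h').trans hz.2⟩, h'⟩
  have hone : ∑ M ∈ range (K + 1), ∑ x ∈ X M, wordMass (tilt p θ) K x = 1 := by
    rw [sum_fiberwise_of_maps_to (fun x _ => mem_range.mpr (Nat.lt_succ_of_le (stopDepth_le p K τ x))),
      sum_wordMass, sum_tilt hp, one_pow]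
  -- Pigeonhole on the tilted law: its total mass `1` is spread over the `K + 1` possible stopping
  -- lengths. Losing `K + 1`, of order `log N`, is harmless against powers of `N`.
  obtain ⟨M, hM, hbig⟩ : ∃ M ∈ range (K + 1),
      1 / ((K : ℝ) + 1) ≤ ∑ x ∈ X M, wordMass (tilt p θ) K x := by
    refine exists_le_of_sum_le nonempty_range_add_one ?_
    rw [hone, sum_const, card_range, nsmul_eq_mul]
    push_cast
    exact (mul_one_div_cancel (by positivity)).le
  have hMK : M ≤ K := Nat.lt_succ_iff.mp (mem_range.mp hM)
  have depth : ∀ x ∈ X M, stopDepth p K τ x = M := fun x hx => (mem_filter.mp hx).2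
  refine ⟨M, hMK, _, rfl, ?_, ?_⟩
  · have h1 : ∑ x ∈ X M, wordMass (tilt p θ) K x ≤
        ((X M).image (stopPrefix p K τ)).card * (τ ^ θ / (phi p 2 ^ 2) ^ M) := by
      rw [fiber, ← nsmul_eq_mul]
      refine sum_le_card_nsmul _ _ _ fun b hb => ?_
      obtain ⟨x, hx, rfl⟩ := mem_image.mp hb
      rw [sum_stopPrefix_eq _ (mem_range.mp (mem_filter.mp hx).1), sum_tilt hp, one_pow, mul_one,
        wordMass_tilt hp', hθ, depth x hx]
      have h := wordMass_stopDepth_le (hτ x)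
      rw [depth x hx] at h
      exact div_le_div_of_nonneg_right
        (Real.rpow_le_rpow (wordMass_nonneg hp' _ _) h hθ0) (by positivity)
    have h2 := hbig.trans h1
    rw [div_le_iff₀ (by positivity)] at h2
    have e : phi p 2 ^ (2 * K) = (phi p 2 ^ (K - M)) ^ 2 * (phi p 2 ^ 2) ^ M := by
      rw [← pow_mul, ← pow_mul, ← pow_add]; congr 1; omega
    rw [e]
    calc (phi p 2 ^ (K - M)) ^ 2 * (phi p 2 ^ 2) ^ M
        = (phi p 2 ^ (K - M)) ^ 2 * (phi p 2 ^ 2) ^ M * 1 := (mul_one _).symm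
      _ ≤ (phi p 2 ^ (K - M)) ^ 2 * (phi p 2 ^ 2) ^ M * _ :=
          mul_le_mul_of_nonneg_left h2 (by positivity)
      _ = _ := by field_simp; rfl
  · change _ ≤ ∑ x ∈ X M, wordMass p K x ^ 2
    rw [fiber, ← nsmul_eq_mul]
    refine card_nsmul_le_sum _ _ _ fun b hb => ?_
    obtain ⟨x, hx, rfl⟩ := mem_image.mp hb
    have h := sum_stopPrefix_eq (p := p) (τ := τ) (fun i => p i ^ (2 : ℝ))
      (mem_range.mp (mem_filter.mp hx).1)
    simp only [wordMass_rpow hp'] at h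
    simp only [Real.rpow_two] at h
    rw [h, depth x hx]
    simp only [phi, Real.rpow_two]
    have h2 := le_wordMass_stopDepth (K := K) hp' hc0.le hc1 hc hτ1 x
    rw [depth x hx] at h2
    exact mul_le_mul_of_nonneg_right (pow_le_pow_left₀ (by positivity) h2 2)
      (pow_nonneg (sum_nonneg fun _ _ => sq_nonneg _) _)

theorem card_image_stopPrefix_le (hp : ∀ i, 0 ≤ p i) (hp1 : ∑ i, p i = 1) {c : ℝ} (hc0 : 0 < c)
    (hc1 : c ≤ 1) (hc : ∀ i, c ≤ p i) {K : ℕ} {τ : ℝ} (hτ1 : τ ≤ 1)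
    (hτ : ∀ x, wordMass p K x ≤ τ) (hτ0 : 0 < τ) {X : Finset ℕ} (hX : X ⊆ range (k ^ K)) :
    ((X.image (stopPrefix p K τ)).card : ℝ) ≤ 4 / c * (1 / τ) := by
  have h := card_image_stopPrefix_mul_le hp hp1 hc0.le hc1 hc hτ1 hτ hX
    (lo := 0) (hi := 1) zero_le_one (by
      intro x hx
      have hx := mem_range.mp (hX hx)
      refine ⟨sum_nonneg fun _ _ => wordMass_nonneg hp _ _, ?_⟩
      calc _ ≤ ∑ w ∈ range (k ^ K), wordMass p K w :=
            sum_le_sum_of_subset_of_nonneg (range_subset_range.mpr hx.le)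
              fun _ _ _ => wordMass_nonneg hp _ _
        _ = 1 := by rw [sum_wordMass, hp1, one_pow])
  rw [div_mul_div_comm, mul_one, le_div_iff₀ (by positivity)]
  linarith

/-- The lower bound at a given deck size. -/
theorem le_tvDist_of_lt_collision (hp : ∀ i, 0 < p i) (hp1 : ∑ i, p i = 1) {c : ℝ} (hc0 : 0 < c)
    (hc1 : c ≤ 1) (hc : ∀ i, c ≤ p i) {θ : ℝ} (hθ0 : 0 ≤ θ) (hθ : phi p θ = phi p 2 ^ 2)
    {N K : ℕ} (hN : 2 ≤ N) {ℓ σ a : ℝ} (hσ0 : 0 < σ) (hσ : σ ≤ 1 / 2)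
    (hℓ : ∀ x, N * wordMass p K x ≤ ℓ) (hτ : ∀ x, wordMass p K x ≤ 1 / (N : ℝ) ^ (1 / 2 : ℝ))
    (hφ : (N : ℝ) ^ (4 * σ - (3 + θ) / 2) ≤ phi p 2 ^ (2 * K))
    (hK : (K : ℝ) + 1 ≤ c / 4 * (N : ℝ) ^ (2 * σ))
    (ha : a = c ^ 2 / (8 * (1 + ℓ))) (haN : 144 ≤ a * (N : ℝ) ^ σ) :
    1 - (8 / c * ((N : ℝ) ^ (1 / 2 : ℝ) * Real.exp (-(1 / 4) * (N : ℝ) ^ (2 * σ))) +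
      4 * (1 + ℓ) / a * (N : ℝ) ^ (-σ)) - 5760 / a ^ 2 * (N : ℝ) ^ (-σ) ≤ tvDist p N K := by
  classical
  have hp' : ∀ i, 0 ≤ p i := fun i => (hp i).le
  have hN0 : (0 : ℝ) < N := by exact_mod_cast (by omega : 0 < N)
  have hN1 : (1 : ℝ) ≤ N := by exact_mod_cast (by omega : 1 ≤ N)
  have hℓ0 : 0 ≤ ℓ := (mul_nonneg hN0.le (wordMass_nonneg hp' K 0)).trans (hℓ 0)
  have ha0 : 0 < a := by rw [ha]; positivity
  have hφ0 := phi_pos hp 2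
  rw [Real.rpow_neg hN0.le, two_mul σ, Real.rpow_add hN0] at *
  set r : ℝ := (N : ℝ) ^ (1 / 2 : ℝ) with hr
  set u : ℝ := (N : ℝ) ^ σ with hu
  have hr1 : 1 ≤ r := Real.one_le_rpow hN1 (by norm_num)
  have hu1 : 1 ≤ u := Real.one_le_rpow hN1 hσ0.le
  have hur : u ≤ r := Real.rpow_le_rpow_of_exponent_le hN1 hσ
  have hr0 : 0 < r := by linarith
  have hu0 : 0 < u := by linarith
  have hrr : r * r = N := by rw [hr, ← Real.rpow_add hN0]; norm_num
  have hτ1 : 1 / r ≤ 1 := by rw [div_le_one hr0]; exact hr1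
  -- The threshold is `τ = N ^ (-1 / 2)`, at which a cylinder holds about as many cards as the
  -- fluctuation `√N` of its place in the whole deck.
  obtain ⟨M, -, B, hB, hbig, hsq⟩ := exists_stopDepth_large hp hc0 hc1 hc hτ1 hτ hθ0 hθ
  set F := phi p 2 ^ (K - M) with hF
  have hF0 : 0 < F := pow_pos hφ0 _
  have hbr : (B.card : ℝ) ≤ 4 / c * r := by
    have h := card_image_stopPrefix_le hp' hp1 hc0 hc1 hc hτ1 hτ (by positivity)
      (filter_subset (fun x => stopDepth p K (1 / r) x = M) _)
    rwa [← hB, one_div_one_div] at h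
  -- The squared gain `(|B| N F)²` has to beat the number of positions, of order `|B| r u`, so `|B|
  -- (N F)²` must exceed `r u`. Here `N² τ ^ (-θ) φ(2) ^ (2 K)` is at least `r u ^ 4`, and dividing
  -- by `K + 1` leaves the spare factor `u`.
  have hmain : 4 / c * (r * u ^ 2) ≤ B.card * (N * F) ^ 2 := by
    have e1 : (N : ℝ) ^ (4 * σ - (3 + θ) / 2) = r * u ^ 4 / (N ^ 2 * (1 / (1 / r) ^ θ)) := by
      rw [Real.div_rpow zero_le_one hr0.le, Real.one_rpow, one_div_one_div, hr, hu,
        ← Real.rpow_natCast ((N : ℝ) ^ σ), ← Real.rpow_natCast (N : ℝ), ← Real.rpow_mul hN0.le,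
        ← Real.rpow_mul hN0.le, ← Real.rpow_add hN0, ← Real.rpow_add hN0, ← Real.rpow_sub hN0]
      congr 1
      push_cast
      ring
    have hpos : 0 < (1 / r) ^ θ := by positivity
    have h1 := hφ.trans hbig
    rw [e1, div_le_iff₀ (by positivity)] at h1
    have h2 : r * u ^ 4 ≤ (K + 1) * (B.card * (N * F) ^ 2) := by
      refine h1.trans (le_of_eq ?_)
      field_simp
    have h3 : r * u ^ 4 ≤ c / 4 * (u * u) * (B.card * (N * F) ^ 2) :=
      h2.trans (mul_le_mul_of_nonneg_right hK (by positivity))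
    have h4 : u ^ 2 * (r * u ^ 2) ≤ u ^ 2 * (c / 4 * (B.card * (N * F) ^ 2)) := by linarith
    have h5 := le_of_mul_le_mul_left h4 (by positivity)
    rw [div_mul_eq_mul_div, div_le_iff₀ hc0]
    linarith
  have hb0 : (0 : ℝ) < B.card := by
    by_contra h
    have : (B.card : ℝ) = 0 := le_antisymm (not_lt.mp h) (Nat.cast_nonneg _)
    rw [this, zero_mul] at hmain
    have : 0 < 4 / c * (r * u ^ 2) := by positivity
    linarith
  have hb1 : (1 : ℝ) ≤ B.card := by exact_mod_cast Nat.pos_of_ne_zero (by rintro h; simp [h] at hb0)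
  have hFu : u ≤ N * F := by
    have h1 : 4 / c * (r * u ^ 2) ≤ 4 / c * (r * (N * F) ^ 2) := by
      refine hmain.trans ?_
      rw [← mul_assoc]
      exact mul_le_mul_of_nonneg_right hbr (by positivity)
    have h2 := le_of_mul_le_mul_left (le_of_mul_le_mul_left h1 (by positivity)) hr0
    exact le_of_sq_le_sq h2 (by positivity)
  have hru : r * u ^ 2 ≤ B.card * (N * F) ^ 2 := by
    refine le_trans (le_mul_of_one_le_left (by positivity) ?_) hmain
    rw [le_div_iff₀ hc0]; linarith
  have hEu : a * u ≤ a * (N * F) := mul_le_mul_of_nonneg_left hFu ha0.le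
  -- The margin `w = N ^ (1 / 2 + σ)` makes each localisation fail with probability at most `exp (-N
  -- ^ (2 σ) / 4)`, which beats the number of prefixes, of order `√N`.
  have key := le_tvDist_of_prefixes hp' hp1 hN hτ hℓ (w := r * u) (D := B.card * (a * (N * F)))
    (by positivity) (by linarith [mul_le_mul_of_nonneg_left hur hr0.le]) hB (by positivity) (by
      refine le_trans (le_of_eq ?_) (mul_le_mul_of_nonneg_left hsq (by positivity))
      rw [ha, ← hrr]
      field_simp) (by linarith [mul_le_mul_of_nonneg_left (haN.trans hEu) hb0.le])
  refine le_trans ?_ key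
  have g1 : 2 * (B.card : ℝ) * Real.exp (-((r * u) ^ 2 / (4 * N))) ≤
      8 / c * (r * Real.exp (-(1 / 4) * (u * u))) := by
    have e : -((r * u) ^ 2 / (4 * (N : ℝ))) = -(1 / 4) * (u * u) := by
      rw [← hrr]; field_simp
    rw [e, ← mul_assoc (8 / c)]
    refine mul_le_mul_of_nonneg_right ?_ (Real.exp_nonneg _)
    calc 2 * (B.card : ℝ) ≤ 2 * (4 / c * r) := by linarith
      _ = _ := by ring
  have g2 : 4 * (1 + ℓ) / (B.card * (a * (N * F))) ≤ 4 * (1 + ℓ) / a * u⁻¹ := by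
    rw [← div_eq_mul_inv, div_div]
    refine div_le_div_of_nonneg_left (by positivity) (by positivity) ?_
    exact hEu.trans (le_mul_of_one_le_left (by positivity) hb1)
  have g3 : 2 * (576 * (B.card * (N * (1 / r) + 2 * (r * u) + 2)) / (B.card * (a * (N * F))) ^ 2) ≤
      5760 / a ^ 2 * u⁻¹ := by
    have e1 : (N : ℝ) * (1 / r) = r := by rw [← hrr]; field_simp
    have e2 : 2 * (576 * (B.card * (N * (1 / r) + 2 * (r * u) + 2)) /
        (B.card * (a * (N * F))) ^ 2) =
        1152 * (r + 2 * (r * u) + 2) / (a ^ 2 * (B.card * (N * F) ^ 2)) := by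
      rw [e1]; field_simp; ring
    rw [e2, ← div_eq_mul_inv, div_div]
    have h1 : r + 2 * (r * u) + 2 ≤ 5 * (r * u) := by linarith [le_mul_of_one_le_right hr0.le hu1]
    calc 1152 * (r + 2 * (r * u) + 2) / (a ^ 2 * (B.card * (N * F) ^ 2))
        ≤ 1152 * (5 * (r * u)) / (a ^ 2 * (r * u ^ 2)) := by gcongr
      _ = 5760 / (a ^ 2 * u) := by field_simp; norm_num
  linarith

theorem tendsto_tvDist_one_of_lt_collision (hk : 2 ≤ k) (hp : ∀ i, 0 < p i) (hp1 : ∑ i, p i = 1)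
    {θ κ : ℝ} (hθ0 : 0 < θ) (hθ : phi p θ = phi p 2 ^ 2) (hκ1 : 1 / Real.log (1 / pMax p) ≤ κ)
    (hκ : κ < (3 + θ) / (4 * psi p 2)) :
    Tendsto (fun N : ℕ => tvDist p N ⌊κ * Real.log N⌋₊) atTop (𝓝 1) := by
  have hlb := log_inv_pMax_pos hk hp hp1
  have hψ := psi_two_pos hk hp hp1
  have hφ0 := phi_pos hp 2
  have hb0 := pMax_pos hp
  have hb1 := pMax_lt_one hk hp hp1
  have hp' : ∀ i, 0 ≤ p i := fun i => (hp i).le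
  have hκ0 : 0 < κ := (one_div_pos.mpr hlb).trans_le hκ1
  obtain ⟨c, hc0, hc⟩ := exists_pos_le hp
  have hc1 : c ≤ 1 := (hc 0).trans (lt_one_of_sum_eq_one hk hp hp1 0).le
  -- Since `κ log (1 / p_max) ≥ 1`, rounding `K` down loses less than one factor of `p_max`, so the
  -- expected content of every cell stays below `1 / p_max`.
  set ℓ := 1 / pMax p with hℓ
  have hℓ0 : 0 < ℓ := by positivity
  set δ := (3 + θ) / 2 - 2 * psi p 2 * κ with hδ
  have hδ0 : 0 < δ := by
    rw [lt_div_iff₀ (by positivity)] at hκ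
    rw [hδ]; linarith
  -- `4 σ ≤ δ` spends the distance to the threshold on the bound for `φ(2) ^ (2 K)`, and `σ ≤ 1 / 2`
  -- keeps the margin `N ^ (1 / 2 + σ)` below `2 N`.
  set σ := min δ 2 / 4 with hσdef
  have hσ0 : 0 < σ := by rw [hσdef]; have := lt_min hδ0 two_pos; positivity
  have hσ : σ ≤ 1 / 2 := by rw [hσdef]; linarith [min_le_right δ 2]
  have hσδ : 4 * σ ≤ δ := by rw [hσdef]; linarith [min_le_left δ 2]
  set a := c ^ 2 / (8 * (1 + ℓ)) with ha
  have ha0 : 0 < a := by positivity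
  have t0 : Tendsto (fun n : ℕ => (n : ℝ)) atTop atTop := tendsto_natCast_atTop_atTop
  have tneg : Tendsto (fun n : ℕ => (n : ℝ) ^ (-σ)) atTop (𝓝 0) :=
    (tendsto_rpow_neg_atTop hσ0).comp t0
  have tσ : Tendsto (fun n : ℕ => (n : ℝ) ^ σ) atTop atTop := (tendsto_rpow_atTop hσ0).comp t0
  have t2σ : Tendsto (fun n : ℕ => (n : ℝ) ^ (2 * σ)) atTop atTop :=
    (tendsto_rpow_atTop (by positivity)).comp t0
  have texp : Tendsto (fun n : ℕ => (n : ℝ) ^ (1 / 2 : ℝ) *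
      Real.exp (-(1 / 4) * (n : ℝ) ^ (2 * σ))) atTop (𝓝 0) := by
    refine ((tendsto_rpow_mul_exp_neg_mul_atTop_nhds_zero (1 / (4 * σ)) (1 / 4)
      (by norm_num)).comp t2σ).congr fun n => ?_
    rw [Function.comp_apply, ← Real.rpow_mul n.cast_nonneg]
    congr 2
    field_simp
    norm_num
  have hlim := ((texp.const_mul (8 / c)).add (tneg.const_mul (4 * (1 + ℓ) / a))).const_sub 1 |>.sub
    (tneg.const_mul (5760 / a ^ 2))
  simp only [mul_zero, add_zero, sub_zero] at hlim
  refine tendsto_of_tendsto_of_tendsto_of_le_of_le' hlim tendsto_const_nhds ?_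
    (Eventually.of_forall fun N => tvDist_le_one hp' hp1 N _)
  have hsmall := eventually_mul_pMax_pow_le hk hp hp1 (κ := κ) (s := 1 / 2) (by
    rw [div_le_iff₀ hlb] at hκ1; linarith)
  have hlog := ((isLittleO_log_rpow_atTop (r := 2 * σ) (by positivity)).comp_tendsto t0).bound
    (c := c / (8 * κ)) (by positivity)
  filter_upwards [hsmall, hlog, t2σ.eventually_ge_atTop (8 / c), tσ.eventually_ge_atTop (144 / a),
    eventually_ge_atTop 2] with N h1 h2 h3 h4 hN
  have hN0 : (0 : ℝ) < N := by exact_mod_cast (by omega : 0 < N)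
  have hN1 : (1 : ℝ) ≤ N := by exact_mod_cast (by omega : 1 ≤ N)
  have hlogN : 0 ≤ Real.log N := Real.log_nonneg hN1
  have hKle : (⌊κ * Real.log N⌋₊ : ℝ) ≤ κ * Real.log N := Nat.floor_le (by positivity)
  refine le_tvDist_of_lt_collision hp hp1 hc0 hc1 hc hθ0.le hθ hN hσ0 hσ (fun x => ?_)
    (fun x => ?_) ?_ ?_ ha ?_
  · refine (mul_le_mul_of_nonneg_left (wordMass_le_pow hp' (le_pMax p) _ x) hN0.le).trans ?_
    rw [hℓ, le_div_iff₀ hb0, ← Real.log_nonpos_iff (by positivity),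
      Real.log_mul (by positivity) (by positivity), Real.log_mul (by positivity) (by positivity),
      Real.log_pow]
    have e : Real.log (pMax p) = -Real.log (1 / pMax p) := by rw [one_div, Real.log_inv, neg_neg]
    rw [e]
    have h5 := Nat.lt_floor_add_one (κ * Real.log N)
    rw [div_le_iff₀ hlb] at hκ1
    nlinarith
  · refine (wordMass_le_pow hp' (le_pMax p) _ x).trans ?_
    rw [le_div_iff₀ (by positivity), mul_comm]
    exact h1
  · rw [← Real.log_le_log_iff (by positivity) (by positivity), Real.log_rpow hN0, Real.log_pow]
    have e : Real.log (phi p 2) = -psi p 2 := by rw [psi, neg_neg]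
    rw [e]
    push_cast
    rw [hδ] at hσδ
    have h5 := mul_le_mul_of_nonneg_left hKle hψ.le
    have h6 := mul_le_mul_of_nonneg_right hσδ hlogN
    nlinarith
  · have h5 : Real.log N ≤ c / (8 * κ) * (N : ℝ) ^ (2 * σ) := by
      have := h2
      simp only [Function.comp_apply, Real.norm_eq_abs] at this
      rwa [abs_of_nonneg hlogN, abs_of_nonneg (by positivity)] at this
    have h6 : κ * Real.log N ≤ c / 8 * (N : ℝ) ^ (2 * σ) := by
      refine (mul_le_mul_of_nonneg_left h5 hκ0.le).trans (le_of_eq ?_)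
      field_simp
    rw [div_le_iff₀ hc0] at h3
    linarith
  · rw [div_le_iff₀ ha0] at h4
    linarith

end Subcritical

/-! ### Existence and uniqueness of the exponent -/

section Exponent

variable {k : ℕ} {p : Fin k → ℝ}

theorem phi_strictAnti (hk : 2 ≤ k) (hp : ∀ i, 0 < p i) (hp1 : ∑ i, p i = 1) :
    StrictAnti (phi p) := fun _ _ hst =>
  have : NeZero k := ⟨by omega⟩
  sum_lt_sum_of_nonempty univ_nonempty fun i _ =>
    Real.rpow_lt_rpow_of_exponent_gt (hp i) (lt_one_of_sum_eq_one hk hp hp1 i) hst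

theorem continuous_phi (hp : ∀ i, 0 < p i) : Continuous (phi p) :=
  continuous_finsetSum _ fun i _ => Real.continuous_const_rpow (hp i).ne'

/-- There is exactly one positive exponent `θ` with `ψ(θ) = 2ψ(2)`. -/
theorem existsUnique_psi_eq (hk : 2 ≤ k) (hp : ∀ i, 0 < p i) (hp1 : ∑ i, p i = 1) :
    ∃! θ : ℝ, 0 < θ ∧ psi p θ = 2 * psi p 2 := by
  have : NeZero k := ⟨by omega⟩
  have hφ := phi_pos hp 2
  have hb := pMax_lt_one hk hp hp1
  have hφ1 : phi p 2 < 1 := (phi_two_le hp hp1).trans_lt hb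
  -- `φ` decreases strictly from `φ(1) = 1`, and `φ(n + 1) ≤ p_max ^ n` falls below `φ(2)²`; the
  -- intermediate value theorem applies on `[1, n + 1]`.
  obtain ⟨n, hn⟩ := exists_pow_lt_of_lt_one (pow_pos hφ 2) hb
  have h1 : phi p 1 = 1 := by simp only [phi, Real.rpow_one, hp1]
  have hlow : phi p (n + 1 : ℕ) ≤ phi p 2 ^ 2 := (phi_add_one_le hp hp1 n).trans hn.le
  have hhigh : phi p 2 ^ 2 < phi p 1 := by rw [h1]; exact pow_lt_one₀ hφ.le hφ1 two_ne_zero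
  obtain ⟨θ, hθ, h⟩ := intermediate_value_Icc' (a := (1 : ℝ)) (b := (n + 1 : ℕ))
    (by push_cast; linarith [(Nat.cast_nonneg n : (0 : ℝ) ≤ n)]) (continuous_phi hp).continuousOn
    ⟨hlow, hhigh.le⟩
  refine ⟨θ, ⟨by linarith [hθ.1], ?_⟩, fun s hs => ?_⟩
  · rw [psi, h, Real.log_pow, psi]; push_cast; ring
  · exact (phi_strictAnti hk hp hp1).injective ((phi_eq_sq_of_psi_eq hp hs.2).trans h.symm)

end Exponent

end RiffleShuffle

/-! ### The cutoff -/

theorem theorem1 {k : ℕ} (hk : 2 ≤ k) (p : Fin k → ℝ) (hpos : ∀ i, 0 < p i)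
    (hsum : ∑ i, p i = 1) :
    (∃! θ : ℝ, 0 < θ ∧ RiffleShuffle.psi p θ = 2 * RiffleShuffle.psi p 2) ∧
    ∀ θ : ℝ, 0 < θ → RiffleShuffle.psi p θ = 2 * RiffleShuffle.psi p 2 →
      ∀ ε : ℝ, 0 < ε →
        Filter.Tendsto
          (fun N : ℕ => RiffleShuffle.tvDist p N
            ⌊(1 - ε) * RiffleShuffle.cutoffConst p θ * Real.log N⌋₊)
          Filter.atTop (nhds 1) ∧
        Filter.Tendsto
          (fun N : ℕ => RiffleShuffle.tvDist p N
            ⌊(1 + ε) * RiffleShuffle.cutoffConst p θ * Real.log N⌋₊)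
          Filter.atTop (nhds 0) := by
  have : NeZero k := ⟨by omega⟩
  refine ⟨RiffleShuffle.existsUnique_psi_eq hk hpos hsum, fun θ hθ0 hψ ε hε => ?_⟩
  have hθ := RiffleShuffle.phi_eq_sq_of_psi_eq hpos hψ
  have hC := RiffleShuffle.cutoffConst_pos hk hpos hsum θ
  constructor
  -- Below `1 / log (1 / p_max)` the long run test applies. From there on, being below the maximum
  -- forces the constant below `(3 + θ) / (4 ψ(2))`, and ascents are counted instead.
  · rcases lt_or_ge ((1 - ε) * RiffleShuffle.cutoffConst p θ)
      (1 / Real.log (1 / RiffleShuffle.pMax p)) with h | h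
    · exact RiffleShuffle.tendsto_tvDist_one_of_lt hk hpos hsum h
    · refine RiffleShuffle.tendsto_tvDist_one_of_lt_collision hk hpos hsum hθ0 hθ h ?_
      have hlt : (1 - ε) * RiffleShuffle.cutoffConst p θ < RiffleShuffle.cutoffConst p θ := by
        nlinarith
      exact (lt_max_iff.mp hlt).resolve_left (not_lt.mpr h)
  · refine RiffleShuffle.tendsto_tvDist_zero hk hpos hsum hθ0 hθ ?_
    nlinarith
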